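/- Let $p$ be an odd prime, $n\ge 2$, $N=p^n$, and let $K$ be a field of characteristic $p$. Let $M=C_N\times C_N=\langle a,b\rangle$, let $Q=C_N=\langle\sigma\rangle$ act on the right on $M$ by $a^\sigma=ab$, $b^\sigma=b$, and let $G=Q\ltimes M$ be the Heisenberg group modulo $p^n$. Let $E_2^{r,s}=H^r(Q;H^s(M;K))$ be the second page of the Lyndon–Hochschild–Serre spectral sequence of $1\to M\to G\to Q\to 1$, a bigraded $K$-algebra whose product $E_2^{r,s}\times E_2^{r',s'}\to E_2^{r+r',s+s'}$ is $(-1)^{r's}$ times the cup product of $Q$ with coefficients paired by the cup product of $H^\bullet(M)=H^\bullet(M;K)$. In $H^\bullet(M)$ put $x_1=a^*$, $y_1=b^*$ (degree $1$), $x_2=\beta_n(x_1)$, $y_2=\beta_n(y_1)$ (degree $2$), where $\beta_n$ is the $n$-th Bockstein, and $z_{2p}=\prod_{i=0}^{p-1}\sigma^i\cdot y_2$, a $Q$-invariant element of $H^{2p}(M)$. Let $W$ be the span of the monomials $x_1^{\varepsilon}y_1^{\delta}x_2^iy_2^j$ with $\varepsilon,\delta\in\{0,1\}$, $i\ge0$,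 $0\le j<p$, let $W^s=W\cap H^s(M)$, and let $D_2^{r,s}\subseteq E_2^{r,s}$ consist of the classes represented by cocycles with values in $W^s$; $D_2=\bigoplus_{r,s}D_2^{r,s}$. The norm $\sum_{i<N}\sigma^i$ is zero on $H^\bullet(M)$, and the periodic resolution of $Q$ gives $$E_2^{r,s}\cong\begin{cases}H^s(M)^Q,&r\text{ even},\\ H^s(M)/(\sigma-1)H^s(M),&r\text{ odd},\end{cases}\qquad D_2^{r,s}\cong\begin{cases}(W^s)^Q,&r\text{ even},\\ W^s/(\sigma-1)W^s,&r\text{ odd}.\end{cases}$$ Here a bar denotes the represented class: for $r=0$ the invariant itself; for $r=1$ the class of the $1$-cocycle of $Q$ with value $\varphi$ at $\sigma$; in general the class in column $r$ is the class in column $0$ or $1$ (by the parity of $r$) times $\gamma_2^{\lfloor r/2\rfloor}$, where $\gamma_2\in E_2^{2,0}$ is the class of the carry cocycle of $Q$ (value $1$ at $(\sigma^i,\sigma^j)$, $0\le i,j<N$, if $i+j\ge N$, and $0$ otherwise). Put $$\lambda_1=x_1,\ \lambda_2=x_2,\ \nu_2=x_1y_1,\ \nu_3=x_1y_2-y_1x_2,\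 \nu_{2p}=z_{2p}\ \text{(column }0),$$ $$\gamma_1=\bar 1\in E_2^{1,0},\quad \mu_{2i}=\overline{y_1y_2^{i-1}}\in E_2^{1,2i-1}\ (1\le i\le p),\quad \mu_{2i+1}=\overline{y_2^{i}}\in E_2^{1,2i}\ (1\le i\le p-1).$$ **Bases for $W$.** (a) A basis of $(W^s)^Q$ is: $1$ for $s=0$; $x_1$ for $s=1$; $x_2^i,\ x_1y_1x_2^{i-1}$ for $s=2i\ge2$; $x_1x_2^i,\ (x_1y_2-y_1x_2)x_2^{i-1}$ for $s=2i+1\ge3$. (b) A basis of $(\sigma-1)W^s$ is: - for $s=1$: $x_1$; - for $s=2i\ge2$: the $x_2^jy_2^k$ with $j\ge1$, $0\le k\le p-2$, $j+k=i$, and the $x_1y_1x_2^jy_2^k$ with $j\ge1$, $0\le k\le p-2$, $j+k+1=i$; - for $s=2i+1\ge3$: the $x_1x_2^jy_2^k$ with $j\ge1$, $0\le k\le p-2$, $j+k=i$; the $y_1x_2^jy_2^k$ with $j\ge2$, $0\le k\le p-3$, $j+k=i$; and the $x_1x_2^jy_2^k+k\,y_1x_2^{j+1}y_2^{k-1}$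 with $j\ge 0$, $0\le k\le p-1$, $j+k=i$ and ($j=0$ or $k=p-1$). (c) A basis of $W^s/(\sigma-1)W^s$ is given by the classes of: $1$ for $s=0$; $y_1$ for $s=1$; for $s=2i$: $x_1y_1y_2^{i-1},\ y_2^i$ if $1\le i\le p-1$, and $x_1y_1x_2^{i-p}y_2^{p-1},\ x_2^{i-p+1}y_2^{p-1}$ if $i\ge p$; for $s=2i+1$: $x_1y_2^i,\ y_1y_2^i$ if $1\le i\le p-1$, and $x_1x_2^{i-p+1}y_2^{p-1},\ y_1x_2^{i-p+1}y_2^{p-1}$ if $i\ge p$. **Structure of $E_2$.** (i) As graded $K$-algebras, with the indicated generators corresponding, $$E_2^{0,\bullet}=K[\nu_{2p}]\otimes K[\lambda_1,\lambda_2,\nu_2,\nu_3]/(\nu_2^2,\ \lambda_1\nu_2,\ \nu_2\nu_3,\ \lambda_1\nu_3+\lambda_2\nu_2),$$ where $K[\lambda_1,\lambda_2,\nu_2,\nu_3]$ is the free graded-commutative algebra on generators of degrees $1,2,2,3$. (ii) A basis of $D_2^{0,s}$ is: $1$ for $s=0$; $\lambda_1$ for $s=1$; $\lambda_2^i,\ \lambda_2^{i-1}\nu_2$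 for $s=2i\ge2$; $\lambda_1\lambda_2^i,\ \lambda_2^{i-1}\nu_3$ for $s=2i+1\ge3$. A basis of $D_2^{1,s}$ is: $\gamma_1$ for $s=0$; $\mu_2$ for $s=1$; $\mu_{s+1},\ \lambda_1\mu_s$ for $2\le s<2p$; $\lambda_1\lambda_2^{i-p}\mu_{2p},\ \lambda_2^{i-p+1}\mu_{2p-1}$ for $s=2i\ge2p$; $\lambda_2^{i-p+1}\mu_{2p},\ \lambda_1\lambda_2^{i-p+1}\mu_{2p-1}$ for $s=2i+1\ge2p+1$. For $r\ge2$ one has $D_2^{r,s}=D_2^{r-2,s}\gamma_2$, and multiplying these bases by $\gamma_2^{j}$ gives bases of $D_2^{2j,s}$ and $D_2^{2j+1,s}$ for all $j\ge0$. (iii) The multiplication map $K[\nu_{2p}]\otimes D_2\to E_2$ is bijective, and the $K$-algebra $E_2$ is generated by $\lambda_1,\lambda_2,\nu_2,\nu_3,\nu_{2p},\gamma_1,\gamma_2,\mu_2,\dots,\mu_{2p}$. -/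

import Mathlib

universe u
noncomputable section
open CategoryTheory

namespace LHS
variable {K G : Type u} [CommRing K] [Group G]

/-- The inhomogeneous `n`-cocycles of `G` with values in `A`, as functions. -/
def cocycleSubmodule (A : Rep.{u} K G) (n : ℕ) : Submodule K ((Fin n → G) → A) :=
  LinearMap.ker (inhomogeneousCochains.d A n).hom

theorem iCocycles_injective (A : Rep.{u} K G) (n : ℕ) :
    Function.Injective (groupCohomology.iCocycles A n) :=
  (ModuleCat.mono_iff_injective _).1 inferInstance

/-- The cohomology class of an inhomogeneous cocycle, in Mathlib's `groupCohomology`. -/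
def classMap (A : Rep.{u} K G) (n : ℕ) : cocycleSubmodule A n →ₗ[K] groupCohomology A n where
  toFun f := groupCohomology.π A n (groupCohomology.cocyclesMk f.1 f.2)
  map_add' f g := by
    rw [← map_add]
    congr 1
    apply iCocycles_injective
    rw [map_add, groupCohomology.iCocycles_mk, groupCohomology.iCocycles_mk,
      groupCohomology.iCocycles_mk]
    · rfl
    · exact g.2
    · exact f.2
    · exact (f + g).2
  map_smul' c f := by
    rw [RingHom.id_apply, ← map_smul]
    congr 1
    apply iCocycles_injective
    rw [map_smul, groupCohomology.iCocycles_mk, groupCohomology.iCocycles_mk]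
    · rfl
    · exact f.2
    · exact (c • f).2

theorem classMap_surjective (A : Rep.{u} K G) (n : ℕ) : Function.Surjective (classMap A n) := by
  intro c
  induction c using groupCohomology_induction_on with
  | h z =>
    have hz : inhomogeneousCochains.d A n (groupCohomology.iCocycles A n z) = 0 := by
      have := congrArg (fun f => f z) ((groupCohomology.inhomogeneousCochains A).iCycles_d n (n+1))
      simpa using this
    refine ⟨⟨_, hz⟩, ?_⟩
    show groupCohomology.π A n _ = _
    congr 1
    apply iCocycles_injective
    exact groupCohomology.iCocycles_mk _ _

theorem iCocycles_toCocycles (A : Rep.{u} K G) (n : ℕ) (f : (Fin n → G) → A) :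
    groupCohomology.iCocycles A (n + 1) (groupCohomology.toCocycles A n (n + 1) f) =
      inhomogeneousCochains.d A n f := by
  have h := ConcreteCategory.congr_hom
    ((groupCohomology.inhomogeneousCochains A).toCycles_i n (n + 1)) f
  rw [groupCohomology.inhomogeneousCochains.d_def] at h
  exact h

theorem classMap_d (A : Rep.{u} K G) (n : ℕ) (f : (Fin n → G) → A)
    (h : inhomogeneousCochains.d A n f ∈ cocycleSubmodule A (n + 1)) :
    classMap A (n + 1) ⟨inhomogeneousCochains.d A n f, h⟩ = 0 := by
  have h1 : groupCohomology.cocyclesMk (inhomogeneousCochains.d A n f) h =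
      groupCohomology.toCocycles A n (n + 1) f := by
    apply iCocycles_injective
    rw [groupCohomology.iCocycles_mk]
    · exact (iCocycles_toCocycles A n f).symm
    · exact h
  show groupCohomology.π A (n + 1) _ = _
  rw [h1]
  exact ConcreteCategory.congr_hom
    ((groupCohomology.inhomogeneousCochains A).toCycles_comp_homologyπ n (n + 1)) f

theorem exists_of_pi_eq_zero (A : Rep.{u} K G) (n i : ℕ) (hi : (ComplexShape.up ℕ).prev n = i)
    (z : groupCohomology.cocycles A n) (h : groupCohomology.π A n z = 0) :
    ∃ e, groupCohomology.toCocycles A i n e = z := by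
  have hk := (groupCohomology.inhomogeneousCochains A).homologyIsCokernel i n hi
  have hex := ShortComplex.exact_of_g_is_cokernel (ShortComplex.mk _ _
    ((groupCohomology.inhomogeneousCochains A).toCycles_comp_homologyπ i n)) hk
  rw [ShortComplex.moduleCat_exact_iff] at hex
  exact hex z h

theorem eq_zero_of_classMap_zero (A : Rep.{u} K G) (f : cocycleSubmodule A 0)
    (h : classMap A 0 f = 0) : f = 0 := by
  obtain ⟨e, he⟩ := exists_of_pi_eq_zero A 0 0 (by simp) _ h
  have h1 := congrArg (groupCohomology.iCocycles A 0) he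
  rw [groupCohomology.iCocycles_mk] at h1
  · have h2 := ConcreteCategory.congr_hom
      ((groupCohomology.inhomogeneousCochains A).toCycles_i 0 0) e
    rw [HomologicalComplex.shape _ _ _ (by simp)] at h2
    exact Subtype.ext (h1.symm.trans h2)
  · exact f.2

theorem exists_of_classMap_succ (A : Rep.{u} K G) (n : ℕ) (f : cocycleSubmodule A (n + 1))
    (h : classMap A (n + 1) f = 0) : ∃ e, inhomogeneousCochains.d A n e = f.1 := by
  obtain ⟨e, he⟩ := exists_of_pi_eq_zero A (n + 1) n (by simp) _ h
  refine ⟨e, ?_⟩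
  rw [← iCocycles_toCocycles, he, groupCohomology.iCocycles_mk]
  exact f.2

theorem partialProd_congr {N N' : ℕ} (x : Fin N → G) (y : Fin N' → G) (k : ℕ) (h : k < N + 1)
    (h' : k < N' + 1)
    (hxy : ∀ i (hi : i < k), x ⟨i, by omega⟩ = y ⟨i, by omega⟩) :
    Fin.partialProd x ⟨k, h⟩ = Fin.partialProd y ⟨k, h'⟩ := by
  induction k with
  | zero => exact (Fin.partialProd_zero x).trans (Fin.partialProd_zero y).symm
  | succ k ih =>
    have h1 := Fin.partialProd_succ x ⟨k, by omega⟩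
    have h2 := Fin.partialProd_succ y ⟨k, by omega⟩
    have h3 := ih (by omega) (by omega) (fun i hi => hxy i (by omega))
    have h4 := hxy k (by omega)
    exact h1.trans ((congrArg₂ (· * ·) h3 h4).trans h2.symm)

theorem partialProd_add {m n : ℕ} (x : Fin (m + n) → G) (k : ℕ) (h : k < n + 1) :
    Fin.partialProd x ⟨m + k, by omega⟩ =
      Fin.partialProd x ⟨m, by omega⟩ *
        Fin.partialProd (fun j => x (Fin.natAdd m j)) ⟨k, h⟩ := by
  induction k with
  | zero =>
    have := Fin.partialProd_zero (fun j => x (Fin.natAdd m j))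
    exact (((congrArg _) this).trans (mul_one _)).symm
  | succ k ih =>
    have h1 := Fin.partialProd_succ x ⟨m + k, by omega⟩
    have h2 := Fin.partialProd_succ (fun j => x (Fin.natAdd m j)) ⟨k, by omega⟩
    have h3 := ih (by omega)
    refine h1.trans (Eq.trans ?_ (congrArg _ h2).symm)
    rw [← mul_assoc]
    exact congrArg₂ (· * ·) h3 rfl

section cup
variable {A B C : Rep.{u} K G}

/-- The cup product of inhomogeneous cochains along a pairing `θ` of coefficients:
`(f ∪ g)(x₁, …, x_{m+n}) = θ (f(x₁, …, x_m), (x₁ ⋯ x_m) • g(x_{m+1}, …, x_{m+n}))`. -/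
def cupCochain (θ : A →ₗ[K] B →ₗ[K] C) (m n : ℕ) :
    ((Fin m → G) → A) →ₗ[K] ((Fin n → G) → B) →ₗ[K] ((Fin (m + n) → G) → C) :=
  LinearMap.mk₂ K
    (fun f g x => θ (f fun i => x (Fin.castAdd n i))
      (B.ρ (Fin.partialProd x ⟨m, by omega⟩) (g fun j => x (Fin.natAdd m j))))
    (fun _ _ _ => by ext; simp) (fun _ _ _ => by ext; simp)
    (fun _ _ _ => by ext; simp) (fun _ _ _ => by ext; simp)

theorem cupCochain_apply (θ : A →ₗ[K] B →ₗ[K] C) (m n : ℕ) (f : (Fin m → G) → A)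
    (g : (Fin n → G) → B) (x : Fin (m + n) → G) :
    cupCochain θ m n f g x = θ (f fun i => x (Fin.castAdd n i))
      (B.ρ (Fin.partialProd x ⟨m, by omega⟩) (g fun j => x (Fin.natAdd m j))) := rfl

/-- The pairing `θ` is compatible with the actions of `G`. -/
def IsEquivariant (θ : A →ₗ[K] B →ₗ[K] C) : Prop :=
  ∀ (g : G) (a : A) (b : B), θ (A.ρ g a) (B.ρ g b) = C.ρ g (θ a b)

/-- The Leibniz rule for the cup product of inhomogeneous cochains. -/
theorem d_cupCochain {θ : A →ₗ[K] B →ₗ[K] C} (hθ : IsEquivariant θ) (m n : ℕ)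
    (f : (Fin m → G) → A) (g : (Fin n → G) → B) (x : Fin (m + n + 1) → G) :
    inhomogeneousCochains.d C (m + n) (cupCochain θ m n f g) x =
      cupCochain θ (m + 1) n (inhomogeneousCochains.d A m f) g
        (x ∘ Fin.cast (by omega)) +
      (-1 : K) ^ m • cupCochain θ m (n + 1) f (inhomogeneousCochains.d B n g) x := by
  have hc : m + 1 + n = m + n + 1 := by omega
  have hg : (fun j => (x ∘ Fin.cast hc) (Fin.natAdd (m + 1) j)) =
      fun j : Fin n => x (Fin.natAdd m j).succ := by
    funext j
    simp only [Function.comp_apply]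
    congr 1
    ext
    simp
    omega
  let jL : Fin m → Fin (m + n + 1) := fun j => ⟨j, by omega⟩
  let jR : Fin (n + 1) → Fin (m + n + 1) := fun j => ⟨m + j, by omega⟩
  have e0 : B.ρ (x 0) (B.ρ (Fin.partialProd (fun i => x i.succ) ⟨m, by omega⟩)
      (g fun j => x (Fin.natAdd m j).succ)) =
      B.ρ (Fin.partialProd (x ∘ Fin.cast hc) ⟨m + 1, by omega⟩)
        (g fun j => (x ∘ Fin.cast hc) (Fin.natAdd (m + 1) j)) := by
    rw [hg, ← Module.End.mul_apply, ← map_mul]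
    congr 2
    have h1 := Fin.partialProd_succ' x ⟨m, by omega⟩
    refine h1.symm.trans ?_
    exact partialProd_congr _ _ (m + 1) _ _ (fun i hi => rfl)
  have e1 : ∀ j : Fin m, cupCochain θ m n f g (Fin.contractNth (jL j) (· * ·) x) =
      θ (f (Fin.contractNth j.castSucc (· * ·)
          fun i => (x ∘ Fin.cast hc) (Fin.castAdd n i)))
        (B.ρ (Fin.partialProd (x ∘ Fin.cast hc) ⟨m + 1, by omega⟩)
        (g fun j => (x ∘ Fin.cast hc) (Fin.natAdd (m + 1) j))) := by
    intro j
    have p1 : (fun i => Fin.contractNth (jL j) (· * ·) x (Fin.castAdd n i)) =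
        Fin.contractNth j.castSucc (· * ·)
          fun i => (x ∘ Fin.cast hc) (Fin.castAdd n i) := by
      funext i
      rcases lt_trichotomy (i : ℕ) (j : ℕ) with h | h | h
      · rw [Fin.contractNth_apply_of_lt _ _ _ _ (by simpa [jL] using h),
          Fin.contractNth_apply_of_lt _ _ _ _ (by simpa using h)]
        rfl
      · rw [Fin.contractNth_apply_of_eq _ _ _ _ (by simpa [jL] using h),
          Fin.contractNth_apply_of_eq _ _ _ _ (by simpa using h)]
        rfl
      · rw [Fin.contractNth_apply_of_gt _ _ _ _ (by simpa [jL] using h),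
          Fin.contractNth_apply_of_gt _ _ _ _ (by simpa using h)]
        rfl
    have p2 : Fin.partialProd (Fin.contractNth (jL j) (· * ·) x) ⟨m, by omega⟩ =
        Fin.partialProd (x ∘ Fin.cast hc) ⟨m + 1, by omega⟩ := by
      have h1 := congrFun (Fin.partialProd_contractNth x (jL j)) ⟨m, by omega⟩
      refine h1.trans ?_
      rw [Function.comp_apply, Fin.succAbove_of_le_castSucc _ _ (by
        rw [Fin.le_def]; simp [jL])]
      exact partialProd_congr _ _ (m + 1) _ _ (fun i hi => rfl)
    have p3 : (fun i => Fin.contractNth (jL j) (· * ·) x (Fin.natAdd m i)) =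
        fun j => (x ∘ Fin.cast hc) (Fin.natAdd (m + 1) j) := by
      rw [hg]
      funext i
      rw [Fin.contractNth_apply_of_gt _ _ _ _ (by simp [jL]; omega)]
    rw [cupCochain_apply, p1, p2, p3]
  have e2 : ∀ j : Fin (n + 1), cupCochain θ m n f g (Fin.contractNth (jR j) (· * ·) x) =
      θ (f fun i => x (Fin.castAdd (n + 1) i)) (B.ρ (Fin.partialProd x ⟨m, by omega⟩)
        (g (Fin.contractNth j (· * ·) fun i => x (Fin.natAdd m i)))) := by
    intro j
    have p1 : (fun i => Fin.contractNth (jR j) (· * ·) x (Fin.castAdd n i)) =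
        fun i => x (Fin.castAdd (n + 1) i) := by
      funext i
      rw [Fin.contractNth_apply_of_lt _ _ _ _ (by simp [jR]; omega)]
      rfl
    have p2 : Fin.partialProd (Fin.contractNth (jR j) (· * ·) x) ⟨m, by omega⟩ =
        Fin.partialProd x ⟨m, by omega⟩ := by
      have h1 := congrFun (Fin.partialProd_contractNth x (jR j)) ⟨m, by omega⟩
      refine h1.trans ?_
      rw [Function.comp_apply, Fin.succAbove_of_castSucc_lt _ _ (by
        rw [Fin.lt_def]; simp [jR])]
      exact partialProd_congr _ _ m _ _ (fun i hi => rfl)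
    have p3 : (fun i => Fin.contractNth (jR j) (· * ·) x (Fin.natAdd m i)) =
        Fin.contractNth j (· * ·) fun i => x (Fin.natAdd m i) := by
      funext i
      rcases lt_trichotomy (i : ℕ) (j : ℕ) with h | h | h
      · rw [Fin.contractNth_apply_of_lt _ _ _ _ (by simpa [jR] using h),
          Fin.contractNth_apply_of_lt _ _ _ _ h]
        rfl
      · rw [Fin.contractNth_apply_of_eq _ _ _ _ (by simpa [jR] using h),
          Fin.contractNth_apply_of_eq _ _ _ _ h]
        rfl
      · rw [Fin.contractNth_apply_of_gt _ _ _ _ (by simpa [jR] using h),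
          Fin.contractNth_apply_of_gt _ _ _ _ h]
        rfl
    rw [cupCochain_apply, p1, p2, p3]
  have e3 : B.ρ (Fin.partialProd (x ∘ Fin.cast hc) ⟨m + 1, by omega⟩)
        (g fun j => (x ∘ Fin.cast hc) (Fin.natAdd (m + 1) j)) =
      B.ρ (Fin.partialProd x ⟨m, by omega⟩) (B.ρ (x (Fin.natAdd m (0 : Fin (n + 1))))
        (g fun j => x (Fin.natAdd m j.succ))) := by
    rw [hg, ← Module.End.mul_apply, ← map_mul]
    congr 2
    have h1 := Fin.partialProd_succ x ⟨m, by omega⟩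
    refine Eq.trans ?_ h1
    exact partialProd_congr _ _ (m + 1) _ _ (fun i hi => rfl)
  have e4 : (Fin.contractNth (Fin.last m) (· * ·)
      fun i => (x ∘ Fin.cast hc) (Fin.castAdd n i)) =
      fun i => x (Fin.castAdd (n + 1) i) := by
    funext i
    rw [Fin.contractNth_apply_of_lt _ _ _ _ (by simp)]
    rfl
  have hsplit := Fin.sum_univ_add (a := m) (b := n + 1) (fun j : Fin (m + n + 1) =>
    (-1 : K) ^ ((j : ℕ) + 1) • cupCochain θ m n f g (Fin.contractNth j (· * ·) x))
  have hL : inhomogeneousCochains.d C (m + n) (cupCochain θ m n f g) x =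
      θ (A.ρ (x 0) (f fun i => x (Fin.castAdd n i).succ))
        (B.ρ (x 0) (B.ρ (Fin.partialProd (fun i => x i.succ) ⟨m, by omega⟩)
      (g fun j => x (Fin.natAdd m j).succ))) +
      ((∑ j : Fin m, (-1 : K) ^ ((j : ℕ) + 1) • cupCochain θ m n f g
        (Fin.contractNth (jL j) (· * ·) x)) +
      ∑ j : Fin (n + 1), (-1 : K) ^ (m + (j : ℕ) + 1) • cupCochain θ m n f g
        (Fin.contractNth (jR j) (· * ·) x)) := by
    rw [hθ]
    exact (inhomogeneousCochains.d_hom_apply C (m + n) _ x).trans (congrArg _ hsplit)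
  rw [hL, e0, cupCochain_apply, cupCochain_apply]
  simp only [inhomogeneousCochains.d_hom_apply, e1, e2]
  rw [Fin.sum_univ_castSucc (n := m), e4]
  simp only [map_add, map_sum, map_smul, LinearMap.add_apply, LinearMap.sum_apply,
    LinearMap.smul_apply, smul_add, Finset.smul_sum]
  simp only [← e3, Fin.val_castSucc, Fin.val_last, smul_smul, ← pow_add]
  have key : ∀ a b c e : C, a + (b + e) =
      a + (b + (-1 : K) ^ (m + 1) • c) + ((-1 : K) ^ m • c + e) := by
    intro a b c e
    rw [pow_succ, mul_neg_one, neg_smul]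
    abel
  exact key _ _ _ _

theorem cupCochain_mem {θ : A →ₗ[K] B →ₗ[K] C} (hθ : IsEquivariant θ) (m n : ℕ)
    (f : cocycleSubmodule A m) (g : cocycleSubmodule B n) :
    cupCochain θ m n f.1 g.1 ∈ cocycleSubmodule C (m + n) := by
  have hf : inhomogeneousCochains.d A m f.1 = 0 := f.2
  have hg : inhomogeneousCochains.d B n g.1 = 0 := g.2
  show inhomogeneousCochains.d C (m + n) _ = 0
  funext x
  rw [d_cupCochain hθ, hf, hg]
  simp
  rfl

/-- The class of the cup product of two cocycles. -/
def cupCocycle {θ : A →ₗ[K] B →ₗ[K] C} (hθ : IsEquivariant θ) (m n : ℕ) :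
    cocycleSubmodule A m →ₗ[K] cocycleSubmodule B n →ₗ[K] groupCohomology C (m + n) :=
  LinearMap.mk₂ K (fun f g => classMap C (m + n) ⟨_, cupCochain_mem hθ m n f g⟩)
    (fun f f' g => by
      rw [← map_add]; congr 1; ext1; simp)
    (fun c f g => by
      rw [← map_smul]; congr 1; ext1; simp)
    (fun f g g' => by
      rw [← map_add]; congr 1; ext1; simp)
    (fun c f g => by
      rw [← map_smul]; congr 1; ext1; simp)

theorem classMap_eq_zero (A : Rep.{u} K G) (n k : ℕ) (h : n = k + 1) (f : cocycleSubmodule A n)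
    (e : (Fin k → G) → A)
    (he : ∀ x, f.1 (x ∘ Fin.cast h) = inhomogeneousCochains.d A k e x) : classMap A n f = 0 := by
  subst h
  have he' : f.1 = inhomogeneousCochains.d A k e := funext he
  have h2 : inhomogeneousCochains.d A k e ∈ cocycleSubmodule A (k + 1) := he' ▸ f.2
  have h3 : f = ⟨_, h2⟩ := Subtype.ext he'
  rw [h3]
  exact classMap_d A k e h2

theorem cupCocycle_left {θ : A →ₗ[K] B →ₗ[K] C} (hθ : IsEquivariant θ) (m n : ℕ)
    (f : cocycleSubmodule A m) (g : cocycleSubmodule B n) (hf : classMap A m f = 0) :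
    cupCocycle hθ m n f g = 0 := by
  cases m with
  | zero => rw [eq_zero_of_classMap_zero A f hf]; simp
  | succ m =>
    obtain ⟨e, he⟩ := exists_of_classMap_succ A m f hf
    refine classMap_eq_zero C _ (m + n) (by omega) _ (cupCochain θ m n e g.1) fun x => ?_
    have hg : inhomogeneousCochains.d B n g.1 = 0 := g.2
    rw [d_cupCochain hθ, hg, he]
    simp

theorem cupCocycle_right {θ : A →ₗ[K] B →ₗ[K] C} (hθ : IsEquivariant θ) (m n : ℕ)
    (f : cocycleSubmodule A m) (g : cocycleSubmodule B n) (hg : classMap B n g = 0) :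
    cupCocycle hθ m n f g = 0 := by
  cases n with
  | zero => rw [eq_zero_of_classMap_zero B g hg]; simp
  | succ n =>
    obtain ⟨e, he⟩ := exists_of_classMap_succ B n g hg
    refine classMap_eq_zero C _ (m + n) (by omega) _
      ((-1 : K) ^ m • cupCochain θ m n f.1 e) fun x => ?_
    have hf : inhomogeneousCochains.d A m f.1 = 0 := f.2
    rw [map_smul, Pi.smul_apply, d_cupCochain hθ, hf, he]
    simp [smul_smul, ← mul_pow]

def cohomologyEquiv (A : Rep.{u} K G) (n : ℕ) :
    (cocycleSubmodule A n ⧸ LinearMap.ker (classMap A n)) ≃ₗ[K] groupCohomology A n :=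
  (classMap A n).quotKerEquivOfSurjective (classMap_surjective A n)

def cupRight {θ : A →ₗ[K] B →ₗ[K] C} (hθ : IsEquivariant θ) (m n : ℕ) :
    groupCohomology B n →ₗ[K] cocycleSubmodule A m →ₗ[K] groupCohomology C (m + n) :=
  ((LinearMap.ker (classMap B n)).liftQ (cupCocycle hθ m n).flip
    (fun g hg => LinearMap.ext fun f => cupCocycle_right hθ m n f g hg)).comp
    (cohomologyEquiv B n).symm.toLinearMap

theorem cupRight_classMap {θ : A →ₗ[K] B →ₗ[K] C} (hθ : IsEquivariant θ) (m n : ℕ)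
    (f : cocycleSubmodule A m) (g : cocycleSubmodule B n) :
    cupRight hθ m n (classMap B n g) f = cupCocycle hθ m n f g := by
  have h : (cohomologyEquiv B n).symm (classMap B n g) = Submodule.Quotient.mk g :=
    (LinearEquiv.symm_apply_eq _).2 rfl
  rw [cupRight, LinearMap.comp_apply, LinearEquiv.coe_coe, h]
  rfl

/-- The cup product on group cohomology. -/
def cup {θ : A →ₗ[K] B →ₗ[K] C} (hθ : IsEquivariant θ) (m n : ℕ) :
    groupCohomology A m →ₗ[K] groupCohomology B n →ₗ[K] groupCohomology C (m + n) :=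
  ((LinearMap.ker (classMap A m)).liftQ (cupRight hθ m n).flip
    (fun f hf => LinearMap.ext fun c => by
      obtain ⟨g, rfl⟩ := classMap_surjective B n c
      exact (cupRight_classMap hθ m n f g).trans (cupCocycle_left hθ m n f g hf))).comp
    (cohomologyEquiv A m).symm.toLinearMap

theorem cup_classMap {θ : A →ₗ[K] B →ₗ[K] C} (hθ : IsEquivariant θ) (m n : ℕ)
    (f : cocycleSubmodule A m) (g : cocycleSubmodule B n) :
    cup hθ m n (classMap A m f) (classMap B n g) =
      classMap C (m + n) ⟨cupCochain θ m n f.1 g.1, cupCochain_mem hθ m n f g⟩ := by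
  have h : (cohomologyEquiv A m).symm (classMap A m f) = Submodule.Quotient.mk f :=
    (LinearEquiv.symm_apply_eq _).2 rfl
  rw [cup, LinearMap.comp_apply, LinearEquiv.coe_coe, h]
  exact cupRight_classMap hθ m n f g
end cup

section coh
variable (K G)
/-- `Coh K G s` is `H^s(G; K)`, with trivial action on the coefficients. -/
def Coh (s : ℕ) : Type u := groupCohomology (Rep.trivial K G K) s

instance (s : ℕ) : AddCommGroup (Coh K G s) :=
  inferInstanceAs (AddCommGroup (groupCohomology (Rep.trivial K G K) s))

instance (s : ℕ) : Module K (Coh K G s) :=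
  inferInstanceAs (Module K (groupCohomology (Rep.trivial K G K) s))

def mulK : Rep.trivial K G K →ₗ[K] Rep.trivial K G K →ₗ[K] Rep.trivial K G K :=
  LinearMap.mul K K

theorem mulK_equivariant : IsEquivariant (mulK K G) := fun _ _ _ => rfl

def Coh.mk (s : ℕ) : cocycleSubmodule (Rep.trivial K G K) s →ₗ[K] Coh K G s :=
  classMap _ s

/-- The cup product `H^s(G; K) × H^t(G; K) → H^{s+t}(G; K)`. -/
def Coh.cup (s t : ℕ) : Coh K G s →ₗ[K] Coh K G t →ₗ[K] Coh K G (s + t) :=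
  LHS.cup (mulK_equivariant K G) s t

theorem const_mem (c : K) :
    (fun _ => c) ∈ cocycleSubmodule (Rep.trivial K G K) 0 := by
  show inhomogeneousCochains.d _ 0 _ = 0
  funext x
  rw [inhomogeneousCochains.d_hom_apply]
  simp
  rfl

theorem Coh.sigma_eq {n n' : ℕ} (h : n' = n)
    (f : cocycleSubmodule (Rep.trivial K G K) n) (f' : cocycleSubmodule (Rep.trivial K G K) n')
    (hf : ∀ x, f.1 (x ∘ Fin.cast h.symm) = f'.1 x) :
    (GradedMonoid.mk n (Coh.mk K G n f) : GradedMonoid (Coh K G)) =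
      GradedMonoid.mk n' (Coh.mk K G n' f') := by
  subst h
  congr 2
  ext x
  exact hf x

theorem Coh.mk_surjective (s : ℕ) : Function.Surjective (Coh.mk K G s) :=
  classMap_surjective _ s

theorem Coh.cup_mk (s t : ℕ) (f : cocycleSubmodule (Rep.trivial K G K) s)
    (g : cocycleSubmodule (Rep.trivial K G K) t) :
    Coh.cup K G s t (Coh.mk K G s f) (Coh.mk K G t g) =
      Coh.mk K G (s + t) ⟨cupCochain (mulK K G) s t f.1 g.1,
        cupCochain_mem (mulK_equivariant K G) s t f g⟩ :=
  cup_classMap _ s t f g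

theorem cupCochain_mulK (s t : ℕ) (f : (Fin s → G) → K) (g : (Fin t → G) → K)
    (x : Fin (s + t) → G) :
    cupCochain (mulK K G) s t f g x =
      f (fun i => x (Fin.castAdd t i)) * g (fun j => x (Fin.natAdd s j)) := rfl

/-- The scalars in `H^0(G; K)`. -/
def Coh.const : K →ₗ[K] Coh K G 0 where
  toFun c := Coh.mk K G 0 ⟨fun _ => c, const_mem K G c⟩
  map_add' c d := map_add (Coh.mk K G 0) ⟨_, const_mem K G c⟩ ⟨_, const_mem K G d⟩
  map_smul' c d := map_smul (Coh.mk K G 0) c ⟨_, const_mem K G d⟩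

theorem Coh.const_apply (c : K) :
    Coh.const K G c = Coh.mk K G 0 ⟨fun _ => c, const_mem K G c⟩ := rfl

theorem Coh.const_cup (c : K) (n : ℕ) (a : Coh K G n) :
    (GradedMonoid.mk (0 + n) (Coh.cup K G 0 n (Coh.const K G c) a) : GradedMonoid (Coh K G)) =
      GradedMonoid.mk n (c • a) := by
  obtain ⟨f, rfl⟩ := Coh.mk_surjective K G n a
  rw [Coh.const_apply, Coh.cup_mk, ← map_smul]
  refine Coh.sigma_eq K G (by omega) _ _ fun x => ?_
  refine (cupCochain_mulK K G _ _ _ _ _).trans ?_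
  refine congrArg (fun y => c * f.1 y) ?_
  funext i
  refine congrArg x ?_
  ext
  simp

theorem Coh.cup_const (c : K) (n : ℕ) (a : Coh K G n) :
    (GradedMonoid.mk (n + 0) (Coh.cup K G n 0 a (Coh.const K G c)) : GradedMonoid (Coh K G)) =
      GradedMonoid.mk n (c • a) := by
  obtain ⟨f, rfl⟩ := Coh.mk_surjective K G n a
  rw [Coh.const_apply, Coh.cup_mk, ← map_smul]
  refine Coh.sigma_eq K G (by omega) _ _ fun x => ?_
  refine (cupCochain_mulK K G _ _ _ _ _).trans ((mul_comm _ _).trans ?_)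
  refine congrArg (fun y => c * f.1 y) ?_
  funext i
  refine congrArg x ?_
  ext
  simp

theorem Coh.cup_assoc (l m n : ℕ) (a : Coh K G l) (b : Coh K G m) (c : Coh K G n) :
    (GradedMonoid.mk (l + m + n) (Coh.cup K G _ _ (Coh.cup K G _ _ a b) c) :
      GradedMonoid (Coh K G)) =
      GradedMonoid.mk (l + (m + n)) (Coh.cup K G _ _ a (Coh.cup K G _ _ b c)) := by
  obtain ⟨f, rfl⟩ := Coh.mk_surjective K G l a
  obtain ⟨g, rfl⟩ := Coh.mk_surjective K G m b
  obtain ⟨h, rfl⟩ := Coh.mk_surjective K G n c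
  simp only [Coh.cup_mk]
  refine Coh.sigma_eq K G (by omega) _ _ fun x => ?_
  simp only [cupCochain_mulK]
  refine (mul_assoc _ _ _).trans ?_
  refine congrArg₂ (· * ·) rfl (congrArg₂ (· * ·) rfl (congrArg h.1 ?_))
  funext i
  refine congrArg x ?_
  ext
  simp [add_assoc]

instance : GradedMonoid.GOne (Coh K G) where
  one := Coh.const K G 1

instance : GradedMonoid.GMul (Coh K G) where
  mul a b := Coh.cup K G _ _ a b

instance : DirectSum.GRing (Coh K G) where
  mul_zero _ := map_zero _
  zero_mul b := LinearMap.congr_fun (map_zero (Coh.cup K G _ _)) b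
  mul_add _ _ _ := map_add _ _ _
  add_mul a b c := LinearMap.congr_fun (map_add (Coh.cup K G _ _) a b) c
  one_mul := fun ⟨n, a⟩ => (Coh.const_cup K G 1 n a).trans (by rw [one_smul]; rfl)
  mul_one := fun ⟨n, a⟩ => (Coh.cup_const K G 1 n a).trans (by rw [one_smul]; rfl)
  mul_assoc := fun ⟨_, a⟩ ⟨_, b⟩ ⟨_, c⟩ => Coh.cup_assoc K G _ _ _ a b c
  natCast n := Coh.const K G n
  natCast_zero := by rw [Nat.cast_zero, map_zero]
  natCast_succ n := by
    rw [Nat.cast_succ, map_add]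
    rfl
  intCast n := Coh.const K G n
  intCast_ofNat n := by rw [Int.cast_natCast]
  intCast_negSucc_ofNat n := by rw [Int.cast_negSucc, map_neg]

instance : DirectSum.GAlgebra K (Coh K G) where
  toFun := (Coh.const K G).toAddMonoidHom
  map_one := rfl
  map_mul c d := (congrArg (GradedMonoid.mk 0) ((Coh.const K G).map_smul c d)).trans
    (Coh.const_cup K G c 0 (Coh.const K G d)).symm
  commutes c := fun ⟨n, a⟩ => (Coh.const_cup K G c n a).trans (Coh.cup_const K G c n a).symm
  smul_def c := fun ⟨n, a⟩ => (Coh.const_cup K G c n a).symm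

/-- The cohomology ring `H^•(G; K) = ⨁ s, H^s(G; K)`, with the cup product. -/
abbrev CohRing : Type u := DirectSum ℕ (Coh K G)

end coh

section pull
variable (K) {H : Type u} [Group H]

/-- The map induced on cohomology by a group homomorphism. -/
def Coh.pull (α : G →* H) (s : ℕ) : Coh K H s →ₗ[K] Coh K G s :=
  (groupCohomology.map (A := Rep.trivial K H K) (B := Rep.trivial K G K) α
    (Rep.ofHom (.id (Representation.trivial K G K))) s).hom

theorem pull_mem (α : G →* H) (s : ℕ) (f : cocycleSubmodule (Rep.trivial K H K) s) :
    (fun x => f.1 (α ∘ x)) ∈ cocycleSubmodule (Rep.trivial K G K) s := by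
  have hf : inhomogeneousCochains.d _ s f.1 = 0 := f.2
  show inhomogeneousCochains.d _ s _ = 0
  funext x
  have := congrFun hf (α ∘ x)
  rw [inhomogeneousCochains.d_hom_apply] at this ⊢
  refine Eq.trans ?_ this
  refine congrArg₂ (· + ·) rfl (Finset.sum_congr rfl fun j _ => congrArg _ (congrArg f.1 ?_))
  exact Fin.comp_contractNth (· * ·) (· * ·) (fun a b => map_mul α a b) j x

theorem Coh.pull_mk (α : G →* H) (s : ℕ) (f : cocycleSubmodule (Rep.trivial K H K) s) :
    Coh.pull K α s (Coh.mk K H s f) = Coh.mk K G s ⟨fun x => f.1 (α ∘ x), pull_mem K α s f⟩ := by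
  have h := ConcreteCategory.congr_hom (groupCohomology.π_map (A := Rep.trivial K H K) (B := Rep.trivial K G K) α
    (Rep.ofHom (.id (Representation.trivial K G K))) s) (groupCohomology.cocyclesMk f.1 f.2)
  refine h.trans ?_
  refine congrArg (groupCohomology.π _ s) ?_
  apply iCocycles_injective
  rw [groupCohomology.iCocycles_mk _ (pull_mem K α s f)]
  have h2 := ConcreteCategory.congr_hom (HomologicalComplex.cyclesMap_i
    (groupCohomology.cochainsMap (A := Rep.trivial K H K) (B := Rep.trivial K G K) α
    (Rep.ofHom (.id (Representation.trivial K G K)))) s) (groupCohomology.cocyclesMk f.1 f.2)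
  refine h2.trans ?_
  have h3 := groupCohomology.iCocycles_mk f.1 f.2
  refine (congrArg (ConcreteCategory.hom ((groupCohomology.cochainsMap (A := Rep.trivial K H K) (B := Rep.trivial K G K) α
    (Rep.ofHom (.id (Representation.trivial K G K)))).f s)) h3).trans ?_
  rfl
end pull

section page
variable (K) {M Q : Type u} [Group M] [Group Q] (φ : Q →* MulAut M)

/-- For a split extension `M ⋊[φ] Q`, where `q m q⁻¹ = φ q m`: the (left) action of `Q` on
`H^s(M; K)` induced by conjugation, `(q • f)(m₁, …) = f(q⁻¹ m₁ q, …)`. -/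
def cohAction (s : ℕ) : Representation K Q (Coh K M s) where
  toFun q := Coh.pull K (φ q⁻¹).toMonoidHom s
  map_one' := by
    refine LinearMap.ext fun a => ?_
    obtain ⟨f, rfl⟩ := Coh.mk_surjective K M s a
    rw [Coh.pull_mk]
    refine congrArg (Coh.mk K M s) (Subtype.ext (funext fun x => congrArg f.1 ?_))
    funext i
    simp
  map_mul' q q' := by
    refine LinearMap.ext fun a => ?_
    obtain ⟨f, rfl⟩ := Coh.mk_surjective K M s a
    rw [Module.End.mul_apply, Coh.pull_mk, Coh.pull_mk, Coh.pull_mk]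
    refine congrArg (Coh.mk K M s) (Subtype.ext (funext fun x => congrArg f.1 ?_))
    funext i
    simp

theorem cohAction_mk (s : ℕ) (q : Q) (f : cocycleSubmodule (Rep.trivial K M K) s) :
    cohAction K φ s q (Coh.mk K M s f) =
      Coh.mk K M s ⟨fun x => f.1 ((φ q⁻¹).toMonoidHom ∘ x), pull_mem K _ s f⟩ :=
  Coh.pull_mk K _ s f

theorem cohAction_cup (s t : ℕ) (q : Q) (a : Coh K M s) (b : Coh K M t) :
    Coh.cup K M s t (cohAction K φ s q a) (cohAction K φ t q b) =
      cohAction K φ (s + t) q (Coh.cup K M s t a b) := by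
  obtain ⟨f, rfl⟩ := Coh.mk_surjective K M s a
  obtain ⟨g, rfl⟩ := Coh.mk_surjective K M t b
  rw [cohAction_mk, cohAction_mk, Coh.cup_mk, Coh.cup_mk, cohAction_mk]
  rfl

theorem cohAction_const (q : Q) (c : K) :
    cohAction K φ 0 q (Coh.const K M c) = Coh.const K M c := by
  rw [Coh.const_apply, cohAction_mk]

/-- `H^s(M; K)` as a representation of `Q`. -/
abbrev cohRep (s : ℕ) : Rep.{u} K Q := Rep.of (cohAction K φ s)

/-- The entry `E_2^{r,s} = H^r(Q; H^s(M; K))` of the second page of the Lyndon-Hochschild-Serre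
spectral sequence of the split extension `M ⋊[φ] Q`. -/
def E2 (rs : ℕ × ℕ) : Type u := groupCohomology (cohRep K φ rs.2) rs.1

instance (rs : ℕ × ℕ) : AddCommGroup (E2 K φ rs) :=
  inferInstanceAs (AddCommGroup (groupCohomology (cohRep K φ rs.2) rs.1))

instance (rs : ℕ × ℕ) : Module K (E2 K φ rs) :=
  inferInstanceAs (Module K (groupCohomology (cohRep K φ rs.2) rs.1))

def E2.mk (r s : ℕ) : cocycleSubmodule (cohRep K φ s) r →ₗ[K] E2 K φ (r, s) :=
  classMap _ r

theorem E2.mk_surjective (r s : ℕ) : Function.Surjective (E2.mk K φ r s) :=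
  classMap_surjective _ r

/-- The cup product of `M`, as a pairing of coefficients. -/
def coeffCup (s t : ℕ) : cohRep K φ s →ₗ[K] cohRep K φ t →ₗ[K] cohRep K φ (s + t) :=
  Coh.cup K M s t

theorem coeffCup_equivariant (s t : ℕ) : IsEquivariant (coeffCup K φ s t) :=
  fun q a b => cohAction_cup K φ s t q a b

/-- The product of the second page: the cup product of `Q` with coefficients paired by the cup
product of `M`, with the sign `(-1)^(r' * s)`. -/
def E2.mul (r s r' s' : ℕ) : E2 K φ (r, s) →ₗ[K] E2 K φ (r', s') →ₗ[K] E2 K φ (r + r', s + s') :=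
  (-1 : K) ^ (r' * s) • LHS.cup (coeffCup_equivariant K φ s s') r r'

theorem E2.mul_mk (r s r' s' : ℕ) (f : cocycleSubmodule (cohRep K φ s) r)
    (g : cocycleSubmodule (cohRep K φ s') r') :
    E2.mul K φ r s r' s' (E2.mk K φ r s f) (E2.mk K φ r' s' g) =
      (-1 : K) ^ (r' * s) • E2.mk K φ (r + r') (s + s')
        ⟨cupCochain (coeffCup K φ s s') r r' f.1 g.1,
          cupCochain_mem (coeffCup_equivariant K φ s s') r r' f g⟩ :=
  congrArg (fun z => (-1 : K) ^ (r' * s) • z) (cup_classMap _ r r' f g)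

theorem E2.sigma_eq {r s r' s' : ℕ} (hr : r' = r) (hs : s' = s)
    (f : cocycleSubmodule (cohRep K φ s) r) (f' : cocycleSubmodule (cohRep K φ s') r')
    (hf : ∀ x, (GradedMonoid.mk s (f.1 (x ∘ Fin.cast hr.symm)) : GradedMonoid (Coh K M)) =
      GradedMonoid.mk s' (f'.1 x)) (c : K) :
    (GradedMonoid.mk (r, s) (c • E2.mk K φ r s f) : GradedMonoid (E2 K φ)) =
      GradedMonoid.mk (r', s') (c • E2.mk K φ r' s' f') := by
  subst hr hs
  refine congrArg (fun z => GradedMonoid.mk _ (c • E2.mk K φ _ _ z)) (Subtype.ext ?_)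
  funext x
  exact eq_of_heq (Sigma.mk.inj (hf x)).2

theorem constE_mem (c : K) :
    (fun _ => Coh.const K M c) ∈ cocycleSubmodule (cohRep K φ 0) 0 := by
  show inhomogeneousCochains.d _ 0 _ = 0
  funext x
  rw [inhomogeneousCochains.d_hom_apply]
  refine (congrArg₂ (· + ·) (cohAction_const K φ (x 0) c) rfl).trans ?_
  simp
  rfl

/-- The scalars in `E_2^{0,0}`. -/
def E2.const : K →ₗ[K] E2 K φ (0, 0) where
  toFun c := E2.mk K φ 0 0 ⟨fun _ => Coh.const K M c, constE_mem K φ c⟩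
  map_add' c d := by
    rw [← map_add]
    refine congrArg (E2.mk K φ 0 0) (Subtype.ext (funext fun x => ?_))
    exact map_add (Coh.const K M) c d
  map_smul' c d := by
    rw [← map_smul]
    refine congrArg (E2.mk K φ 0 0) (Subtype.ext (funext fun x => ?_))
    exact map_smul (Coh.const K M) c d

theorem E2.const_apply (c : K) :
    E2.const K φ c = E2.mk K φ 0 0 ⟨fun _ => Coh.const K M c, constE_mem K φ c⟩ := rfl

theorem E2.const_mul (c : K) (r s : ℕ) (a : E2 K φ (r, s)) :
    (GradedMonoid.mk (0 + r, 0 + s) (E2.mul K φ 0 0 r s (E2.const K φ c) a) :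
      GradedMonoid (E2 K φ)) = GradedMonoid.mk (r, s) (c • a) := by
  obtain ⟨f, rfl⟩ := E2.mk_surjective K φ r s a
  rw [E2.const_apply, E2.mul_mk, mul_zero, pow_zero, ← map_smul (E2.mk K φ r s) c f]
  refine (E2.sigma_eq K φ (Nat.zero_add r).symm (Nat.zero_add s).symm _ (c • f)
    (fun x => ?_) 1).trans (by rw [one_smul])
  have h1 := Fin.partialProd_zero (x ∘ Fin.cast (Nat.zero_add r))
  refine (congrArg (GradedMonoid.mk (0 + s)) (cupCochain_apply _ _ _ _ _ _)).trans ?_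
  refine (Coh.const_cup K M c s _).trans ?_
  refine congrArg (fun z => GradedMonoid.mk s (c • z)) ?_
  refine (congrArg₂ (fun q y => cohAction K φ s q (f.1 y)) h1 ?_).trans
    (LinearMap.congr_fun (map_one (cohAction K φ s)) (f.1 x))
  funext i
  refine congrArg x ?_
  ext
  simp

theorem E2.mul_const (c : K) (r s : ℕ) (a : E2 K φ (r, s)) :
    (GradedMonoid.mk (r + 0, s + 0) (E2.mul K φ r s 0 0 a (E2.const K φ c)) :
      GradedMonoid (E2 K φ)) = GradedMonoid.mk (r, s) (c • a) := by
  obtain ⟨f, rfl⟩ := E2.mk_surjective K φ r s a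
  rw [E2.const_apply, E2.mul_mk, zero_mul, pow_zero, ← map_smul (E2.mk K φ r s) c f]
  refine (E2.sigma_eq K φ (Nat.add_zero r).symm (Nat.add_zero s).symm _ (c • f)
    (fun x => ?_) 1).trans (by rw [one_smul])
  refine (congrArg (GradedMonoid.mk (s + 0)) (cupCochain_apply _ _ _ _ _ _)).trans ?_
  refine (congrArg (fun z => GradedMonoid.mk (s + 0) (Coh.cup K M s 0 (f.1 _) z))
    (cohAction_const K φ _ c)).trans ?_
  exact Coh.cup_const K M c s _

theorem E2.mul_assoc (r s r' s' r'' s'' : ℕ) (a : E2 K φ (r, s)) (b : E2 K φ (r', s'))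
    (c : E2 K φ (r'', s'')) :
    (GradedMonoid.mk (r + r' + r'', s + s' + s'')
      (E2.mul K φ _ _ _ _ (E2.mul K φ _ _ _ _ a b) c) : GradedMonoid (E2 K φ)) =
      GradedMonoid.mk (r + (r' + r''), s + (s' + s''))
        (E2.mul K φ _ _ _ _ a (E2.mul K φ _ _ _ _ b c)) := by
  obtain ⟨f, rfl⟩ := E2.mk_surjective K φ _ _ a
  obtain ⟨g, rfl⟩ := E2.mk_surjective K φ _ _ b
  obtain ⟨h, rfl⟩ := E2.mk_surjective K φ _ _ c
  rw [E2.mul_mk, E2.mul_mk, map_smul, map_smul, LinearMap.smul_apply, E2.mul_mk, E2.mul_mk,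
    smul_smul, smul_smul, ← pow_add, ← pow_add]
  have hsign : r' * s + r'' * (s + s') = r'' * s' + (r' + r'') * s := by ring
  rw [hsign]
  refine E2.sigma_eq K φ (by omega) (by omega) _ _ (fun x => ?_) _
  refine (Coh.cup_assoc K M s s' s'' _ _ _).trans ?_
  refine congrArg (GradedMonoid.mk (s + (s' + s''))) ?_
  refine congrArg₂ (fun u v => Coh.cup K M s (s' + s'') u v) rfl ?_
  refine Eq.trans ?_ (cohAction_cup K φ s' s'' _ _ _)
  refine congrArg₂ (fun u v => Coh.cup K M s' s'' u v) ?_ ?_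
  · refine congrArg₂ (fun q y => cohAction K φ s' q (g.1 y)) ?_ rfl
    exact partialProd_congr _ _ r _ _ (fun i hi => rfl)
  · refine Eq.trans ?_ (LinearMap.congr_fun (map_mul (cohAction K φ s'') _ _) _)
    refine congrArg₂ (fun q y => cohAction K φ s'' q (h.1 y)) ?_ ?_
    · refine Eq.trans ?_ (partialProd_add (m := r) (n := r' + r'') x r' (by omega))
      exact partialProd_congr _ _ (r + r') _ _ (fun i hi => rfl)
    · funext i
      refine congrArg x ?_
      ext
      simp [add_assoc]

instance : GradedMonoid.GOne (E2 K φ) where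
  one := E2.const K φ 1

instance : GradedMonoid.GMul (E2 K φ) where
  mul a b := E2.mul K φ _ _ _ _ a b

instance : DirectSum.GRing (E2 K φ) where
  mul_zero _ := map_zero _
  zero_mul b := LinearMap.congr_fun (map_zero (E2.mul K φ _ _ _ _)) b
  mul_add _ _ _ := map_add _ _ _
  add_mul a b c := LinearMap.congr_fun (map_add (E2.mul K φ _ _ _ _) a b) c
  one_mul := fun ⟨(r, s), a⟩ => (E2.const_mul K φ 1 r s a).trans (by rw [one_smul]; rfl)
  mul_one := fun ⟨(r, s), a⟩ => (E2.mul_const K φ 1 r s a).trans (by rw [one_smul]; rfl)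
  mul_assoc := fun ⟨_, a⟩ ⟨_, b⟩ ⟨_, c⟩ => E2.mul_assoc K φ _ _ _ _ _ _ a b c
  natCast n := E2.const K φ n
  natCast_zero := by rw [Nat.cast_zero, map_zero]
  natCast_succ n := by
    rw [Nat.cast_succ, map_add]
    rfl
  intCast n := E2.const K φ n
  intCast_ofNat n := by rw [Int.cast_natCast]
  intCast_negSucc_ofNat n := by rw [Int.cast_negSucc, map_neg]

instance : DirectSum.GAlgebra K (E2 K φ) where
  toFun := (E2.const K φ).toAddMonoidHom
  map_one := rfl
  map_mul c d := (congrArg (GradedMonoid.mk (0, 0)) ((E2.const K φ).map_smul c d)).trans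
    (E2.const_mul K φ c 0 0 (E2.const K φ d)).symm
  commutes c := fun ⟨(r, s), a⟩ =>
    (E2.const_mul K φ c r s a).trans (E2.mul_const K φ c r s a).symm
  smul_def c := fun ⟨(r, s), a⟩ => (E2.const_mul K φ c r s a).symm

/-- The second page as a bigraded `K`-algebra. -/
abbrev E2Ring : Type u := DirectSum (ℕ × ℕ) (E2 K φ)

open Classical in
/-- The class of a cochain that is a cocycle (and `0` if it is not one). -/
def Coh.ofCochain {G : Type u} [Group G] (s : ℕ) (f : (Fin s → G) → K) : Coh K G s :=
  if h : f ∈ cocycleSubmodule (Rep.trivial K G K) s then Coh.mk K G s ⟨f, h⟩ else 0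

open Classical in
/-- The class of a cochain that is a cocycle (and `0` if it is not one). -/
def E2.ofCochain (r s : ℕ) (f : (Fin r → Q) → Coh K M s) : E2 K φ (r, s) :=
  if h : f ∈ cocycleSubmodule (cohRep K φ s) r then E2.mk K φ r s ⟨f, h⟩ else 0

/-- The action of `Q` on the whole cohomology ring of `M`. -/
def actTot (q : Q) : CohRing K M →ₗ[K] CohRing K M :=
  DirectSum.lmap (fun s => cohAction K φ s q)

end page

section heis

/-- The cyclic group of order `N`, written multiplicatively. -/
abbrev Cyc (N : ℕ) : Type u := ULift.{u} (Multiplicative (ZMod N))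

/-- The exponent `k` of the element `σ ^ k`. -/
def Cyc.exp {N : ℕ} (g : Cyc.{u} N) : ZMod N := g.down.toAdd

/-- The generator `σ`. -/
def Cyc.gen (N : ℕ) : Cyc.{u} N := ⟨Multiplicative.ofAdd 1⟩

/-- `M = ⟨a⟩ × ⟨b⟩`; the element `(a ^ i, b ^ j)` has exponents `i` and `j`. -/
abbrev BaseM (N : ℕ) : Type u := Cyc.{u} N × Cyc.{u} N

/-- Conjugation by `q = σ ^ k`: it sends `a ^ i b ^ j` to `a ^ i b ^ (j - k i)`, so that
`σ⁻¹ a σ = a b` and `σ⁻¹ b σ = b`. -/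
def heisAut {N : ℕ} (q : Cyc.{u} N) : MulAut (BaseM.{u} N) where
  toFun m := (m.1, ⟨Multiplicative.ofAdd (m.2.exp - q.exp * m.1.exp)⟩)
  invFun m := (m.1, ⟨Multiplicative.ofAdd (m.2.exp + q.exp * m.1.exp)⟩)
  left_inv m := by
    refine Prod.ext rfl (ULift.ext _ _ ?_)
    exact congrArg Multiplicative.ofAdd (sub_add_cancel m.2.exp (q.exp * m.1.exp))
  right_inv m := by
    refine Prod.ext rfl (ULift.ext _ _ ?_)
    exact congrArg Multiplicative.ofAdd (add_sub_cancel_right m.2.exp (q.exp * m.1.exp))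
  map_mul' m m' := by
    refine Prod.ext rfl (ULift.ext _ _ (congrArg Multiplicative.ofAdd ?_))
    show (m.2.exp + m'.2.exp) - q.exp * (m.1.exp + m'.1.exp) =
      (m.2.exp - q.exp * m.1.exp) + (m'.2.exp - q.exp * m'.1.exp)
    ring

/-- The action of `Q = ⟨σ⟩` on `M`; the Heisenberg group modulo `N` is `M ⋊[heisAction N] Q`. -/
def heisAction (N : ℕ) : Cyc.{u} N →* MulAut (BaseM.{u} N) where
  toFun := heisAut
  map_one' := by
    refine MulEquiv.ext fun m => Prod.ext rfl (ULift.ext _ _ (congrArg Multiplicative.ofAdd ?_))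
    show m.2.exp - 0 * m.1.exp = m.2.exp
    ring
  map_mul' q q' := by
    refine MulEquiv.ext fun m => Prod.ext rfl (ULift.ext _ _ (congrArg Multiplicative.ofAdd ?_))
    show m.2.exp - (q.exp + q'.exp) * m.1.exp =
      (m.2.exp - q'.exp * m.1.exp) - q.exp * m.1.exp
    ring

variable {K : Type u} [Field K] {N : ℕ}

variable (K N) in
/-- The cohomology ring `H^•(M)`. -/
abbrev HRing : Type u := CohRing K (BaseM.{u} N)

variable (K N) in
/-- The second page for the Heisenberg group modulo `N`. -/
abbrev ERing : Type u := E2Ring K (heisAction.{u} N)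

/-- The `1`-cochain with values in `K` given by the reduction of `χ : G → ℤ/N`. -/
def dualCochain {G : Type u} (χ : G → ZMod N) : (Fin 1 → G) → K :=
  fun g => ((χ (g 0)).val : K)

/-- The Bockstein of `χ : G → ℤ/N` at the level of cochains: lift `χ` to a cochain with integer
values, take its coboundary, divide by `N`, and reduce to `K`. For `N = p ^ n` this represents the
`n`-th Bockstein of the class of `χ`. -/
def bocksteinCochain {G : Type u} [Mul G] (χ : G → ZMod N) : (Fin 2 → G) → K :=
  fun g => (((((χ (g 0)).val : ℤ) + ((χ (g 1)).val : ℤ) - ((χ (g 0 * g 1)).val : ℤ)) / (N : ℤ) : ℤ) : K)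

/-- `x₁ = a^*` in `H^1(M)`. -/
def x1 : HRing K N :=
  DirectSum.of _ 1 (Coh.ofCochain K 1 (dualCochain fun m : BaseM.{u} N => m.1.exp))
/-- `y₁ = b^*` in `H^1(M)`. -/
def y1 : HRing K N :=
  DirectSum.of _ 1 (Coh.ofCochain K 1 (dualCochain fun m : BaseM.{u} N => m.2.exp))
/-- `x₂ = β_n(x₁)` in `H^2(M)`. -/
def x2 : HRing K N :=
  DirectSum.of _ 2 (Coh.ofCochain K 2 (bocksteinCochain fun m : BaseM.{u} N => m.1.exp))
/-- `y₂ = β_n(y₁)` in `H^2(M)`. -/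
def y2 : HRing K N :=
  DirectSum.of _ 2 (Coh.ofCochain K 2 (bocksteinCochain fun m : BaseM.{u} N => m.2.exp))

/-- The action of `Q` on `H^•(M)`. -/
def act (q : Cyc.{u} N) : HRing K N →ₗ[K] HRing K N := actTot K (heisAction N) q

/-- `z_{2p} = ∏_{i<p} σ^i • y₂`. -/
def z2p (p : ℕ) : HRing K N :=
  ((List.range p).map fun i => act (Cyc.gen N ^ i) y2).prod

variable (K N) in
/-- `H^s(M)` inside `H^•(M)`. -/
def Hs (s : ℕ) : Submodule K (HRing K N) :=
  LinearMap.range (DirectSum.lof K ℕ (Coh K (BaseM.{u} N)) s)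

variable (K N) in
/-- `W = Λ[x₁, y₁] ⊗ ⟨x₂^i y₂^j | 0 ≤ i, 0 ≤ j < p⟩`. -/
def W (p : ℕ) : Submodule K (HRing K N) :=
  Submodule.span K {w | ∃ a b i j : ℕ, a ≤ 1 ∧ b ≤ 1 ∧ j < p ∧ w = x1 ^ a * y1 ^ b * x2 ^ i * y2 ^ j}

variable (K N) in
/-- The degree `s` part `W^s`. -/
def Ws (p s : ℕ) : Submodule K (HRing K N) := W K N p ⊓ Hs K N s

/-- The `Q`-invariants in `U`. -/
def invariants (U : Submodule K (HRing K N)) : Submodule K (HRing K N) :=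
  U ⊓ ⨅ q : Cyc.{u} N, LinearMap.eqLocus (act q) LinearMap.id

/-- The image `(σ - 1) U`. -/
def sigmaSubOne (U : Submodule K (HRing K N)) : Submodule K (HRing K N) :=
  U.map (act (Cyc.gen N) - LinearMap.id)

/-- The `0`-cochain of `Q` with value `w` in `H^s(M)`. -/
def evenCochain (s : ℕ) (w : HRing K N) : (Fin 0 → Cyc.{u} N) → Coh K (BaseM.{u} N) s :=
  fun _ => w s

/-- The `1`-cochain of `Q` determined by `w` in `H^s(M)`: it sends `σ ^ k`, `0 ≤ k < N`, to
`∑_{i<k} σ^i • w`. It is the cocycle with value `w` at `σ`, provided that the norm of `Q` kills `w`. -/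
def oddCochain (s : ℕ) (w : HRing K N) : (Fin 1 → Cyc.{u} N) → Coh K (BaseM.{u} N) s :=
  fun g => ∑ i ∈ Finset.range (g 0).exp.val, (act (Cyc.gen N ^ i) w) s

variable (K N) in
/-- The carry cocycle of `Q = ⟨σ⟩` with values in the scalars `K = H^0(M)`: it sends
`(σ^i, σ^j)`, `0 ≤ i, j < N`, to `1` if `i + j ≥ N` and to `0` otherwise. -/
def gammaCochain : (Fin 2 → Cyc.{u} N) → Coh K (BaseM.{u} N) 0 :=
  fun g => Coh.const K (BaseM.{u} N) (bocksteinCochain Cyc.exp g)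

/-- The class in `E_2^{0,s}` of an invariant element of `H^s(M)`. -/
def bar0 (s : ℕ) (w : HRing K N) : ERing K N :=
  DirectSum.of _ (0, s) (E2.ofCochain K (heisAction N) 0 s (evenCochain s w))

/-- The class in `E_2^{1,s}` represented by an element of `H^s(M)`. -/
def bar1 (s : ℕ) (w : HRing K N) : ERing K N :=
  DirectSum.of _ (1, s) (E2.ofCochain K (heisAction N) 1 s (oddCochain s w))

def lam1 : ERing K N := bar0 1 x1
def lam2 : ERing K N := bar0 2 x2
def nu2 : ERing K N := bar0 2 (x1 * y1)
def nu3 : ERing K N := bar0 3 (x1 * y2 - y1 * x2)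
def nu2p (p : ℕ) : ERing K N := bar0 (2 * p) (z2p p)
def gam1 : ERing K N := bar1 0 1
/-- The class of `1` in `E_2^{2,0}`, under the periodicity isomorphism of the cyclic group `Q`. -/
def gam2 : ERing K N :=
  DirectSum.of _ (2, 0) (E2.ofCochain K (heisAction N) 2 0 (gammaCochain K N))
/-- `μ_{2i}` is the class of `y₁ y₂^(i-1)` and `μ_{2i+1}` is the class of `y₂^i`, in column one. -/
def mu (k : ℕ) : ERing K N :=
  if Even k then bar1 (k - 1) (y1 * y2 ^ (k / 2 - 1)) else bar1 (k - 1) (y2 ^ (k / 2))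

/-- The class in `E_2^{r,s}` represented by an element of `H^s(M)`, through the periodic
resolution of `Q`. -/
def bar (r s : ℕ) (w : HRing K N) : ERing K N :=
  (if Even r then bar0 s w else bar1 s w) * gam2 ^ (r / 2)

variable (K N) in
/-- `E_2^{r,s}` inside the second page. -/
def Ers (r s : ℕ) : Submodule K (ERing K N) :=
  LinearMap.range (DirectSum.lof K (ℕ × ℕ) (E2 K (heisAction.{u} N)) (r, s))

variable (K N) in
/-- `D_2^{r,s}`: the classes in `E_2^{r,s} = H^r(Q; H^s(M))` that are represented by cocycles with
values in `W^s`. -/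
def D2 (p r s : ℕ) : Submodule K (ERing K N) :=
  Submodule.map (DirectSum.lof K (ℕ × ℕ) (E2 K (heisAction.{u} N)) (r, s) ∘ₗ
      E2.mk K (heisAction.{u} N) r s)
    (⨅ g : Fin r → Cyc.{u} N, (W K N p).comap (DirectSum.lof K ℕ (Coh K (BaseM.{u} N)) s ∘ₗ
      LinearMap.proj g ∘ₗ Submodule.subtype _))

variable (K N) in
/-- `D_2`, the sum of all `D_2^{r,s}`. -/
def D2tot (p : ℕ) : Submodule K (ERing K N) := ⨆ r : ℕ, ⨆ s : ℕ, D2 K N p r s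

variable (K N) in
/-- The multiplication map `K[ν_{2p}] ⊗ D_2 → E_2`. -/
def tensorMul (p : ℕ) : TensorProduct K (Polynomial K) (D2tot K N p) →ₗ[K] ERing K N :=
  TensorProduct.lift
    (((LinearMap.mul K (ERing K N)).comp (Polynomial.aeval (nu2p p : ERing K N)).toLinearMap).compl₂
      (D2tot K N p).subtype)

/-- The family `v` is a basis of the subspace `U`. -/
def IsBasisOf {ι V : Type*} [AddCommGroup V] [Module K V] (v : ι → V) (U : Submodule K V) : Prop :=
  LinearIndependent K v ∧ Submodule.span K (Set.range v) = U

/-- Names for the generators `λ₁, λ₂, ν₂, ν₃` of the zeroth column. -/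
inductive ColGen
  | l1 | l2 | n2 | n3

/-- Their degrees. -/
def ColGen.deg : ColGen → ℕ
  | l1 => 1
  | l2 => 2
  | n2 => 2
  | n3 => 3

open FreeAlgebra in
/-- The relations of the zeroth column, with graded commutativity. -/
inductive ColRel (K : Type u) [Field K] : FreeAlgebra K ColGen → FreeAlgebra K ColGen → Prop
  | comm (a b : ColGen) :
      ColRel K (ι K a * ι K b) ((-1 : K) ^ (a.deg * b.deg) • (ι K b * ι K a))
  | nu2_sq : ColRel K (ι K .n2 ^ 2) 0
  | lam1_nu2 : ColRel K (ι K .l1 * ι K .n2) 0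
  | nu2_nu3 : ColRel K (ι K .n2 * ι K .n3) 0
  | lam1_nu3 : ColRel K (ι K .l1 * ι K .n3 + ι K .l2 * ι K .n2) 0

/-- The graded commutative algebra
`K[λ₁, λ₂, ν₂, ν₃] / (ν₂², λ₁ν₂, ν₂ν₃, λ₁ν₃ + λ₂ν₂)`. -/
abbrev ColAlg (K : Type u) [Field K] : Type u := RingQuot (ColRel K)

/-- The generators of `ColAlg K`. -/
def ColAlg.gen (K : Type u) [Field K] (a : ColGen) : ColAlg K :=
  RingQuot.mkAlgHom K (ColRel K) (FreeAlgebra.ι K a)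

end heis
end LHS
end
open LHS TensorProduct

/-!
The first step is the cohomology ring of `M = C_N × C_N`. Let `I` be the module of functions on
`ℤ/N`, on which `M` acts by translations through the first coordinate. It is coinduced from the
kernel of the first projection, which is cyclic, so by Shapiro's lemma its cohomology is one
dimensional in each degree and detected by restriction to that kernel (`shapiroInjective`).
Constants and sums of values give exact sequences `0 → K → I → J → 0` and `0 → J → I → K → 0`
whose connecting maps are, up to sign, the products with `x₁` and, composed, with `x₂`. Chasing
them on cochains shows that a class of degree at least two that restricts to zero is generated by
`x₁` and `x₂` (`exists_of_restrict_eq_zero`) and that there are no unexpected relations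
(`restrict_eq_zero_of_relation`, `eq_zero_of_relation`). By induction on the degree the monomials
`x₁^ε y₁^δ x₂^i y₂^j` form a basis of `H^•(M)` (`sum_monomials_eq_zero`, `Hs_le_span`).

Dehomogenizing forms in `x₂, y₂` turns `H^s(M)` into pairs of polynomials of bounded degree in one
variable `X` (`lev`), and `W^s` into the pairs of polynomials of degree less than `p`. The generator
`σ` acts by the translation `X ↦ X + 1`, with an additional shear in odd degrees (`act_lev`). As
translations have order `p` and `p² ∣ N`, the norm of `Q` is zero (`norm_eq_zero`). The element
`z_{2p}` acts as multiplication by the translation invariant monic polynomial `∏ (X + i)` of degree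
`p`, so division with remainder gives a decomposition `H^•(M) = W ⊕ z_{2p} H^•(M)` that is
compatible with `σ` (`exists_box_decomp`, `box_decomp_unique`). The bases of the invariants, the
differences and the coinvariants of `W` come from the difference operator `f(X + 1) - f(X)`: on
polynomials of degree less than `p` its kernel consists of the constants, and it lowers the degree by
exactly one (`eq_C_of_diffOp_eq_zero`, `exists_diffOp_eq`).

For the cohomology of `Q`, invariants and values of cocycles at `σ` describe columns zero and one.
The slant product with the chain `∑ [y | σ]` is a map of complexes when the norm vanishes, and it is
a left inverse, on cochains, of the product with the carry class `γ₂` (`slant_cup`). Since the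
cohomology groups of `Q` in degrees `r` and `r + 2` have the same finite dimension, the product with
`γ₂` is bijective (`cupClass_bijective`). The slant product sums values of a cocycle, so it preserves
cocycles with values in `W`, and therefore `D_2` is periodic as well (`D2_add_two`).

The decomposition of `H^•(M)` passes to `E_2 = D_2 ⊕ ν_{2p} E_2` with `ν_{2p}` a nonzerodivisor
(`exists_decomp`, `decomp_unique`). By induction on the degree `K[ν_{2p}] ⊗ D_2 → E_2` is bijective
(`tensorMul_injective`, `tensorMul_surjective`), and `E_2` is generated by the listed classes because
the bases of `D_2` consist of products of them (`adjoin_eq_top`). In column zero, the relations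
bring every element of the presented algebra into the form
`a(λ₂) + b(λ₂) λ₁ + c(λ₂) ν₂ + d(λ₂) ν₃` (`ColAlg.normalForm_surjective`), and the basis of
`D_2^{0,•}` shows that such an element is zero in `E_2` only if `a`, `b`, `c`, `d` are zero
(`colHom_injective`). Tensoring with `K[ν_{2p}]` gives the whole column (`columnHom_injective`,
`range_columnHom`).
-/

noncomputable section
open CategoryTheory

namespace LHS

/-! ### The slant product with a 2-chain -/

section tuple
variable {G : Type*}

/-- The tuple `(x, y, g)`. -/
abbrev snoc2 {r : ℕ} (x : Fin r → G) (y g : G) : Fin (r + 2) → G :=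
  Fin.snoc (α := fun _ => G) (Fin.snoc (α := fun _ => G) x y) g

theorem snoc2_zero_of_succ {r : ℕ} (x : Fin (r + 1) → G) (y g : G) : snoc2 x y g 0 = x 0 := by
  simp [snoc2, Fin.snoc]

theorem snoc_lt {r : ℕ} (x : Fin r → G) (y : G) (k : Fin (r + 1)) (h : (k : ℕ) < r) :
    Fin.snoc (α := fun _ => G) x y k = x ⟨k, h⟩ := by
  simp [Fin.snoc, h]; rfl

theorem snoc_eq {r : ℕ} (x : Fin r → G) (y : G) (k : Fin (r + 1)) (h : ¬ (k : ℕ) < r) :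
    Fin.snoc (α := fun _ => G) x y k = y := by
  simp [Fin.snoc, h]

theorem tail_snoc2 {r : ℕ} (x : Fin (r + 1) → G) (y g : G) :
    (fun i : Fin (r + 2) => snoc2 x y g i.succ) = snoc2 (fun i => x i.succ) y g := by
  funext i
  by_cases h1 : (i : ℕ) < r + 1
  · by_cases h2 : (i : ℕ) < r
    · rw [snoc2, snoc_lt _ _ _ (by simpa using h1), snoc_lt _ _ _ (by simpa using h2),
        snoc2, snoc_lt _ _ _ h1, snoc_lt _ _ _ (by simpa using h2)]
      rfl
    · rw [snoc2, snoc_lt _ _ _ (by simpa using h1), snoc_eq _ _ _ (by simpa using h2),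
        snoc2, snoc_lt _ _ _ h1, snoc_eq _ _ _ (by simpa using h2)]
  · rw [snoc2, snoc_eq _ _ _ (by simpa using h1), snoc2, snoc_eq _ _ _ h1]

variable [Group G]

theorem contractNth_snoc {r : ℕ} (x : Fin (r + 1) → G) (y : G) (j : Fin (r + 1)) :
    Fin.contractNth j.castSucc (· * ·) (Fin.snoc (α := fun _ => G) x y) =
      if (j : ℕ) < r then Fin.snoc (α := fun _ => G) (Fin.contractNth j (· * ·) x) y
        else Fin.snoc (α := fun _ => G) (fun i : Fin r => x i.castSucc) (x (Fin.last r) * y) := by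
  funext k
  split_ifs with hj
  · rcases lt_trichotomy (k : ℕ) (j : ℕ) with h | h | h
    · rw [Fin.contractNth_apply_of_lt _ _ _ _ (by simpa using h), snoc_lt _ _ _ (by simp; omega),
        snoc_lt _ _ _ (by omega), Fin.contractNth_apply_of_lt _ _ _ _ (by simpa using h)]
      rfl
    · rw [Fin.contractNth_apply_of_eq _ _ _ _ (by simpa using h), snoc_lt _ _ _ (by simp; omega),
        snoc_lt _ _ _ (by simp; omega),
        snoc_lt _ _ _ (by omega), Fin.contractNth_apply_of_eq _ _ _ _ (by simpa using h)]
      rfl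
    · rw [Fin.contractNth_apply_of_gt _ _ _ _ (by simpa using h)]
      by_cases hk : (k : ℕ) < r
      · rw [snoc_lt _ _ _ (by simp; omega),
          snoc_lt _ _ _ hk, Fin.contractNth_apply_of_gt _ _ _ _ (by simpa using h)]
        rfl
      · rw [snoc_eq _ _ _ (by simp; omega), snoc_eq _ _ _ hk]
  · have hj' : (j : ℕ) = r := by omega
    by_cases hk : (k : ℕ) < r
    · rw [Fin.contractNth_apply_of_lt _ _ _ _ (by simp; omega), snoc_lt _ _ _ (by simp; omega),
        snoc_lt _ _ _ hk]
      rfl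
    · have hk' : (k : ℕ) = r := by omega
      rw [Fin.contractNth_apply_of_eq _ _ _ _ (by simp; omega), snoc_lt _ _ _ (by simp; omega),
        snoc_eq _ _ _ (by simp; omega), snoc_eq _ _ _ hk]
      congr 2
      ext
      exact hk'

theorem contractNth_snoc_last {r : ℕ} (x : Fin r → G) (y : G) :
    Fin.contractNth (Fin.last r) (· * ·) (Fin.snoc (α := fun _ => G) x y) = x := by
  funext k
  rw [Fin.contractNth_apply_of_lt _ _ _ _ (by simp), snoc_lt _ _ _ (by simp)]
  rfl

end tuple

section slant
variable {K G : Type u} [CommRing K] [Group G] [Fintype G]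

/-- The slant product with the `2`-chain `∑ y, [y | g]`, which is a cycle modulo the norm. -/
def slant (A : Rep.{u} K G) (g : G) (r : ℕ) :
    ((Fin (r + 2) → G) → A) →ₗ[K] ((Fin r → G) → A) where
  toFun f x := ∑ y : G, f (snoc2 x y g)
  map_add' f f' := by ext x; simp [Finset.sum_add_distrib]
  map_smul' c f := by ext x; simp [Finset.smul_sum]

theorem slant_apply (A : Rep.{u} K G) (g : G) (r : ℕ) (f : (Fin (r + 2) → G) → A)
    (x : Fin r → G) : slant A g r f x = ∑ y : G, f (snoc2 x y g) := rfl

/-- The slant product is a map of complexes in positive degrees: in the last coordinates, the two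
boundary terms `[y * g]` and `[y]` have the same sum over `y`. -/
theorem d_slant (A : Rep.{u} K G) (g : G) (r : ℕ) (f : (Fin (r + 2) → G) → A) :
    inhomogeneousCochains.d A r (slant A g r f) =
      slant A g (r + 1) (inhomogeneousCochains.d A (r + 2) f) := by
  funext x
  rw [slant_apply]
  simp only [inhomogeneousCochains.d_hom_apply]
  rw [Finset.sum_add_distrib]
  congr 1
  · rw [slant_apply, map_sum]
    refine Finset.sum_congr rfl fun y _ => ?_
    rw [tail_snoc2, snoc2_zero_of_succ]
  · rw [Finset.sum_comm, Fin.sum_univ_castSucc (n := r + 2), Fin.sum_univ_castSucc (n := r + 1),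
      add_assoc]
    have h1 : ∀ y : G, Fin.contractNth (Fin.last (r + 2)) (· * ·) (snoc2 x y g) =
        Fin.snoc (α := fun _ => G) x y := fun y => contractNth_snoc_last _ _
    have h2 : ∀ y : G, Fin.contractNth (Fin.last (r + 1)).castSucc (· * ·) (snoc2 x y g) =
        Fin.snoc (α := fun _ => G) x (y * g) := fun y => by
      rw [snoc2, contractNth_snoc, if_neg (by simp)]
      congr 1
      · funext i
        rw [snoc_lt _ _ _ (by simp; omega)]
        rfl
      · rw [snoc_eq _ _ _ (by simp)]
    simp only [h1, h2]
    have h3 : ∑ y : G, f (Fin.snoc (α := fun _ => G) x (y * g)) =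
        ∑ y : G, f (Fin.snoc (α := fun _ => G) x y) :=
      Fintype.sum_equiv (Equiv.mulRight g) _ _ fun y => rfl
    rw [← Finset.smul_sum, ← Finset.smul_sum, h3, ← add_smul]
    have h4 : ((-1 : K) ^ ((((Fin.last (r + 1)).castSucc : Fin (r + 3)) : ℕ) + 1) +
      (-1 : K) ^ (((Fin.last (r + 2) : Fin (r + 3)) : ℕ) + 1)) = 0 := by
      simp [pow_succ]
    rw [h4, zero_smul, add_zero]
    refine Finset.sum_congr rfl fun j _ => ?_
    rw [slant_apply, ← Finset.smul_sum]
    congr 1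
    have h5 : ∀ y : G, Fin.contractNth j.castSucc.castSucc (· * ·) (snoc2 x y g) =
        Fin.snoc (α := fun _ => G) (Fin.contractNth j.castSucc (· * ·)
          (Fin.snoc (α := fun _ => G) x y)) g := fun y => by
      rw [snoc2, contractNth_snoc, if_pos (by simp; omega)]
    simp only [h5, contractNth_snoc]
    split_ifs with hj
    · rfl
    · have hj' : j = Fin.last r := by ext; simp; omega
      subst hj'
      have h6 : Fin.contractNth (Fin.last r) (· * ·) x = fun i => x i.castSucc := by
        funext k
        rw [Fin.contractNth_apply_of_lt _ _ _ _ (by simp)]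
      rw [h6]
      exact (Fintype.sum_equiv (Equiv.mulLeft (x (Fin.last r))) _ _ fun y => rfl).symm

/-- In degree zero the slant product of a coboundary is a value of the norm, not zero. -/
theorem slant_d_zero (A : Rep.{u} K G) (g : G) (e : (Fin 1 → G) → A) (x : Fin 0 → G) :
    slant A g 0 (inhomogeneousCochains.d A 1 e) x = A.ρ.norm (e fun _ => g) := by
  rw [slant_apply]
  simp only [inhomogeneousCochains.d_hom_apply]
  have h1 : ∀ y, ∑ j : Fin (1 + 1), (-1 : K) ^ ((j : ℕ) + 1) •
      e (Fin.contractNth j (· * ·) (snoc2 x y g)) = -e (fun _ => y * g) + e (fun _ => y) := by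
    intro y
    have h1 : Fin.contractNth 0 (· * ·) (snoc2 x y g) = fun _ => y * g := by
      funext k; fin_cases k; rfl
    have h2 : Fin.contractNth 1 (· * ·) (snoc2 x y g) = fun _ => y := by
      funext k; fin_cases k; rfl
    rw [Fin.sum_univ_two, h1, h2]
    simp
  have h3 : ∀ y, (fun i : Fin 1 => snoc2 x y g i.succ) = fun _ => g := fun y => by
    funext k; fin_cases k; rfl
  have h0 : ∀ y, snoc2 x y g 0 = y := fun y => rfl
  simp only [h1, h3, h0, Finset.sum_add_distrib, Finset.sum_neg_distrib]
  have h4 : ∑ y : G, e (fun _ => y * g) = ∑ y : G, e (fun _ => y) :=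
      Fintype.sum_equiv (Equiv.mulRight g) _ _ fun y => rfl
  rw [h4]
  simp [Representation.norm]

/-- Only the slant product of the right factor remains, as the last two entries of the tuple feed
it. -/
theorem slant_cupCochain {A B C : Rep.{u} K G} (θ : A →ₗ[K] B →ₗ[K] C) (g : G) (r : ℕ)
    (f : (Fin r → G) → A) (c : (Fin 2 → G) → B) (x : Fin r → G) :
    slant C g r (cupCochain θ r 2 f c) x =
      θ (f x) (B.ρ (Fin.partialProd x (Fin.last r)) (∑ y : G, c ![y, g])) := by
  rw [slant_apply, map_sum, map_sum]
  refine Finset.sum_congr rfl fun y _ => ?_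
  rw [cupCochain_apply]
  have h1 : (fun i => snoc2 x y g (Fin.castAdd 2 i)) = x := by
    funext i
    rw [snoc2, snoc_lt _ _ _ (by simp), snoc_lt _ _ _ (by simp)]
    rfl
  have h2 : (fun j => snoc2 x y g (Fin.natAdd r j)) = ![y, g] := by
    funext j
    fin_cases j
    · rw [snoc2, snoc_lt _ _ _ (by simp), snoc_eq _ _ _ (by simp)]
      rfl
    · rw [snoc2, snoc_eq _ _ _ (by simp)]
      rfl
  have h3 : Fin.partialProd (snoc2 x y g) ⟨r, by omega⟩ = Fin.partialProd x (Fin.last r) := by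
    refine partialProd_congr _ _ r _ _ fun i hi => ?_
    rw [snoc2, snoc_lt _ _ _ (by simp; omega), snoc_lt _ _ _ (by simpa using hi)]
  rw [h1, h2, h3]

end slant

/-! ### Dimension of the cohomology of a cyclic group -/

section cyclic
variable {K G : Type u} [Field K] [CommGroup G] [Fintype G]

open Rep.FiniteCyclicGroup in
/-- If the norm kills `A`, all cohomology groups of a finite cyclic group with coefficients in `A`
have the dimension of the invariants. -/
theorem finrank_cyclic (A : Rep.{u} K G) [Module.Finite K A] (g : G)
    (hg : ∀ x, x ∈ Subgroup.zpowers g) (hA : A.ρ.norm = 0) (r : ℕ) :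
    Module.Finite K (groupCohomology A r) ∧ Module.finrank K (groupCohomology A r) =
      Module.finrank K (LinearMap.ker (A.ρ g - LinearMap.id)) := by
  have hsub : (A.applyAsHom g - 𝟙 A).hom.toLinearMap = A.ρ g - LinearMap.id := by
    ext; simp [Rep.sub_hom]
  have hnorm : A.norm.hom.toLinearMap = 0 := by
    ext x
    exact LinearMap.congr_fun hA x
  rcases Nat.eq_zero_or_pos r with rfl | hr
  · have e := (groupCohomologyIso₀ A g hg).toLinearEquiv
    rw [hsub] at e
    exact ⟨Module.Finite.equiv e.symm, e.finrank_eq⟩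
  · have : NeZero r := ⟨hr.ne'⟩
    rcases Nat.even_or_odd r with h | h
    · have hs : Function.Surjective (groupCohomologyπEven A g hg r h).hom := by
        have h1 := (normHomCompSub A g).moduleCatCyclesIso.toLinearEquiv.symm.surjective
        have h2 : Function.Surjective (normHomCompSub A g).homologyπ.hom :=
          (ModuleCat.epi_iff_surjective _).1 inferInstance
        have h3 := (groupCohomologyIsoEven A g hg r h).toLinearEquiv.symm.surjective
        exact (h3.comp h2).comp h1
      have hi : Function.Injective (groupCohomologyπEven A g hg r h).hom := by
        refine (injective_iff_map_eq_zero _).2 fun x hx => ?_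
        have := (groupCohomologyπEven_eq_zero_iff A g hg r h x).1 hx
        rw [hnorm] at this
        simpa using this
      have e := LinearEquiv.ofBijective _ ⟨hi, hs⟩
      have e' : (LinearMap.ker (A.applyAsHom g - 𝟙 A).hom.toLinearMap) ≃ₗ[K]
        groupCohomology A r := e
      rw [hsub] at e'
      exact ⟨Module.Finite.equiv e', e'.finrank_eq.symm⟩
    · have hs : Function.Surjective (groupCohomologyπOdd A g hg r h).hom := by
        have h1 := (subCompNormHom A g).moduleCatCyclesIso.toLinearEquiv.symm.surjective
        have h2 : Function.Surjective (subCompNormHom A g).homologyπ.hom :=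
          (ModuleCat.epi_iff_surjective _).1 inferInstance
        have h3 := (groupCohomologyIsoOdd A g hg r h).toLinearEquiv.symm.surjective
        exact (h3.comp h2).comp h1
      -- As the norm vanishes, the class in odd degree is defined on all of `A`.
      let F : A →ₗ[K] groupCohomology A r := (groupCohomologyπOdd A g hg r h).hom ∘ₗ
        LinearMap.codRestrict (LinearMap.ker A.norm.hom.toLinearMap) LinearMap.id
          (fun x => by rw [hnorm]; rfl)
      have hF : Function.Surjective F := fun y => by
        obtain ⟨x, rfl⟩ := hs y
        exact ⟨x.1, rfl⟩
      have hk : LinearMap.ker F = LinearMap.range (A.ρ g - LinearMap.id) := by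
        ext x
        rw [LinearMap.mem_ker, ← hsub]
        exact groupCohomologyπOdd_eq_zero_iff A g hg r h _
      have hfin : Module.Finite K (groupCohomology A r) := Module.Finite.of_surjective F hF
      refine ⟨hfin, ?_⟩
      have h1 := F.finrank_range_add_finrank_ker
      have h2 := (A.ρ g - LinearMap.id).finrank_range_add_finrank_ker
      rw [LinearMap.range_eq_top.2 hF, finrank_top, hk] at h1
      omega

end cyclic

/-! ### The carry cocycle and periodicity -/

section carry
variable {N : ℕ} [NeZero N]

/-- The carry of the addition of the representatives `0 ≤ a, b < N`. -/
def carry (a b : ZMod N) : ℤ := ((a.val : ℤ) + (b.val : ℤ) - ((a + b).val : ℤ)) / (N : ℤ)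

/-- The division in the definition of `carry` is exact. -/
theorem mul_carry (a b : ZMod N) :
    (N : ℤ) * carry a b = (a.val : ℤ) + (b.val : ℤ) - ((a + b).val : ℤ) := by
  refine Int.mul_ediv_cancel' ?_
  rw [← ZMod.intCast_zmod_eq_zero_iff_dvd]
  push_cast
  simp

theorem carry_cocycle (a b c : ZMod N) :
    carry b c - carry (a + b) c + carry a (b + c) - carry a b = 0 := by
  have hN : (N : ℤ) ≠ 0 := by exact_mod_cast NeZero.ne N
  apply mul_left_cancel₀ hN
  have h1 := mul_carry b c
  have h2 := mul_carry (a + b) c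
  have h3 := mul_carry a (b + c)
  have h4 := mul_carry a b
  rw [add_assoc] at h2
  linear_combination h1 - h2 + h3 - h4

/-- The carry cocycle is additive in the characters up to the coboundary of a carry. -/
theorem carry_add (a b a' b' : ZMod N) :
    carry (a + a') (b + b') = carry a b + carry a' b' -
      (carry a a' + carry b b' - carry (a + b) (a' + b')) := by
  have hN : (N : ℤ) ≠ 0 := by exact_mod_cast NeZero.ne N
  apply mul_left_cancel₀ hN
  have h1 := mul_carry (a + a') (b + b')
  have h2 := mul_carry a b
  have h3 := mul_carry a' b'
  have h4 := mul_carry a a'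
  have h5 := mul_carry b b'
  have h6 := mul_carry (a + b) (a' + b')
  rw [show a + a' + (b + b') = a + b + (a' + b') by ring] at h1
  linear_combination h1 - h2 - h3 + h4 + h5 - h6

theorem carry_zero_left (b : ZMod N) : carry 0 b = 0 := by simp [carry]

/-- The slant product of the carry cocycle with the fundamental chain is one. -/
theorem sum_carry_one (hN : 1 < N) : ∑ a : ZMod N, carry a 1 = 1 := by
  have hN0 : (N : ℤ) ≠ 0 := by exact_mod_cast NeZero.ne N
  have : Fact (1 < N) := ⟨hN⟩
  apply mul_left_cancel₀ hN0
  rw [Finset.mul_sum]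
  simp only [mul_carry]
  rw [Finset.sum_sub_distrib, Finset.sum_add_distrib]
  have h : ∑ a : ZMod N, ((a + 1).val : ℤ) = ∑ a : ZMod N, (a.val : ℤ) :=
    Fintype.sum_equiv (Equiv.addRight 1) _ _ fun _ => rfl
  rw [h, ZMod.val_one]
  simp [ZMod.card]

variable {K G : Type u} [Field K]

omit [NeZero N] in
theorem bocksteinCochain_apply [Group G] {χ : G → ZMod N} (hχ : ∀ x y, χ (x * y) = χ x + χ y)
    (x : Fin 2 → G) :
    (bocksteinCochain χ x : K) = ((carry (χ (x 0)) (χ (x 1)) : ℤ) : K) := by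
  rw [bocksteinCochain, hχ]
  rfl
end carry

section lowdegree
variable {K G : Type u} [CommRing K] [Group G]

theorem d_one_apply (A : Rep.{u} K G) (f : (Fin 1 → G) → A) (x : Fin 2 → G) :
    inhomogeneousCochains.d A 1 f x =
      A.ρ (x 0) (f fun _ => x 1) - f (fun _ => x 0 * x 1) + f (fun _ => x 0) := by
  rw [inhomogeneousCochains.d_hom_apply, Fin.sum_univ_two]
  have h1 : Fin.contractNth 0 (· * ·) x = fun _ => x 0 * x 1 := by
    funext k; fin_cases k; rfl
  have h2 : Fin.contractNth 1 (· * ·) x = fun _ => x 0 := by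
    funext k; fin_cases k; rfl
  have h3 : (fun i : Fin 1 => x i.succ) = fun _ => x 1 := by
    funext k; fin_cases k; rfl
  rw [h1, h2, h3]
  simp
  abel

theorem d_zero_apply (A : Rep.{u} K G) (f : (Fin 0 → G) → A) (x : Fin 1 → G) :
    inhomogeneousCochains.d A 0 f x = A.ρ (x 0) (f Fin.elim0) - f Fin.elim0 := by
  rw [inhomogeneousCochains.d_hom_apply]
  have h : ∀ y : Fin 0 → G, f y = f Fin.elim0 := fun y => congrArg f (Subsingleton.elim _ _)
  simp [h, sub_eq_add_neg]

theorem d_two_apply (A : Rep.{u} K G) (f : (Fin 2 → G) → A) (x : Fin 3 → G) :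
    inhomogeneousCochains.d A 2 f x =
      A.ρ (x 0) (f ![x 1, x 2]) - f ![x 0 * x 1, x 2] + f ![x 0, x 1 * x 2] - f ![x 0, x 1] := by
  rw [inhomogeneousCochains.d_hom_apply, Fin.sum_univ_three]
  have h1 : Fin.contractNth 0 (· * ·) x = ![x 0 * x 1, x 2] := by
    funext k; fin_cases k <;> rfl
  have h2 : Fin.contractNth 1 (· * ·) x = ![x 0, x 1 * x 2] := by
    funext k; fin_cases k <;> rfl
  have h2' : Fin.contractNth 2 (· * ·) x = ![x 0, x 1] := by
    funext k; fin_cases k <;> rfl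
  have h3 : (fun i : Fin 2 => x i.succ) = ![x 1, x 2] := by
    funext k; fin_cases k <;> rfl
  rw [h1, h2, h2', h3]
  simp [pow_succ]
  abel

theorem d_three_apply (A : Rep.{u} K G) (f : (Fin 3 → G) → A) (x : Fin 4 → G) :
    inhomogeneousCochains.d A 3 f x =
      A.ρ (x 0) (f ![x 1, x 2, x 3]) - f ![x 0 * x 1, x 2, x 3] + f ![x 0, x 1 * x 2, x 3] -
        f ![x 0, x 1, x 2 * x 3] + f ![x 0, x 1, x 2] := by
  rw [inhomogeneousCochains.d_hom_apply, Fin.sum_univ_four]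
  have h0 : Fin.contractNth 0 (· * ·) x = ![x 0 * x 1, x 2, x 3] := by
    funext k; fin_cases k <;> rfl
  have h1 : Fin.contractNth 1 (· * ·) x = ![x 0, x 1 * x 2, x 3] := by
    funext k; fin_cases k <;> rfl
  have h2 : Fin.contractNth 2 (· * ·) x = ![x 0, x 1, x 2 * x 3] := by
    funext k; fin_cases k <;> rfl
  have h2' : Fin.contractNth 3 (· * ·) x = ![x 0, x 1, x 2] := by
    funext k; fin_cases k <;> rfl
  have h3 : (fun i : Fin 3 => x i.succ) = ![x 1, x 2, x 3] := by
    funext k; fin_cases k <;> rfl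
  rw [h0, h1, h2, h2', h3]
  simp [pow_succ]
  abel

theorem mem_cocycle_iff (A : Rep.{u} K G) (n : ℕ) (f : (Fin n → G) → A) :
    f ∈ cocycleSubmodule A n ↔ ∀ x, inhomogeneousCochains.d A n f x = 0 :=
  ⟨fun h x => congrFun (show inhomogeneousCochains.d A n f = 0 from h) x, fun h => funext h⟩

end lowdegree

section lowdegree
variable {K G : Type u} [Field K] [Group G] {N : ℕ} [NeZero N]

theorem dualCochain_mem (hN : (N : K) = 0) {χ : G → ZMod N} (hχ : ∀ x y, χ (x * y) = χ x + χ y) :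
    dualCochain (K := K) χ ∈ cocycleSubmodule (Rep.trivial K G K) 1 := by
  rw [mem_cocycle_iff]
  intro x
  rw [d_one_apply]
  show ((χ (x 1)).val : K) - ((χ (x 0 * x 1)).val : K) + ((χ (x 0)).val : K) = 0
  have h := congrArg (Int.cast : ℤ → K) (mul_carry (χ (x 0)) (χ (x 1)))
  push_cast at h
  rw [hN, zero_mul] at h
  rw [hχ]
  linear_combination -h

theorem bocksteinCochain_mem {χ : G → ZMod N} (hχ : ∀ x y, χ (x * y) = χ x + χ y) :
    bocksteinCochain (K := K) χ ∈ cocycleSubmodule (Rep.trivial K G K) 2 := by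
  rw [mem_cocycle_iff]
  intro x
  rw [d_two_apply]
  show (bocksteinCochain χ ![x 1, x 2] : K) - bocksteinCochain χ ![x 0 * x 1, x 2] +
    bocksteinCochain χ ![x 0, x 1 * x 2] - bocksteinCochain χ ![x 0, x 1] = 0
  simp only [bocksteinCochain_apply hχ, Matrix.cons_val_zero, Matrix.cons_val_one, hχ]
  have h := congrArg (Int.cast : ℤ → K) (carry_cocycle (χ (x 0)) (χ (x 1)) (χ (x 2)))
  push_cast at h
  exact h
end lowdegree

section period
variable {K G : Type u} [Field K] [CommGroup G] [Fintype G]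

/-- Cup product on the right with a class `c` of degree two. -/
def cupClass {A B : Rep.{u} K G} {θ : A →ₗ[K] B →ₗ[K] A} (hθ : IsEquivariant θ)
    (c : cocycleSubmodule B 2) (r : ℕ) : groupCohomology A r →ₗ[K] groupCohomology A (r + 2) :=
  (cup hθ r 2).flip (classMap B 2 c)

variable {A B : Rep.{u} K G} {θ : A →ₗ[K] B →ₗ[K] A} (hθ : IsEquivariant θ)
  (c : cocycleSubmodule B 2) (g : G)

theorem slant_mem (r : ℕ) (F : cocycleSubmodule A (r + 2)) :
    slant A g r F.1 ∈ cocycleSubmodule A r := by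
  have hF : inhomogeneousCochains.d A (r + 2) F.1 = 0 := F.2
  show inhomogeneousCochains.d A r _ = 0
  rw [d_slant, hF, map_zero]

/-- On classes the slant product is well defined when the norm vanishes. -/
theorem classMap_slant_eq_zero (hA : A.ρ.norm = 0) (r : ℕ) (F : cocycleSubmodule A (r + 2))
    (hF : classMap A (r + 2) F = 0) : classMap A r ⟨_, slant_mem g r F⟩ = 0 := by
  obtain ⟨e, he⟩ := exists_of_classMap_succ A (r + 1) F hF
  cases r with
  | zero =>
    have h : (⟨_, slant_mem g 0 F⟩ : cocycleSubmodule A 0) = 0 := by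
      ext x
      show slant A g 0 F.1 x = 0
      rw [← he, slant_d_zero, hA]
      rfl
    rw [h, map_zero]
  | succ r =>
    refine classMap_eq_zero A (r + 1) r rfl _ (slant A g r e) fun x => ?_
    rw [d_slant, he]
    rfl

/-- On cochains the slant product is a left inverse of the cup product with `c`. -/
theorem slant_cup (hc : ∀ a q, θ a (B.ρ q (∑ y : G, c.1 ![y, g])) = a) (r : ℕ)
    (f : (Fin r → G) → A) : slant A g r (cupCochain θ r 2 f c.1) = f := by
  funext x
  rw [slant_cupCochain, hc]

theorem cupClass_injective (hA : A.ρ.norm = 0)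
    (hc : ∀ a q, θ a (B.ρ q (∑ y : G, c.1 ![y, g])) = a) (r : ℕ) :
    Function.Injective (cupClass hθ c r) := by
  refine (injective_iff_map_eq_zero _).2 fun x hx => ?_
  obtain ⟨f, rfl⟩ := classMap_surjective A r x
  have h1 : classMap A (r + 2) ⟨_, cupCochain_mem hθ r 2 f c⟩ = 0 :=
    (cup_classMap hθ r 2 f c).symm.trans hx
  have h2 := classMap_slant_eq_zero g hA r _ h1
  rw [← h2]
  congr 1
  ext1
  exact (slant_cup c g hc r f.1).symm

/-- The periodicity of the cohomology of a cyclic group: cup product with a class `c` whose slant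
product with the fundamental cycle is the identity. -/
theorem cupClass_bijective [Module.Finite K A] (hg : ∀ x, x ∈ Subgroup.zpowers g)
    (hA : A.ρ.norm = 0) (hc : ∀ a q, θ a (B.ρ q (∑ y : G, c.1 ![y, g])) = a) (r : ℕ) :
    Function.Bijective (cupClass hθ c r) := by
  have hi := cupClass_injective hθ c g hA hc r
  obtain ⟨h1, h2⟩ := finrank_cyclic A g hg hA r
  obtain ⟨h3, h4⟩ := finrank_cyclic A g hg hA (r + 2)
  exact ⟨hi, (LinearMap.injective_iff_surjective_of_finrank_eq_finrank (h2.trans h4.symm)).1 hi⟩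

/-- On cocycles the slant product computes the inverse of the cup product with `c`. Unlike the
abstract inverse, it keeps the values of a cocycle in any given subspace of the coefficients. -/
theorem cupClass_slant [Module.Finite K A] (hg : ∀ x, x ∈ Subgroup.zpowers g)
    (hA : A.ρ.norm = 0) (hc : ∀ a q, θ a (B.ρ q (∑ y : G, c.1 ![y, g])) = a) (r : ℕ)
    (F : cocycleSubmodule A (r + 2)) :
    cupClass hθ c r (classMap A r ⟨_, slant_mem g r F⟩) = classMap A (r + 2) F := by
  obtain ⟨x, hx⟩ := (cupClass_bijective hθ c g hg hA hc r).2 (classMap A (r + 2) F)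
  obtain ⟨f, rfl⟩ := classMap_surjective A r x
  have h1 : classMap A (r + 2) ⟨_, cupCochain_mem hθ r 2 f c⟩ = classMap A (r + 2) F :=
    (cup_classMap hθ r 2 f c).symm.trans hx
  have h2 := classMap_slant_eq_zero g hA r (F - ⟨_, cupCochain_mem hθ r 2 f c⟩)
    (by rw [map_sub, h1, sub_self])
  have h3 : (⟨_, slant_mem g r (F - ⟨_, cupCochain_mem hθ r 2 f c⟩)⟩ : cocycleSubmodule A r) =
      ⟨_, slant_mem g r F⟩ - f := by
    ext1
    show slant A g r (F.1 - cupCochain θ r 2 f.1 c.1) = slant A g r F.1 - f.1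
    rw [map_sub, slant_cup c g hc]
  rw [h3, map_sub, sub_eq_zero] at h2
  rw [h2, hx]

end period

/-! ### Graded commutativity in low degrees -/

section ring
variable {K G : Type u} [Field K] [Group G]

theorem Coh.of_mk_mul (s t : ℕ) (f : cocycleSubmodule (Rep.trivial K G K) s)
    (g : cocycleSubmodule (Rep.trivial K G K) t) :
    (DirectSum.of (Coh K G) s (Coh.mk K G s f) * DirectSum.of (Coh K G) t (Coh.mk K G t g)) =
      DirectSum.of (Coh K G) (s + t) (Coh.mk K G (s + t) ⟨cupCochain (mulK K G) s t f.1 g.1,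
        cupCochain_mem (mulK_equivariant K G) s t f g⟩) :=
  (DirectSum.of_mul_of _ _).trans (congrArg _ (Coh.cup_mk K G s t f g))

theorem Coh.mk_eq_of_d (n : ℕ) (f g : cocycleSubmodule (Rep.trivial K G K) (n + 1))
    (e : (Fin n → G) → K)
    (h : ∀ x, f.1 x - g.1 x = inhomogeneousCochains.d (Rep.trivial K G K) n e x) :
    Coh.mk K G (n + 1) f = Coh.mk K G (n + 1) g := by
  rw [← sub_eq_zero, ← map_sub]
  exact classMap_eq_zero _ (n + 1) n rfl _ e h

theorem Coh.ofCochain_of_mem {s : ℕ} {f : (Fin s → G) → K}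
    (h : f ∈ cocycleSubmodule (Rep.trivial K G K) s) :
    Coh.ofCochain K s f = Coh.mk K G s ⟨f, h⟩ := dif_pos h

/-- In degree one there are no coboundaries for trivial coefficients. -/
theorem Coh.mk_one_injective : Function.Injective (Coh.mk K G 1) := by
  refine (injective_iff_map_eq_zero _).2 fun f hf => ?_
  obtain ⟨e, he⟩ := exists_of_classMap_succ _ 0 f hf
  ext x
  rw [← he, d_zero_apply]
  exact sub_self (e _)

theorem Coh.mk_zero_injective : Function.Injective (Coh.mk K G 0) :=
  (injective_iff_map_eq_zero _).2 fun f hf => eq_zero_of_classMap_zero _ f hf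

theorem cocycle_one_mul (f : cocycleSubmodule (Rep.trivial K G K) 1) (x y : G) :
    (f.1 fun _ => x * y : K) = (f.1 fun _ => x) + (f.1 fun _ => y) := by
  have h := (mem_cocycle_iff _ 1 f.1).1 f.2 ![x, y]
  rw [d_one_apply] at h
  have h' : (f.1 fun _ => y : K) - (f.1 fun _ => x * y) + (f.1 fun _ => x) = 0 := h
  linear_combination -h'

theorem cocycle_two_mul (f : cocycleSubmodule (Rep.trivial K G K) 2) (x y z : G) :
    (f.1 ![y, z] : K) - f.1 ![x * y, z] + f.1 ![x, y * z] - f.1 ![x, y] = 0 := by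
  have h := (mem_cocycle_iff _ 2 f.1).1 f.2 ![x, y, z]
  rw [d_two_apply] at h
  exact h

/-- Two classes of degree one anticommute: for cocycles `f`, `g` of degree one the function `-f g`
bounds `f ∪ g + g ∪ f`. -/
theorem Coh.mul_comm_one_one (f g : cocycleSubmodule (Rep.trivial K G K) 1) :
    (DirectSum.of (Coh K G) 1 (Coh.mk K G 1 f) * DirectSum.of (Coh K G) 1 (Coh.mk K G 1 g)) =
      -(DirectSum.of (Coh K G) 1 (Coh.mk K G 1 g) *
        DirectSum.of (Coh K G) 1 (Coh.mk K G 1 f)) := by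
  rw [Coh.of_mk_mul, Coh.of_mk_mul, ← map_neg, ← map_neg]
  refine congrArg (DirectSum.of (Coh K G) 2) ?_
  refine Coh.mk_eq_of_d 1 _ _ (fun x => - ((f.1 x : K) * (g.1 x : K))) fun x => ?_
  rw [d_one_apply]
  have e1 : ∀ f g : cocycleSubmodule (Rep.trivial K G K) 1,
      cupCochain (mulK K G) 1 1 f.1 g.1 x = (f.1 fun _ => x 0 : K) * g.1 fun _ => x 1 := by
    intro f g
    rw [cupCochain_mulK]
    refine congrArg₂ (· * ·) (congrArg _ ?_) (congrArg _ ?_) <;> funext k <;> fin_cases k <;> rfl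
  refine (congrArg₂ (fun a b : K => a - -b) (e1 f g) (e1 g f)).trans ?_
  show (f.1 fun _ => x 0 : K) * (g.1 fun _ => x 1) - -((g.1 fun _ => x 0) * (f.1 fun _ => x 1)) =
    -((f.1 fun _ => x 1 : K) * (g.1 fun _ => x 1)) -
      -((f.1 fun _ => x 0 * x 1 : K) * (g.1 fun _ => x 0 * x 1)) +
      -((f.1 fun _ => x 0 : K) * (g.1 fun _ => x 0))
  rw [cocycle_one_mul, cocycle_one_mul]
  ring

theorem Coh.mul_comm_one_two (f : cocycleSubmodule (Rep.trivial K G K) 1)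
    (g : cocycleSubmodule (Rep.trivial K G K) 2) :
    Commute (DirectSum.of (Coh K G) 1 (Coh.mk K G 1 f))
      (DirectSum.of (Coh K G) 2 (Coh.mk K G 2 g)) := by
  rw [Commute, SemiconjBy, Coh.of_mk_mul, Coh.of_mk_mul]
  refine congrArg (DirectSum.of (Coh K G) 3) ?_
  -- The homotopy is the cup-one product of `f` and `g`.
  refine Coh.mk_eq_of_d 2 _ _ (fun x => - ((f.1 fun _ => x 0 * x 1 : K) * (g.1 x : K)))
    fun x => ?_
  rw [d_two_apply]
  have e1 : cupCochain (mulK K G) 1 2 f.1 g.1 x = (f.1 fun _ => x 0 : K) * g.1 ![x 1, x 2] := by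
    rw [cupCochain_mulK]
    refine congrArg₂ (· * ·) (congrArg _ ?_) (congrArg _ ?_) <;> funext k <;> fin_cases k <;> rfl
  have e2 : cupCochain (mulK K G) 2 1 g.1 f.1 x = (g.1 ![x 0, x 1] : K) * f.1 fun _ => x 2 := by
    rw [cupCochain_mulK]
    refine congrArg₂ (· * ·) (congrArg _ ?_) (congrArg _ ?_) <;> funext k <;> fin_cases k <;> rfl
  refine (congrArg₂ (· - ·) e1 e2).trans ?_
  show (f.1 fun _ => x 0 : K) * g.1 ![x 1, x 2] - (g.1 ![x 0, x 1] : K) * (f.1 fun _ => x 2) =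
    -((f.1 fun _ => x 1 * x 2 : K) * g.1 ![x 1, x 2]) -
      -((f.1 fun _ => x 0 * x 1 * x 2 : K) * g.1 ![x 0 * x 1, x 2]) +
      -((f.1 fun _ => x 0 * (x 1 * x 2) : K) * g.1 ![x 0, x 1 * x 2]) -
      -((f.1 fun _ => x 0 * x 1 : K) * g.1 ![x 0, x 1])
  have h := cocycle_two_mul g (x 0) (x 1) (x 2)
  simp only [cocycle_one_mul]
  linear_combination ((f.1 fun _ => x 0 : K) + (f.1 fun _ => x 1) + (f.1 fun _ => x 2)) * h

theorem Coh.mul_comm_two_two (f g : cocycleSubmodule (Rep.trivial K G K) 2) :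
    Commute (DirectSum.of (Coh K G) 2 (Coh.mk K G 2 f))
      (DirectSum.of (Coh K G) 2 (Coh.mk K G 2 g)) := by
  rw [Commute, SemiconjBy, Coh.of_mk_mul, Coh.of_mk_mul]
  refine congrArg (DirectSum.of (Coh K G) 4) ?_
  -- The homotopy is the cup-one product of `f` and `g`.
  refine Coh.mk_eq_of_d 3 _ _ (fun x =>
    (f.1 ![x 0, x 1 * x 2] : K) * (g.1 ![x 1, x 2] : K) -
      (f.1 ![x 0 * x 1, x 2] : K) * (g.1 ![x 0, x 1] : K)) fun x => ?_
  rw [d_three_apply]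
  have e1 : ∀ f g : cocycleSubmodule (Rep.trivial K G K) 2,
      cupCochain (mulK K G) 2 2 f.1 g.1 x = (f.1 ![x 0, x 1] : K) * g.1 ![x 2, x 3] := by
    intro f g
    rw [cupCochain_mulK]
    refine congrArg₂ (· * ·) (congrArg _ ?_) (congrArg _ ?_) <;> funext k <;> fin_cases k <;> rfl
  refine (congrArg₂ (· - ·) (e1 f g) (e1 g f)).trans ?_
  generalize x 0 = a, x 1 = b, x 2 = c, x 3 = d
  show (f.1 ![a, b] : K) * g.1 ![c, d] - (g.1 ![a, b] : K) * f.1 ![c, d] =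
    ((f.1 ![b, c * d] : K) * g.1 ![c, d] - (f.1 ![b * c, d] : K) * g.1 ![b, c]) -
    ((f.1 ![a * b, c * d] : K) * g.1 ![c, d] - (f.1 ![a * b * c, d] : K) * g.1 ![a * b, c]) +
    ((f.1 ![a, b * c * d] : K) * g.1 ![b * c, d] - (f.1 ![a * (b * c), d] : K) * g.1 ![a, b * c]) -
    ((f.1 ![a, b * (c * d)] : K) * g.1 ![b, c * d] - (f.1 ![a * b, c * d] : K) * g.1 ![a, b]) +
    ((f.1 ![a, b * c] : K) * g.1 ![b, c] - (f.1 ![a * b, c] : K) * g.1 ![a, b])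
  have f2 := cocycle_two_mul f a b (c * d)
  have f3 := cocycle_two_mul f a (b * c) d
  have f4 := cocycle_two_mul f (a * b) c d
  have g1 := cocycle_two_mul g a b c
  have g5 := cocycle_two_mul g b c d
  simp only [← mul_assoc] at f2 f3 f4 g1 g5 ⊢
  linear_combination (f.1 ![a * b * c, d] : K) * g1 + (f.1 ![a, b * c * d] : K) * g5 +
    (g.1 ![b, c] : K) * f3 - (g.1 ![c, d] : K) * f2 - (g.1 ![a, b] : K) * f4

end ring

/-! ### Pullback of cohomology rings, characters and Bocksteins -/

section pullRing
variable (K : Type u) {G H : Type u} [Field K] [Group G] [Group H]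

theorem Coh.pull_cup (α : G →* H) (s t : ℕ) (a : Coh K H s) (b : Coh K H t) :
    Coh.cup K G s t (Coh.pull K α s a) (Coh.pull K α t b) =
      Coh.pull K α (s + t) (Coh.cup K H s t a b) := by
  obtain ⟨f, rfl⟩ := Coh.mk_surjective K H s a
  obtain ⟨g, rfl⟩ := Coh.mk_surjective K H t b
  rw [Coh.pull_mk, Coh.pull_mk, Coh.cup_mk, Coh.cup_mk, Coh.pull_mk]
  rfl

/-- The homomorphism of cohomology rings induced by a group homomorphism. -/
def pullRing (α : G →* H) : CohRing K H →ₐ[K] CohRing K G :=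
  AlgHom.ofLinearMap (DirectSum.lmap fun s => Coh.pull K α s)
    (by
      refine (DirectSum.lmap_lof (Coh.pull K α) 0 (Coh.const K H 1)).trans ?_
      refine congrArg (DirectSum.of (Coh K G) 0) ?_
      rw [Coh.const_apply, Coh.pull_mk]
      rfl)
    (by
      intro x y
      induction x using DirectSum.induction_on with
      | zero => simp
      | add a b ha hb => rw [add_mul, map_add, map_add, ha, hb, add_mul]
      | of s a =>
        induction y using DirectSum.induction_on with
        | zero => simp
        | add c d hc hd => rw [mul_add, map_add, map_add, hc, hd, mul_add]
        | of t b =>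
          rw [DirectSum.of_mul_of]
          refine (DirectSum.lmap_lof (Coh.pull K α) (s + t) _).trans ?_
          refine Eq.trans ?_ (congrArg₂ (· * ·) (DirectSum.lmap_lof (Coh.pull K α) s a)
            (DirectSum.lmap_lof (Coh.pull K α) t b)).symm
          refine Eq.trans ?_ (DirectSum.of_mul_of _ _).symm
          exact congrArg _ (Coh.pull_cup K α s t a b).symm)

theorem pullRing_of (α : G →* H) (s : ℕ) (a : Coh K H s) :
    pullRing K α (DirectSum.of (Coh K H) s a) = DirectSum.of (Coh K G) s (Coh.pull K α s a) :=
  DirectSum.lmap_lof (Coh.pull K α) s a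

/-- The class in degree one of a character with values in `ℤ/N`. -/
def chi1 {N : ℕ} (χ : G → ZMod N) : CohRing K G :=
  DirectSum.of _ 1 (Coh.ofCochain K 1 (dualCochain χ))

/-- The Bockstein of a character with values in `ℤ/N`. -/
def chi2 {N : ℕ} (χ : G → ZMod N) : CohRing K G :=
  DirectSum.of _ 2 (Coh.ofCochain K 2 (bocksteinCochain χ))

variable {N : ℕ} [NeZero N]

section
variable {χ ψ : G → ZMod N} (hχ : ∀ x y, χ (x * y) = χ x + χ y)
  (hψ : ∀ x y, ψ (x * y) = ψ x + ψ y)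
include hχ

theorem chi1_eq (hN : (N : K) = 0) :
    chi1 K χ = DirectSum.of _ 1 (Coh.mk K G 1 ⟨_, dualCochain_mem hN hχ⟩) :=
  congrArg _ (Coh.ofCochain_of_mem _)

theorem chi2_eq :
    chi2 K χ = DirectSum.of _ 2 (Coh.mk K G 2 ⟨_, bocksteinCochain_mem hχ⟩) :=
  congrArg _ (Coh.ofCochain_of_mem _)

theorem pullRing_chi1 (hN : (N : K) = 0) (α : H →* G) :
    pullRing K α (chi1 K χ) = chi1 K (χ ∘ α) := by
  rw [chi1_eq K hχ hN, chi1_eq K (χ := χ ∘ α) (fun x y => by simp [hχ]) hN, pullRing_of,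
    Coh.pull_mk]
  rfl

theorem pullRing_chi2 (α : H →* G) : pullRing K α (chi2 K χ) = chi2 K (χ ∘ α) := by
  rw [chi2_eq K hχ, chi2_eq K (χ := χ ∘ α) (fun x y => by simp [hχ]), pullRing_of,
    Coh.pull_mk]
  refine congrArg _ (congrArg _ (Subtype.ext (funext fun x => ?_)))
  show (bocksteinCochain χ (α ∘ x) : K) = bocksteinCochain (χ ∘ α) x
  rw [bocksteinCochain_apply hχ, bocksteinCochain_apply (χ := χ ∘ α) (fun x y => by simp [hχ])]
  rfl

include hψ

theorem chi1_add (hN : (N : K) = 0) : chi1 K (fun x => χ x + ψ x) = chi1 K χ + chi1 K ψ := by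
  rw [chi1_eq K hχ hN, chi1_eq K hψ hN, chi1_eq K (χ := fun x => χ x + ψ x)
    (fun x y => by rw [hχ, hψ]; ring) hN, ← map_add, ← map_add]
  refine congrArg _ (congrArg _ (Subtype.ext (funext fun x => ?_)))
  show ((χ (x 0) + ψ (x 0)).val : K) = ((χ (x 0)).val : K) + ((ψ (x 0)).val : K)
  have h := congrArg (Int.cast : ℤ → K) (mul_carry (χ (x 0)) (ψ (x 0)))
  push_cast at h
  rw [hN, zero_mul] at h
  linear_combination h

/-- The Bockstein is additive, by `carry_add`. -/
theorem chi2_add : chi2 K (fun x => χ x + ψ x) = chi2 K χ + chi2 K ψ := by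
  rw [chi2_eq K hχ, chi2_eq K hψ, chi2_eq K (χ := fun x => χ x + ψ x)
    (fun x y => by rw [hχ, hψ]; ring), ← map_add, ← map_add]
  refine congrArg _ (Coh.mk_eq_of_d 1 _ _ (fun x => -((carry (χ (x 0)) (ψ (x 0)) : ℤ) : K))
    fun x => ?_)
  rw [d_one_apply]
  show (bocksteinCochain (fun x => χ x + ψ x) x : K) -
      (bocksteinCochain χ x + bocksteinCochain ψ x) =
    -((carry (χ (x 1)) (ψ (x 1)) : ℤ) : K) - -((carry (χ (x 0 * x 1)) (ψ (x 0 * x 1)) : ℤ) : K) +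
      -((carry (χ (x 0)) (ψ (x 0)) : ℤ) : K)
  rw [bocksteinCochain_apply hχ, bocksteinCochain_apply hψ,
    bocksteinCochain_apply (χ := fun x => χ x + ψ x) (fun x y => by rw [hχ, hψ]; ring), carry_add,
    hχ, hψ]
  push_cast
  ring

theorem chi1_mul_chi1 (hN : (N : K) = 0) : chi1 K χ * chi1 K ψ = -(chi1 K ψ * chi1 K χ) := by
  rw [chi1_eq K hχ hN, chi1_eq K hψ hN]
  exact Coh.mul_comm_one_one _ _

theorem chi1_commute_chi2 (hN : (N : K) = 0) : Commute (chi1 K χ) (chi2 K ψ) := by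
  rw [chi1_eq K hχ hN, chi2_eq K hψ]
  exact Coh.mul_comm_one_two _ _

theorem chi2_commute_chi2 : Commute (chi2 K χ) (chi2 K ψ) := by
  rw [chi2_eq K hχ, chi2_eq K hψ]
  exact Coh.mul_comm_two_two _ _
end

end pullRing

section cyc
variable {N : ℕ}

theorem Cyc.exp_mul (x y : Cyc.{u} N) : (x * y).exp = x.exp + y.exp := rfl

theorem Cyc.exp_gen : (Cyc.gen.{u} N).exp = 1 := rfl

theorem Cyc.exp_pow (x : Cyc.{u} N) (k : ℕ) : (x ^ k).exp = k * x.exp := by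
  induction k with
  | zero => simp; rfl
  | succ k ih => rw [pow_succ, Cyc.exp_mul, ih]; push_cast; ring

/-- The elements of the cyclic group, by their exponents. -/
def Cyc.expEquiv : Cyc.{u} N ≃ ZMod N := Equiv.ulift.trans Multiplicative.toAdd

theorem Cyc.ext {x y : Cyc.{u} N} (h : x.exp = y.exp) : x = y := Cyc.expEquiv.injective h

variable [NeZero N]

instance : Fintype (Cyc.{u} N) := Fintype.ofEquiv _ Cyc.expEquiv.symm

theorem Cyc.gen_pow_val (x : Cyc.{u} N) : Cyc.gen N ^ x.exp.val = x := by
  apply Cyc.ext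
  rw [Cyc.exp_pow, Cyc.exp_gen, mul_one, ZMod.natCast_zmod_val]

theorem Cyc.mem_zpowers (x : Cyc.{u} N) : x ∈ Subgroup.zpowers (Cyc.gen N) :=
  Cyc.gen_pow_val x ▸ Subgroup.npow_mem_zpowers _ _

theorem Cyc.sum_eq {A : Type*} [AddCommMonoid A] (f : Cyc.{u} N → A) :
    ∑ x, f x = ∑ i ∈ Finset.range N, f (Cyc.gen N ^ i) := by
  symm
  refine Finset.sum_bij (fun i _ => Cyc.gen N ^ i) (fun _ _ => Finset.mem_univ _) ?_ ?_
    (fun _ _ => rfl)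
  · intro i hi j hj h
    have h1 := congrArg (fun x => (Cyc.exp x).val) h
    simpa [Cyc.exp_pow, Cyc.exp_gen, ZMod.val_natCast, Nat.mod_eq_of_lt (Finset.mem_range.1 hi),
      Nat.mod_eq_of_lt (Finset.mem_range.1 hj)] using h1
  · exact fun x _ => ⟨x.exp.val, Finset.mem_range.2 (ZMod.val_lt _), Cyc.gen_pow_val x⟩

theorem Cyc.sum_bockstein (K : Type u) [Field K] (hN : 1 < N) :
    ∑ y : Cyc.{u} N, (bocksteinCochain Cyc.exp ![y, Cyc.gen N] : K) = 1 := by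
  have h := congrArg (Int.cast : ℤ → K) (sum_carry_one hN)
  rw [Int.cast_sum, Int.cast_one] at h
  rw [← h]
  refine Fintype.sum_equiv Cyc.expEquiv _ _ fun y => ?_
  rw [bocksteinCochain_apply Cyc.exp_mul]
  rfl

end cyc

/-! ### Cohomology of a cyclic group -/

section cycCoh
variable (K : Type u) [Field K]

theorem norm_trivial {G : Type u} [Group G] [Fintype G] (hG : (Fintype.card G : K) = 0) :
    (Rep.trivial K G K).ρ.norm = 0 := by
  refine LinearMap.ext fun x => ?_
  rw [Representation.norm, LinearMap.sum_apply]
  refine (Finset.sum_const x).trans ?_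
  rw [← Nat.cast_smul_eq_nsmul K, Finset.card_univ, hG]
  exact zero_smul K x

instance {G : Type u} [Group G] : Module.Finite K (Rep.trivial K G K) :=
  inferInstanceAs (Module.Finite K K)

theorem finrank_coh_cyclic {G : Type u} [CommGroup G] [Fintype G] (g : G)
    (hg : ∀ x, x ∈ Subgroup.zpowers g) (hG : (Fintype.card G : K) = 0) (s : ℕ) :
    Module.Finite K (groupCohomology (Rep.trivial K G K) s) ∧
      Module.finrank K (groupCohomology (Rep.trivial K G K) s) = 1 := by
  obtain ⟨h1, h2⟩ := finrank_cyclic (Rep.trivial K G K) g hg (norm_trivial K hG) s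
  refine ⟨h1, h2.trans ?_⟩
  have h : (Rep.trivial K G K).ρ g - LinearMap.id = 0 := by
    refine LinearMap.ext fun x => ?_
    exact sub_self x
  rw [h, LinearMap.ker_zero, finrank_top]
  exact Module.finrank_self K

variable {N : ℕ} [NeZero N]

theorem Cyc.card : Fintype.card (Cyc.{u} N) = N :=
  (Fintype.card_congr Cyc.expEquiv).trans (ZMod.card N)

/-- The monomial of degree `s` in the cohomology of a cyclic group. -/
def cycMon (N s : ℕ) : CohRing K (Cyc.{u} N) :=
  chi1 K Cyc.exp ^ (s % 2) * chi2 K Cyc.exp ^ (s / 2)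

omit [NeZero N] in
theorem cycMon_add_two (s : ℕ) : cycMon K N (s + 2) = cycMon K N s * chi2 K Cyc.exp := by
  rw [cycMon, cycMon, mul_assoc, ← pow_succ]
  congr 2
  · simp
  · omega

/-- The cohomology of a cyclic group is one dimensional in every degree, spanned by the monomial
of that degree. -/
theorem cyc_span (hN1 : 1 < N) (hN : (N : K) = 0) (s : ℕ) :
    ∃ m : Coh K (Cyc.{u} N) s, m ≠ 0 ∧ DirectSum.of _ s m = cycMon K N s ∧
      ∀ a : Coh K (Cyc.{u} N) s, ∃ c : K, a = c • m := by
  have hcard : (Fintype.card (Cyc.{u} N) : K) = 0 := by rw [Cyc.card]; exact hN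
  have key : ∀ s (m : Coh K (Cyc.{u} N) s), m ≠ 0 → ∀ a, ∃ c : K, a = c • m := by
    intro s m hm a
    obtain ⟨_, h⟩ := finrank_coh_cyclic K (Cyc.gen.{u} N) Cyc.mem_zpowers hcard s
    obtain ⟨c, hc⟩ := (finrank_eq_one_iff_of_nonzero' (V := Coh K (Cyc.{u} N) s) m hm).1 h a
    exact ⟨c, hc.symm⟩
  suffices h : ∃ m : Coh K (Cyc.{u} N) s, m ≠ 0 ∧ DirectSum.of _ s m = cycMon K N s by
    obtain ⟨m, hm, hm'⟩ := h
    exact ⟨m, hm, hm', key s m hm⟩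
  induction s using Nat.strong_induction_on with
  | _ s ih =>
    match s, ih with
    | 0, _ =>
      refine ⟨Coh.const K _ 1, fun h => ?_, ?_⟩
      · have := Coh.mk_zero_injective (h.trans (map_zero (Coh.mk K (Cyc.{u} N) 0)).symm)
        have h1 := congrFun (congrArg Subtype.val this) Fin.elim0
        exact one_ne_zero (α := K) h1
      · simp [cycMon]; rfl
    | 1, _ =>
      refine ⟨Coh.mk K _ 1 ⟨_, dualCochain_mem hN Cyc.exp_mul⟩, fun h => ?_, ?_⟩
      · have := Coh.mk_one_injective (h.trans (map_zero (Coh.mk K (Cyc.{u} N) 1)).symm)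
        have h1 := congrFun (congrArg Subtype.val this) fun _ => Cyc.gen N
        have h2 : (((Cyc.gen.{u} N).exp.val : ℕ) : K) = 0 := h1
        have : Fact (1 < N) := ⟨hN1⟩
        rw [Cyc.exp_gen, ZMod.val_one] at h2
        simp at h2
      · rw [cycMon, chi1_eq K (χ := Cyc.exp) Cyc.exp_mul hN]
        simp
    | s + 2, ih =>
      obtain ⟨m, hm, hm'⟩ := ih s (by omega)
      let c : cocycleSubmodule (Rep.trivial K (Cyc.{u} N) K) 2 :=
        ⟨_, bocksteinCochain_mem Cyc.exp_mul⟩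
      have hinj := cupClass_injective (mulK_equivariant K (Cyc.{u} N)) c (Cyc.gen N)
        (norm_trivial K hcard) (fun a q => by
          show (a : K) * (∑ y : Cyc.{u} N, (bocksteinCochain Cyc.exp ![y, Cyc.gen N] : K)) = a
          rw [Cyc.sum_bockstein K hN1, mul_one]) s
      refine ⟨Coh.cup K _ s 2 m (Coh.mk K _ 2 c), fun h => hm ?_, ?_⟩
      · exact hinj (h.trans (map_zero (cupClass (mulK_equivariant K (Cyc.{u} N)) c s)).symm)
      · rw [cycMon_add_two, ← hm', chi2_eq K Cyc.exp_mul]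
        exact (DirectSum.of_mul_of _ _).symm

end cycCoh

/-! ### Functions on `ℤ/N` as coefficients -/

theorem carry_comm {N : ℕ} (a b : ZMod N) : carry a b = carry b a := by
  rw [carry, carry, add_comm (a.val : ℤ), add_comm a b]

section cochains
variable {K G : Type u} [CommRing K] [Group G]

/-- An equivariant map of coefficients commutes with the coboundary. -/
theorem d_comp {A B : Rep.{u} K G} (T : A →ₗ[K] B) (hT : ∀ g a, T (A.ρ g a) = B.ρ g (T a)) (n : ℕ)
    (f : (Fin n → G) → A) (x : Fin (n + 1) → G) :
    inhomogeneousCochains.d B n (fun y => T (f y)) x = T (inhomogeneousCochains.d A n f x) := by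
  simp only [inhomogeneousCochains.d_hom_apply, map_add, map_sum, map_smul, hT]

/-- The Leibniz rule when the left factor is a cocycle. -/
theorem d_cup_of_cocycle {A B C : Rep.{u} K G} {θ : A →ₗ[K] B →ₗ[K] C} (hθ : IsEquivariant θ)
    (m n : ℕ) (f : cocycleSubmodule A m) (g : (Fin n → G) → B) :
    inhomogeneousCochains.d C (m + n) (cupCochain θ m n f.1 g) =
      (-1 : K) ^ m • cupCochain θ m (n + 1) f.1 (inhomogeneousCochains.d B n g) := by
  have hf : inhomogeneousCochains.d A m f.1 = 0 := f.2
  funext x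
  rw [d_cupCochain hθ, hf, map_zero]
  simp

theorem classMap_eq_zero_of_d {A : Rep.{u} K G} (n : ℕ) (f : cocycleSubmodule A (n + 1))
    (e : (Fin n → G) → A) (h : f.1 = inhomogeneousCochains.d A n e) : classMap A (n + 1) f = 0 :=
  classMap_eq_zero A (n + 1) n rfl f e fun x => congrFun h x

/-- The map of cocycles induced by an equivariant map of coefficients. -/
def mapCocycle {A B : Rep.{u} K G} (T : A →ₗ[K] B) (hT : ∀ g a, T (A.ρ g a) = B.ρ g (T a)) (n : ℕ) :
    cocycleSubmodule A n →ₗ[K] cocycleSubmodule B n where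
  toFun f := ⟨fun y => T (f.1 y), by
    rw [mem_cocycle_iff]
    intro x
    rw [d_comp T hT, (mem_cocycle_iff _ _ _).1 f.2, map_zero]⟩
  map_add' f g := by ext y; exact map_add T _ _
  map_smul' c f := by ext y; exact map_smul T _ _

theorem classMap_mapCocycle_eq_zero {A B : Rep.{u} K G} (T : A →ₗ[K] B)
    (hT : ∀ g a, T (A.ρ g a) = B.ρ g (T a)) (n : ℕ) (f : cocycleSubmodule A n)
    (hf : classMap A n f = 0) : classMap B n (mapCocycle T hT n f) = 0 := by
  cases n with
  | zero => rw [eq_zero_of_classMap_zero A f hf, map_zero, map_zero]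
  | succ n =>
    obtain ⟨e, he⟩ := exists_of_classMap_succ A n f hf
    refine classMap_eq_zero_of_d n _ (fun y => T (e y)) ?_
    funext x
    rw [d_comp T hT, he]
    rfl

end cochains

section translation
variable (K : Type u) {G : Type u} [Field K] [Group G] {N : ℕ} (χ : G → ZMod N)

/-- The functions on `ℤ/N`, on which `G` acts by translations through the character `χ`. -/
def transRep (hχ : ∀ x y, χ (x * y) = χ x + χ y) : Rep.{u} K G :=
  Rep.of (X := ZMod N → K)
    { toFun := fun g => LinearMap.funLeft K K fun t => t + χ g
      map_one' := by
        have h1 : χ 1 = 0 := by simpa using hχ 1 1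
        ext; simp [h1, LinearMap.funLeft_apply]
      map_mul' := fun g h => by
        ext i t
        simp [LinearMap.funLeft_apply, hχ, add_assoc] }

variable {χ} (hχ : ∀ x y, χ (x * y) = χ x + χ y)

/-- Scalars act on functions. -/
def transSmul : Rep.trivial K G K →ₗ[K] transRep K χ hχ →ₗ[K] transRep K χ hχ :=
  (LinearMap.lsmul K (ZMod N → K) : K →ₗ[K] (ZMod N → K) →ₗ[K] (ZMod N → K))

theorem transSmul_equivariant : IsEquivariant (transSmul K hχ) := fun _ _ _ => rfl

/-- The constant functions. -/
def transConst : Rep.trivial K G K →ₗ[K] transRep K χ hχ :=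
  (LinearMap.pi fun _ => LinearMap.id : K →ₗ[K] (ZMod N → K))

/-- The difference operator on functions. -/
def transDiff : transRep K χ hχ →ₗ[K] transRep K χ hχ :=
  (LinearMap.funLeft K K (fun t : ZMod N => t + 1) - LinearMap.id :
    (ZMod N → K) →ₗ[K] (ZMod N → K))

theorem transConst_equivariant (g : G) (c : Rep.trivial K G K) :
    transConst K hχ ((Rep.trivial K G K).ρ g c) = (transRep K χ hχ).ρ g (transConst K hχ c) := rfl

theorem transDiff_equivariant (g : G) (φ : transRep K χ hχ) :
    transDiff K hχ ((transRep K χ hχ).ρ g φ) = (transRep K χ hχ).ρ g (transDiff K hχ φ) := by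
  funext t
  show (φ : ZMod N → K) (t + 1 + χ g) - (φ : ZMod N → K) (t + χ g) =
    (φ : ZMod N → K) (t + χ g + 1) - (φ : ZMod N → K) (t + χ g)
  rw [add_right_comm]

theorem transDiff_const (c : Rep.trivial K G K) : transDiff K hχ (transConst K hχ c) = 0 := by
  funext t
  exact sub_self (c : K)

variable [NeZero N]

/-- The sum of all values of a function. -/
def transSum : transRep K χ hχ →ₗ[K] Rep.trivial K G K :=
  (∑ t : ZMod N, LinearMap.proj t : (ZMod N → K) →ₗ[K] K)

theorem transSum_apply (φ : transRep K χ hχ) :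
    (transSum K hχ φ : K) = ∑ t : ZMod N, (φ : ZMod N → K) t :=
  LinearMap.sum_apply Finset.univ (fun t => (LinearMap.proj t : (ZMod N → K) →ₗ[K] K)) φ

theorem transSum_equivariant (g : G) (φ : transRep K χ hχ) :
    transSum K hχ ((transRep K χ hχ).ρ g φ) = (Rep.trivial K G K).ρ g (transSum K hχ φ) := by
  refine (transSum_apply K hχ _).trans (Eq.trans ?_ (transSum_apply K hχ φ).symm)
  exact Fintype.sum_equiv (Equiv.addRight (χ g)) _ _ fun t => rfl

theorem transSum_diff (φ : transRep K χ hχ) : transSum K hχ (transDiff K hχ φ) = 0 := by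
  refine (transSum_apply K hχ _).trans ?_
  refine (Finset.sum_sub_distrib (fun t : ZMod N => (φ : ZMod N → K) (t + 1))
    (φ : ZMod N → K)).trans (sub_eq_zero.2 ?_)
  exact Fintype.sum_equiv (Equiv.addRight 1) _ _ fun t => rfl

theorem transSum_const (hN : (N : K) = 0) (c : Rep.trivial K G K) :
    transSum K hχ (transConst K hχ c) = 0 := by
  refine (transSum_apply K hχ _).trans ?_
  show ∑ t : ZMod N, (c : K) = 0
  rw [Finset.sum_const, Finset.card_univ, ZMod.card, ← Nat.cast_smul_eq_nsmul K, hN, zero_smul]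

/-- A function whose differences vanish is constant. -/
theorem exists_const_of_diff (φ : transRep K χ hχ) (h : transDiff K hχ φ = 0) :
    φ = transConst K hχ ((φ : ZMod N → K) 0) := by
  have h1 : ∀ t : ZMod N, (φ : ZMod N → K) (t + 1) = (φ : ZMod N → K) t := fun t =>
    sub_eq_zero.1 (congrFun h t)
  have h2 : ∀ k : ℕ, (φ : ZMod N → K) (k : ZMod N) = (φ : ZMod N → K) 0 := by
    intro k
    induction k with
    | zero => simp
    | succ k ih => rw [Nat.cast_succ, h1, ih]
  funext t
  have := h2 t.val
  rw [ZMod.natCast_zmod_val] at this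
  exact this

/-- A function with sum zero is a difference. -/
theorem exists_diff_of_sum (φ : transRep K χ hχ) (h : transSum K hχ φ = 0) :
    ∃ ψ, transDiff K hχ ψ = φ := by
  have h0 : ∑ t : ZMod N, (φ : ZMod N → K) t = 0 := (transSum_apply K hχ φ).symm.trans h
  have h0' : ∑ i ∈ Finset.range N, (φ : ZMod N → K) (i : ZMod N) = 0 := by
    rw [← h0]
    refine Finset.sum_bij (fun i _ => (i : ZMod N)) (fun _ _ => Finset.mem_univ _) ?_ ?_
      (fun _ _ => rfl)
    · intro i hi j hj hij
      have := congrArg ZMod.val hij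
      rwa [ZMod.val_natCast, ZMod.val_natCast, Nat.mod_eq_of_lt (Finset.mem_range.1 hi),
        Nat.mod_eq_of_lt (Finset.mem_range.1 hj)] at this
    · exact fun t _ => ⟨t.val, Finset.mem_range.2 (ZMod.val_lt _), ZMod.natCast_zmod_val t⟩
  let F : ℕ → K := fun k => ∑ i ∈ Finset.range k, (φ : ZMod N → K) (i : ZMod N)
  have hF : ∀ k, F (k + 1) = F k + (φ : ZMod N → K) (k : ZMod N) := fun k =>
    Finset.sum_range_succ _ _
  refine ⟨(fun t : ZMod N => F t.val : ZMod N → K), ?_⟩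
  funext t
  show F (t + 1).val - F t.val = (φ : ZMod N → K) t
  have hs : F (t.val + 1) - F t.val = (φ : ZMod N → K) t := by
    rw [hF, ZMod.natCast_zmod_val]
    ring
  rw [← hs]
  congr 1
  have hv : (t + 1).val = (t.val + 1) % N := by
    rw [← ZMod.val_natCast, Nat.cast_succ, ZMod.natCast_zmod_val]
  rcases Nat.lt_or_ge (t.val + 1) N with h1 | h1
  · rw [hv, Nat.mod_eq_of_lt h1]
  · have h2 : t.val + 1 = N := le_antisymm (ZMod.val_lt t) h1
    rw [hv, h2, Nat.mod_self]
    exact (Finset.sum_range_zero _).trans h0'.symm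

/-- The function of `t` with values the carries of `1 + t`; its sum is one. -/
def transPoint : (Fin 0 → G) → transRep K χ hχ :=
  fun _ => (fun t : ZMod N => ((carry 1 t : ℤ) : K) : ZMod N → K)

/-- The cochain bounding the carry cocycle in the functions on `ℤ/N`. -/
def transCarry : (Fin 1 → G) → transRep K χ hχ :=
  fun g => (fun t : ZMod N => ((carry t (χ (g 0)) : ℤ) : K) : ZMod N → K)

/-- The function sending `t` to its representative; its coboundary is the class of `χ`. -/
def transId : (Fin 0 → G) → transRep K χ hχ :=
  fun _ => (fun t : ZMod N => (t.val : K) : ZMod N → K)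

theorem transSum_point (hN1 : 1 < N) (x : Fin 0 → G) :
    (transSum K hχ (transPoint K hχ x) : K) = 1 := by
  refine (transSum_apply K hχ _).trans ?_
  have h := congrArg (Int.cast : ℤ → K) (sum_carry_one hN1)
  rw [Int.cast_sum, Int.cast_one] at h
  rw [← h]
  exact Finset.sum_congr rfl fun t _ => congrArg _ (carry_comm _ _)

/-- The three cochains `transPoint`, `transCarry` and `transId` splice the exact sequences of
constants, functions and differences: `d_transPoint`, `d_transCarry` and `d_transId` say that the
class of `χ` is the connecting image of `1` in one sequence, and its Bockstein the composite
connecting image of `1` in both. -/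
theorem d_transPoint (x : Fin 1 → G) :
    inhomogeneousCochains.d (transRep K χ hχ) 0 (transPoint K hχ) x =
      transDiff K hχ (transCarry K hχ x) := by
  rw [d_zero_apply]
  funext t
  show ((carry 1 (t + χ (x 0)) : ℤ) : K) - ((carry 1 t : ℤ) : K) =
    ((carry (t + 1) (χ (x 0)) : ℤ) : K) - ((carry t (χ (x 0)) : ℤ) : K)
  have h := congrArg (Int.cast : ℤ → K) (carry_cocycle 1 t (χ (x 0)))
  push_cast at h
  rw [add_comm 1 t] at h
  linear_combination h

theorem d_transCarry (x : Fin 2 → G) :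
    inhomogeneousCochains.d (transRep K χ hχ) 1 (transCarry K hχ) x =
      transConst K hχ (bocksteinCochain χ x : K) := by
  rw [d_one_apply]
  funext t
  show ((carry (t + χ (x 0)) (χ (x 1)) : ℤ) : K) - ((carry t (χ (x 0 * x 1)) : ℤ) : K) +
    ((carry t (χ (x 0)) : ℤ) : K) = (bocksteinCochain χ x : K)
  rw [bocksteinCochain_apply hχ, hχ]
  have h := congrArg (Int.cast : ℤ → K) (carry_cocycle t (χ (x 0)) (χ (x 1)))
  push_cast at h
  linear_combination -h

theorem val_add_cast (hN : (N : K) = 0) (a b : ZMod N) :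
    ((a + b).val : K) = (a.val : K) + (b.val : K) := by
  have h := congrArg (Int.cast : ℤ → K) (mul_carry a b)
  push_cast at h
  rw [hN, zero_mul] at h
  linear_combination h

theorem d_transId (hN : (N : K) = 0) (x : Fin 1 → G) :
    inhomogeneousCochains.d (transRep K χ hχ) 0 (transId K hχ) x =
      transConst K hχ (dualCochain χ x : K) := by
  rw [d_zero_apply]
  funext t
  show ((t + χ (x 0)).val : K) - (t.val : K) = ((χ (x 0)).val : K)
  rw [val_add_cast K hN]
  ring

theorem transDiff_id (hN1 : 1 < N) (hN : (N : K) = 0) (x : Fin 0 → G) :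
    transDiff K hχ (transId K hχ x) = transConst K hχ (1 : K) := by
  have : Fact (1 < N) := ⟨hN1⟩
  funext t
  show ((t + 1).val : K) - (t.val : K) = 1
  rw [val_add_cast K hN, ZMod.val_one]
  simp

end translation

/-! ### Classes that restrict to zero on the kernel of a character -/

section exactness
variable {K G H : Type u} [Field K] [Group G] [Group H] {N : ℕ} [NeZero N] {χ : G → ZMod N}
  (hχ : ∀ x y, χ (x * y) = χ x + χ y) (ι : H →* G) (hι : ∀ h, χ (ι h) = 0)

omit [NeZero N] in
include hι in
/-- Evaluation at zero is equivariant for the group `H`, on which `χ` vanishes. -/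
theorem d_restrict (s : ℕ) (f : (Fin s → G) → transRep K χ hχ) (x : Fin (s + 1) → H) :
    (inhomogeneousCochains.d (Rep.trivial K H K) s
      (fun x : Fin s → H => (f (ι ∘ x) : ZMod N → K) 0) x : K) =
      (inhomogeneousCochains.d (transRep K χ hχ) s f (ι ∘ x) : ZMod N → K) 0 := by
  let ev : transRep K χ hχ →ₗ[K] K := (LinearMap.proj 0 : (ZMod N → K) →ₗ[K] K)
  rw [inhomogeneousCochains.d_hom_apply]
  refine Eq.trans ?_
    (congrArg ev (inhomogeneousCochains.d_hom_apply (transRep K χ hχ) s f (ι ∘ x))).symm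
  rw [map_add, map_sum]
  refine congrArg₂ (· + ·) ?_ (Finset.sum_congr rfl fun j _ => ?_)
  · show (f _ : ZMod N → K) 0 = (f _ : ZMod N → K) (0 + χ (ι (x 0)))
    rw [hι, add_zero]
    rfl
  · rw [map_smul]
    refine congrArg (fun z : K => (-1 : K) ^ ((j : ℕ) + 1) • z) ?_
    refine congrArg (fun y => ev (f y)) ?_
    exact Fin.comp_contractNth (· * ·) (· * ·) (fun a b => map_mul ι a b) j x

omit [NeZero N] in
include hι in
theorem restrict_mem (s : ℕ) (f : cocycleSubmodule (transRep K χ hχ) s) :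
    (fun x : Fin s → H => (f.1 (ι ∘ x) : ZMod N → K) 0) ∈
      cocycleSubmodule (Rep.trivial K H K) s := by
  rw [mem_cocycle_iff]
  intro x
  rw [d_restrict hχ ι hι, (mem_cocycle_iff _ _ _).1 f.2]
  rfl

/-- Restriction of cocycles along a homomorphism that `χ` kills, followed by evaluation at zero. -/
def restrictCocycle (s : ℕ) :
    cocycleSubmodule (transRep K χ hχ) s →ₗ[K] cocycleSubmodule (Rep.trivial K H K) s where
  toFun f := ⟨_, restrict_mem hχ ι hι s f⟩
  map_add' _ _ := rfl
  map_smul' _ _ := rfl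

variable (K) in
/-- Injectivity in Shapiro's lemma: a class with coefficients in the functions on `ℤ/N` is
determined by its restriction to the kernel of `χ`. -/
def ShapiroInjective : Prop :=
  ∀ s (f : cocycleSubmodule (transRep K χ hχ) s),
    Coh.mk K H s (restrictCocycle hχ ι hι s f) = 0 → classMap _ s f = 0

/-- Cocycles with constant values. -/
abbrev constCocycle (s : ℕ) :
    cocycleSubmodule (Rep.trivial K G K) s →ₗ[K] cocycleSubmodule (transRep K χ hχ) s :=
  mapCocycle (transConst K hχ) (transConst_equivariant K hχ) s

variable {hχ} in
omit [NeZero N] in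
theorem transDiff_cup (m n : ℕ) (f : (Fin m → G) → K) (g : (Fin n → G) → transRep K χ hχ)
    (x : Fin (m + n) → G) :
    transDiff K hχ (cupCochain (transSmul K hχ) m n f g x) =
      cupCochain (transSmul K hχ) m n f (fun y => transDiff K hχ (g y)) x := by
  refine (map_smul (transDiff K hχ) (f _ : K) _).trans ?_
  rw [transDiff_equivariant]
  rfl

variable {hχ} in
theorem transSum_cup (m n : ℕ) (f : (Fin m → G) → K) (g : (Fin n → G) → transRep K χ hχ)
    (x : Fin (m + n) → G) :
    transSum K hχ (cupCochain (transSmul K hχ) m n f g x) =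
      cupCochain (mulK K G) m n f (fun y => transSum K hχ (g y)) x := by
  refine (map_smul (transSum K hχ) (f _ : K) _).trans ?_
  rw [transSum_equivariant]
  rfl

variable {hχ ι hι} (hS : ShapiroInjective K hχ ι hι) (π : G →* H) (hπ : π.comp ι = MonoidHom.id H)

include hS hπ

omit [NeZero N] in
/-- Every class with coefficients in the functions on `ℤ/N` has a cocycle with constant values. -/
theorem exists_const (s : ℕ) (f : cocycleSubmodule (transRep K χ hχ) s) :
    ∃ q, classMap _ s (f - constCocycle hχ s q) = 0 := by
  refine ⟨⟨_, pull_mem K π s (restrictCocycle hχ ι hι s f)⟩, hS s _ ?_⟩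
  rw [map_sub, map_sub, sub_eq_zero]
  refine congrArg _ (Subtype.ext (funext fun x => ?_))
  show (f.1 (ι ∘ x) : ZMod N → K) 0 = (f.1 (ι ∘ (π ∘ ι ∘ x)) : ZMod N → K) 0
  exact congrArg (fun z => (f.1 z : ZMod N → K) 0)
    (funext fun i => congrArg ι (DFunLike.congr_fun hπ (x i)).symm)

variable {s : ℕ}

/-- The connecting homomorphisms of the two exact sequences `0 → K → I → J → 0` and
`0 → J → I → K → 0`, with `I` the functions on `ℤ/N`, applied to a relation. -/
theorem exists_of_relation (hN1 : 1 < N) (hN : (N : K) = 0)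
    (v : cocycleSubmodule (Rep.trivial K G K) (s + 1))
    (e : cocycleSubmodule (Rep.trivial K G K) s) (k : (Fin (s + 1) → G) → K)
    (h : ∀ x, (cupCochain (mulK K G) (s + 1) 1 v.1 (dualCochain χ) x : K) +
      (cupCochain (mulK K G) s 2 e.1 (bocksteinCochain χ) x : K) =
        inhomogeneousCochains.d (Rep.trivial K G K) (s + 1) k x) :
    ∃ r : (Fin s → G) → transRep K χ hχ,
      (fun x => transConst K hχ (v.1 x)) = inhomogeneousCochains.d (transRep K χ hχ) s
        ((-1 : K) ^ (s + 1) • ((fun y => transDiff K hχ (r y)) -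
          cupCochain (transSmul K hχ) s 0 e.1 (transPoint K hχ))) := by
  have hθ := transSmul_equivariant K hχ
  have c1 : inhomogeneousCochains.d (transRep K χ hχ) (s + 1)
      (cupCochain (transSmul K hχ) (s + 1) 0 v.1 (transId K hχ)) =
      (-1 : K) ^ (s + 1) • fun x => transConst K hχ
        (cupCochain (mulK K G) (s + 1) 1 v.1 (dualCochain χ) x) := by
    refine (d_cup_of_cocycle hθ (s + 1) 0 v _).trans ?_
    rw [show inhomogeneousCochains.d (transRep K χ hχ) 0 (transId K hχ) = _ from
      funext (d_transId K hχ hN)]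
    rfl
  have c2 : inhomogeneousCochains.d (transRep K χ hχ) (s + 1)
      (cupCochain (transSmul K hχ) s 1 e.1 (transCarry K hχ)) =
      (-1 : K) ^ s • fun x => transConst K hχ
        (cupCochain (mulK K G) s 2 e.1 (bocksteinCochain χ) x) := by
    refine (d_cup_of_cocycle hθ s 1 e _).trans ?_
    rw [show inhomogeneousCochains.d (transRep K χ hχ) 1 (transCarry K hχ) = _ from
      funext (d_transCarry K hχ)]
    rfl
  have c3 : inhomogeneousCochains.d (transRep K χ hχ) s
      (cupCochain (transSmul K hχ) s 0 e.1 (transPoint K hχ)) =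
      (-1 : K) ^ s • fun x => transDiff K hχ
        (cupCochain (transSmul K hχ) s 1 e.1 (transCarry K hχ) x) := by
    refine (d_cup_of_cocycle hθ s 0 e _).trans ?_
    rw [show inhomogeneousCochains.d (transRep K χ hχ) 0 (transPoint K hχ) = _ from
      funext (d_transPoint K hχ)]
    congr 1
    funext x
    exact (transDiff_cup s 1 e.1 (transCarry K hχ) x).symm
  have hs : ∀ m : ℕ, (-1 : K) ^ m * (-1 : K) ^ m = 1 := fun m => by rw [← mul_pow]; simp
  -- The relation makes `w` a cocycle. By Shapiro's lemma `w` is a constant cocycle `q` up to a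
  -- coboundary `d r`, and its differences are the differences of `d r`.
  let w : (Fin (s + 1) → G) → transRep K χ hχ :=
    (-1 : K) ^ (s + 1) • cupCochain (transSmul K hχ) (s + 1) 0 v.1 (transId K hχ) +
    (-1 : K) ^ s • cupCochain (transSmul K hχ) s 1 e.1 (transCarry K hχ) -
    (fun x => transConst K hχ (k x))
  have hw : w ∈ cocycleSubmodule (transRep K χ hχ) (s + 1) := by
    show inhomogeneousCochains.d (transRep K χ hχ) (s + 1) w = 0
    rw [map_sub, map_add, map_smul, map_smul, c1, c2, smul_smul, smul_smul, hs, hs, one_smul,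
      one_smul, sub_eq_zero]
    funext x
    rw [d_comp (transConst K hχ) (transConst_equivariant K hχ), ← h x]
    exact (map_add (transConst K hχ) _ _).symm
  obtain ⟨q, hq⟩ := exists_const hS π hπ (s + 1) ⟨w, hw⟩
  obtain ⟨r, hr⟩ := exists_of_classMap_succ _ s _ hq
  refine ⟨r, ?_⟩
  rw [map_smul, map_sub, c3]
  funext x
  have h1 : inhomogeneousCochains.d (transRep K χ hχ) s (fun y => transDiff K hχ (r y)) x =
      transDiff K hχ (w x - transConst K hχ (q.1 x)) := by
    rw [d_comp (transDiff K hχ) (transDiff_equivariant K hχ), hr]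
    rfl
  have h2 : transDiff K hχ (cupCochain (transSmul K hχ) (s + 1) 0 v.1 (transId K hχ) x) =
      transConst K hχ (v.1 x) := by
    rw [transDiff_cup, show (fun y => transDiff K hχ (transId K hχ y)) = _ from
      funext (transDiff_id K hχ hN1 hN)]
    funext t
    exact mul_one (v.1 x : K)
  rw [Pi.smul_apply, Pi.sub_apply, h1, map_sub, transDiff_const, sub_zero]
  show _ = (-1 : K) ^ (s + 1) • (transDiff K hχ
    ((-1 : K) ^ (s + 1) • cupCochain (transSmul K hχ) (s + 1) 0 v.1 (transId K hχ) x +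
    (-1 : K) ^ s • cupCochain (transSmul K hχ) s 1 e.1 (transCarry K hχ) x -
    transConst K hχ (k x)) -
    (-1 : K) ^ s • transDiff K hχ (cupCochain (transSmul K hχ) s 1 e.1 (transCarry K hχ) x))
  rw [map_sub, map_add, map_smul, map_smul, h2, transDiff_const, sub_zero, add_sub_cancel_right,
    smul_smul, hs, one_smul]

/-- In a relation `v ∪ x + e ∪ β x = 0` the class `v` restricts to zero on the kernel of the
character. -/
theorem restrict_eq_zero_of_relation (hN1 : 1 < N) (hN : (N : K) = 0)
    (v : cocycleSubmodule (Rep.trivial K G K) (s + 1))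
    (e : cocycleSubmodule (Rep.trivial K G K) s)
    (h : Coh.cup K G (s + 1) 1 (Coh.mk K G (s + 1) v) (Coh.mk K G 1 ⟨_, dualCochain_mem hN hχ⟩) +
      Coh.cup K G s 2 (Coh.mk K G s e) (Coh.mk K G 2 ⟨_, bocksteinCochain_mem hχ⟩) = 0) :
    Coh.pull K ι (s + 1) (Coh.mk K G (s + 1) v) = 0 := by
  rw [Coh.cup_mk, Coh.cup_mk] at h
  obtain ⟨k, hk⟩ := exists_of_classMap_succ _ (s + 1) _ ((map_add (Coh.mk K G (s + 2)) _ _).trans h)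
  obtain ⟨r, hr⟩ := exists_of_relation hS π hπ hN1 hN v e k fun x => (congrFun hk x).symm
  have h1 : classMap _ (s + 1) (constCocycle hχ (s + 1) v) = 0 := classMap_eq_zero_of_d s _ _ hr
  rw [Coh.pull_mk]
  -- Restriction of the coboundary `h1` is again a coboundary.
  obtain ⟨e', he'⟩ := exists_of_classMap_succ _ s _ h1
  refine classMap_eq_zero _ (s + 1) s rfl _ (fun x => (e' (ι ∘ x) : ZMod N → K) 0) fun x => ?_
  rw [d_restrict hχ ι hι, he']
  rfl

/-- Cup product with the Bockstein of the character is injective. -/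
theorem eq_zero_of_relation (hN1 : 1 < N) (hN : (N : K) = 0)
    (e : cocycleSubmodule (Rep.trivial K G K) s)
    (h : Coh.cup K G s 2 (Coh.mk K G s e) (Coh.mk K G 2 ⟨_, bocksteinCochain_mem hχ⟩) = 0) :
    Coh.mk K G s e = 0 := by
  rw [Coh.cup_mk] at h
  obtain ⟨k, hk⟩ := exists_of_classMap_succ _ (s + 1) _ h
  obtain ⟨r, hr⟩ := exists_of_relation hS π hπ hN1 hN 0 e k fun x => by
    refine Eq.trans ?_ (congrFun hk x).symm
    rw [ZeroMemClass.coe_zero, map_zero]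
    exact zero_add _
  -- For `v = 0` the cochain of the relation is a cocycle, and the sum of its values is `-e`.
  let w : (Fin s → G) → transRep K χ hχ := (fun y => transDiff K hχ (r y)) -
    cupCochain (transSmul K hχ) s 0 e.1 (transPoint K hχ)
  have hw : w ∈ cocycleSubmodule (transRep K χ hχ) s := by
    show inhomogeneousCochains.d (transRep K χ hχ) s w = 0
    have h0 : (fun x => transConst K hχ ((0 : cocycleSubmodule (Rep.trivial K G K) (s + 1)).1 x)) =
        0 := funext fun x => map_zero (transConst K hχ)
    rw [h0, map_smul] at hr
    exact (smul_eq_zero.1 hr.symm).resolve_left (pow_ne_zero _ (neg_ne_zero.2 one_ne_zero))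
  obtain ⟨q, hq⟩ := exists_const hS π hπ s ⟨w, hw⟩
  have h1 := classMap_mapCocycle_eq_zero (transSum K hχ) (transSum_equivariant K hχ) s _ hq
  rw [← neg_eq_zero, ← map_neg]
  refine Eq.trans (congrArg _ (Subtype.ext (funext fun x => ?_))) h1
  show -e.1 x = transSum K hχ (transDiff K hχ (r x) -
    cupCochain (transSmul K hχ) s 0 e.1 (transPoint K hχ) x - transConst K hχ (q.1 x))
  rw [map_sub, map_sub, transSum_diff, transSum_const K hχ hN, transSum_cup,
    show (fun y => transSum K hχ (transPoint K hχ y)) = _ from funext (transSum_point K hχ hN1)]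
  refine Eq.trans ?_ (sub_zero _).symm
  refine Eq.trans ?_ (zero_sub _).symm
  exact congrArg Neg.neg (mul_one (e.1 x : K)).symm

/-- A class of degree at least two with zero restriction to the kernel of the character is
generated by the class of the character and its Bockstein. -/
theorem exists_of_restrict_eq_zero (hN1 : 1 < N) (hN : (N : K) = 0)
    (f : cocycleSubmodule (Rep.trivial K G K) (s + 2))
    (hf : Coh.pull K ι (s + 2) (Coh.mk K G (s + 2) f) = 0) :
    ∃ (w : Coh K G (s + 1)) (g : Coh K G s), Coh.mk K G (s + 2) f =
      Coh.cup K G (s + 1) 1 w (Coh.mk K G 1 ⟨_, dualCochain_mem hN hχ⟩) +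
      Coh.cup K G s 2 g (Coh.mk K G 2 ⟨_, bocksteinCochain_mem hχ⟩) := by
  have hθ := transSmul_equivariant K hχ
  have h1 : classMap _ (s + 2) (constCocycle hχ (s + 2) f) = 0 := by
    refine hS _ _ (Eq.trans ?_ hf)
    rw [Coh.pull_mk]
    rfl
  -- The class `f` dies in the functions on `ℤ/N`, where `v` bounds it. The differences of `v` are a
  -- cocycle, hence a constant cocycle `w` up to a coboundary `d r`, and the sum of the values of
  -- `r` is a cocycle `g`.
  obtain ⟨v, hv⟩ := exists_of_classMap_succ _ (s + 1) _ h1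
  have hv' : ∀ x, inhomogeneousCochains.d (transRep K χ hχ) (s + 1) v x =
      transConst K hχ (f.1 x) := fun x => congrFun hv x
  have hv1 : (fun x => transDiff K hχ (v x)) ∈ cocycleSubmodule (transRep K χ hχ) (s + 1) := by
    rw [mem_cocycle_iff]
    intro x
    rw [d_comp (transDiff K hχ) (transDiff_equivariant K hχ), hv', transDiff_const]
  obtain ⟨w, hw⟩ := exists_const hS π hπ (s + 1) ⟨_, hv1⟩
  obtain ⟨r, hr⟩ := exists_of_classMap_succ _ s _ hw
  have hr' : ∀ x, inhomogeneousCochains.d (transRep K χ hχ) s r x =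
      transDiff K hχ (v x) - transConst K hχ (w.1 x) := fun x => congrFun hr x
  have hg : (fun x => transSum K hχ (r x)) ∈ cocycleSubmodule (Rep.trivial K G K) s := by
    rw [mem_cocycle_iff]
    intro x
    rw [d_comp (transSum K hχ) (transSum_equivariant K hχ), hr', map_sub, transSum_diff,
      transSum_const K hχ hN, sub_zero]
  let g : cocycleSubmodule (Rep.trivial K G K) s := ⟨_, hg⟩
  have ht : ∀ x, ∃ t, transDiff K hχ t =
      r x - cupCochain (transSmul K hχ) s 0 g.1 (transPoint K hχ) x := by
    intro x
    apply exists_diff_of_sum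
    rw [map_sub, transSum_cup,
      show (fun y => transSum K hχ (transPoint K hχ y)) = _ from funext (transSum_point K hχ hN1),
      sub_eq_zero]
    exact (mul_one (g.1 x : K)).symm
  choose t ht using ht
  -- The correction of `v` by the standard cochains for `w` and `g` has no differences, so that it
  -- is constant, and its coboundary is the difference between `f` and the asserted expression.
  let z : (Fin (s + 1) → G) → transRep K χ hχ := v -
    cupCochain (transSmul K hχ) (s + 1) 0 w.1 (transId K hχ) -
    (-1 : K) ^ s • cupCochain (transSmul K hχ) s 1 g.1 (transCarry K hχ) -
    inhomogeneousCochains.d (transRep K χ hχ) s t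
  have c3 : inhomogeneousCochains.d (transRep K χ hχ) s
      (cupCochain (transSmul K hχ) s 0 g.1 (transPoint K hχ)) =
      (-1 : K) ^ s • fun x => transDiff K hχ
        (cupCochain (transSmul K hχ) s 1 g.1 (transCarry K hχ) x) := by
    refine (d_cup_of_cocycle hθ s 0 g _).trans ?_
    rw [show inhomogeneousCochains.d (transRep K χ hχ) 0 (transPoint K hχ) = _ from
      funext (d_transPoint K hχ)]
    congr 1
    funext x
    exact (transDiff_cup s 1 g.1 (transCarry K hχ) x).symm
  have hz : ∀ x, transDiff K hχ (z x) = 0 := by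
    intro x
    have h2 : transDiff K hχ (cupCochain (transSmul K hχ) (s + 1) 0 w.1 (transId K hχ) x) =
        transConst K hχ (w.1 x) := by
      rw [transDiff_cup, show (fun y => transDiff K hχ (transId K hχ y)) = _ from
        funext (transDiff_id K hχ hN1 hN)]
      funext t
      exact mul_one (w.1 x : K)
    have h3 : transDiff K hχ (inhomogeneousCochains.d (transRep K χ hχ) s t x) =
        (transDiff K hχ (v x) - transConst K hχ (w.1 x)) - (-1 : K) ^ s • transDiff K hχ
        (cupCochain (transSmul K hχ) s 1 g.1 (transCarry K hχ) x) := by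
      rw [← d_comp (transDiff K hχ) (transDiff_equivariant K hχ), funext ht, ← hr']
      have := congrFun c3 x
      exact (congrFun (map_sub (inhomogeneousCochains.d (transRep K χ hχ) s).hom r _) x).trans
        (congrArg (fun y => inhomogeneousCochains.d (transRep K χ hχ) s r x - y) this)
    show transDiff K hχ (v x - cupCochain (transSmul K hχ) (s + 1) 0 w.1 (transId K hχ) x -
      (-1 : K) ^ s • cupCochain (transSmul K hχ) s 1 g.1 (transCarry K hχ) x -
      inhomogeneousCochains.d (transRep K χ hχ) s t x) = 0
    rw [map_sub, map_sub, map_sub, map_smul, h2, h3]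
    abel
  have c1 : inhomogeneousCochains.d (transRep K χ hχ) (s + 1)
      (cupCochain (transSmul K hχ) (s + 1) 0 w.1 (transId K hχ)) =
      (-1 : K) ^ (s + 1) • fun x => transConst K hχ
        (cupCochain (mulK K G) (s + 1) 1 w.1 (dualCochain χ) x) := by
    refine (d_cup_of_cocycle hθ (s + 1) 0 w _).trans ?_
    rw [show inhomogeneousCochains.d (transRep K χ hχ) 0 (transId K hχ) = _ from
      funext (d_transId K hχ hN)]
    rfl
  have c2 : inhomogeneousCochains.d (transRep K χ hχ) (s + 1)
      (cupCochain (transSmul K hχ) s 1 g.1 (transCarry K hχ)) =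
      (-1 : K) ^ s • fun x => transConst K hχ
        (cupCochain (mulK K G) s 2 g.1 (bocksteinCochain χ) x) := by
    refine (d_cup_of_cocycle hθ s 1 g _).trans ?_
    rw [show inhomogeneousCochains.d (transRep K χ hχ) 1 (transCarry K hχ) = _ from
      funext (d_transCarry K hχ)]
    rfl
  refine ⟨(-1 : K) ^ (s + 1) • Coh.mk K G (s + 1) w, Coh.mk K G s g, ?_⟩
  rw [map_smul, LinearMap.smul_apply, Coh.cup_mk, Coh.cup_mk, ← map_smul, ← map_add]
  refine Coh.mk_eq_of_d (s + 1) _ _ (fun x => (z x : ZMod N → K) 0) fun x => ?_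
  -- All terms are compared after the embedding of the constants.
  have hinj : Function.Injective (transConst K hχ) := fun a b hab => congrFun hab (0 : ZMod N)
  apply hinj
  rw [← d_comp (transConst K hχ) (transConst_equivariant K hχ),
    show (fun y => transConst K hχ ((z y : ZMod N → K) 0)) = z from
      funext fun y => (exists_const_of_diff K hχ (z y) (hz y)).symm]
  have hdd : inhomogeneousCochains.d (transRep K χ hχ) (s + 1)
      (inhomogeneousCochains.d (transRep K χ hχ) s t) = 0 :=
    ConcreteCategory.congr_hom (groupCohomology.inhomogeneousCochains.d_comp_d s _) t
  have hs : (-1 : K) ^ s * (-1 : K) ^ s = 1 := by rw [← mul_pow]; simp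
  have hdz : inhomogeneousCochains.d (transRep K χ hχ) (s + 1) z x =
      transConst K hχ (f.1 x) - (-1 : K) ^ (s + 1) • transConst K hχ
        (cupCochain (mulK K G) (s + 1) 1 w.1 (dualCochain χ) x) -
      transConst K hχ (cupCochain (mulK K G) s 2 g.1 (bocksteinCochain χ) x) := by
    have h4 : inhomogeneousCochains.d (transRep K χ hχ) (s + 1) z =
        inhomogeneousCochains.d (transRep K χ hχ) (s + 1) v -
        (-1 : K) ^ (s + 1) • (fun x => transConst K hχ
          (cupCochain (mulK K G) (s + 1) 1 w.1 (dualCochain χ) x)) -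
        (fun x => transConst K hχ (cupCochain (mulK K G) s 2 g.1 (bocksteinCochain χ) x)) := by
      rw [map_sub, map_sub, map_sub, map_smul, c1, c2, hdd, smul_smul, hs, one_smul, sub_zero]
    rw [h4, ← hv' x]
    rfl
  rw [hdz, sub_sub, ← map_smul, ← map_add, ← map_sub]
  rfl

end exactness

/-! ### Shapiro's lemma for the kernel of the first projection of `M` -/

section shapiro
variable (K : Type u) [Field K] {N : ℕ} [NeZero N]

/-- The exponent of the first coordinate. -/
def expA (m : BaseM.{u} N) : ZMod N := m.1.exp
/-- The exponent of the second coordinate. -/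
def expB (m : BaseM.{u} N) : ZMod N := m.2.exp

omit [NeZero N] in
theorem expA_mul (x y : BaseM.{u} N) : expA (x * y) = expA x + expA y := rfl
omit [NeZero N] in
theorem expB_mul (x y : BaseM.{u} N) : expB (x * y) = expB x + expB y := rfl

/-- The second factor of `M`. -/
abbrev facB (N : ℕ) : Cyc.{u} N →* BaseM.{u} N := MonoidHom.inr _ _
/-- The projection of `M` to the second factor. -/
abbrev projB (N : ℕ) : BaseM.{u} N →* Cyc.{u} N := MonoidHom.snd _ _

omit [NeZero N] in
theorem expA_facB (h : Cyc.{u} N) : expA (facB N h) = 0 := rfl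

/-- The kernel of the first projection of `M`. -/
abbrev kerA (N : ℕ) : Subgroup (BaseM.{u} N) := (MonoidHom.fst (Cyc.{u} N) (Cyc.{u} N)).ker

/-- The kernel of the first projection is the second factor. -/
def kerAEquiv (N : ℕ) : kerA.{u} N ≃ Cyc.{u} N where
  toFun x := x.1.2
  invFun y := ⟨(1, y), rfl⟩
  left_inv x := Subtype.ext (Prod.ext (MonoidHom.mem_ker.1 x.2).symm rfl)
  right_inv _ := rfl

/-- The functions on `ℤ/N` are coinduced from the kernel of the first projection. -/
def coindEquiv : transRep K (expA (N := N)) expA_mul ≃ₗ[K]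
    Representation.coindV (kerA.{u} N).subtype (Rep.trivial K (kerA.{u} N) K).ρ where
  toFun φ := ⟨fun m => (φ : ZMod N → K) (expA m), fun s h => by
    have hs : expA s.1 = 0 := congrArg Cyc.exp (MonoidHom.mem_ker.1 s.2)
    show (φ : ZMod N → K) (expA (s.1 * h)) = (φ : ZMod N → K) (expA h)
    rw [expA_mul, hs, zero_add]⟩
  map_add' _ _ := rfl
  map_smul' _ _ := rfl
  invFun f := (fun t : ZMod N => f.1 (Cyc.expEquiv.symm t, 1) : ZMod N → K)
  left_inv φ := rfl
  right_inv f := by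
    ext m
    have h := f.2 ⟨(1, m.2), rfl⟩ (m.1, 1)
    refine Eq.trans ?_ (h.symm.trans ?_)
    · rfl
    · exact congrArg f.1 (Prod.ext (one_mul m.1) (mul_one m.2))

/-- Shapiro's lemma: the cohomology of the functions on `ℤ/N` is that of the cyclic kernel. -/
theorem finrank_transRep (hN : (N : K) = 0) (s : ℕ) :
    Module.finrank K (groupCohomology (transRep K (expA.{u} (N := N)) expA_mul) s) = 1 := by
  let e1 := groupCohomology.mapIso (MulEquiv.refl (BaseM.{u} N))
    (A := Rep.coind (kerA.{u} N).subtype (Rep.trivial K (kerA.{u} N) K))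
    (B := transRep K (expA.{u} (N := N)) expA_mul) (coindEquiv K) (fun g => rfl) s
  let e2 := groupCohomology.coindIso (Rep.trivial K (kerA.{u} N) K) s
  rw [(e1 ≪≫ e2).toLinearEquiv.finrank_eq]
  let _ : Fintype (kerA.{u} N) := Fintype.ofEquiv _ (kerAEquiv N).symm
  refine (finrank_coh_cyclic K (G := kerA.{u} N) ⟨(1, Cyc.gen N), rfl⟩ (fun x => ?_) ?_ s).2
  · refine ⟨(x.1.2.exp.val : ℤ), ?_⟩
    apply (kerAEquiv N).injective
    exact (zpow_natCast _ _).trans (Cyc.gen_pow_val x.1.2)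
  · rw [Fintype.card_congr (kerAEquiv N), Cyc.card, hN]

theorem shapiroInjective (hN1 : 1 < N) (hN : (N : K) = 0) :
    ShapiroInjective K (expA_mul.{u} (N := N)) (facB N) expA_facB := by
  intro s f hf
  obtain ⟨m, hm0, -, -⟩ := cyc_span.{u} K hN1 hN s
  obtain ⟨q, rfl⟩ := Coh.mk_surjective K _ s m
  -- A cocycle whose restriction is not zero spans, as the cohomology is one dimensional.
  let g := constCocycle (expA_mul.{u} (N := N)) s ⟨_, pull_mem K (projB N) s q⟩
  have hg : restrictCocycle (expA_mul.{u} (N := N)) (facB N) expA_facB s g = q := rfl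
  have hker : ∀ z : cocycleSubmodule (transRep K (expA.{u} (N := N)) expA_mul) s,
      classMap _ s z = 0 → Coh.mk K _ s (restrictCocycle _ (facB N) expA_facB s z) = 0 := by
    intro z hz
    cases s with
    | zero => rw [eq_zero_of_classMap_zero _ z hz, map_zero, map_zero]
    | succ s =>
      obtain ⟨e, he⟩ := exists_of_classMap_succ _ s z hz
      refine classMap_eq_zero _ (s + 1) s rfl _
        (fun x => (e (facB N ∘ x) : ZMod N → K) 0) fun x => ?_
      rw [d_restrict _ (facB N) expA_facB, he]
      rfl
  have hg0 : classMap _ s g ≠ 0 := fun h => hm0 (hker g h)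
  obtain ⟨c, hc⟩ := (finrank_eq_one_iff_of_nonzero' _ hg0).1 (finrank_transRep K hN s)
    (classMap _ s f)
  have h1 := hker (f - c • g) (by rw [map_sub, map_smul, hc, sub_self])
  rw [map_sub, map_smul, map_sub, map_smul, hf, hg, zero_sub, neg_eq_zero] at h1
  have hc0 : c = 0 := (smul_eq_zero.1 h1).resolve_right hm0
  rw [← hc, hc0, zero_smul]

end shapiro

/-! ### The monomial basis of `H^•(M)` -/

section monomials
variable {K : Type u} [Field K] {N : ℕ} [NeZero N]

omit [NeZero N] in
theorem x1_eq_chi : (x1 : HRing.{u} K N) = chi1 K expA := rfl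
omit [NeZero N] in
theorem y1_eq_chi : (y1 : HRing.{u} K N) = chi1 K expB := rfl
omit [NeZero N] in
theorem x2_eq_chi : (x2 : HRing.{u} K N) = chi2 K expA := rfl
omit [NeZero N] in
theorem y2_eq_chi : (y2 : HRing.{u} K N) = chi2 K expB := rfl

section comm
variable (hN : (N : K) = 0)
include hN

theorem x1_comm_x2 : Commute (x1 : HRing.{u} K N) x2 :=
  chi1_commute_chi2 K expA_mul expA_mul hN
theorem x1_comm_y2 : Commute (x1 : HRing.{u} K N) y2 :=
  chi1_commute_chi2 K expA_mul expB_mul hN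
theorem y1_comm_x2 : Commute (y1 : HRing.{u} K N) x2 :=
  chi1_commute_chi2 K expB_mul expA_mul hN
theorem y1_comm_y2 : Commute (y1 : HRing.{u} K N) y2 :=
  chi1_commute_chi2 K expB_mul expB_mul hN
theorem y1_mul_x1 : (y1 : HRing.{u} K N) * x1 = -(x1 * y1) :=
  chi1_mul_chi1 K expB_mul expA_mul hN

variable (h2 : (2 : K) ≠ 0)
include h2

theorem chi1_sq {G : Type u} [Group G] {χ : G → ZMod N} (hχ : ∀ x y, χ (x * y) = χ x + χ y) :
    chi1 K χ * chi1 K χ = 0 := by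
  have h := chi1_mul_chi1 K hχ hχ hN
  rw [eq_neg_iff_add_eq_zero, ← two_smul K] at h
  exact (smul_eq_zero.1 h).resolve_left h2

theorem x1_sq : (x1 : HRing.{u} K N) * x1 = 0 := chi1_sq hN h2 expA_mul
theorem y1_sq : (y1 : HRing.{u} K N) * y1 = 0 := chi1_sq hN h2 expB_mul
end comm

theorem x2_comm_y2 : Commute (x2 : HRing.{u} K N) y2 :=
  chi2_commute_chi2 K expA_mul expB_mul

/-- The monomial in `x₁, x₂` of degree `k`. -/
def monX (k : ℕ) : HRing.{u} K N := x1 ^ (k % 2) * x2 ^ (k / 2)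
/-- The monomial in `y₁, y₂` of degree `l`. -/
def monY (l : ℕ) : HRing.{u} K N := y1 ^ (l % 2) * y2 ^ (l / 2)

omit [NeZero N] in
theorem monX_add_two (k : ℕ) : (monX (k + 2) : HRing.{u} K N) = monX k * x2 := by
  rw [monX, monX, mul_assoc, ← pow_succ]
  congr 2
  · simp
  · omega

theorem pull_cycMon (hN : (N : K) = 0) (l : ℕ) :
    pullRing K (projB N) (cycMon K N l) = (monY l : HRing.{u} K N) := by
  rw [cycMon, monY, map_mul, map_pow, map_pow, pullRing_chi1 K Cyc.exp_mul hN,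
    pullRing_chi2 K Cyc.exp_mul]
  rfl

omit [NeZero N] in
theorem pull_proj_fac (z : CohRing K (Cyc.{u} N)) :
    pullRing K (facB N) (pullRing K (projB N) z) = z := by
  induction z using DirectSum.induction_on with
  | zero => simp
  | add a b ha hb => rw [map_add, map_add, ha, hb]
  | of s a =>
    obtain ⟨f, rfl⟩ := Coh.mk_surjective K _ s a
    rw [pullRing_of, pullRing_of, Coh.pull_mk, Coh.pull_mk]
    rfl

theorem fac_monY (hN : (N : K) = 0) (l : ℕ) :
    pullRing K (facB N) (monY l : HRing.{u} K N) = cycMon K N l := by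
  rw [← pull_cycMon hN, pull_proj_fac]

omit [NeZero N] in
theorem expA_facB_mul (x y : Cyc.{u} N) :
    (expA ∘ facB N) (x * y) = (expA ∘ facB N) x + (expA ∘ facB N) y :=
  (congrArg expA (map_mul (facB N) x y)).trans (expA_mul (facB N x) (facB N y))

theorem fac_x1 (hN : (N : K) = 0) : pullRing K (facB N) (x1 : HRing.{u} K N) = 0 := by
  rw [x1_eq_chi, pullRing_chi1 K expA_mul hN, chi1_eq K expA_facB_mul hN]
  refine (congrArg _ ?_).trans (map_zero (DirectSum.of (Coh K (Cyc.{u} N)) 1))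
  refine Eq.trans (congrArg _ (Subtype.ext (funext fun x => ?_))) (map_zero (Coh.mk K _ 1))
  show ((0 : ZMod N).val : K) = 0
  simp

theorem fac_x2 : pullRing K (facB N) (x2 : HRing.{u} K N) = 0 := by
  rw [x2_eq_chi, pullRing_chi2 K expA_mul, chi2_eq K expA_facB_mul]
  refine (congrArg _ ?_).trans (map_zero (DirectSum.of (Coh K (Cyc.{u} N)) 2))
  refine Eq.trans (congrArg _ (Subtype.ext (funext fun x => ?_))) (map_zero (Coh.mk K _ 2))
  refine (bocksteinCochain_apply expA_facB_mul x).trans ?_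
  show ((carry 0 0 : ℤ) : K) = 0
  rw [carry_zero_left, Int.cast_zero]

/-- The monomials in `x₁, x₂` of positive degree restrict to zero on the second factor. -/
theorem fac_monX (hN : (N : K) = 0) (k : ℕ) (hk : 0 < k) :
    pullRing K (facB N) (monX k : HRing.{u} K N) = 0 := by
  rw [monX, map_mul, map_pow, map_pow, fac_x1 hN, fac_x2]
  rcases Nat.mod_two_eq_zero_or_one k with h | h
  · rw [zero_pow (n := k / 2) (by omega), mul_zero]
  · rw [h, pow_one, zero_mul]

omit [NeZero N] in
theorem mul_mem_Hs {s t : ℕ} {w z : HRing.{u} K N} (hw : w ∈ Hs K N s) (hz : z ∈ Hs K N t) :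
    w * z ∈ Hs K N (s + t) := by
  obtain ⟨a, rfl⟩ := hw
  obtain ⟨b, rfl⟩ := hz
  exact ⟨Coh.cup K _ s t a b, (DirectSum.of_mul_of _ _).symm⟩

omit [NeZero N] in
theorem one_mem_Hs : (1 : HRing.{u} K N) ∈ Hs K N 0 := ⟨Coh.const K _ 1, rfl⟩

omit [NeZero N] in
theorem pow_mem_Hs {s : ℕ} {w : HRing.{u} K N} (hw : w ∈ Hs K N s) (k : ℕ) :
    w ^ k ∈ Hs K N (k * s) := by
  induction k with
  | zero => rw [pow_zero, zero_mul]; exact one_mem_Hs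
  | succ k ih => rw [pow_succ, Nat.succ_mul]; exact mul_mem_Hs ih hw

omit [NeZero N] in
theorem x1_mem : (x1 : HRing.{u} K N) ∈ Hs K N 1 := ⟨_, rfl⟩
omit [NeZero N] in
theorem y1_mem : (y1 : HRing.{u} K N) ∈ Hs K N 1 := ⟨_, rfl⟩
omit [NeZero N] in
theorem x2_mem : (x2 : HRing.{u} K N) ∈ Hs K N 2 := ⟨_, rfl⟩
omit [NeZero N] in
theorem y2_mem : (y2 : HRing.{u} K N) ∈ Hs K N 2 := ⟨_, rfl⟩

omit [NeZero N] in
theorem monX_mem (k : ℕ) : (monX k : HRing.{u} K N) ∈ Hs K N k := by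
  have h := mul_mem_Hs (pow_mem_Hs (x1_mem (K := K) (N := N)) (k % 2))
    (pow_mem_Hs (x2_mem (K := K) (N := N)) (k / 2))
  rwa [show k % 2 * 1 + k / 2 * 2 = k by omega] at h

omit [NeZero N] in
theorem monY_mem (k : ℕ) : (monY k : HRing.{u} K N) ∈ Hs K N k := by
  have h := mul_mem_Hs (pow_mem_Hs (y1_mem (K := K) (N := N)) (k % 2))
    (pow_mem_Hs (y2_mem (K := K) (N := N)) (k / 2))
  rwa [show k % 2 * 1 + k / 2 * 2 = k by omega] at h

variable (hN1 : 1 < N) (hN : (N : K) = 0)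
include hN1 hN

theorem cycMon_ne_zero (s : ℕ) : cycMon K N s ≠ 0 := by
  obtain ⟨m, hm, hm', -⟩ := cyc_span.{u} K hN1 hN s
  rw [← hm']
  intro h
  exact hm (DirectSum.of_injective s (h.trans (map_zero _).symm))

theorem x1_ne_zero : (x1 : HRing.{u} K N) ≠ 0 := by
  intro h
  rw [x1_eq_chi, chi1_eq K expA_mul hN] at h
  have h1 := DirectSum.of_injective (β := Coh K (BaseM.{u} N)) 1 (h.trans (map_zero _).symm)
  have h2 := Coh.mk_one_injective (h1.trans (map_zero _).symm)
  have h3 : (((Cyc.gen.{u} N).exp.val : ℕ) : K) = 0 :=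
    congrFun (congrArg Subtype.val h2) fun _ => (Cyc.gen N, 1)
  have : Fact (1 < N) := ⟨hN1⟩
  rw [Cyc.exp_gen, ZMod.val_one] at h3
  simp at h3

/-- A relation `v * x₁ + e * x₂ = 0` forces `v` to restrict to zero. -/
theorem fac_eq_zero_of_relation {s : ℕ} {v e : HRing.{u} K N} (hv : v ∈ Hs K N (s + 1))
    (he : e ∈ Hs K N s) (h : v * x1 + e * x2 = 0) : pullRing K (facB N) v = 0 := by
  obtain ⟨a, rfl⟩ := hv
  obtain ⟨b, rfl⟩ := he
  obtain ⟨f, rfl⟩ := Coh.mk_surjective K _ _ a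
  obtain ⟨g, rfl⟩ := Coh.mk_surjective K _ _ b
  rw [x1_eq_chi, x2_eq_chi, chi1_eq K expA_mul hN, chi2_eq K expA_mul] at h
  have h1 : DirectSum.of (Coh K (BaseM.{u} N)) (s + 2)
    (Coh.cup K _ (s + 1) 1 (Coh.mk K _ (s + 1) f) (Coh.mk K _ 1 ⟨_, dualCochain_mem hN expA_mul⟩) +
      Coh.cup K _ s 2 (Coh.mk K _ s g) (Coh.mk K _ 2 ⟨_, bocksteinCochain_mem expA_mul⟩)) = 0 :=
    (map_add _ _ _).trans
      ((congrArg₂ (· + ·) (DirectSum.of_mul_of _ _) (DirectSum.of_mul_of _ _)).symm.trans h)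
  have h2 := restrict_eq_zero_of_relation (shapiroInjective K hN1 hN) (projB N) rfl hN1 hN f g
    (DirectSum.of_injective (β := Coh K (BaseM.{u} N)) (s + 2) (h1.trans (map_zero _).symm))
  exact (pullRing_of K (facB N) (s + 1) (Coh.mk K _ (s + 1) f)).trans
    ((congrArg _ h2).trans (map_zero _))

/-- Multiplication by `x₂` is injective. -/
theorem eq_zero_of_mul_x2 {s : ℕ} {e : HRing.{u} K N}
    (he : e ∈ Hs K N s) (h : e * x2 = 0) : e = 0 := by
  obtain ⟨b, rfl⟩ := he
  obtain ⟨g, rfl⟩ := Coh.mk_surjective K _ _ b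
  rw [x2_eq_chi, chi2_eq K expA_mul] at h
  have h1 : DirectSum.of (Coh K (BaseM.{u} N)) (s + 2)
      (Coh.cup K _ s 2 (Coh.mk K _ s g) (Coh.mk K _ 2 ⟨_, bocksteinCochain_mem expA_mul⟩)) = 0 :=
    (DirectSum.of_mul_of _ _).symm.trans h
  have h2 := eq_zero_of_relation (shapiroInjective K hN1 hN) (projB N) rfl hN1 hN g
    (DirectSum.of_injective (β := Coh K (BaseM.{u} N)) (s + 2) (h1.trans (map_zero _).symm))
  exact (congrArg _ h2).trans (map_zero _)

/-- The kernel of the restriction to the second factor is generated by `x₁` and `x₂`. -/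
theorem exists_of_fac_eq_zero {s : ℕ} {z : HRing.{u} K N} (hz : z ∈ Hs K N (s + 2))
    (h : pullRing K (facB N) z = 0) :
    ∃ w ∈ Hs K N (s + 1), ∃ g ∈ Hs K N s, z = w * x1 + g * x2 := by
  obtain ⟨a, rfl⟩ := hz
  obtain ⟨f, rfl⟩ := Coh.mk_surjective K _ _ a
  obtain ⟨w, g, hwg⟩ := exists_of_restrict_eq_zero (shapiroInjective K hN1 hN) (projB N) rfl hN1 hN
    f (DirectSum.of_injective (β := Coh K (Cyc.{u} N)) (s + 2)
      ((pullRing_of K (facB N) (s + 2) _).symm.trans (h.trans (map_zero _).symm)))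
  refine ⟨_, ⟨w, rfl⟩, _, ⟨g, rfl⟩, ?_⟩
  rw [x1_eq_chi, x2_eq_chi, chi1_eq K expA_mul hN, chi2_eq K expA_mul]
  refine (congrArg (DirectSum.of (Coh K (BaseM.{u} N)) (s + 2)) hwg).trans ?_
  have e1 := DirectSum.of_mul_of (A := Coh K (BaseM.{u} N)) w
    (Coh.mk K (BaseM.{u} N) 1 ⟨_, dualCochain_mem hN expA_mul⟩)
  have e2 := DirectSum.of_mul_of (A := Coh K (BaseM.{u} N)) g
    (Coh.mk K (BaseM.{u} N) 2 ⟨_, bocksteinCochain_mem expA_mul⟩)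
  exact (map_add (DirectSum.of (Coh K (BaseM.{u} N)) (s + 2)) _ _).trans
    (congrArg₂ (· + ·) e1 e2).symm

/-- The monomials of degree `s` are linearly independent. Restriction to the second factor detects
the coefficient of `y_s`; a relation without this term has the form `v x₁ + e x₂ = 0`, where `v` is
a multiple of a monomial in `y₁, y₂` that is again detected by restriction, and the remaining
relation `e x₂ = 0` can be divided by `x₂`. -/
theorem sum_monomials_eq_zero (s : ℕ) (c : ℕ → K)
    (h : ∑ k ∈ Finset.range (s + 1), c k • (monY (s - k) * monX k : HRing.{u} K N) = 0) :
    ∀ k ≤ s, c k = 0 := by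
  induction s using Nat.strong_induction_on generalizing c with
  | _ s ih =>
    -- Restriction to the second factor kills all terms but the one for `k = 0`.
    have h0 : c 0 = 0 := by
      have h1 := congrArg (pullRing K (facB N)) h
      rw [map_sum, map_zero, Finset.sum_range_succ', Finset.sum_eq_zero, zero_add] at h1
      · rw [map_smul, map_mul, fac_monY hN] at h1
        have h2 : (monX 0 : HRing.{u} K N) = 1 := by simp [monX]
        rw [h2, map_one, mul_one] at h1
        exact (smul_eq_zero.1 h1).resolve_right (cycMon_ne_zero hN1 hN _)
      · intro k _
        rw [map_smul, map_mul, fac_monX hN _ k.succ_pos, mul_zero, smul_zero]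
    match s, ih with
    | 0, _ =>
      intro k hk
      rw [Nat.le_zero.1 hk, h0]
    | 1, _ =>
      have h1 : c 1 • (x1 : HRing.{u} K N) = 0 := by
        simpa [Finset.sum_range_succ, h0, monY, monX] using h
      have h1' := (smul_eq_zero.1 h1).resolve_right (x1_ne_zero hN1 hN)
      intro k hk
      interval_cases k
      · exact h0
      · exact h1'
    | s + 2, ih =>
      rw [Finset.sum_range_succ', h0, zero_smul, add_zero, Finset.sum_range_succ'] at h
      have hX1 : (monX 1 : HRing.{u} K N) = x1 := by simp [monX]
      let e : HRing.{u} K N := ∑ k ∈ Finset.range (s + 1), c (k + 2) • (monY (s - k) * monX k)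
      have hsum : ∑ k ∈ Finset.range (s + 1),
          c (k + 1 + 1) • (monY (s + 2 - (k + 1 + 1)) * monX (k + 1 + 1) : HRing.{u} K N) =
          e * x2 := by
        rw [Finset.sum_mul]
        refine Finset.sum_congr rfl fun k _ => ?_
        rw [show k + 1 + 1 = k + 2 from rfl, monX_add_two, smul_mul_assoc, mul_assoc,
          Nat.add_sub_add_right]
      have he : e ∈ Hs K N s := by
        refine Submodule.sum_mem _ fun k hk => Submodule.smul_mem _ _ ?_
        have := mul_mem_Hs (monY_mem (K := K) (N := N) (s - k)) (monX_mem k)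
        rwa [Nat.sub_add_cancel (by have := Finset.mem_range.1 hk; omega)] at this
      -- What is left is `c₁ y x₁ + e x₂ = 0`, where `y` is a monomial in `y₁, y₂`.
      rw [hsum, zero_add, hX1, show s + 2 - 1 = s + 1 by omega, ← smul_mul_assoc, add_comm] at h
      have h1 := fac_eq_zero_of_relation hN1 hN (Submodule.smul_mem _ _ (monY_mem (s + 1))) he h
      rw [map_smul, fac_monY hN] at h1
      have hc1 : c 1 = 0 := (smul_eq_zero.1 h1).resolve_right (cycMon_ne_zero hN1 hN _)
      have hc1' : c (0 + 1) = 0 := hc1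
      rw [hc1', zero_smul, zero_mul, zero_add] at h
      have h3 := ih s (by omega) (fun k => c (k + 2)) (eq_zero_of_mul_x2 hN1 hN he h)
      intro k hk
      match k, hk with
      | 0, _ => exact h0
      | 1, _ => exact hc1
      | k + 2, hk => exact h3 k (by omega)

/-- The monomials of degree `s` span `H^s(M)`. A multiple of the monomial in `y₁, y₂` corrects the
restriction of a class to zero, and what is left is generated by `x₁` and `x₂` over classes of lower
degree. -/
theorem Hs_le_span (h2 : (2 : K) ≠ 0) (s : ℕ) : Hs K N s ≤ Submodule.span K
    {z : HRing.{u} K N | ∃ l k, l + k = s ∧ z = monY l * monX k} := by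
  induction s using Nat.strong_induction_on with
  | _ s ih =>
    suffices h : ∀ z ∈ Hs K N s, pullRing K (facB N) z = 0 → z ∈ Submodule.span K
        {z : HRing.{u} K N | ∃ l k, l + k = s ∧ z = monY l * monX k} by
      intro z hz
      obtain ⟨m, -, hm, hspan⟩ := cyc_span.{u} K hN1 hN s
      obtain ⟨a, ha⟩ := hz
      obtain ⟨c, hc⟩ := hspan (Coh.pull K (facB N) s a)
      have h1 := h (z - c • monY s)
        (Submodule.sub_mem _ ⟨a, ha⟩ (Submodule.smul_mem _ _ (monY_mem s))) (by
          rw [map_sub, map_smul, fac_monY hN, ← hm, sub_eq_zero, ← ha]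
          exact (pullRing_of K (facB N) s a).trans ((congrArg (DirectSum.lof K ℕ (Coh K (Cyc.{u} N)) s) hc).trans
            ((DirectSum.lof K ℕ (Coh K (Cyc.{u} N)) s).map_smul c m)))
      rw [← sub_add_cancel z (c • monY s)]
      refine Submodule.add_mem _ h1 (Submodule.smul_mem _ _ (Submodule.subset_span ⟨s, 0, rfl, ?_⟩))
      simp [monX]
    match s, ih with
    -- In degrees zero and one the claim is read off from cocycles, which have no coboundaries.
    | 0, _ =>
      rintro z ⟨a, rfl⟩ hz
      obtain ⟨f, rfl⟩ := Coh.mk_surjective K _ _ a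
      have h1 := DirectSum.of_injective (β := Coh K (Cyc.{u} N)) 0
        ((pullRing_of K (facB N) 0 _).symm.trans (hz.trans (map_zero _).symm))
      rw [Coh.pull_mk] at h1
      have h3 := Coh.mk_zero_injective (h1.trans (map_zero _).symm)
      have hf : f = 0 := by
        ext x
        have := congrFun (congrArg Subtype.val h3) Fin.elim0
        refine Eq.trans (congrArg f.1 (Subsingleton.elim _ _)) this
      rw [hf, map_zero, map_zero]
      exact Submodule.zero_mem _
    | 1, _ =>
      rintro z ⟨a, rfl⟩ hz
      obtain ⟨f, rfl⟩ := Coh.mk_surjective K _ _ a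
      have h1 := DirectSum.of_injective (β := Coh K (Cyc.{u} N)) 1
        ((pullRing_of K (facB N) 1 _).symm.trans (hz.trans (map_zero _).symm))
      rw [Coh.pull_mk] at h1
      have h3 := Coh.mk_one_injective (h1.trans (map_zero _).symm)
      have hfb : ∀ y : Cyc.{u} N, (f.1 fun _ => (1, y) : K) = 0 := fun y =>
        congrFun (congrArg Subtype.val h3) fun _ => y
      have hf1 : (f.1 fun _ => 1 : K) = 0 := hfb 1
      have hfa : ∀ k : ℕ, (f.1 fun _ => ((Cyc.gen N, 1) : BaseM.{u} N) ^ k : K) =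
          k * (f.1 fun _ => (Cyc.gen N, 1) : K) := by
        intro k
        induction k with
        | zero => simpa using hf1
        | succ k ih =>
          simp only [pow_succ]
          rw [cocycle_one_mul, ih]
          push_cast
          ring
      let c : K := f.1 fun _ => (Cyc.gen N, 1)
      have hf : f = c • ⟨_, dualCochain_mem hN expA_mul⟩ := by
        ext x
        have hx : x = fun _ => ((Cyc.gen N, 1) : BaseM.{u} N) ^ (x 0).1.exp.val * (1, (x 0).2) := by
          funext i
          rw [Subsingleton.elim i 0]
          refine Prod.ext ?_ ?_
          · show (x 0).1 = Cyc.gen N ^ (x 0).1.exp.val * 1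
            rw [mul_one, Cyc.gen_pow_val]
          · show (x 0).2 = 1 ^ (x 0).1.exp.val * (x 0).2
            rw [one_pow, one_mul]
        refine (congrArg f.1 hx).trans ((cocycle_one_mul f _ _).trans ?_)
        rw [hfa, hfb, add_zero]
        exact mul_comm _ _
      have hz1 : DirectSum.of (Coh K (BaseM.{u} N)) 1 (Coh.mk K _ 1 f) = c • x1 := by
        rw [x1_eq_chi, chi1_eq K expA_mul hN, hf, map_smul]
        exact (DirectSum.lof K ℕ (Coh K (BaseM.{u} N)) 1).map_smul c _
      refine hz1 ▸ Submodule.smul_mem _ _ (Submodule.subset_span ⟨0, 1, rfl, ?_⟩)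
      simp [monX, monY]
    | s + 2, ih =>
      intro z hz hz0
      obtain ⟨w, hw, g, hg, rfl⟩ := exists_of_fac_eq_zero hN1 hN hz hz0
      refine Submodule.add_mem _ ?_ ?_
      · have := Submodule.mem_map_of_mem (f := LinearMap.mulRight K (x1 : HRing.{u} K N))
          (ih (s + 1) (by omega) hw)
        rw [Submodule.map_span] at this
        refine Submodule.span_le.2 ?_ this
        rintro _ ⟨_, ⟨l, k, hlk, rfl⟩, rfl⟩
        rw [LinearMap.mulRight_apply, mul_assoc, monX, mul_assoc,
          ((x1_comm_x2 hN).pow_right (k / 2)).symm.eq]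
        rcases Nat.mod_two_eq_zero_or_one k with h | h
        · refine Submodule.subset_span ⟨l, k + 1, by omega, ?_⟩
          rw [monX, h, pow_zero, one_mul, show (k + 1) % 2 = 1 by omega, pow_one,
            show (k + 1) / 2 = k / 2 by omega]
        · rw [h, pow_one, ← mul_assoc x1, x1_sq hN h2, zero_mul, mul_zero]
          exact Submodule.zero_mem _
      · have := Submodule.mem_map_of_mem (f := LinearMap.mulRight K (x2 : HRing.{u} K N))
          (ih s (by omega) hg)
        rw [Submodule.map_span] at this
        refine Submodule.span_mono ?_ this
        rintro _ ⟨_, ⟨l, k, hlk, rfl⟩, rfl⟩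
        refine ⟨l, k + 2, by omega, ?_⟩
        rw [LinearMap.mulRight_apply, mul_assoc, monX_add_two]

end monomials

/-! ### Polynomial coordinates on `H^s(M)` -/

section forms
open Polynomial
variable {K : Type u} [Field K] {N : ℕ}

variable (K N) in
/-- The form `∑ fⱼ x₂^(m-j) y₂^j` of degree `m` in `x₂, y₂` with dehomogenization `f`; coefficients
of `f` beyond degree `m` are ignored. -/
def form (m : ℕ) : K[X] →ₗ[K] HRing.{u} K N :=
  ∑ i ∈ Finset.range (m + 1), (lcoeff K (m - i)).smulRight (x2 ^ i * y2 ^ (m - i))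

theorem form_apply (m : ℕ) (f : K[X]) :
    form K N m f = ∑ i ∈ Finset.range (m + 1), f.coeff (m - i) • (x2 ^ i * y2 ^ (m - i)) := by
  simp [form, LinearMap.sum_apply]

theorem form_X_pow {m j : ℕ} (h : j ≤ m) : form K N m (X ^ j) = x2 ^ (m - j) * y2 ^ j := by
  rw [form_apply, Finset.sum_eq_single (m - j)]
  · rw [show m - (m - j) = j by omega, coeff_X_pow_self, one_smul]
  · intro i hi hij
    rw [coeff_X_pow, if_neg, zero_smul]
    have := Finset.mem_range.1 hi
    omega
  · intro hi
    exact absurd (Finset.mem_range.2 (by omega)) hi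

theorem form_one (m : ℕ) : form K N m 1 = x2 ^ m := by
  simpa using form_X_pow (K := K) (N := N) (Nat.zero_le m)

theorem form_mul_X [NeZero N] (m : ℕ) (f : K[X]) : form K N (m + 1) (X * f) = y2 * form K N m f := by
  rw [form_apply, form_apply, Finset.sum_range_succ, Nat.sub_self, coeff_X_mul_zero, zero_smul,
    add_zero, Finset.mul_sum]
  refine Finset.sum_congr rfl fun i hi => ?_
  rw [show m + 1 - i = m - i + 1 by have := Finset.mem_range.1 hi; omega, coeff_X_mul,
    mul_smul_comm, pow_succ', ← mul_assoc, ← mul_assoc, (x2_comm_y2.pow_left i).eq]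

/-- Raising the degree of a form with a given dehomogenization is multiplication by `x₂`. -/
theorem form_succ {m : ℕ} {f : K[X]} (hf : f ∈ degreeLT K (m + 1)) :
    form K N (m + 1) f = x2 * form K N m f := by
  rw [form_apply, form_apply, Finset.sum_range_succ', Nat.sub_zero,
    coeff_eq_zero_of_degree_lt (mem_degreeLT.1 hf), zero_smul, add_zero, Finset.mul_sum]
  refine Finset.sum_congr rfl fun i _ => ?_
  rw [Nat.add_sub_add_right, mul_smul_comm, pow_succ', mul_assoc]

/-- Multiplication by a linear form in coordinates; the dehomogenization of `y₂ + c x₂` is `X + c`.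
-/
theorem form_linear_mul [NeZero N] {m : ℕ} {f : K[X]} (hf : f ∈ degreeLT K (m + 1)) (c : K) :
    form K N (m + 1) ((X + C c) * f) = (y2 + c • x2) * form K N m f := by
  rw [add_mul, map_add, form_mul_X, ← smul_eq_C_mul, map_smul, form_succ hf, add_mul,
    smul_mul_assoc]

theorem linear_mul_mem {m : ℕ} {f : K[X]} (hf : f ∈ degreeLT K m) (c : K) :
    (X + C c) * f ∈ degreeLT K (m + 1) := by
  rcases eq_or_ne f 0 with rfl | h
  · simp
  rw [mem_degreeLT, degree_mul, degree_X_add_C, degree_eq_natDegree h] at *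
  have : f.natDegree < m := by exact_mod_cast hf
  have h : 1 + f.natDegree < m + 1 := by omega
  exact_mod_cast h

theorem form_linear_pow [NeZero N] (c : K) (i j : ℕ) :
    (X + C c) ^ j ∈ degreeLT K (i + j + 1) ∧
      form K N (i + j) ((X + C c) ^ j) = (y2 + c • x2) ^ j * x2 ^ i := by
  induction j with
  | zero =>
    refine ⟨?_, by simp [form_one]⟩
    rw [pow_zero, mem_degreeLT, degree_one]
    exact_mod_cast Nat.succ_pos i
  | succ j ih =>
    rw [pow_succ']
    refine ⟨linear_mul_mem ih.1 c, ?_⟩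
    rw [← add_assoc, form_linear_mul ih.1, ih.2, pow_succ', mul_assoc]

/-- A ring endomorphism that fixes `x₂` and sends `y₂` to `y₂ + c x₂` acts on forms by the
translation `X ↦ X + c`. -/
theorem map_form [NeZero N] {c : K} (φ : HRing.{u} K N →ₐ[K] HRing.{u} K N) (h1 : φ x2 = x2)
    (h2 : φ y2 = y2 + c • x2) {m : ℕ} {f : K[X]} (hf : f ∈ degreeLT K (m + 1)) :
    φ (form K N m f) = form K N m (taylor c f) := by
  classical
  rw [degreeLT_eq_span_X_pow] at hf
  refine LinearMap.eqOn_span (f := φ.toLinearMap ∘ₗ form K N m)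
    (g := form K N m ∘ₗ taylor c) ?_ hf
  intro g hg
  obtain ⟨j, hj, rfl⟩ := Finset.mem_image.1 (Finset.mem_coe.1 hg)
  have hj : j ≤ m := Nat.lt_succ_iff.1 (Finset.mem_range.1 hj)
  show φ (form K N m (X ^ j)) = form K N m (taylor c (X ^ j))
  have h3 := (form_linear_pow (N := N) c (m - j) j).2
  rw [Nat.sub_add_cancel hj] at h3
  rw [form_X_pow hj, map_mul, map_pow, map_pow, h1, h2, taylor_X_pow, h3]
  have h4 : Commute (x2 : HRing.{u} K N) (y2 + c • x2) :=
    x2_comm_y2.add_right ((Commute.refl _).smul_right c)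
  exact (h4.pow_pow _ _).eq

theorem form_mem_Hs (m : ℕ) (f : K[X]) : form K N m f ∈ Hs K N (2 * m) := by
  rw [form_apply]
  refine Submodule.sum_mem _ fun i hi => Submodule.smul_mem _ _ ?_
  have h := mul_mem_Hs (pow_mem_Hs (x2_mem (K := K) (N := N)) i)
    (pow_mem_Hs (y2_mem (K := K) (N := N)) (m - i))
  have := Finset.mem_range.1 hi
  rwa [show i * 2 + (m - i) * 2 = 2 * m by omega] at h

variable (K N) in
/-- The element of `H^s(M)` with coordinates `(f, g)`: for `s = 2m` it is
`f + x₁ y₁ g` and for `s = 2m + 1` it is `x₁ f + y₁ g`, where `f` and `g` stand for forms in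
`x₂, y₂` of the appropriate degree. For `s = 0` the second coordinate has to be zero. -/
def lev (s : ℕ) : K[X] × K[X] →ₗ[K] HRing.{u} K N :=
  if s % 2 = 0 then
    (form K N (s / 2)).coprod (LinearMap.mulLeft K (x1 * y1) ∘ₗ form K N (s / 2 - 1))
  else
    (LinearMap.mulLeft K x1 ∘ₗ form K N (s / 2)).coprod (LinearMap.mulLeft K y1 ∘ₗ form K N (s / 2))

theorem lev_even (m : ℕ) (v : K[X] × K[X]) :
    lev K N (2 * m) v = form K N m v.1 + x1 * y1 * form K N (m - 1) v.2 := by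
  rw [lev, if_pos (by omega), show 2 * m / 2 = m by omega]
  rfl

theorem lev_odd (m : ℕ) (v : K[X] × K[X]) :
    lev K N (2 * m + 1) v = x1 * form K N m v.1 + y1 * form K N m v.2 := by
  rw [lev, if_neg (by omega), show (2 * m + 1) / 2 = m by omega]
  rfl

variable (K) in
/-- Pairs of polynomials of degrees less than `d` and `e`. -/
def box (d e : ℕ) : Submodule K (K[X] × K[X]) := (degreeLT K d).prod (degreeLT K e)

theorem box_mono {d e d' e' : ℕ} (h : d ≤ d') (h' : e ≤ e') : box K d e ≤ box K d' e' :=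
  fun _ hv => ⟨degreeLT_mono h hv.1, degreeLT_mono h' hv.2⟩

variable (K) in
/-- The coordinates of all of `H^s(M)`. -/
abbrev boxH (s : ℕ) : Submodule K (K[X] × K[X]) := box K (s / 2 + 1) ((s + 1) / 2)

variable (K) in
/-- The coordinates of `W^s`. -/
abbrev boxW (p s : ℕ) : Submodule K (K[X] × K[X]) :=
  box K (min (s / 2 + 1) p) (min ((s + 1) / 2) p)

theorem boxW_le (p s : ℕ) : boxW K p s ≤ boxH K s := box_mono (min_le_left _ _) (min_le_left _ _)

theorem X_pow_mem {j d : ℕ} : (X ^ j : K[X]) ∈ degreeLT K d ↔ j < d := by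
  rw [mem_degreeLT, degree_X_pow]
  exact Nat.cast_lt

theorem degreeLT_eq_span (d : ℕ) :
    degreeLT K d = Submodule.span K {f | ∃ j < d, (X : K[X]) ^ j = f} := by
  classical
  rw [degreeLT_eq_span_X_pow]
  congr 1
  ext f
  simp

theorem box_eq_span (d e : ℕ) : box K d e =
    Submodule.span K ({v | ∃ j < d, ((X : K[X]) ^ j, (0 : K[X])) = v} ∪
      {v | ∃ j < e, ((0 : K[X]), (X : K[X]) ^ j) = v}) := by
  apply le_antisymm
  · rintro ⟨f, g⟩ ⟨hf, hg⟩
    have h1 := Submodule.mem_map_of_mem (f := LinearMap.inl K K[X] K[X]) hf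
    have h2 := Submodule.mem_map_of_mem (f := LinearMap.inr K K[X] K[X]) hg
    rw [degreeLT_eq_span, Submodule.map_span] at h1 h2
    have h3 : (f, g) = LinearMap.inl K K[X] K[X] f + LinearMap.inr K K[X] K[X] g := by simp
    rw [h3]
    refine Submodule.add_mem _ (Submodule.span_mono ?_ h1) (Submodule.span_mono ?_ h2)
    · rintro _ ⟨_, ⟨j, hj, rfl⟩, rfl⟩
      exact Or.inl ⟨j, hj, rfl⟩
    · rintro _ ⟨_, ⟨j, hj, rfl⟩, rfl⟩
      exact Or.inr ⟨j, hj, rfl⟩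
  · refine Submodule.span_le.2 ?_
    rintro _ (⟨j, hj, rfl⟩ | ⟨j, hj, rfl⟩)
    · exact ⟨X_pow_mem.2 hj, Submodule.zero_mem _⟩
    · exact ⟨Submodule.zero_mem _, X_pow_mem.2 hj⟩

/-- The coordinates of the monomial `x₁^a y₁^b x₂^i y₂^j`. -/
def monCoord (b j : ℕ) : K[X] × K[X] := if b = 0 then (X ^ j, 0) else (0, X ^ j)

theorem lev_monCoord {a b : ℕ} (ha : a ≤ 1) (hb : b ≤ 1) (i j : ℕ) :
    lev K N (a + b + 2 * (i + j)) (monCoord b j) = x1 ^ a * y1 ^ b * x2 ^ i * y2 ^ j := by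
  have hi : i + j - j = i := by omega
  interval_cases a <;> interval_cases b
  · rw [show 0 + 0 + 2 * (i + j) = 2 * (i + j) by omega, lev_even]
    simp [monCoord, form_X_pow, hi]
  · rw [show 0 + 1 + 2 * (i + j) = 2 * (i + j) + 1 by omega, lev_odd]
    simp [monCoord, form_X_pow, hi, mul_assoc]
  · rw [show 1 + 0 + 2 * (i + j) = 2 * (i + j) + 1 by omega, lev_odd]
    simp [monCoord, form_X_pow, hi, mul_assoc]
  · rw [show 1 + 1 + 2 * (i + j) = 2 * (i + j + 1) by omega, lev_even]
    simp [monCoord, form_X_pow, hi, mul_assoc]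

theorem lev_mem_Hs {s : ℕ} {v : K[X] × K[X]} (hv : v ∈ boxH K s) : lev K N s v ∈ Hs K N s := by
  obtain ⟨m, rfl | rfl⟩ := Nat.even_or_odd' s
  · rw [lev_even]
    refine Submodule.add_mem _ (form_mem_Hs _ _) ?_
    rcases m with _ | m
    · have h0 : v.2 = 0 := by
        have : v.2 ∈ degreeLT K ((2 * 0 + 1) / 2) := hv.2
        rw [mem_degreeLT] at this
        exact degree_eq_bot.1 (Nat.WithBot.lt_zero_iff.1 (by exact_mod_cast this))
      rw [h0, map_zero, mul_zero (x1 * y1)]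
      exact Submodule.zero_mem _
    · have h := mul_mem_Hs (mul_mem_Hs (x1_mem (K := K) (N := N)) y1_mem) (form_mem_Hs m v.2)
      rwa [show 1 + 1 + 2 * m = 2 * (m + 1) by omega] at h
  · rw [lev_odd]
    have h1 := mul_mem_Hs (x1_mem (K := K) (N := N)) (form_mem_Hs m v.1)
    have h2 := mul_mem_Hs (y1_mem (K := K) (N := N)) (form_mem_Hs m v.2)
    rw [add_comm] at h1 h2
    exact Submodule.add_mem _ h1 h2

/-- The projection of `H^•(M)` onto its component of degree `s`. -/
def projHs (s : ℕ) : HRing.{u} K N →ₗ[K] HRing.{u} K N :=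
  DirectSum.lof K ℕ (Coh K (BaseM.{u} N)) s ∘ₗ DirectSum.component K ℕ (Coh K (BaseM.{u} N)) s

theorem projHs_apply (s : ℕ) (w : HRing.{u} K N) :
    projHs s w = DirectSum.of (Coh K (BaseM.{u} N)) s (w s) := rfl

theorem of_apply_eq {s : ℕ} {w : HRing.{u} K N} (hw : w ∈ Hs K N s) :
    DirectSum.of (Coh K (BaseM.{u} N)) s (w s) = w := by
  obtain ⟨a, rfl⟩ := hw
  exact congrArg _ (DirectSum.of_eq_same s a)

theorem apply_eq_zero_of_ne {s t : ℕ} (h : t ≠ s) {w : HRing.{u} K N} (hw : w ∈ Hs K N t) :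
    w s = 0 := by
  obtain ⟨a, rfl⟩ := hw
  exact DirectSum.of_eq_of_ne t s a h.symm

theorem monomial_mem_Hs (a b i j : ℕ) :
    (x1 ^ a * y1 ^ b * x2 ^ i * y2 ^ j : HRing.{u} K N) ∈ Hs K N (a + b + 2 * (i + j)) := by
  have h := mul_mem_Hs (mul_mem_Hs (mul_mem_Hs (pow_mem_Hs (x1_mem (K := K) (N := N)) a)
    (pow_mem_Hs (y1_mem (K := K) (N := N)) b)) (pow_mem_Hs (x2_mem (K := K) (N := N)) i))
    (pow_mem_Hs (y2_mem (K := K) (N := N)) j)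
  rwa [show a * 1 + b * 1 + i * 2 + j * 2 = a + b + 2 * (i + j) by omega] at h

theorem monCoord_mem {d e b j : ℕ} (h0 : b = 0 → j < d) (h1 : b ≠ 0 → j < e) :
    (monCoord b j : K[X] × K[X]) ∈ box K d e := by
  rw [monCoord]
  split_ifs with h
  · exact ⟨X_pow_mem.2 (h0 h), Submodule.zero_mem _⟩
  · exact ⟨Submodule.zero_mem _, X_pow_mem.2 (h1 h)⟩

/-- The coordinates of `W^s`: forms of degree less than `p` in `y₂`. -/
theorem Ws_eq (p s : ℕ) : Ws K N p s = (boxW K p s).map (lev K N s) := by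
  apply le_antisymm
  · rintro w ⟨hw, hs⟩
    have h := Submodule.mem_map_of_mem (f := projHs s) hw
    rw [projHs_apply, of_apply_eq hs, W, Submodule.map_span] at h
    refine Submodule.span_le.2 ?_ h
    rintro _ ⟨_, ⟨a, b, i, j, ha, hb, hj, rfl⟩, rfl⟩
    rcases eq_or_ne (a + b + 2 * (i + j)) s with hs | hs
    · rw [SetLike.mem_coe, projHs_apply, of_apply_eq (hs ▸ monomial_mem_Hs a b i j)]
      refine ⟨monCoord b j, monCoord_mem ?_ ?_, ?_⟩
      · omega
      · omega
      · rw [← hs]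
        exact lev_monCoord ha hb i j
    · rw [SetLike.mem_coe, projHs_apply, apply_eq_zero_of_ne hs (monomial_mem_Hs a b i j), map_zero]
      exact Submodule.zero_mem _
  · rintro _ ⟨v, hv, rfl⟩
    refine ⟨?_, lev_mem_Hs (boxW_le p s hv)⟩
    have h := Submodule.mem_map_of_mem (f := lev K N s) hv
    rw [boxW, box_eq_span, Submodule.map_span] at h
    refine Submodule.span_mono ?_ h
    rintro _ ⟨_, ⟨j, hj, rfl⟩ | ⟨j, hj, rfl⟩, rfl⟩
    · refine ⟨s % 2, 0, s / 2 - j, j, by omega, by omega, by omega, ?_⟩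
      rw [← lev_monCoord (by omega) (by omega)]
      congr 1
      congr 1
      omega
    · refine ⟨(s + 1) % 2, 1, (s + 1) / 2 - 1 - j, j, by omega, le_rfl, by omega, ?_⟩
      rw [← lev_monCoord (by omega) (by omega)]
      congr 1
      congr 1
      omega

section
variable [NeZero N] (hN1 : 1 < N) (hN : (N : K) = 0) (h2 : (2 : K) ≠ 0)
include hN1 hN

omit hN1 in
/-- Reordering a monomial costs a sign when both degrees are odd. -/
theorem monY_mul_monX (k l : ℕ) : (monY l * monX k : HRing.{u} K N) =
    (-1 : K) ^ (l % 2 * (k % 2)) •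
      (x1 ^ (k % 2) * y1 ^ (l % 2) * x2 ^ (k / 2) * y2 ^ (l / 2)) := by
  have hc : Commute (y2 ^ (l / 2) : HRing.{u} K N) (x1 ^ (k % 2) * x2 ^ (k / 2)) :=
    (((x1_comm_y2 hN).symm.pow_pow _ _)).mul_right (x2_comm_y2.symm.pow_pow _ _)
  rw [monY, monX, mul_assoc, hc.eq, ← mul_assoc, ← mul_assoc, ← smul_mul_assoc, ← smul_mul_assoc]
  congr 2
  rcases Nat.mod_two_eq_zero_or_one k with h | h <;>
    rcases Nat.mod_two_eq_zero_or_one l with h' | h' <;> rw [h, h']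
  · simp
  · simp
  · simp
  · simp [y1_mul_x1 hN]

include h2 in
/-- Every element of `H^s(M)` has coordinates. -/
theorem Hs_eq (s : ℕ) : Hs K N s = (boxH K s).map (lev K N s) := by
  apply le_antisymm
  · refine (Hs_le_span hN1 hN h2 s).trans (Submodule.span_le.2 ?_)
    rintro _ ⟨l, k, hlk, rfl⟩
    rw [monY_mul_monX hN]
    refine Submodule.smul_mem _ _ ⟨monCoord (l % 2) (l / 2), monCoord_mem ?_ ?_, ?_⟩
    · omega
    · omega
    · rw [← lev_monCoord (by omega) (by omega)]
      congr 1
      congr 1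
      omega
  · rintro _ ⟨v, hv, rfl⟩
    exact lev_mem_Hs hv

omit hN1 hN [NeZero N] in
theorem sum_range_two_mul {A : Type*} [AddCommMonoid A] (F : ℕ → A) (m : ℕ) :
    ∑ k ∈ Finset.range (2 * m), F k =
      ∑ i ∈ Finset.range m, F (2 * i) + ∑ i ∈ Finset.range m, F (2 * i + 1) := by
  induction m with
  | zero => simp
  | succ m ih =>
    rw [show 2 * (m + 1) = 2 * m + 1 + 1 by ring, Finset.sum_range_succ, Finset.sum_range_succ, ih,
      Finset.sum_range_succ, Finset.sum_range_succ]
    abel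

/-- Coordinates are unique. -/
theorem eq_zero_of_lev {s : ℕ} {v : K[X] × K[X]} (hv : v ∈ boxH K s) (h : lev K N s v = 0) :
    v = 0 := by
  have key : ∀ {d : ℕ} {f : K[X]}, f ∈ degreeLT K d → (∀ j < d, f.coeff j = 0) → f = 0 := by
    intro d f hf h0
    ext j
    rcases lt_or_ge j d with hj | hj
    · rw [h0 j hj, coeff_zero]
    · rw [coeff_zero, coeff_eq_zero_of_degree_lt]
      exact (mem_degreeLT.1 hf).trans_le (by exact_mod_cast hj)
  obtain ⟨m, rfl | rfl⟩ := Nat.even_or_odd' s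
  · have hc := sum_monomials_eq_zero hN1 hN (2 * m)
      (fun k => if k % 2 = 0 then v.1.coeff (m - k / 2) else -v.2.coeff (m - 1 - k / 2)) (by
        rw [← h, lev_even, Finset.sum_range_succ, sum_range_two_mul, add_right_comm,
          ← Finset.sum_range_succ (fun i => _) m, form_apply, form_apply, Finset.mul_sum]
        refine congrArg₂ (· + ·) (Finset.sum_congr rfl fun i hi => ?_) ?_
        · have hi := Finset.mem_range.1 hi
          rw [if_pos (by omega), monY_mul_monX hN, show 2 * i % 2 = 0 by omega,
            show (2 * m - 2 * i) % 2 = 0 by omega, show 2 * i / 2 = i by omega,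
            show (2 * m - 2 * i) / 2 = m - i by omega]
          simp
        · have hv2 : v.2 ∈ degreeLT K m := by
            have := hv.2
            rwa [show (2 * m + 1) / 2 = m by omega] at this
          rcases m with _ | m
          · have h0 : v.2 = 0 := key hv2 (fun j hj => by omega)
            rw [h0]
            simp
          · refine Finset.sum_congr rfl fun i hi => ?_
            have hi := Finset.mem_range.1 hi
            rw [if_neg (by omega), monY_mul_monX hN, show (2 * i + 1) % 2 = 1 by omega,
              show (2 * (m + 1) - (2 * i + 1)) % 2 = 1 by omega, show (2 * i + 1) / 2 = i by omega,
              show (2 * (m + 1) - (2 * i + 1)) / 2 = m + 1 - 1 - i by omega]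
            simp [mul_assoc])
    refine Prod.ext (key hv.1 fun j hj => ?_) (key hv.2 fun j hj => ?_)
    · have := hc (2 * (m - j)) (by omega)
      rwa [if_pos (by omega), show m - 2 * (m - j) / 2 = j by omega] at this
    · have := hc (2 * (m - 1 - j) + 1) (by omega)
      rwa [if_neg (by omega), show m - 1 - (2 * (m - 1 - j) + 1) / 2 = j by omega,
        neg_eq_zero] at this
  · have hc := sum_monomials_eq_zero hN1 hN (2 * m + 1)
      (fun k => if k % 2 = 0 then v.2.coeff (m - k / 2) else v.1.coeff (m - k / 2)) (by
        rw [← h, lev_odd, show 2 * m + 1 + 1 = 2 * (m + 1) by ring, sum_range_two_mul, add_comm,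
          form_apply, form_apply, Finset.mul_sum, Finset.mul_sum]
        refine congrArg₂ (· + ·) (Finset.sum_congr rfl fun i hi => ?_)
          (Finset.sum_congr rfl fun i hi => ?_)
        · have hi := Finset.mem_range.1 hi
          rw [if_neg (by omega), monY_mul_monX hN, show (2 * i + 1) % 2 = 1 by omega,
            show (2 * m + 1 - (2 * i + 1)) % 2 = 0 by omega, show (2 * i + 1) / 2 = i by omega,
            show (2 * m + 1 - (2 * i + 1)) / 2 = m - i by omega]
          simp [mul_assoc]
        · have hi := Finset.mem_range.1 hi
          rw [if_pos (by omega), monY_mul_monX hN, show 2 * i % 2 = 0 by omega,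
            show (2 * m + 1 - 2 * i) % 2 = 1 by omega, show 2 * i / 2 = i by omega,
            show (2 * m + 1 - 2 * i) / 2 = m - i by omega]
          simp [mul_assoc])
    refine Prod.ext (key hv.1 fun j hj => ?_) (key hv.2 fun j hj => ?_)
    · have := hc (2 * (m - j) + 1) (by omega)
      rwa [if_neg (by omega), show m - (2 * (m - j) + 1) / 2 = j by omega] at this
    · have := hc (2 * (m - j)) (by omega)
      rwa [if_pos (by omega), show m - 2 * (m - j) / 2 = j by omega] at this

theorem lev_injOn (s : ℕ) : Set.InjOn (lev K N s) (boxH K s : Set (K[X] × K[X])) := by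
  intro v hv w hw h
  rw [← sub_eq_zero] at h ⊢
  rw [← map_sub] at h
  exact eq_zero_of_lev hN1 hN (Submodule.sub_mem _ hv hw) h

end
end forms

/-! ### The action of `Q` and division by `z_{2p}` in coordinates -/

section action
open Polynomial
variable {K : Type u} [Field K] {N : ℕ}

/-- The action of `q ∈ Q` as an endomorphism of the algebra `H^•(M)`. -/
def actAlg (q : Cyc.{u} N) : HRing.{u} K N →ₐ[K] HRing.{u} K N :=
  pullRing K (heisAction N q⁻¹).toMonoidHom

theorem act_eq (q : Cyc.{u} N) (w : HRing.{u} K N) : act q w = actAlg q w := rfl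

theorem act_apply (q : Cyc.{u} N) (w : HRing.{u} K N) (s : ℕ) :
    act q w s = cohAction K (heisAction N) s q (w s) := DirectSum.lmap_apply _ w s

theorem act_of (q : Cyc.{u} N) (s : ℕ) (a : Coh K (BaseM.{u} N) s) :
    act q (DirectSum.of (Coh K (BaseM.{u} N)) s a) =
      DirectSum.of (Coh K (BaseM.{u} N)) s (cohAction K (heisAction N) s q a) :=
  DirectSum.lmap_lof (fun s => cohAction K (heisAction N) s q) s a

theorem act_one (w : HRing.{u} K N) : act 1 w = w := by
  refine DFinsupp.ext fun s => ?_
  rw [act_apply, map_one]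
  rfl

theorem act_mul (q q' : Cyc.{u} N) (w : HRing.{u} K N) : act (q * q') w = act q (act q' w) := by
  refine DFinsupp.ext fun s => ?_
  rw [act_apply, act_apply, act_apply, map_mul]
  rfl

section
variable [NeZero N]

omit [NeZero N] in
theorem expA_heis (q : Cyc.{u} N) : expA ∘ (heisAction N q⁻¹).toMonoidHom = expA := rfl

omit [NeZero N] in
theorem expB_heis (k : ℕ) : expB ∘ (heisAction N (Cyc.gen.{u} N ^ k)⁻¹).toMonoidHom =
    fun m => expB m + (k : ZMod N) * expA m := by
  funext m
  have h : (Cyc.gen.{u} N ^ k).exp = k := by rw [Cyc.exp_pow, Cyc.exp_gen, mul_one]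
  show expB m - (-(Cyc.gen.{u} N ^ k).exp) * expA m = _
  rw [h]
  ring

theorem act_x1 (hN : (N : K) = 0) (q : Cyc.{u} N) : act q (x1 : HRing.{u} K N) = x1 := by
  rw [act_eq, actAlg, x1_eq_chi, pullRing_chi1 K expA_mul hN, expA_heis]

theorem act_x2 (q : Cyc.{u} N) : act q (x2 : HRing.{u} K N) = x2 := by
  rw [act_eq, actAlg, x2_eq_chi, pullRing_chi2 K expA_mul, expA_heis]

theorem chi1_expB_add (hN : (N : K) = 0) (k : ℕ) :
    chi1 K (fun m : BaseM.{u} N => expB m + (k : ZMod N) * expA m) = y1 + (k : K) • x1 := by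
  induction k with
  | zero => simp [y1_eq_chi]
  | succ k ih =>
    have h1 : ∀ x y : BaseM.{u} N, expB (x * y) + k * expA (x * y) =
        (expB x + k * expA x) + (expB y + k * expA y) := fun x y => by
      rw [expB_mul, expA_mul]; ring
    have h := chi1_add K (χ := fun m : BaseM.{u} N => expB m + (k : ZMod N) * expA m) (ψ := expA) h1
      expA_mul hN
    rw [Nat.cast_succ (R := K), add_smul, one_smul, ← add_assoc, ← ih, x1_eq_chi, ← h]
    refine congrArg (chi1 K) (funext fun m => ?_)
    push_cast
    ring

theorem chi2_expB_add (k : ℕ) :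
    chi2 K (fun m : BaseM.{u} N => expB m + (k : ZMod N) * expA m) = y2 + (k : K) • x2 := by
  induction k with
  | zero => simp [y2_eq_chi]
  | succ k ih =>
    have h1 : ∀ x y : BaseM.{u} N, expB (x * y) + k * expA (x * y) =
        (expB x + k * expA x) + (expB y + k * expA y) := fun x y => by
      rw [expB_mul, expA_mul]; ring
    have h := chi2_add K (χ := fun m : BaseM.{u} N => expB m + (k : ZMod N) * expA m) (ψ := expA) h1
      expA_mul
    rw [Nat.cast_succ (R := K), add_smul, one_smul, ← add_assoc, ← ih, x2_eq_chi, ← h]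
    refine congrArg (chi2 K) (funext fun m => ?_)
    push_cast
    ring

theorem act_y1 (hN : (N : K) = 0) (k : ℕ) :
    act (Cyc.gen N ^ k) (y1 : HRing.{u} K N) = y1 + (k : K) • x1 := by
  rw [act_eq, actAlg, y1_eq_chi, pullRing_chi1 K expB_mul hN, expB_heis, chi1_expB_add hN,
    y1_eq_chi]

theorem act_y2 (k : ℕ) : act (Cyc.gen N ^ k) (y2 : HRing.{u} K N) = y2 + (k : K) • x2 := by
  rw [act_eq, actAlg, y2_eq_chi, pullRing_chi2 K expB_mul, expB_heis, chi2_expB_add, y2_eq_chi]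
end

/-- The action of `σ^c` on coordinates in degree `s`. -/
def shear (s : ℕ) (c : K) : K[X] × K[X] →ₗ[K] K[X] × K[X] :=
  ((taylor c ∘ₗ LinearMap.fst K K[X] K[X]) +
    (((s % 2 : ℕ) : K) * c) • (taylor c ∘ₗ LinearMap.snd K K[X] K[X])).prod
    (taylor c ∘ₗ LinearMap.snd K K[X] K[X])

theorem shear_apply (s : ℕ) (c : K) (v : K[X] × K[X]) : shear s c v =
    (taylor c v.1 + (((s % 2 : ℕ) : K) * c) • taylor c v.2, taylor c v.2) := rfl

theorem taylor_mem {d : ℕ} {c : K} {f : K[X]} (hf : f ∈ degreeLT K d) :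
    taylor c f ∈ degreeLT K d := by
  rw [mem_degreeLT] at hf ⊢
  rwa [degree_taylor]

theorem shear_mem {d e s : ℕ} (h : e ≤ d) (c : K) {v : K[X] × K[X]} (hv : v ∈ box K d e) :
    shear s c v ∈ box K d e :=
  ⟨Submodule.add_mem _ (taylor_mem hv.1)
    (Submodule.smul_mem _ _ (degreeLT_mono h (taylor_mem hv.2))), taylor_mem hv.2⟩

theorem boxH_le (s : ℕ) : (s + 1) / 2 ≤ s / 2 + 1 := by omega

theorem shear_memH {s : ℕ} (c : K) {v : K[X] × K[X]} (hv : v ∈ boxH K s) :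
    shear s c v ∈ boxH K s := shear_mem (boxH_le s) c hv

theorem shear_memW {p s : ℕ} (c : K) {v : K[X] × K[X]} (hv : v ∈ boxW K p s) :
    shear s c v ∈ boxW K p s := shear_mem (min_le_min_right p (boxH_le s)) c hv

theorem degreeLT_zero_eq {f : K[X]} (hf : f ∈ degreeLT K 0) : f = 0 := by
  rw [mem_degreeLT] at hf
  exact degree_eq_bot.1 (Nat.WithBot.lt_zero_iff.1 (by exact_mod_cast hf))

section
variable [NeZero N] (hN : (N : K) = 0) (h2 : (2 : K) ≠ 0)

section
include hN h2

/-- In coordinates `σ^k` acts by the translation `X ↦ X + k`, with a shear in odd degrees that comes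
from `y₁ ↦ y₁ + k x₁`. In even degrees the shear disappears because `x₁² = 0`. -/
theorem act_lev (k : ℕ) {s : ℕ} {v : K[X] × K[X]} (hv : v ∈ boxH K s) :
    act (Cyc.gen N ^ k) (lev K N s v) = lev K N s (shear s (k : K) v) := by
  have hf : ∀ {m : ℕ} {f : K[X]}, f ∈ degreeLT K (m + 1) →
      actAlg (Cyc.gen N ^ k) (form K N m f) = form K N m (taylor (k : K) f) :=
    fun hf => map_form (actAlg (Cyc.gen N ^ k)) (act_x2 _) (act_y2 k) hf
  have hx1 : actAlg (Cyc.gen N ^ k) x1 = (x1 : HRing.{u} K N) := act_x1 hN _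
  have hy1 : actAlg (Cyc.gen N ^ k) y1 = (y1 : HRing.{u} K N) + (k : K) • x1 := act_y1 hN k
  rw [shear_apply, act_eq]
  obtain ⟨m, rfl | rfl⟩ := Nat.even_or_odd' s
  · have h1 : v.1 ∈ degreeLT K (m + 1) := degreeLT_mono (by omega) hv.1
    have e1 : (x1 * y1 + (k : K) • (x1 * x1) : HRing.{u} K N) = x1 * y1 := by
      rw [x1_sq hN h2, smul_zero, add_zero]
    rw [lev_even, lev_even, map_add, map_mul, map_mul, hf h1, hx1, hy1, mul_add, mul_smul_comm, e1,
      show 2 * m % 2 = 0 by omega, Nat.cast_zero, zero_mul, zero_smul, add_zero]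
    rcases m with _ | m
    · have h0 : v.2 = 0 := degreeLT_zero_eq hv.2
      simp [h0]
    · have h2' : v.2 ∈ degreeLT K (m + 1) := degreeLT_mono (by omega) hv.2
      rw [show m + 1 - 1 = m from rfl, hf h2']
  · have h1 : v.1 ∈ degreeLT K (m + 1) := degreeLT_mono (by omega) hv.1
    have h2' : v.2 ∈ degreeLT K (m + 1) := degreeLT_mono (by omega) hv.2
    rw [lev_odd, lev_odd, map_add, map_mul, map_mul, hf h1, hf h2', hx1, hy1,
      show (2 * m + 1) % 2 = 1 by omega, Nat.cast_one, one_mul, map_add, map_smul, mul_add, add_mul,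
      smul_mul_assoc, mul_smul_comm]
    abel

end

theorem linear_mul_lev (hN : (N : K) = 0) (c : K) {s : ℕ} {v : K[X] × K[X]} (hv : v ∈ boxH K s) :
    (y2 + c • x2) * lev K N s v = lev K N (s + 2) ((X + C c) • v) := by
  have hx : Commute (y2 + c • x2 : HRing.{u} K N) x1 :=
    ((x1_comm_y2 hN).add_right ((x1_comm_x2 hN).smul_right c)).symm
  have hy : Commute (y2 + c • x2 : HRing.{u} K N) y1 :=
    ((y1_comm_y2 hN).add_right ((y1_comm_x2 hN).smul_right c)).symm
  obtain ⟨m, rfl | rfl⟩ := Nat.even_or_odd' s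
  · have h1 : v.1 ∈ degreeLT K (m + 1) := degreeLT_mono (by omega) hv.1
    rw [show 2 * m + 2 = 2 * (m + 1) by ring, lev_even, lev_even, mul_add, ← form_linear_mul h1,
      ← mul_assoc, (hx.mul_right hy).eq, mul_assoc]
    rcases m with _ | m
    · have h0 : v.2 = 0 := degreeLT_zero_eq hv.2
      simp [h0]
    · have h2' : v.2 ∈ degreeLT K (m + 1) := degreeLT_mono (by omega) hv.2
      rw [show m + 1 - 1 = m from rfl, ← form_linear_mul h2']
      rfl
  · have h1 : v.1 ∈ degreeLT K (m + 1) := degreeLT_mono (by omega) hv.1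
    have h2' : v.2 ∈ degreeLT K (m + 1) := degreeLT_mono (by omega) hv.2
    rw [show 2 * m + 1 + 2 = 2 * (m + 1) + 1 by ring, lev_odd, lev_odd, mul_add, ← mul_assoc, hx.eq,
      mul_assoc, ← form_linear_mul h1, ← mul_assoc, hy.eq, mul_assoc, ← form_linear_mul h2']
    rfl

theorem linear_smul_mem (c : K) {s : ℕ} {v : K[X] × K[X]} (hv : v ∈ boxH K s) :
    (X + C c) • v ∈ boxH K (s + 2) :=
  ⟨degreeLT_mono (by omega) (linear_mul_mem hv.1 c), degreeLT_mono (by omega) (linear_mul_mem hv.2 c)⟩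

variable (K) in
/-- The dehomogenization of `z_{2k}`. -/
def zpoly (k : ℕ) : K[X] := ∏ i ∈ Finset.range k, (X + C (i : K))

theorem zpoly_smul_mem (k : ℕ) {s : ℕ} {v : K[X] × K[X]} (hv : v ∈ boxH K s) :
    zpoly K k • v ∈ boxH K (s + 2 * k) := by
  induction k with
  | zero => simpa [zpoly] using hv
  | succ k ih =>
    have h := linear_smul_mem (k : K) ih
    rw [← mul_smul, mul_comm (X + C (k : K))] at h
    rwa [zpoly, Finset.prod_range_succ]

theorem z2p_succ (k : ℕ) : (z2p (k + 1) : HRing.{u} K N) = z2p k * (y2 + (k : K) • x2) := by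
  unfold z2p
  rw [List.range_succ, List.map_append, List.prod_append, List.map_singleton,
    List.prod_singleton, act_y2]

/-- In coordinates `z_{2k}` acts as multiplication by the polynomial `∏ (X + i)`. -/
theorem z2p_mul_lev (hN : (N : K) = 0) (k : ℕ) {s : ℕ} {v : K[X] × K[X]} (hv : v ∈ boxH K s) :
    z2p k * lev K N s v = lev K N (s + 2 * k) (zpoly K k • v) := by
  induction k generalizing s v with
  | zero => simp [z2p, zpoly]
  | succ k ih =>
    rw [z2p_succ, mul_assoc, linear_mul_lev hN _ hv, ih (linear_smul_mem _ hv), zpoly, zpoly,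
      Finset.prod_range_succ, mul_smul, show s + 2 + 2 * k = s + 2 * (k + 1) by ring]

omit [NeZero N] in
theorem one_eq_lev : (1 : HRing.{u} K N) = lev K N 0 (1, 0) := by
  have := lev_even (K := K) (N := N) 0 (1, 0)
  rw [mul_zero] at this
  rw [this]
  simp [form_one]

theorem one_mem_boxH : ((1, 0) : K[X] × K[X]) ∈ boxH K 0 := by
  refine ⟨?_, Submodule.zero_mem _⟩
  have := X_pow_mem (K := K) (j := 0) (d := 0 / 2 + 1)
  rw [pow_zero] at this
  exact this.2 (by omega)

theorem z2p_eq_lev (hN : (N : K) = 0) (k : ℕ) :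
    (z2p k : HRing.{u} K N) = lev K N (2 * k) (zpoly K k, 0) := by
  rw [← mul_one (z2p k), one_eq_lev, z2p_mul_lev hN k one_mem_boxH, zero_add, Prod.smul_mk,
    smul_zero, smul_eq_mul, mul_one]

theorem zpoly_monic (k : ℕ) : (zpoly K k).Monic :=
  monic_prod_of_monic _ _ fun _ _ => monic_X_add_C _

theorem natDegree_zpoly (k : ℕ) : (zpoly K k).natDegree = k := by
  rw [zpoly, natDegree_prod_of_monic _ _ fun _ _ => monic_X_add_C _]
  simp only [natDegree_X_add_C, Finset.sum_const, Finset.card_range, smul_eq_mul, mul_one]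

/-- The product over the prime field is invariant under translation. -/
theorem taylor_zpoly (p : ℕ) [CharP K p] : taylor (1 : K) (zpoly K p) = zpoly K p := by
  -- Both sides are the product of the `p + 1` factors `X + i`, as `X + p = X`.
  have h : taylor (1 : K) (zpoly K p) * X = zpoly K p * X := by
    have e1 : zpoly K (p + 1) = zpoly K p * X := by
      rw [zpoly, Finset.prod_range_succ, CharP.cast_eq_zero, C_0, add_zero]
      rfl
    have e2 : zpoly K (p + 1) = taylor (1 : K) (zpoly K p) * X := by
      rw [zpoly, Finset.prod_range_succ', Nat.cast_zero, C_0, add_zero]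
      congr 1
      refine Eq.trans ?_ (map_prod (taylorAlgHom (1 : K)) (fun i : ℕ => X + C (i : K))
        (Finset.range p)).symm
      refine Finset.prod_congr rfl fun i _ => ?_
      show X + C ((i + 1 : ℕ) : K) = taylor (1 : K) (X + C (i : K))
      rw [map_add, taylor_X, taylor_C, Nat.cast_succ, C_add]
      ring
    rw [← e1, ← e2]
  exact mul_right_cancel₀ X_ne_zero h

theorem shear_zpoly_smul (p : ℕ) [CharP K p] (s : ℕ) (v : K[X] × K[X]) :
    shear (s + 2 * p) (1 : K) (zpoly K p • v) = zpoly K p • shear s (1 : K) v := by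
  rw [shear_apply, shear_apply, show (s + 2 * p) % 2 = s % 2 by omega]
  refine Prod.ext ?_ ?_
  · show taylor (1 : K) (zpoly K p * v.1) + _ • taylor (1 : K) (zpoly K p * v.2) = zpoly K p * (_ + _)
    rw [taylor_mul, taylor_mul, taylor_zpoly, mul_add, mul_smul_comm]
  · show taylor (1 : K) (zpoly K p * v.2) = zpoly K p * _
    rw [taylor_mul, taylor_zpoly]

/-- The quotient by the monic polynomial `zpoly K p` has degree smaller by `p`. -/
theorem divModByMonic_mem {p d : ℕ} {f : K[X]} (hf : f ∈ degreeLT K (d + p)) :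
    f /ₘ zpoly K p ∈ degreeLT K d := by
  have hq := zpoly_monic (K := K) p
  rw [mem_degreeLT] at hf ⊢
  rcases eq_or_ne (f /ₘ zpoly K p) 0 with h | h
  · rw [h, degree_zero]
    exact WithBot.bot_lt_coe d
  · have hf0 : f ≠ 0 := by
      rintro rfl
      simp at h
    rw [degree_eq_natDegree hf0] at hf
    rw [degree_eq_natDegree h, natDegree_divByMonic f hq, natDegree_zpoly]
    have h1 : f.natDegree < d + p := by exact_mod_cast hf
    have h2 : zpoly K p ∣ f ∨ p ≤ f.natDegree := by
      by_contra hc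
      push Not at hc
      refine h ((divByMonic_eq_zero_iff hq).2 ?_)
      rw [degree_eq_natDegree hf0, degree_eq_natDegree hq.ne_zero, natDegree_zpoly]
      exact_mod_cast hc.2
    have h3 : p ≤ f.natDegree := by
      rcases h2 with h2 | h2
      · have := natDegree_le_of_dvd h2 hf0
        rwa [natDegree_zpoly] at this
      · exact h2
    have h4 : f.natDegree - p < d := by omega
    exact_mod_cast h4

theorem modByMonic_mem (p : ℕ) (f : K[X]) : f %ₘ zpoly K p ∈ degreeLT K p := by
  rw [mem_degreeLT]
  have h := degree_modByMonic_lt f (zpoly_monic (K := K) p)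
  rwa [degree_eq_natDegree (zpoly_monic (K := K) p).ne_zero, natDegree_zpoly] at h

/-- Division with remainder by `z_{2p}` in coordinates. -/
theorem exists_box_decomp {p t : ℕ} {v : K[X] × K[X]} (hv : v ∈ boxH K (t + 2 * p)) :
    ∃ w ∈ boxW K p (t + 2 * p), ∃ u ∈ boxH K t, v = w + zpoly K p • u := by
  refine ⟨(v.1 %ₘ zpoly K p, v.2 %ₘ zpoly K p), ⟨degreeLT_mono ?_ (modByMonic_mem p _),
    degreeLT_mono ?_ (modByMonic_mem p _)⟩, (v.1 /ₘ zpoly K p, v.2 /ₘ zpoly K p),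
    ⟨divModByMonic_mem (degreeLT_mono ?_ hv.1), divModByMonic_mem (degreeLT_mono ?_ hv.2)⟩, ?_⟩
  · omega
  · omega
  · omega
  · omega
  · exact Prod.ext (modByMonic_add_div v.1 (zpoly K p)).symm
      (modByMonic_add_div v.2 (zpoly K p)).symm

/-- Uniqueness of division with remainder by `z_{2p}`. -/
theorem box_decomp_unique {p s : ℕ} {w u : K[X] × K[X]} (hw : w ∈ boxW K p s)
    (h : w + zpoly K p • u = 0) : w = 0 ∧ u = 0 := by
  have hq := zpoly_monic (K := K) p
  have key : ∀ {a b : K[X]}, a ∈ degreeLT K p → a + zpoly K p * b = 0 → a = 0 ∧ b = 0 := by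
    intro a b ha hab
    have h1 := div_modByMonic_unique (f := 0) (g := zpoly K p) b a hq
      ⟨hab, by rwa [degree_eq_natDegree hq.ne_zero, natDegree_zpoly, ← mem_degreeLT]⟩
    rw [zero_divByMonic, zero_modByMonic] at h1
    exact ⟨h1.2.symm, h1.1.symm⟩
  have h1 := key (degreeLT_mono (min_le_right _ _) hw.1) (congrArg Prod.fst h)
  have h2 := key (degreeLT_mono (min_le_right _ _) hw.2) (congrArg Prod.snd h)
  exact ⟨Prod.ext h1.1 h2.1, Prod.ext h1.2 h2.2⟩

end
end action

/-! ### Kernel and image of the difference operator -/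

theorem _root_.LinearIndependent.congr_fun {K V ι : Type*} [Semiring K] [AddCommMonoid V]
    [Module K V] {v w : ι → V} (h : LinearIndependent K v) (hvw : ∀ i, v i = w i) :
    LinearIndependent K w := funext hvw ▸ h

section bases
variable {K : Type u} [Field K] {V V' : Type*} [AddCommGroup V] [Module K V] [AddCommGroup V']
  [Module K V']

theorem IsBasisOf.map {ι : Type*} {v : ι → V} {U : Submodule K V} (h : IsBasisOf v U)
    (L : V →ₗ[K] V') (hL : Set.InjOn L (U : Set V)) : IsBasisOf (L ∘ v) (U.map L) := by
  obtain ⟨h1, h2⟩ := h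
  refine ⟨h1.map_injOn L (h2 ▸ hL), ?_⟩
  rw [Set.range_comp, Submodule.span_image, h2]

theorem isBasisOf_pair {v w : V} {U : Submodule K V}
    (h : ∀ a b : K, a • v + b • w = 0 → a = 0 ∧ b = 0) (hv : v ∈ U) (hw : w ∈ U)
    (hU : ∀ u ∈ U, ∃ a b : K, a • v + b • w = u) : IsBasisOf ![v, w] U := by
  refine ⟨LinearIndependent.pair_iff.2 h, ?_⟩
  rw [Matrix.range_cons, Matrix.range_cons, Matrix.range_empty, Set.union_empty,
    Set.singleton_union]
  ext u
  rw [Submodule.mem_span_pair]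
  refine ⟨?_, hU u⟩
  rintro ⟨a, b, rfl⟩
  exact Submodule.add_mem _ (Submodule.smul_mem _ _ hv) (Submodule.smul_mem _ _ hw)

theorem isBasisOf_single {v : V} {U : Submodule K V} (h : v ≠ 0) (hv : v ∈ U)
    (hU : ∀ u ∈ U, ∃ a : K, a • v = u) : IsBasisOf ![v] U := by
  refine ⟨?_, ?_⟩
  · rw [linearIndependent_unique_iff]
    exact h
  rw [Matrix.range_cons, Matrix.range_empty, Set.union_empty]
  ext u
  rw [Submodule.mem_span_singleton]
  refine ⟨?_, hU u⟩
  rintro ⟨a, rfl⟩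
  exact Submodule.smul_mem _ _ hv

/-- A basis of an image from a basis of a subspace modulo the kernel. -/
theorem isBasisOf_pair_of_ker (f : V →ₗ[K] V') {W S : Submodule K V}
    (hker : ∀ u ∈ W, f u = 0 ↔ u ∈ S) {v w : V} (hv : v ∈ W) (hw : w ∈ W)
    (hind : ∀ a b : K, a • v + b • w ∈ S → a = 0 ∧ b = 0)
    (hspan : ∀ u ∈ W, ∃ a b : K, u - (a • v + b • w) ∈ S) :
    IsBasisOf ![f v, f w] (W.map f) := by
  have hvw : ∀ a b : K, a • v + b • w ∈ W := fun a b =>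
    Submodule.add_mem _ (Submodule.smul_mem _ _ hv) (Submodule.smul_mem _ _ hw)
  refine isBasisOf_pair (fun a b h => ?_) ⟨v, hv, rfl⟩ ⟨w, hw, rfl⟩ ?_
  · rw [← map_smul, ← map_smul, ← map_add] at h
    exact hind a b ((hker _ (hvw a b)).1 h)
  · rintro _ ⟨u, hu, rfl⟩
    obtain ⟨a, b, hab⟩ := hspan u hu
    have h := (hker _ (Submodule.sub_mem _ hu (hvw a b))).2 hab
    rw [map_sub, sub_eq_zero, map_add, map_smul, map_smul] at h
    exact ⟨a, b, h.symm⟩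

/-- A basis of a one dimensional image from a complement of the kernel. -/
theorem isBasisOf_single_of_ker (f : V →ₗ[K] V') {W S : Submodule K V}
    (hker : ∀ u ∈ W, f u = 0 ↔ u ∈ S) {v : V} (hv : v ∈ W) (hind : v ∉ S)
    (hspan : ∀ u ∈ W, ∃ a : K, u - a • v ∈ S) : IsBasisOf ![f v] (W.map f) := by
  refine isBasisOf_single (fun h => hind ((hker v hv).1 h)) ⟨v, hv, rfl⟩ ?_
  rintro _ ⟨u, hu, rfl⟩
  obtain ⟨a, ha⟩ := hspan u hu
  have h := (hker _ (Submodule.sub_mem _ hu (Submodule.smul_mem _ a hv))).2 ha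
  rw [map_sub, sub_eq_zero, map_smul] at h
  exact ⟨a, h.symm⟩

theorem IsBasisOf.swap {v w : V} {U : Submodule K V} (h : IsBasisOf ![v, w] U) :
    IsBasisOf ![w, v] U := by
  have e : (![w, v] : Fin 2 → V) = ![v, w] ∘ Equiv.swap 0 1 := by
    funext i
    fin_cases i <;> rfl
  rw [e]
  refine ⟨(linearIndependent_equiv _).2 h.1, ?_⟩
  rw [EquivLike.range_comp]
  exact h.2

theorem IsBasisOf.smul_pair {v w : V} {U : Submodule K V} (h : IsBasisOf ![v, w] U) {a b : K}
    (ha : a ≠ 0) (hb : b ≠ 0) : IsBasisOf ![a • v, b • w] U := by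
  have hmem : ∀ i, (![v, w] : Fin 2 → V) i ∈ U := fun i =>
    h.2 ▸ Submodule.subset_span (Set.mem_range_self i)
  refine isBasisOf_pair (fun c d hcd => ?_) (Submodule.smul_mem _ _ (hmem 0))
    (Submodule.smul_mem _ _ (hmem 1)) fun u hu => ?_
  · rw [smul_smul, smul_smul] at hcd
    have := LinearIndependent.pair_iff.1 h.1 _ _ hcd
    exact ⟨(mul_eq_zero.1 this.1).resolve_right ha, (mul_eq_zero.1 this.2).resolve_right hb⟩
  · rw [← h.2, Matrix.range_cons, Matrix.range_cons, Matrix.range_empty, Set.union_empty,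
      Set.singleton_union, Submodule.mem_span_pair] at hu
    obtain ⟨c, d, rfl⟩ := hu
    refine ⟨c * a⁻¹, d * b⁻¹, ?_⟩
    rw [smul_smul, smul_smul, inv_mul_cancel_right₀ ha, inv_mul_cancel_right₀ hb]

end bases

section difference
open Polynomial
variable {K : Type u} [Field K]

variable (K) in
/-- The difference operator `f(X) ↦ f(X + 1) - f(X)`. -/
def diffOp : K[X] →ₗ[K] K[X] := taylor 1 - LinearMap.id

theorem diffOp_apply (f : K[X]) : diffOp K f = taylor 1 f - f := rfl

theorem degreeLT_succ (d : ℕ) : degreeLT K (d + 1) = degreeLT K d ⊔ Submodule.span K {X ^ d} := by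
  apply le_antisymm
  · rw [degreeLT_eq_span (d + 1), Submodule.span_le]
    rintro _ ⟨j, hj, rfl⟩
    rcases Nat.lt_succ_iff_lt_or_eq.1 hj with h | rfl
    · exact Submodule.mem_sup_left (X_pow_mem.2 h)
    · exact Submodule.mem_sup_right (Submodule.mem_span_singleton_self _)
  · refine sup_le (degreeLT_mono (Nat.le_succ d)) ?_
    rw [Submodule.span_singleton_le_iff_mem]
    exact X_pow_mem.2 (Nat.lt_succ_self d)

/-- The leading term of the difference of a power. -/
theorem diffOp_X_pow (k : ℕ) :
    diffOp K (X ^ (k + 1)) - ((k + 1 : ℕ) : K) • X ^ k ∈ degreeLT K k := by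
  have h : diffOp K (X ^ (k + 1)) - ((k + 1 : ℕ) : K) • X ^ k =
      ∑ m ∈ Finset.range k, ((k + 1).choose m : K) • X ^ m := by
    rw [diffOp_apply, taylor_X_pow, C_1, add_pow, Finset.sum_range_succ, Finset.sum_range_succ,
      smul_eq_C_mul]
    simp only [one_pow, mul_one, Nat.choose_self, Nat.cast_one, Nat.choose_succ_self_right,
      smul_eq_C_mul, map_natCast]
    rw [Finset.sum_congr rfl fun m _ => mul_comm (((k + 1).choose m : ℕ) : K[X]) (X ^ m)]
    ring
  rw [h]
  exact Submodule.sum_mem _ fun m hm =>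
    Submodule.smul_mem _ _ (X_pow_mem.2 (Finset.mem_range.1 hm))

theorem diffOp_X_pow_mem (k : ℕ) : diffOp K (X ^ k) ∈ degreeLT K k := by
  rcases k with _ | k
  · rw [pow_zero, diffOp_apply, taylor_one, C_1, sub_self]
    exact Submodule.zero_mem _
  · have h := degreeLT_mono (Nat.le_succ k) (diffOp_X_pow (K := K) k)
    have h' := Submodule.add_mem _ h (Submodule.smul_mem _ ((k + 1 : ℕ) : K)
      (X_pow_mem.2 (Nat.lt_succ_self k)))
    rwa [sub_add_cancel] at h'

theorem diffOp_mem {d : ℕ} {f : K[X]} (hf : f ∈ degreeLT K (d + 1)) :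
    diffOp K f ∈ degreeLT K d := by
  have h := Submodule.mem_map_of_mem (f := diffOp K) hf
  rw [degreeLT_eq_span, Submodule.map_span] at h
  refine Submodule.span_le.2 ?_ h
  rintro _ ⟨_, ⟨j, hj, rfl⟩, rfl⟩
  exact degreeLT_mono (Nat.lt_succ_iff.1 hj) (diffOp_X_pow_mem j)

variable {p : ℕ} [Fact p.Prime] [CharP K p]

omit [Fact p.Prime] in
theorem natCast_ne_zero {k : ℕ} (h0 : k ≠ 0) (hk : k < p) : (k : K) ≠ 0 := by
  rw [Ne, CharP.cast_eq_zero_iff K p]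
  exact Nat.not_dvd_of_pos_of_lt (Nat.pos_of_ne_zero h0) hk

omit [Fact p.Prime] in
/-- Below degree `p` the difference operator is surjective, as the leading coefficients that occur
are invertible. -/
theorem exists_diffOp_eq {d : ℕ} (hd : d < p) {g : K[X]} (hg : g ∈ degreeLT K d) :
    ∃ f ∈ degreeLT K (d + 1), diffOp K f = g := by
  suffices h : degreeLT K d ≤ (degreeLT K (d + 1)).map (diffOp K) from h hg
  clear hg
  induction d with
  | zero =>
    intro g hg
    rw [degreeLT_zero_eq hg]
    exact Submodule.zero_mem _
  | succ d ih =>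
    have ih' : degreeLT K d ≤ (degreeLT K (d + 1 + 1)).map (diffOp K) :=
      (ih (by omega)).trans (Submodule.map_mono (degreeLT_mono (Nat.le_succ _)))
    rw [degreeLT_succ d]
    refine sup_le ih' ?_
    rw [Submodule.span_singleton_le_iff_mem]
    have h1 : diffOp K (X ^ (d + 1)) ∈ (degreeLT K (d + 1 + 1)).map (diffOp K) :=
      Submodule.mem_map_of_mem (X_pow_mem.2 (Nat.lt_succ_self _))
    have h2 := Submodule.sub_mem _ h1 (ih' (diffOp_X_pow (K := K) d))
    rw [sub_sub_cancel] at h2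
    exact (Submodule.smul_mem_iff _ (natCast_ne_zero (p := p) d.succ_ne_zero hd)).1 h2

/-- A polynomial of degree less than `p` that is invariant under translation is constant, as it
takes the same value at the `p` elements of the prime field. -/
theorem eq_C_of_diffOp_eq_zero {f : K[X]} (hf : f ∈ degreeLT K p) (h : diffOp K f = 0) :
    f = C (f.coeff 0) := by
  rw [diffOp_apply, sub_eq_zero, taylor_apply] at h
  have heval : ∀ k : ℕ, f.eval (k : K) = f.coeff 0 := by
    intro k
    induction k with
    | zero => rw [Nat.cast_zero, coeff_zero_eq_eval_zero]
    | succ k ih =>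
      rw [← ih]
      conv_rhs => rw [← h]
      rw [eval_comp]
      simp
  refine eq_of_degree_sub_lt_of_eval_index_eq (v := fun k : ℕ => (k : K)) (Finset.range p) ?_ ?_ ?_
  · intro a ha b hb hab
    exact CharP.natCast_injOn_Iio K p (Finset.mem_range.1 ha) (Finset.mem_range.1 hb) hab
  · rw [Finset.card_range, ← mem_degreeLT]
    refine Submodule.sub_mem _ hf ?_
    rw [mem_degreeLT]
    exact degree_C_le.trans_lt (by exact_mod_cast (Fact.out : p.Prime).pos)
  · intro k _
    rw [heval, eval_C]

variable (K) in
/-- The operator `σ - 1` on coordinates in degree `s`. -/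
def shearDiff (s : ℕ) : K[X] × K[X] →ₗ[K] K[X] × K[X] := shear s 1 - LinearMap.id

theorem shearDiff_apply (s : ℕ) (v : K[X] × K[X]) : shearDiff K s v =
    (diffOp K v.1 + ((s % 2 : ℕ) : K) • taylor 1 v.2, diffOp K v.2) := by
  refine Prod.ext ?_ rfl
  show taylor 1 v.1 + (((s % 2 : ℕ) : K) * 1) • taylor 1 v.2 - v.1 = _
  rw [mul_one, diffOp_apply, add_sub_right_comm]

omit [CharP K p] in
theorem boxW_odd (i : ℕ) :
    boxW K p (2 * i + 1) = box K (min i (p - 1) + 1) (min i (p - 1) + 1) := by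
  have := (Fact.out : p.Prime).pos
  rw [boxW]
  congr 1 <;> omega

omit [CharP K p] in
theorem boxW_even_pos {i : ℕ} (hi : 1 ≤ i) :
    boxW K p (2 * i) = box K (min i (p - 1) + 1) (min (i - 1) (p - 1) + 1) := by
  have := (Fact.out : p.Prime).pos
  rw [boxW]
  congr 1 <;> omega

theorem one_mem_degreeLT {d : ℕ} : (1 : K[X]) ∈ degreeLT K d ↔ 0 < d := by
  simpa using X_pow_mem (K := K) (j := 0) (d := d)

theorem C_eq_smul_one (a : K) : C a = a • (1 : K[X]) := by rw [smul_eq_C_mul, mul_one]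

variable (K) (p)

omit [Fact p.Prime] [CharP K p] in
theorem shearDiff_one (s : ℕ) : shearDiff K s (1, 0) = 0 := by
  rw [shearDiff_apply, map_zero, map_zero, smul_zero, add_zero, diffOp_apply, taylor_one, C_1,
    sub_self]
  rfl

variable {K p}

/-- The coordinates of invariants in even degrees are constant. -/
theorem exists_smul_of_even {s : ℕ} (hs : s % 2 = 0) {v : K[X] × K[X]}
    (hv : v ∈ boxW K p s) (h : shearDiff K s v = 0) :
    ∃ a b : K, v = (a • 1, b • 1) := by
  rw [shearDiff_apply, hs, Nat.cast_zero, zero_smul, add_zero] at h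
  refine ⟨v.1.coeff 0, v.2.coeff 0, Prod.ext ?_ ?_⟩
  · exact (eq_C_of_diffOp_eq_zero (degreeLT_mono (min_le_right _ _) hv.1)
      (congrArg Prod.fst h)).trans (C_eq_smul_one _)
  · exact (eq_C_of_diffOp_eq_zero (degreeLT_mono (min_le_right _ _) hv.2)
      (congrArg Prod.snd h)).trans (C_eq_smul_one _)

/-- The invariants in odd degrees: the second coordinate is a constant `-b`, and the first one has
constant difference `b`. -/
theorem exists_smul_of_odd {s : ℕ} (hs : s % 2 = 1) {v : K[X] × K[X]}
    (hv : v ∈ boxW K p s) (h : shearDiff K s v = 0) :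
    ∃ a b : K, v = (a • 1 + b • X, -b • 1) := by
  have hp : 1 < p := (Fact.out : p.Prime).one_lt
  rw [shearDiff_apply, hs, Nat.cast_one, one_smul] at h
  have h2 := (eq_C_of_diffOp_eq_zero (degreeLT_mono (min_le_right _ _) hv.2)
    (congrArg Prod.snd h)).trans (C_eq_smul_one _)
  set b := v.2.coeff 0
  have h3 : diffOp K (v.1 + b • X) = 0 := by
    have h1 : diffOp K v.1 + taylor 1 v.2 = 0 := congrArg Prod.fst h
    have h4 : diffOp K (X : K[X]) = 1 := by
      rw [diffOp_apply, taylor_X, C_1, add_sub_cancel_left]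
    rw [h2, map_smul, taylor_one, C_1] at h1
    rw [map_add, map_smul, h4, h1]
  have hX : (X : K[X]) ∈ degreeLT K p := by
    have := X_pow_mem (K := K) (j := 1) (d := p)
    rw [pow_one] at this
    exact this.2 hp
  have h5 := (eq_C_of_diffOp_eq_zero (Submodule.add_mem _
    (degreeLT_mono (min_le_right _ _) hv.1) (Submodule.smul_mem _ b hX)) h3).trans
    (C_eq_smul_one _)
  refine ⟨(v.1 + b • X).coeff 0, -b, Prod.ext ?_ ?_⟩
  · show v.1 = (v.1 + b • X).coeff 0 • 1 + -b • X
    rw [neg_smul, ← sub_eq_add_neg, eq_sub_iff_add_eq]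
    exact h5
  · show v.2 = _
    rw [neg_neg]
    exact h2

variable (K) (p) in
/-- The coordinates of the invariants of `W^s`. -/
def boxInv (s : ℕ) : Submodule K (K[X] × K[X]) := boxW K p s ⊓ LinearMap.ker (shearDiff K s)

theorem isBasisOf_boxInv_of_le_one {s : ℕ} (hs : s ≤ 1) :
    IsBasisOf (![(1, 0)] : Fin 1 → K[X] × K[X]) (boxInv K p s) := by
  have hp : 1 < p := (Fact.out : p.Prime).one_lt
  refine isBasisOf_single (fun h => one_ne_zero (congrArg Prod.fst h))
    ⟨⟨one_mem_degreeLT.2 (by omega), Submodule.zero_mem _⟩, shearDiff_one K s⟩ ?_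
  rintro v ⟨hv, hv0⟩
  rcases Nat.le_one_iff_eq_zero_or_eq_one.1 hs with rfl | rfl
  · obtain ⟨a, b, rfl⟩ := exists_smul_of_even rfl hv hv0
    have h0 : b • (1 : K[X]) = 0 := degreeLT_zero_eq (degreeLT_mono (by omega) hv.2)
    exact ⟨a, Prod.ext rfl ((smul_zero a).trans h0.symm)⟩
  · obtain ⟨a, b, rfl⟩ := exists_smul_of_odd rfl hv hv0
    have h0 : a • (1 : K[X]) + b • X ∈ degreeLT K 1 := degreeLT_mono (by omega) hv.1
    have hb : b = 0 := by
      have := coeff_eq_zero_of_degree_lt (n := 1) (mem_degreeLT.1 h0)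
      simpa [coeff_one] using this
    refine ⟨a, ?_⟩
    simp [hb]

theorem isBasisOf_boxInv_even {i : ℕ} (hi : 1 ≤ i) :
    IsBasisOf (![(1, 0), (0, 1)] : Fin 2 → K[X] × K[X]) (boxInv K p (2 * i)) := by
  have hp : 1 < p := (Fact.out : p.Prime).one_lt
  refine isBasisOf_pair (fun a b h => ?_)
    ⟨⟨one_mem_degreeLT.2 (by omega), Submodule.zero_mem _⟩, shearDiff_one K _⟩
    ⟨⟨Submodule.zero_mem _, one_mem_degreeLT.2 (by omega)⟩, ?_⟩ ?_
  · simpa using h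
  · show shearDiff K (2 * i) (0, 1) = 0
    rw [shearDiff_apply, show 2 * i % 2 = 0 by omega, Nat.cast_zero, zero_smul,
      map_zero, diffOp_apply, taylor_one, C_1, sub_self, add_zero]
    rfl
  · rintro v ⟨hv, hv0⟩
    obtain ⟨a, b, rfl⟩ := exists_smul_of_even (by omega) hv hv0
    exact ⟨a, b, by simp⟩

theorem isBasisOf_boxInv_odd {i : ℕ} (hi : 1 ≤ i) :
    IsBasisOf (![(1, 0), (X, -1)] : Fin 2 → K[X] × K[X]) (boxInv K p (2 * i + 1)) := by
  have hp : 1 < p := (Fact.out : p.Prime).one_lt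
  have hX : (X : K[X]) ∈ degreeLT K (min ((2 * i + 1) / 2 + 1) p) := by
    have := X_pow_mem (K := K) (j := 1) (d := min ((2 * i + 1) / 2 + 1) p)
    rw [pow_one] at this
    exact this.2 (by omega)
  refine isBasisOf_pair (fun a b h => ?_)
    ⟨⟨one_mem_degreeLT.2 (by omega), Submodule.zero_mem _⟩, shearDiff_one K _⟩
    ⟨⟨hX, Submodule.neg_mem _ (one_mem_degreeLT.2 (by omega))⟩, ?_⟩ ?_
  · have h1 := congrArg Prod.snd h
    have h2 := congrArg Prod.fst h
    have hb : b = 0 := by simpa using h1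
    refine ⟨?_, hb⟩
    simpa [hb] using h2
  · show shearDiff K (2 * i + 1) (X, -1) = 0
    rw [shearDiff_apply, show (2 * i + 1) % 2 = 1 by omega, Nat.cast_one,
      one_smul, map_neg, map_neg, diffOp_apply, diffOp_apply, taylor_one, C_1, sub_self, taylor_X,
      C_1]
    refine Prod.ext ?_ neg_zero
    show X + 1 - X + -1 = (0 : K[X])
    ring
  · rintro v ⟨hv, hv0⟩
    obtain ⟨a, b, rfl⟩ := exists_smul_of_odd (by omega) hv hv0
    exact ⟨a, b, by simp⟩

omit [Fact p.Prime] in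
/-- The image of `σ - 1` in even degrees: each of the two degrees drops by one. -/
theorem map_shearDiff_even {d e s : ℕ} (hs : s % 2 = 0) (hd : d < p) (he : e < p) :
    (box K (d + 1) (e + 1)).map (shearDiff K s) = box K d e := by
  ext v
  constructor
  · rintro ⟨u, hu, rfl⟩
    rw [shearDiff_apply, hs, Nat.cast_zero, zero_smul, add_zero]
    exact ⟨diffOp_mem hu.1, diffOp_mem hu.2⟩
  · rintro hv
    obtain ⟨f, hf, hf'⟩ := exists_diffOp_eq hd hv.1
    obtain ⟨g, hg, hg'⟩ := exists_diffOp_eq he hv.2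
    refine ⟨(f, g), ⟨hf, hg⟩, ?_⟩
    rw [shearDiff_apply, hs, Nat.cast_zero, zero_smul, add_zero, hf', hg']

variable (K) in
/-- The image of `σ - 1` in odd degrees, in coordinates. -/
def oddImage (d : ℕ) : Submodule K (K[X] × K[X]) :=
  box K d (d - 1) ⊔ Submodule.span K {(X ^ d, (d : K) • X ^ (d - 1))}

omit [Fact p.Prime] in
/-- In odd degrees the image contains all smaller monomials of both coordinates, and one vector
more, whose two leading terms are linked by the shear. -/
theorem map_shearDiff_odd {d s : ℕ} (hs : s % 2 = 1) (hd : d < p) :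
    (box K (d + 1) (d + 1)).map (shearDiff K s) = oddImage K d := by
  have hΔ : ∀ v, shearDiff K s v = (diffOp K v.1 + taylor 1 v.2, diffOp K v.2) := fun v => by
    rw [shearDiff_apply, hs, Nat.cast_one, one_smul]
  have hfst : ∀ f ∈ degreeLT K d, (f, 0) ∈ (box K (d + 1) (d + 1)).map (shearDiff K s) := by
    intro f hf
    obtain ⟨g, hg, rfl⟩ := exists_diffOp_eq hd hf
    exact ⟨(g, 0), ⟨hg, Submodule.zero_mem _⟩, by rw [hΔ]; simp⟩
  have hbox : box K d (d - 1) ≤ (box K (d + 1) (d + 1)).map (shearDiff K s) := by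
    rintro ⟨f, g⟩ ⟨hf, hg⟩
    obtain ⟨k, hk, hk'⟩ := exists_diffOp_eq (p := p) (d := d - 1) (by omega) hg
    rcases d with _ | d
    · have h0 : f = 0 := degreeLT_zero_eq hf
      have h1 : g = 0 := degreeLT_zero_eq hg
      rw [h0, h1]
      exact Submodule.zero_mem _
    have hk : k ∈ degreeLT K (d + 1) := hk
    have h1 : shearDiff K s (0, k) ∈ (box K (d + 1 + 1) (d + 1 + 1)).map (shearDiff K s) :=
      Submodule.mem_map_of_mem ⟨Submodule.zero_mem _, degreeLT_mono (Nat.le_succ _) hk⟩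
    have h2 := Submodule.add_mem _ h1 (hfst _ (Submodule.sub_mem _ hf (taylor_mem (c := 1) hk)))
    rw [hΔ, hk', map_zero, zero_add, Prod.mk_add_mk, add_zero, add_sub_cancel] at h2
    exact h2
  -- The additional vector is the leading part of the image of `(0, X ^ d)`.
  have htop : shearDiff K s (0, X ^ d) - (X ^ d, (d : K) • X ^ (d - 1)) ∈ box K d (d - 1) := by
    rw [hΔ, map_zero, zero_add]
    refine ⟨diffOp_X_pow_mem d, ?_⟩
    rcases d with _ | d
    · show diffOp K (X ^ 0) - ((0 : ℕ) : K) • X ^ (0 - 1) ∈ degreeLT K 0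
      rw [Nat.cast_zero, zero_smul, sub_zero]
      exact diffOp_X_pow_mem 0
    · exact diffOp_X_pow d
  apply le_antisymm
  · rintro _ ⟨v, hv, rfl⟩
    have hv2 : v.2 ∈ degreeLT K (d + 1) := hv.2
    rw [degreeLT_succ, Submodule.mem_sup] at hv2
    obtain ⟨g, hg, _, hc, hv2⟩ := hv2
    obtain ⟨c, rfl⟩ := Submodule.mem_span_singleton.1 hc
    have e : v = (v.1, g) + c • (0, X ^ d) :=
      Prod.ext (by simp) hv2.symm
    rw [e, map_add, map_smul]
    refine Submodule.add_mem _ (Submodule.mem_sup_left ?_) (Submodule.smul_mem _ c ?_)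
    · rw [hΔ]
      refine ⟨Submodule.add_mem _ (diffOp_mem hv.1) (taylor_mem hg), ?_⟩
      rcases d with _ | d
      · show diffOp K g ∈ _
        rw [degreeLT_zero_eq hg, map_zero]
        exact Submodule.zero_mem _
      · exact diffOp_mem hg
    · rw [← sub_add_cancel (shearDiff K s (0, X ^ d)) (X ^ d, (d : K) • X ^ (d - 1))]
      exact Submodule.add_mem _ (Submodule.mem_sup_left htop)
        (Submodule.mem_sup_right (Submodule.mem_span_singleton_self _))
  · refine sup_le hbox ?_
    rw [Submodule.span_singleton_le_iff_mem]
    have h := Submodule.sub_mem _ (Submodule.mem_map_of_mem (f := shearDiff K s)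
      (show ((0, X ^ d) : K[X] × K[X]) ∈ box K (d + 1) (d + 1) from
        ⟨Submodule.zero_mem _, X_pow_mem.2 (Nat.lt_succ_self d)⟩)) (hbox htop)
    rwa [sub_sub_cancel] at h

/-- Monomials in either coordinate. -/
def monPair : ℕ ⊕ ℕ → K[X] × K[X] := Sum.elim (fun k => (X ^ k, 0)) fun k => (0, X ^ k)

theorem linearIndependent_monPair : LinearIndependent K (monPair (K := K)) := by
  have h := ((basisMonomials K).prod (basisMonomials K)).linearIndependent
  refine h.congr_fun fun i => ?_
  rcases i with i | i
  · refine Prod.ext ?_ ?_ <;> simp [monPair, monomial_one_right_eq_X_pow]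
  · refine Prod.ext ?_ ?_ <;> simp [monPair, monomial_one_right_eq_X_pow]

theorem isBasisOf_box {ι κ : Type*} {e : ι → ℕ} {e' : κ → ℕ} (he : Function.Injective e)
    (he' : Function.Injective e') {d d' : ℕ} (hd : Set.range e = Set.Iio d)
    (hd' : Set.range e' = Set.Iio d') :
    IsBasisOf (Sum.elim (fun i => (X ^ e i, 0)) fun i => (0, X ^ e' i) : ι ⊕ κ → K[X] × K[X])
      (box K d d') := by
  constructor
  · have h := linearIndependent_monPair (K := K) |>.comp (Sum.map e e') (he.sumMap he')
    refine h.congr_fun fun i => ?_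
    rcases i with i | i <;> rfl
  · rw [box_eq_span, Set.Sum.elim_range]
    congr 2
    · ext v
      constructor
      · rintro ⟨i, rfl⟩
        exact ⟨e i, hd.subset (Set.mem_range_self i), rfl⟩
      · rintro ⟨j, hj, rfl⟩
        obtain ⟨i, rfl⟩ : j ∈ Set.range e := hd.superset hj
        exact ⟨i, rfl⟩
    · ext v
      constructor
      · rintro ⟨i, rfl⟩
        exact ⟨e' i, hd'.subset (Set.mem_range_self i), rfl⟩
      · rintro ⟨j, hj, rfl⟩
        obtain ⟨i, rfl⟩ : j ∈ Set.range e' := hd'.superset hj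
        exact ⟨i, rfl⟩

theorem isBasisOf_oddImage {ι κ τ : Type*} [Unique τ] {e : ι → ℕ} {e' : κ → ℕ}
    (he : Function.Injective e) (he' : Function.Injective e') {d : ℕ}
    (hd : Set.range e = Set.Iio d) (hd' : Set.range e' = Set.Iio (d - 1)) :
    IsBasisOf (Sum.elim (fun i => (X ^ e i, 0)) (Sum.elim (fun i => (0, X ^ e' i))
      fun _ => (X ^ d, (d : K) • X ^ (d - 1))) : ι ⊕ κ ⊕ τ → K[X] × K[X]) (oddImage K d) := by
  constructor
  · -- the family is the image of a family of monomials under a transvection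
    have h := linearIndependent_monPair (K := K) |>.comp
      (Sum.elim (fun i => Sum.inl (e i)) (Sum.elim (fun i => Sum.inr (e' i)) fun _ => Sum.inl d) :
        ι ⊕ κ ⊕ τ → ℕ ⊕ ℕ) (by
        have hlt : ∀ i, e i < d := fun i => hd.subset (Set.mem_range_self i)
        rintro (i | i | i) (j | j | j) hij
        · exact congrArg _ (he (Sum.inl_injective hij))
        · cases hij
        · exact absurd (Sum.inl_injective hij) (hlt i).ne
        · cases hij
        · exact congrArg _ (congrArg _ (he' (Sum.inr_injective hij)))
        · cases hij
        · exact absurd (Sum.inl_injective hij) (hlt j).ne'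
        · cases hij
        · rw [Subsingleton.elim i j])
    let φ : K[X] × K[X] →ₗ[K] K[X] × K[X] := LinearMap.id +
      LinearMap.inr K K[X] K[X] ∘ₗ (lcoeff K d ∘ₗ LinearMap.fst K K[X] K[X]).smulRight
        ((d : K) • X ^ (d - 1))
    have hφ : ∀ v, φ v = (v.1, v.2 + v.1.coeff d • ((d : K) • X ^ (d - 1))) := fun v => by
      refine Prod.ext ?_ rfl
      exact add_zero v.1
    have hφi : Function.Injective φ := by
      intro v w h
      rw [hφ, hφ, Prod.mk.injEq] at h
      refine Prod.ext h.1 ?_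
      have := h.2
      rw [h.1] at this
      exact add_right_cancel this
    refine (h.map_injOn φ hφi.injOn).congr_fun fun i => ?_
    rcases i with i | i | i
    · have hlt : e i < d := hd.subset (Set.mem_range_self i)
      show φ (X ^ e i, 0) = (X ^ e i, 0)
      rw [hφ, coeff_X_pow, if_neg hlt.ne', zero_smul, add_zero]
    · show φ (0, X ^ e' i) = (0, X ^ e' i)
      rw [hφ, coeff_zero, zero_smul, add_zero]
    · show φ (X ^ d, 0) = (X ^ d, (d : K) • X ^ (d - 1))
      rw [hφ, coeff_X_pow_self, one_smul, zero_add]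
  · have h := (isBasisOf_box (K := K) he he' hd hd').2
    rw [Set.Sum.elim_range] at h
    rw [Set.Sum.elim_range, Set.Sum.elim_range, ← Set.union_assoc, Submodule.span_union, h,
      Set.range_const]
    rfl

end difference

/-! ### Invariants, differences and coinvariants of `W` -/

section coordinates
open Polynomial
variable {K : Type u} [Field K] {N : ℕ} [NeZero N]

section
omit [NeZero N]

theorem lev_inl_even {m k : ℕ} (h : k ≤ m) :
    lev K N (2 * m) (X ^ k, 0) = x2 ^ (m - k) * y2 ^ k := by
  rw [lev_even]
  simp [form_X_pow h]

theorem lev_inr_even {m k : ℕ} (h : k ≤ m - 1) :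
    lev K N (2 * m) (0, X ^ k) = x1 * y1 * (x2 ^ (m - 1 - k) * y2 ^ k) := by
  rw [lev_even]
  simp [form_X_pow h]

theorem lev_inl_odd {m k : ℕ} (h : k ≤ m) :
    lev K N (2 * m + 1) (X ^ k, 0) = x1 * (x2 ^ (m - k) * y2 ^ k) := by
  rw [lev_odd]
  simp [form_X_pow h]

theorem lev_inr_odd {m k : ℕ} (h : k ≤ m) :
    lev K N (2 * m + 1) (0, X ^ k) = y1 * (x2 ^ (m - k) * y2 ^ k) := by
  rw [lev_odd]
  simp [form_X_pow h]

end

/-- Invariance under the generator suffices. -/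
theorem mem_invariants {U : Submodule K (HRing.{u} K N)} {w : HRing.{u} K N} :
    w ∈ invariants U ↔ w ∈ U ∧ act (Cyc.gen N) w = w := by
  refine and_congr_right fun _ => ?_
  rw [SetLike.mem_coe, Submodule.mem_iInf]
  refine ⟨fun h => h (Cyc.gen N), fun h q => ?_⟩
  have hk : ∀ k : ℕ, act (Cyc.gen N ^ k) w = w := by
    intro k
    induction k with
    | zero => rw [pow_zero, act_one]
    | succ k ih => rw [pow_succ, act_mul, h, ih]
  rw [← Cyc.gen_pow_val q]
  exact hk _

section
variable (hN : (N : K) = 0) (h2 : (2 : K) ≠ 0)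
include hN h2

theorem act_gen_lev {s : ℕ} {v : K[X] × K[X]} (hv : v ∈ boxH K s) :
    act (Cyc.gen N) (lev K N s v) = lev K N s (shear s 1 v) := by
  have h := act_lev hN h2 1 hv
  rwa [pow_one, Nat.cast_one] at h

theorem sigmaSubOne_lev {s : ℕ} {v : K[X] × K[X]} (hv : v ∈ boxH K s) :
    (act (Cyc.gen N) - LinearMap.id : HRing.{u} K N →ₗ[K] HRing.{u} K N) (lev K N s v) =
      lev K N s (shearDiff K s v) := by
  rw [LinearMap.sub_apply, act_gen_lev hN h2 hv, shearDiff, LinearMap.sub_apply, map_sub]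
  rfl

theorem sigmaSubOne_map {s : ℕ} {U : Submodule K (K[X] × K[X])} (hU : U ≤ boxH K s) :
    sigmaSubOne (U.map (lev K N s)) = (U.map (shearDiff K s)).map (lev K N s) := by
  ext w
  constructor
  · rintro ⟨_, ⟨v, hv, rfl⟩, rfl⟩
    exact ⟨_, ⟨v, hv, rfl⟩, (sigmaSubOne_lev hN h2 (hU hv)).symm⟩
  · rintro ⟨_, ⟨v, hv, rfl⟩, rfl⟩
    exact ⟨_, ⟨v, hv, rfl⟩, sigmaSubOne_lev hN h2 (hU hv)⟩

theorem invariants_map (hN1 : 1 < N) {s : ℕ} {U : Submodule K (K[X] × K[X])} (hU : U ≤ boxH K s) :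
    invariants (U.map (lev K N s)) = (U ⊓ LinearMap.ker (shearDiff K s)).map (lev K N s) := by
  ext w
  rw [mem_invariants]
  constructor
  · rintro ⟨⟨v, hv, rfl⟩, h⟩
    refine ⟨v, ⟨hv, ?_⟩, rfl⟩
    rw [act_gen_lev hN h2 (hU hv)] at h
    have := lev_injOn hN1 hN s (shear_memH 1 (hU hv)) (hU hv) h
    show shear s 1 v - v = 0
    rw [this, sub_self]
  · rintro ⟨v, ⟨hv, hv0⟩, rfl⟩
    refine ⟨⟨v, hv, rfl⟩, ?_⟩
    have hv0 : shear s 1 v - v = 0 := hv0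
    rw [act_gen_lev hN h2 (hU hv), sub_eq_zero.1 hv0]

end

section invariantsW
variable {p : ℕ} [Fact p.Prime] [CharP K p] (hN1 : 1 < N) (hN : (N : K) = 0) (h2 : (2 : K) ≠ 0)
include hN1 hN h2

omit [Fact p.Prime] [CharP K p] in
theorem invariants_Ws (s : ℕ) : invariants (Ws K N p s) = (boxInv K p s).map (lev K N s) := by
  rw [Ws_eq, invariants_map hN h2 hN1 (boxW_le p s)]
  rfl

omit [Fact p.Prime] [CharP K p] h2 in
theorem lev_injOn_of_le {s : ℕ} {U : Submodule K (K[X] × K[X])} (hU : U ≤ boxH K s) :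
    Set.InjOn (lev K N s) (U : Set (K[X] × K[X])) := (lev_injOn hN1 hN s).mono hU

theorem isBasisOf_invariants_zero :
    IsBasisOf (![1] : Fin 1 → HRing.{u} K N) (invariants (Ws K N p 0)) := by
  rw [invariants_Ws hN1 hN h2]
  have h := (isBasisOf_boxInv_of_le_one (K := K) (p := p) zero_le_one).map (lev K N 0)
    (lev_injOn_of_le hN1 hN (inf_le_left.trans (boxW_le p 0)))
  convert h using 1
  funext i
  fin_cases i
  exact one_eq_lev

theorem isBasisOf_invariants_one :
    IsBasisOf (![x1] : Fin 1 → HRing.{u} K N) (invariants (Ws K N p 1)) := by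
  rw [invariants_Ws hN1 hN h2]
  have h := (isBasisOf_boxInv_of_le_one (K := K) (p := p) le_rfl).map (lev K N 1)
    (lev_injOn_of_le hN1 hN (inf_le_left.trans (boxW_le p 1)))
  convert h using 1
  funext i
  fin_cases i
  have := lev_inl_odd (K := K) (N := N) (Nat.zero_le 0)
  simpa using this.symm

theorem isBasisOf_invariants_even {i : ℕ} (hi : 1 ≤ i) :
    IsBasisOf (![x2 ^ i, x1 * y1 * x2 ^ (i - 1)] : Fin 2 → HRing.{u} K N)
      (invariants (Ws K N p (2 * i))) := by
  rw [invariants_Ws hN1 hN h2]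
  have h := (isBasisOf_boxInv_even (K := K) (p := p) hi).map (lev K N (2 * i))
    (lev_injOn_of_le hN1 hN (inf_le_left.trans (boxW_le p _)))
  convert h using 1
  funext k
  fin_cases k
  · have := lev_inl_even (K := K) (N := N) (Nat.zero_le i)
    simpa using this.symm
  · have := lev_inr_even (K := K) (N := N) (Nat.zero_le (i - 1))
    simpa using this.symm

theorem isBasisOf_invariants_odd {i : ℕ} (hi : 1 ≤ i) :
    IsBasisOf (![x1 * x2 ^ i, (x1 * y2 - y1 * x2) * x2 ^ (i - 1)] : Fin 2 → HRing.{u} K N)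
      (invariants (Ws K N p (2 * i + 1))) := by
  rw [invariants_Ws hN1 hN h2]
  have h := (isBasisOf_boxInv_odd (K := K) (p := p) hi).map (lev K N (2 * i + 1))
    (lev_injOn_of_le hN1 hN (inf_le_left.trans (boxW_le p _)))
  convert h using 1
  funext k
  fin_cases k
  · have := lev_inl_odd (K := K) (N := N) (Nat.zero_le i)
    simpa using this.symm
  · have e1 := lev_inl_odd (K := K) (N := N) hi
    have e2 := lev_inr_odd (K := K) (N := N) (Nat.zero_le i)
    have e3 : ((X, -1) : K[X] × K[X]) = (X ^ 1, 0) - (0, X ^ 0) := by simp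
    show (x1 * y2 - y1 * x2) * x2 ^ (i - 1) = lev K N (2 * i + 1) (X, -1)
    have hc : (y2 * x2 ^ (i - 1) : HRing.{u} K N) = x2 ^ (i - 1) * y2 :=
      (x2_comm_y2.pow_left _).eq.symm
    rw [e3, map_sub, e1, e2, sub_mul, mul_assoc, hc, pow_one, pow_zero, mul_one, Nat.sub_zero,
      mul_assoc y1, ← pow_succ', Nat.sub_add_cancel hi]

end invariantsW

section image
variable {p : ℕ} [Fact p.Prime] [CharP K p] (hN1 : 1 < N) (hN : (N : K) = 0) (h2 : (2 : K) ≠ 0)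
include hN1 hN h2

omit hN1 in
theorem sigmaSubOne_Ws_even {i : ℕ} (hi : 1 ≤ i) : sigmaSubOne (Ws K N p (2 * i)) =
    (box K (min i (p - 1)) (min (i - 1) (p - 1))).map (lev K N (2 * i)) := by
  have hp := (Fact.out : p.Prime).pos
  rw [Ws_eq, sigmaSubOne_map hN h2 (boxW_le p _), boxW_even_pos hi,
    map_shearDiff_even (p := p) (by omega) (by omega) (by omega)]

omit hN1 in
theorem sigmaSubOne_Ws_odd (i : ℕ) : sigmaSubOne (Ws K N p (2 * i + 1)) =
    (oddImage K (min i (p - 1))).map (lev K N (2 * i + 1)) := by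
  have hp := (Fact.out : p.Prime).pos
  rw [Ws_eq, sigmaSubOne_map hN h2 (boxW_le p _), boxW_odd,
    map_shearDiff_odd (p := p) (by omega) (by omega)]

omit [NeZero N] hN1 hN h2 [CharP K p] in
theorem oddImage_le (i : ℕ) : oddImage K (min i (p - 1)) ≤ boxW K p (2 * i + 1) := by
  rw [boxW_odd]
  refine sup_le (box_mono (by omega) (by omega)) ?_
  rw [Submodule.span_singleton_le_iff_mem]
  exact ⟨X_pow_mem.2 (by omega), Submodule.smul_mem _ _ (X_pow_mem.2 (by omega))⟩

omit hN1 [NeZero N] hN h2 [CharP K p] in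
theorem box_le_even {i : ℕ} (hi : 1 ≤ i) :
    box K (min i (p - 1)) (min (i - 1) (p - 1)) ≤ boxW K p (2 * i) := by
  rw [boxW_even_pos hi]
  exact box_mono (by omega) (by omega)

theorem isBasisOf_image_one :
    IsBasisOf (![x1] : Fin 1 → HRing.{u} K N) (sigmaSubOne (Ws K N p 1)) := by
  have h0 : sigmaSubOne (Ws K N p 1) = (oddImage K 0).map (lev K N 1) := by
    have := sigmaSubOne_Ws_odd (p := p) hN h2 0
    rwa [Nat.zero_min] at this
  have hle : oddImage K 0 ≤ boxH K 1 := by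
    have := (oddImage_le (K := K) (p := p) 0).trans (boxW_le p _)
    rwa [Nat.zero_min] at this
  have hb : IsBasisOf (![(1, 0)] : Fin 1 → K[X] × K[X]) (oddImage K 0) := by
    refine isBasisOf_single (fun h => one_ne_zero (congrArg Prod.fst h)) ?_ ?_
    · refine Submodule.mem_sup_right ?_
      simp
    · intro u hu
      obtain ⟨v, hv, w, hw, rfl⟩ := Submodule.mem_sup.1 hu
      obtain ⟨a, rfl⟩ := Submodule.mem_span_singleton.1 hw
      have hv0 : v = 0 := Prod.ext (degreeLT_zero_eq hv.1) (degreeLT_zero_eq hv.2)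
      exact ⟨a, by simp [hv0]⟩
  rw [h0]
  have h := hb.map (lev K N 1) (lev_injOn_of_le hN1 hN hle)
  convert h using 1
  funext i
  fin_cases i
  have := lev_inl_odd (K := K) (N := N) (Nat.zero_le 0)
  simpa using this.symm

theorem isBasisOf_image_even {i : ℕ} (hi : 1 ≤ i) :
    IsBasisOf
      (Sum.elim
        (fun t : {t : ℕ × ℕ // 1 ≤ t.1 ∧ t.2 ≤ p - 2 ∧ t.1 + t.2 = i} =>
          (x2 ^ t.1.1 * y2 ^ t.1.2 : HRing.{u} K N))
        (fun t : {t : ℕ × ℕ // 1 ≤ t.1 ∧ t.2 ≤ p - 2 ∧ t.1 + t.2 + 1 = i} =>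
          (x1 * y1 * x2 ^ t.1.1 * y2 ^ t.1.2 : HRing.{u} K N)))
      (sigmaSubOne (Ws K N p (2 * i))) := by
  have hp := (Fact.out : p.Prime).two_le
  have h := (isBasisOf_box (K := K)
    (e := fun t : {t : ℕ × ℕ // 1 ≤ t.1 ∧ t.2 ≤ p - 2 ∧ t.1 + t.2 = i} => t.1.2)
    (e' := fun t : {t : ℕ × ℕ // 1 ≤ t.1 ∧ t.2 ≤ p - 2 ∧ t.1 + t.2 + 1 = i} => t.1.2)
    (d := min i (p - 1)) (d' := min (i - 1) (p - 1))
    (fun ⟨⟨a, b⟩, h⟩ ⟨⟨c, d⟩, h'⟩ hbd => by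
      simp only at h h' hbd
      simp only [Subtype.mk.injEq, Prod.mk.injEq]
      omega)
    (fun ⟨⟨a, b⟩, h⟩ ⟨⟨c, d⟩, h'⟩ hbd => by
      simp only at h h' hbd
      simp only [Subtype.mk.injEq, Prod.mk.injEq]
      omega)
    (by
      ext k
      simp only [Set.mem_range, Subtype.exists, Prod.exists, Set.mem_Iio]
      constructor
      · rintro ⟨a, b, h, rfl⟩
        omega
      · intro hk
        exact ⟨i - k, k, by omega, rfl⟩)
    (by
      ext k
      simp only [Set.mem_range, Subtype.exists, Prod.exists, Set.mem_Iio]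
      constructor
      · rintro ⟨a, b, h, rfl⟩
        omega
      · intro hk
        exact ⟨i - 1 - k, k, by omega, rfl⟩)).map (lev K N (2 * i))
    (lev_injOn_of_le hN1 hN ((box_le_even hi).trans (boxW_le p _)))
  rw [sigmaSubOne_Ws_even hN h2 hi]
  convert h using 1
  funext t
  rcases t with ⟨⟨a, b⟩, ht⟩ | ⟨⟨a, b⟩, ht⟩
  · have ht' : 1 ≤ a ∧ b ≤ p - 2 ∧ a + b = i := ht
    have := lev_inl_even (K := K) (N := N) (m := i) (k := b) (by omega)
    rw [show i - b = a by omega] at this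
    exact this.symm
  · have ht' : 1 ≤ a ∧ b ≤ p - 2 ∧ a + b + 1 = i := ht
    have := lev_inr_even (K := K) (N := N) (m := i) (k := b) (by omega)
    rw [show i - 1 - b = a by omega, ← mul_assoc] at this
    exact this.symm

theorem isBasisOf_image_odd (hp2 : p ≠ 2) {i : ℕ} (hi : 1 ≤ i) :
    IsBasisOf
      (Sum.elim
        (fun t : {t : ℕ × ℕ // 1 ≤ t.1 ∧ t.2 ≤ p - 2 ∧ t.1 + t.2 = i} =>
          (x1 * x2 ^ t.1.1 * y2 ^ t.1.2 : HRing.{u} K N))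
        (Sum.elim
          (fun t : {t : ℕ × ℕ // 2 ≤ t.1 ∧ t.2 ≤ p - 3 ∧ t.1 + t.2 = i} =>
            (y1 * x2 ^ t.1.1 * y2 ^ t.1.2 : HRing.{u} K N))
          (fun t : {t : ℕ × ℕ // (t.1 = 0 ∨ t.2 = p - 1) ∧ t.2 ≤ p - 1 ∧ t.1 + t.2 = i} =>
            (x1 * x2 ^ t.1.1 * y2 ^ t.1.2 +
              (t.1.2 : K) • (y1 * x2 ^ (t.1.1 + 1) * y2 ^ (t.1.2 - 1)) : HRing.{u} K N))))
      (sigmaSubOne (Ws K N p (2 * i + 1))) := by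
  have hp := (Fact.out : p.Prime).two_le
  let τ : Type := {t : ℕ × ℕ // (t.1 = 0 ∨ t.2 = p - 1) ∧ t.2 ≤ p - 1 ∧ t.1 + t.2 = i}
  have hτ : ∀ t : τ, t.1.1 = i - min i (p - 1) ∧ t.1.2 = min i (p - 1) := by
    rintro ⟨⟨a, b⟩, h⟩
    simp only at h ⊢
    omega
  let _ : Unique τ :=
    { default := ⟨(i - min i (p - 1), min i (p - 1)), by simp only; omega⟩
      uniq := fun t => Subtype.ext (Prod.ext (hτ t).1 (hτ t).2) }
  have h := (isBasisOf_oddImage (K := K) (τ := τ)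
    (e := fun t : {t : ℕ × ℕ // 1 ≤ t.1 ∧ t.2 ≤ p - 2 ∧ t.1 + t.2 = i} => t.1.2)
    (e' := fun t : {t : ℕ × ℕ // 2 ≤ t.1 ∧ t.2 ≤ p - 3 ∧ t.1 + t.2 = i} => t.1.2)
    (d := min i (p - 1))
    (fun ⟨⟨a, b⟩, h⟩ ⟨⟨c, d⟩, h'⟩ hbd => by
      simp only at h h' hbd
      simp only [Subtype.mk.injEq, Prod.mk.injEq]
      omega)
    (fun ⟨⟨a, b⟩, h⟩ ⟨⟨c, d⟩, h'⟩ hbd => by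
      simp only at h h' hbd
      simp only [Subtype.mk.injEq, Prod.mk.injEq]
      omega)
    (by
      ext k
      simp only [Set.mem_range, Subtype.exists, Prod.exists, Set.mem_Iio]
      constructor
      · rintro ⟨a, b, h, rfl⟩
        omega
      · intro hk
        exact ⟨i - k, k, by omega, rfl⟩)
    (by
      ext k
      simp only [Set.mem_range, Subtype.exists, Prod.exists, Set.mem_Iio]
      constructor
      · rintro ⟨a, b, h, rfl⟩
        omega
      · intro hk
        exact ⟨i - k, k, by omega, rfl⟩)).map (lev K N (2 * i + 1))
    (lev_injOn_of_le hN1 hN ((oddImage_le i).trans (boxW_le p _)))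
  rw [sigmaSubOne_Ws_odd hN h2]
  convert h using 1
  funext t
  rcases t with ⟨⟨a, b⟩, ht⟩ | ⟨⟨a, b⟩, ht⟩ | t
  · have ht' : 1 ≤ a ∧ b ≤ p - 2 ∧ a + b = i := ht
    have := lev_inl_odd (K := K) (N := N) (m := i) (k := b) (by omega)
    rw [show i - b = a by omega, ← mul_assoc] at this
    exact this.symm
  · have ht' : 2 ≤ a ∧ b ≤ p - 3 ∧ a + b = i := ht
    have := lev_inr_odd (K := K) (N := N) (m := i) (k := b) (by omega)
    rw [show i - b = a by omega, ← mul_assoc] at this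
    exact this.symm
  · show x1 * x2 ^ t.1.1 * y2 ^ t.1.2 + (t.1.2 : K) • (y1 * x2 ^ (t.1.1 + 1) * y2 ^ (t.1.2 - 1)) =
      lev K N (2 * i + 1) (X ^ min i (p - 1), ((min i (p - 1) : ℕ) : K) • X ^ (min i (p - 1) - 1))
    rw [(hτ t).1, (hτ t).2]
    set d := min i (p - 1) with hd
    have e1 := lev_inl_odd (K := K) (N := N) (m := i) (k := d) (by omega)
    have e2 := lev_inr_odd (K := K) (N := N) (m := i) (k := d - 1) (by omega)
    have e3 : ((X ^ d, (d : K) • X ^ (d - 1)) : K[X] × K[X]) =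
        (X ^ d, 0) + (d : K) • (0, X ^ (d - 1)) := by simp
    rw [e3, map_add, map_smul, e1, e2, show i - (d - 1) = i - d + 1 by omega, mul_assoc, mul_assoc]

end image

section cokernel
omit [NeZero N]
variable {p : ℕ} [Fact p.Prime] [CharP K p]

theorem sub_coeff_mem {d : ℕ} {f : K[X]} (hf : f ∈ degreeLT K (d + 1)) :
    f - f.coeff d • X ^ d ∈ degreeLT K d := by
  rw [degreeLT_succ, Submodule.mem_sup] at hf
  obtain ⟨g, hg, w, hw, rfl⟩ := hf
  obtain ⟨a, rfl⟩ := Submodule.mem_span_singleton.1 hw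
  rw [coeff_add, coeff_eq_zero_of_degree_lt (mem_degreeLT.1 hg), coeff_smul, coeff_X_pow_self,
    zero_add, smul_eq_mul, mul_one, add_sub_cancel_right]
  exact hg

/-- The two linear conditions that cut out the image of `σ - 1` in odd degrees. -/
theorem coeff_of_mem_oddImage {d : ℕ} (hd : d ≠ 0) {v : K[X] × K[X]} (hv : v ∈ oddImage K d) :
    v.2.coeff d = 0 ∧ v.2.coeff (d - 1) = d * v.1.coeff d := by
  obtain ⟨w, hw, _, hu, rfl⟩ := Submodule.mem_sup.1 hv
  obtain ⟨a, rfl⟩ := Submodule.mem_span_singleton.1 hu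
  have h1 : w.1.coeff d = 0 := coeff_eq_zero_of_degree_lt (mem_degreeLT.1 hw.1)
  have h2 : w.2.coeff (d - 1) = 0 := coeff_eq_zero_of_degree_lt (mem_degreeLT.1 hw.2)
  have h3 : w.2.coeff d = 0 :=
    coeff_eq_zero_of_degree_lt (mem_degreeLT.1 (degreeLT_mono (Nat.sub_le _ _) hw.2))
  have h4 : (X ^ (d - 1) : K[X]).coeff d = 0 := by
    rw [coeff_X_pow, if_neg (by omega)]
  simp only [Prod.snd_add, Prod.smul_snd, Prod.fst_add, Prod.smul_fst, coeff_add, coeff_smul, h1,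
    h2, h3, h4, coeff_X_pow_self, smul_eq_mul]
  constructor <;> ring

variable {V : Type*} [AddCommGroup V] [Module K V] {s : ℕ} (f : K[X] × K[X] →ₗ[K] V)

omit [CharP K p] in
theorem isBasisOf_coker_zero (hker : ∀ u ∈ boxW K p 0, f u = 0 ↔ u ∈ (boxW K p 0).map (shearDiff K 0)) :
    IsBasisOf ![f (1, 0)] ((boxW K p 0).map f) := by
  have hp := (Fact.out : p.Prime).pos
  have h0 : (boxW K p 0).map (shearDiff K 0) = ⊥ := by
    rw [eq_bot_iff]
    rintro _ ⟨v, hv, rfl⟩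
    have h1 := diffOp_mem (d := 0) (degreeLT_mono (by omega) hv.1)
    have h2 : v.2 = 0 := degreeLT_zero_eq (degreeLT_mono (by omega) hv.2)
    rw [Submodule.mem_bot, shearDiff_apply, h2, map_zero, map_zero, smul_zero, add_zero,
      degreeLT_zero_eq h1]
    rfl
  rw [h0] at hker
  refine isBasisOf_single_of_ker f hker ⟨one_mem_degreeLT.2 (by omega), Submodule.zero_mem _⟩ ?_ ?_
  · intro h
    exact one_ne_zero (congrArg Prod.fst h)
  · intro u hu
    refine ⟨u.1.coeff 0, ?_⟩
    have h1 := sub_coeff_mem (d := 0) (degreeLT_mono (by omega) hu.1)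
    have h2 : u.2 = 0 := degreeLT_zero_eq (degreeLT_mono (by omega) hu.2)
    rw [pow_zero] at h1
    refine Prod.ext (degreeLT_zero_eq h1) ?_
    simp [h2]

theorem isBasisOf_coker_one (hker : ∀ u ∈ boxW K p 1, f u = 0 ↔ u ∈ (boxW K p 1).map (shearDiff K 1)) :
    IsBasisOf ![f (0, 1)] ((boxW K p 1).map f) := by
  have hp := (Fact.out : p.Prime).pos
  have e1 : boxW K p 1 = box K 1 1 := by
    rw [boxW]; congr 1 <;> omega
  have e2 : (boxW K p 1).map (shearDiff K 1) = oddImage K 0 := by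
    rw [e1, map_shearDiff_odd (p := p) rfl hp]
  rw [e2, e1] at hker
  rw [e1]
  refine isBasisOf_single_of_ker f hker ⟨Submodule.zero_mem _, one_mem_degreeLT.2 (by omega)⟩ ?_ ?_
  · intro h
    obtain ⟨w, hw, _, hu, h⟩ := Submodule.mem_sup.1 h
    obtain ⟨a, rfl⟩ := Submodule.mem_span_singleton.1 hu
    have h0 : w.2 = 0 := degreeLT_zero_eq hw.2
    have := congrArg Prod.snd h
    simp [h0] at this
  · intro u hu
    refine ⟨u.2.coeff 0, ?_⟩
    have h1 := degreeLT_zero_eq (sub_coeff_mem (d := 0) hu.1)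
    have h2 := degreeLT_zero_eq (sub_coeff_mem (d := 0) hu.2)
    rw [sub_eq_zero] at h1 h2
    refine Submodule.mem_sup_right (Submodule.mem_span_singleton.2 ⟨u.1.coeff 0, Prod.ext ?_ ?_⟩)
    · simpa using h1.symm
    · rw [pow_zero] at h2
      simp [← h2]

/-- The cokernel of `σ - 1` in even degrees, presented as the image of a map with the right kernel;
this form serves both `W^s / (σ - 1) W^s` and the first column of `D_2`. -/
theorem isBasisOf_coker_even {i : ℕ} (hi : 1 ≤ i) (hker : ∀ u ∈ boxW K p (2 * i), f u = 0 ↔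
      u ∈ (boxW K p (2 * i)).map (shearDiff K (2 * i))) :
    IsBasisOf ![f (X ^ min i (p - 1), 0), f (0, X ^ min (i - 1) (p - 1))]
      ((boxW K p (2 * i)).map f) := by
  have hp := (Fact.out : p.Prime).pos
  rw [boxW_even_pos hi, map_shearDiff_even (p := p) (by omega) (by omega) (by omega)] at hker
  rw [boxW_even_pos hi]
  refine isBasisOf_pair_of_ker f hker ⟨X_pow_mem.2 (Nat.lt_succ_self _), Submodule.zero_mem _⟩
    ⟨Submodule.zero_mem _, X_pow_mem.2 (Nat.lt_succ_self _)⟩ ?_ ?_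
  · rintro a b ⟨h1, h2⟩
    constructor
    · simpa using coeff_eq_zero_of_degree_lt (mem_degreeLT.1 h1)
    · simpa using coeff_eq_zero_of_degree_lt (mem_degreeLT.1 h2)
  · intro u hu
    refine ⟨u.1.coeff (min i (p - 1)), u.2.coeff (min (i - 1) (p - 1)), ?_, ?_⟩
    · simpa using sub_coeff_mem hu.1
    · simpa using sub_coeff_mem hu.2

theorem isBasisOf_coker_odd {i : ℕ} (hi : 1 ≤ i) (hker : ∀ u ∈ boxW K p (2 * i + 1), f u = 0 ↔
      u ∈ (boxW K p (2 * i + 1)).map (shearDiff K (2 * i + 1))) :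
    IsBasisOf ![f (X ^ min i (p - 1), 0), f (0, X ^ min i (p - 1))]
      ((boxW K p (2 * i + 1)).map f) := by
  have hp := (Fact.out : p.Prime).one_lt
  rw [boxW_odd, map_shearDiff_odd (p := p) (by omega) (by omega)] at hker
  rw [boxW_odd]
  obtain ⟨d, hd⟩ : ∃ d, min i (p - 1) = d + 1 := ⟨min i (p - 1) - 1, by omega⟩
  have hd0 : ((d + 1 : ℕ) : K) ≠ 0 := natCast_ne_zero (p := p) d.succ_ne_zero (by omega)
  rw [hd] at hker ⊢
  refine isBasisOf_pair_of_ker f hker ⟨X_pow_mem.2 (Nat.lt_succ_self _), Submodule.zero_mem _⟩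
    ⟨Submodule.zero_mem _, X_pow_mem.2 (Nat.lt_succ_self _)⟩ ?_ ?_
  · intro a b h
    obtain ⟨h1, h2⟩ := coeff_of_mem_oddImage d.succ_ne_zero h
    have hb : b = 0 := by simpa using h1
    refine ⟨?_, hb⟩
    rw [hb] at h2
    simpa using (mul_eq_zero.1 (by simpa using h2.symm)).resolve_left hd0
  · intro u hu
    have h1 := sub_coeff_mem hu.1
    have h2 := sub_coeff_mem hu.2
    -- The coefficient of `X ^ d` in the second coordinate is removed by a multiple of the
    -- additional vector, at the cost of the leading coefficient of the first one; this needs `d + 1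
    -- ≠ 0` in `K`.
    set g := u.2 - u.2.coeff (d + 1) • X ^ (d + 1) with hg
    have h3 := sub_coeff_mem h2
    refine ⟨u.1.coeff (d + 1) - g.coeff d * ((d + 1 : ℕ) : K)⁻¹, u.2.coeff (d + 1), ?_⟩
    refine Submodule.mem_sup.2 ⟨(u.1 - u.1.coeff (d + 1) • X ^ (d + 1), g - g.coeff d • X ^ d),
      ⟨h1, h3⟩, _, Submodule.mem_span_singleton.2 ⟨g.coeff d * ((d + 1 : ℕ) : K)⁻¹, rfl⟩, ?_⟩
    refine Prod.ext ?_ ?_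
    · simp only [Prod.fst_add, Prod.smul_fst, Prod.fst_sub, smul_zero, add_zero, sub_smul]
      abel
    · simp only [Prod.snd_add, Prod.smul_snd, Prod.snd_sub, smul_zero, zero_add, smul_smul]
      rw [inv_mul_cancel_right₀ hd0, Nat.add_sub_cancel, sub_add_cancel]

end cokernel

section quotientW
variable {p : ℕ} [Fact p.Prime] [CharP K p] (hN1 : 1 < N) (hN : (N : K) = 0) (h2 : (2 : K) ≠ 0)
include hN1 hN h2

variable (K N) in
omit [NeZero N] in
/-- The map from coordinates to `H^s(M) / (σ - 1) W^s`. -/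
def quotLev (p s : ℕ) : K[X] × K[X] →ₗ[K] HRing.{u} K N ⧸ sigmaSubOne (Ws K N p s) :=
  (sigmaSubOne (Ws K N p s)).mkQ ∘ₗ lev K N s

omit [Fact p.Prime] [CharP K p] in
theorem quotLev_eq_zero_iff {s : ℕ} : ∀ u ∈ boxW K p s,
    quotLev K N p s u = 0 ↔ u ∈ (boxW K p s).map (shearDiff K s) := by
  intro u hu
  rw [quotLev, LinearMap.comp_apply, Submodule.mkQ_apply, Submodule.Quotient.mk_eq_zero, Ws_eq,
    sigmaSubOne_map hN h2 (boxW_le p s)]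
  constructor
  · rintro ⟨v, hv, hvu⟩
    have hv' : v ∈ boxH K s := by
      obtain ⟨w, hw, rfl⟩ := hv
      exact Submodule.sub_mem _ (shear_memH 1 (boxW_le p s hw)) (boxW_le p s hw)
    rwa [← lev_injOn hN1 hN s hv' (boxW_le p s hu) hvu]
  · exact fun h => ⟨u, h, rfl⟩

omit [NeZero N] [Fact p.Prime] [CharP K p] hN1 hN h2 in
theorem map_quotLev (s : ℕ) : (boxW K p s).map (quotLev K N p s) =
    (Ws K N p s).map (sigmaSubOne (Ws K N p s)).mkQ := by
  rw [quotLev, Submodule.map_comp, ← Ws_eq]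

omit [CharP K p] in
theorem isBasisOf_quot_zero : IsBasisOf ((sigmaSubOne (Ws K N p 0)).mkQ ∘ ![(1 : HRing.{u} K N)])
    ((Ws K N p 0).map (sigmaSubOne (Ws K N p 0)).mkQ) := by
  have h := isBasisOf_coker_zero (quotLev K N p 0) (quotLev_eq_zero_iff hN1 hN h2)
  rw [map_quotLev] at h
  convert h using 1
  funext i
  fin_cases i
  exact congrArg _ one_eq_lev

theorem isBasisOf_quot_one : IsBasisOf ((sigmaSubOne (Ws K N p 1)).mkQ ∘ ![(y1 : HRing.{u} K N)])
    ((Ws K N p 1).map (sigmaSubOne (Ws K N p 1)).mkQ) := by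
  have h := isBasisOf_coker_one (quotLev K N p 1) (quotLev_eq_zero_iff hN1 hN h2)
  rw [map_quotLev] at h
  convert h using 1
  funext i
  fin_cases i
  refine congrArg (sigmaSubOne (Ws K N p 1)).mkQ ?_
  have := lev_inr_odd (K := K) (N := N) (Nat.zero_le 0)
  simpa using this.symm

theorem isBasisOf_quot_even {i : ℕ} (hi : 1 ≤ i) :
    IsBasisOf ((sigmaSubOne (Ws K N p (2 * i))).mkQ ∘
      ![(x1 * y1 * (x2 ^ (i - 1 - min (i - 1) (p - 1)) * y2 ^ min (i - 1) (p - 1)) : HRing.{u} K N),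
        x2 ^ (i - min i (p - 1)) * y2 ^ min i (p - 1)])
      ((Ws K N p (2 * i)).map (sigmaSubOne (Ws K N p (2 * i))).mkQ) := by
  have h := (isBasisOf_coker_even (quotLev K N p (2 * i)) hi (quotLev_eq_zero_iff hN1 hN h2)).swap
  rw [map_quotLev] at h
  convert h using 1
  funext k
  fin_cases k
  · exact congrArg (sigmaSubOne (Ws K N p (2 * i))).mkQ (lev_inr_even (by omega)).symm
  · exact congrArg (sigmaSubOne (Ws K N p (2 * i))).mkQ (lev_inl_even (by omega)).symm

theorem isBasisOf_quot_odd {i : ℕ} (hi : 1 ≤ i) :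
    IsBasisOf ((sigmaSubOne (Ws K N p (2 * i + 1))).mkQ ∘
      ![(x1 * (x2 ^ (i - min i (p - 1)) * y2 ^ min i (p - 1)) : HRing.{u} K N),
        y1 * (x2 ^ (i - min i (p - 1)) * y2 ^ min i (p - 1))])
      ((Ws K N p (2 * i + 1)).map (sigmaSubOne (Ws K N p (2 * i + 1))).mkQ) := by
  have h := isBasisOf_coker_odd (quotLev K N p (2 * i + 1)) hi (quotLev_eq_zero_iff hN1 hN h2)
  rw [map_quotLev] at h
  convert h using 1
  funext k
  fin_cases k
  · exact congrArg (sigmaSubOne (Ws K N p (2 * i + 1))).mkQ (lev_inl_odd (by omega)).symm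
  · exact congrArg (sigmaSubOne (Ws K N p (2 * i + 1))).mkQ (lev_inr_odd (by omega)).symm

end quotientW

end coordinates

/-! ### The vanishing of the norm and the first two columns -/

section columns
variable {K : Type u} [Field K] {N : ℕ} [NeZero N]

theorem sum_range_mul_of_periodic {A : Type*} [AddCommMonoid A] {F : ℕ → A} {p : ℕ}
    (hF : ∀ i, F (p + i) = F i) (k : ℕ) :
    ∑ i ∈ Finset.range (p * k), F i = k • ∑ i ∈ Finset.range p, F i := by
  induction k with
  | zero => simp
  | succ k ih =>
    rw [Nat.mul_succ, add_comm (p * k), Finset.sum_range_add, succ_nsmul', ← ih]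
    simp only [hF]

/-- The norm vanishes: `σ^i` depends on `i` modulo `p` only, so that the norm is `p^(n-1)` times the
sum over `i < p`, and `n ≥ 2`. -/
theorem norm_eq_zero {p n : ℕ} [Fact p.Prime] [CharP K p] (hp : p ≠ 2) (hn : 2 ≤ n)
    (hN : N = p ^ n) (w : HRing.{u} K N) :
    ∑ i ∈ Finset.range N, act (Cyc.gen N ^ i) w = 0 := by
  have hp1 := (Fact.out : p.Prime).one_lt
  have hN1 : 1 < N := hN ▸ Nat.one_lt_pow (by omega) hp1
  have hN0 : (N : K) = 0 := by
    rw [hN, Nat.cast_pow, CharP.cast_eq_zero, zero_pow (by omega)]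
  have h2 : (2 : K) ≠ 0 := by
    have := natCast_ne_zero (K := K) (p := p) two_ne_zero (by omega)
    exact_mod_cast this
  induction w using DirectSum.induction_on with
  | zero => simp
  | add a b ha hb =>
    simp only [map_add, Finset.sum_add_distrib, ha, hb, add_zero]
  | of s a =>
    have hw : DirectSum.of (Coh K (BaseM.{u} N)) s a ∈ Hs K N s := ⟨a, rfl⟩
    rw [Hs_eq hN1 hN0 h2] at hw
    obtain ⟨v, hv, hva⟩ := hw
    rw [← hva]
    have hk : N = p * p ^ (n - 1) := by
      rw [hN, ← pow_succ', Nat.sub_add_cancel (by omega)]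
    have h := sum_range_mul_of_periodic (p := p)
      (F := fun i : ℕ => act (Cyc.gen N ^ i) (lev K N s v)) (fun i => by
        rw [act_lev hN0 h2 _ hv, act_lev hN0 h2 _ hv, Nat.cast_add, CharP.cast_eq_zero, zero_add])
      (p ^ (n - 1))
    rw [← hk] at h
    rw [h, ← Nat.cast_smul_eq_nsmul K, Nat.cast_pow, CharP.cast_eq_zero, zero_pow (by omega),
      zero_smul]

variable (K N) in
theorem gammaCochain_mem : gammaCochain K N ∈ cocycleSubmodule (cohRep K (heisAction.{u} N) 0) 2 := by
  rw [mem_cocycle_iff]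
  intro x
  have h := (mem_cocycle_iff _ _ _).1 (bocksteinCochain_mem (K := K) (N := N) Cyc.exp_mul.{u}) x
  rw [d_two_apply] at h ⊢
  have h1 := congrArg (Coh.const K (BaseM.{u} N)) h
  rw [map_zero] at h1
  refine Eq.trans ?_ h1
  rw [map_sub, map_add, map_sub]
  exact congrArg (fun z => z - _ + _ - _) (cohAction_const K (heisAction.{u} N) (x 0) _)

theorem gam2_eq : (gam2 : ERing.{u} K N) =
    DirectSum.of (E2 K (heisAction.{u} N)) (2, 0) (E2.mk K _ 2 0 ⟨_, gammaCochain_mem K N⟩) :=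
  congrArg _ (dif_pos (gammaCochain_mem K N))

section even
omit [NeZero N]

theorem evenCochain_mem {s : ℕ} {w : HRing.{u} K N} (hw : w ∈ invariants (Hs K N s)) :
    evenCochain s w ∈ cocycleSubmodule (cohRep K (heisAction.{u} N) s) 0 := by
  rw [mem_cocycle_iff]
  intro x
  rw [d_zero_apply, sub_eq_zero]
  have h := (Submodule.mem_iInf _).1 hw.2 (x 0)
  have h1 : act (x 0) w = w := h
  exact (act_apply (x 0) w s).symm.trans (congrArg (fun z : HRing.{u} K N => z s) h1)

theorem bar0_eq {s : ℕ} {w : HRing.{u} K N} (hw : w ∈ invariants (Hs K N s)) :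
    bar0 s w = DirectSum.of (E2 K (heisAction.{u} N)) (0, s)
      (E2.mk K _ 0 s ⟨_, evenCochain_mem hw⟩) :=
  congrArg _ (dif_pos (evenCochain_mem hw))

theorem bar0_linear (c : K) {s : ℕ} {w w' : HRing.{u} K N} (hw : w ∈ invariants (Hs K N s))
    (hw' : w' ∈ invariants (Hs K N s)) : bar0 s (c • w + w') = c • bar0 s w + bar0 s w' := by
  rw [bar0_eq hw, bar0_eq hw', bar0_eq (Submodule.add_mem _ (Submodule.smul_mem _ c hw) hw')]
  have h := ((DirectSum.lof K (ℕ × ℕ) (E2 K (heisAction.{u} N)) (0, s)) ∘ₗ E2.mk K _ 0 s).map_add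
    (c • ⟨_, evenCochain_mem hw⟩) ⟨_, evenCochain_mem hw'⟩
  rw [LinearMap.map_smul] at h
  exact h

theorem bar0_injOn (s : ℕ) : Set.InjOn (bar0 s) (invariants (Hs K N s) : Set (HRing.{u} K N)) := by
  intro w hw w' hw' h
  rw [bar0_eq hw, bar0_eq hw'] at h
  have h1 := DirectSum.of_injective _ h
  rw [← sub_eq_zero, ← map_sub] at h1
  have h2 := eq_zero_of_classMap_zero _ _ h1
  rw [sub_eq_zero] at h2
  have h3 : w s = w' s := congrFun (congrArg Subtype.val h2) Fin.elim0
  rw [← of_apply_eq hw.1, ← of_apply_eq hw'.1, h3]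

theorem mem_invariants_of_cocycle {s : ℕ} (F : cocycleSubmodule (cohRep K (heisAction.{u} N) s) 0) :
    DirectSum.of (Coh K (BaseM.{u} N)) s (F.1 Fin.elim0) ∈ invariants (Hs K N s) := by
  refine ⟨⟨_, rfl⟩, ?_⟩
  rw [SetLike.mem_coe, Submodule.mem_iInf]
  intro q
  have h := (mem_cocycle_iff _ _ _).1 F.2 fun _ => q
  rw [d_zero_apply, sub_eq_zero] at h
  exact (act_of q s _).trans (congrArg _ h)

theorem bar0_of_cocycle {s : ℕ} (F : cocycleSubmodule (cohRep K (heisAction.{u} N) s) 0) :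
    bar0 s (DirectSum.of (Coh K (BaseM.{u} N)) s (F.1 Fin.elim0)) =
      DirectSum.of (E2 K (heisAction.{u} N)) (0, s) (E2.mk K _ 0 s F) := by
  rw [bar0_eq (mem_invariants_of_cocycle F)]
  refine congrArg _ (congrArg _ (Subtype.ext (funext fun x => ?_)))
  refine (DirectSum.of_eq_same (β := Coh K (BaseM.{u} N)) s (F.1 Fin.elim0)).trans ?_
  exact congrArg F.1 (Subsingleton.elim _ _)

theorem bar0_image (s : ℕ) : bar0 s '' (invariants (Hs K N s) : Set (HRing.{u} K N)) =
    (Ers K N 0 s : Set (ERing.{u} K N)) := by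
  ext z
  constructor
  · rintro ⟨w, hw, rfl⟩
    rw [bar0_eq hw]
    exact ⟨_, rfl⟩
  · rintro ⟨a, rfl⟩
    obtain ⟨F, rfl⟩ := E2.mk_surjective K _ 0 s a
    exact ⟨_, mem_invariants_of_cocycle F, bar0_of_cocycle F⟩

/-- Membership in `D₂^{r,s}` in terms of representing cocycles. -/
theorem mem_D2 {p r s : ℕ} {z : ERing.{u} K N} : z ∈ D2 K N p r s ↔
    ∃ F : cocycleSubmodule (cohRep K (heisAction.{u} N) s) r,
      (∀ x, DirectSum.of (Coh K (BaseM.{u} N)) s (F.1 x) ∈ W K N p) ∧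
      DirectSum.of (E2 K (heisAction.{u} N)) (r, s) (E2.mk K _ r s F) = z := by
  constructor
  · rintro ⟨F, hF, rfl⟩
    exact ⟨F, fun x => (Submodule.mem_iInf _).1 hF x, rfl⟩
  · rintro ⟨F, hF, rfl⟩
    exact ⟨F, (Submodule.mem_iInf _).2 hF, rfl⟩

theorem invariants_mono {U U' : Submodule K (HRing.{u} K N)} (h : U ≤ U') :
    invariants U ≤ invariants U' := inf_le_inf_right _ h

theorem bar0_image_W (p s : ℕ) : bar0 s '' (invariants (Ws K N p s) : Set (HRing.{u} K N)) =
    (D2 K N p 0 s : Set (ERing.{u} K N)) := by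
  ext z
  rw [SetLike.mem_coe, mem_D2]
  constructor
  · rintro ⟨w, hw, rfl⟩
    have hw' := invariants_mono inf_le_right hw
    rw [bar0_eq hw']
    refine ⟨_, fun x => ?_, rfl⟩
    exact (of_apply_eq hw'.1).symm ▸ hw.1.1
  · rintro ⟨F, hF, rfl⟩
    have h := mem_invariants_of_cocycle F
    exact ⟨_, ⟨⟨hF _, h.1⟩, h.2⟩, bar0_of_cocycle F⟩

end even

section odd

/-- A `1`-cocycle of `Q` is determined by its value at the generator. -/
theorem cocycle_one_eq_zero {s : ℕ} (F : cocycleSubmodule (cohRep K (heisAction.{u} N) s) 1)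
    (h : F.1 (fun _ => Cyc.gen N) = 0) : F = 0 := by
  have hF : ∀ x y : Cyc.{u} N, F.1 (fun _ => x * y) =
      cohAction K (heisAction N) s x (F.1 fun _ => y) + F.1 fun _ => x := by
    intro x y
    have := (mem_cocycle_iff _ _ _).1 F.2 ![x, y]
    rw [d_one_apply] at this
    have h2 : F.1 (fun _ => x * y) - cohAction K (heisAction N) s x (F.1 fun _ => y) =
        F.1 fun _ => x := by
      rw [sub_eq_iff_eq_add, add_comm, ← sub_eq_iff_eq_add, ← sub_eq_zero]
      refine Eq.trans ?_ (congrArg Neg.neg this |>.trans neg_zero)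
      show _ = -(cohAction K (heisAction N) s x (F.1 fun _ => y) - F.1 (fun _ => x * y) +
        F.1 fun _ => x)
      abel
    rw [← h2]
    abel
  have h1 : F.1 (fun _ => 1) = 0 := by
    have := hF 1 1
    rw [mul_one, map_one] at this
    exact (left_eq_add.1 this)
  have hk : ∀ k : ℕ, F.1 (fun _ => Cyc.gen N ^ k) = 0 := by
    intro k
    induction k with
    | zero => simpa only [pow_zero] using h1
    | succ k ih => rw [pow_succ, hF, h, ih, map_zero, add_zero]
  refine Subtype.ext (funext fun x => ?_)
  have hx : x = fun _ => Cyc.gen N ^ (x 0).exp.val := by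
    funext i
    rw [Subsingleton.elim i 0, Cyc.gen_pow_val]
  rw [hx]
  exact hk _

omit [NeZero N] in
theorem oddCochain_apply {s : ℕ} (w : HRing.{u} K N) (x : Fin 1 → Cyc.{u} N) :
    oddCochain s w x = ∑ i ∈ Finset.range (x 0).exp.val, (act (Cyc.gen N ^ i) w) s := rfl

omit [NeZero N] in
theorem oddCochain_gen (hN1 : 1 < N) (s : ℕ) (w : HRing.{u} K N) :
    oddCochain s w (fun _ => Cyc.gen N) = w s := by
  have : Fact (1 < N) := ⟨hN1⟩
  rw [oddCochain_apply, Cyc.exp_gen, ZMod.val_one, Finset.sum_range_one, pow_zero, act_one]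

variable (hnorm : ∀ w : HRing.{u} K N, ∑ i ∈ Finset.range N, act (Cyc.gen N ^ i) w = 0)
include hnorm

/-- The vanishing of the norm makes the partial sums `∑_{i < k} σ^i w` depend on `k` modulo `N`
only, which is the cocycle condition. -/
theorem oddCochain_mem (s : ℕ) (w : HRing.{u} K N) :
    oddCochain s w ∈ cocycleSubmodule (cohRep K (heisAction.{u} N) s) 1 := by
  let P : ℕ → Coh K (BaseM.{u} N) s := fun k => ∑ i ∈ Finset.range k, (act (Cyc.gen N ^ i) w) s
  have hP : ∀ a b, P (a + b) = P a + cohAction K (heisAction N) s (Cyc.gen N ^ a) (P b) := by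
    intro a b
    simp only [P]
    rw [Finset.sum_range_add, map_sum]
    refine congrArg _ (Finset.sum_congr rfl fun i _ => ?_)
    rw [pow_add, act_mul, act_apply]
  have hPN : P N = 0 := by
    have h := congrArg (fun z : HRing.{u} K N => z s) (hnorm w)
    refine Eq.trans ?_ h
    exact (DFinsupp.finsetSum_apply _ _ _).symm
  rw [mem_cocycle_iff]
  intro x
  rw [d_one_apply]
  have hmul : oddCochain s w (fun _ => x 0 * x 1) = P ((x 0).exp.val + (x 1).exp.val) := by
    show P (x 0 * x 1).exp.val = _
    rw [Cyc.exp_mul]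
    rcases lt_or_ge ((x 0).exp.val + (x 1).exp.val) N with h | h
    · rw [ZMod.val_add_of_lt h]
    · have hg : Cyc.gen.{u} N ^ N = 1 := by
        apply Cyc.ext
        rw [Cyc.exp_pow, Cyc.exp_gen, mul_one, ZMod.natCast_self]
        rfl
      rw [ZMod.val_add_val_of_le h, add_comm _ N, hP, hPN, zero_add, hg, map_one]
      rfl
  rw [hmul, hP, Cyc.gen_pow_val]
  show cohAction K (heisAction N) s (x 0) (P (x 1).exp.val) -
    (P (x 0).exp.val + cohAction K (heisAction N) s (x 0) (P (x 1).exp.val)) + P (x 0).exp.val = 0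
  abel

theorem bar1_eq (s : ℕ) (w : HRing.{u} K N) :
    bar1 s w = DirectSum.of (E2 K (heisAction.{u} N)) (1, s)
      (E2.mk K _ 1 s ⟨_, oddCochain_mem hnorm s w⟩) :=
  congrArg _ (dif_pos (oddCochain_mem hnorm s w))

theorem bar1_linear (c : K) (s : ℕ) (w w' : HRing.{u} K N) :
    bar1 s (c • w + w') = c • bar1 s w + bar1 s w' := by
  rw [bar1_eq hnorm, bar1_eq hnorm, bar1_eq hnorm]
  have h := ((DirectSum.lof K (ℕ × ℕ) (E2 K (heisAction.{u} N)) (1, s)) ∘ₗ E2.mk K _ 1 s).map_add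
    (c • ⟨_, oddCochain_mem hnorm s w⟩) ⟨_, oddCochain_mem hnorm s w'⟩
  rw [LinearMap.map_smul] at h
  refine Eq.trans ?_ h
  refine congrArg _ (congrArg _ (Subtype.ext (funext fun x => ?_)))
  show oddCochain s (c • w + w') x = c • oddCochain s w x + oddCochain s w' x
  simp only [oddCochain_apply, map_add, map_smul, Finset.smul_sum, ← Finset.sum_add_distrib]
  rfl

/-- The class in column one, as a linear map. -/
def bar1Lin (s : ℕ) : HRing.{u} K N →ₗ[K] ERing.{u} K N :=
  IsLinearMap.mk' (bar1 s)
    { map_add := fun w w' => by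
        have := bar1_linear hnorm 1 s w w'
        rwa [one_smul, one_smul] at this
      map_smul := fun c w => by
        have h0 : bar1 s (0 : HRing.{u} K N) = 0 := by
          have := bar1_linear hnorm 1 s (0 : HRing.{u} K N) 0
          rw [one_smul, one_smul, add_zero] at this
          exact left_eq_add.1 this
        have := bar1_linear hnorm c s w 0
        rwa [h0, add_zero, add_zero] at this }

theorem bar1Lin_apply (s : ℕ) (w : HRing.{u} K N) : bar1Lin hnorm s w = bar1 s w := rfl

variable (hN1 : 1 < N)
include hN1

theorem bar1_of_cocycle {s : ℕ} (F : cocycleSubmodule (cohRep K (heisAction.{u} N) s) 1) :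
    bar1 s (DirectSum.of (Coh K (BaseM.{u} N)) s (F.1 fun _ => Cyc.gen N)) =
      DirectSum.of (E2 K (heisAction.{u} N)) (1, s) (E2.mk K _ 1 s F) := by
  rw [bar1_eq hnorm]
  refine congrArg _ (congrArg _ (sub_eq_zero.1 (cocycle_one_eq_zero _ ?_)))
  refine sub_eq_zero.2 ((oddCochain_gen hN1 s _).trans ?_)
  exact DirectSum.of_eq_same (β := Coh K (BaseM.{u} N)) s _

theorem bar1_eq_zero_iff {s : ℕ} {w : HRing.{u} K N} (hw : w ∈ Hs K N s) :
    bar1 s w = 0 ↔ w ∈ sigmaSubOne (Hs K N s) := by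
  rw [bar1_eq hnorm]
  constructor
  · intro h
    have h1 := DirectSum.of_injective _ (h.trans (map_zero _).symm)
    obtain ⟨e, he⟩ := exists_of_classMap_succ _ _ _ h1
    refine ⟨DirectSum.of (Coh K (BaseM.{u} N)) s (e Fin.elim0), ⟨_, rfl⟩, ?_⟩
    have h2 := congrFun he fun _ => Cyc.gen N
    rw [d_zero_apply] at h2
    have h3 := h2.trans (oddCochain_gen hN1 s w)
    rw [LinearMap.sub_apply, act_of, ← of_apply_eq hw, ← h3]
    exact (map_sub (DirectSum.of (Coh K (BaseM.{u} N)) s) _ _).symm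
  · rintro ⟨_, ⟨e, rfl⟩, rfl⟩
    have hd : inhomogeneousCochains.d (cohRep K (heisAction.{u} N) s) 0 (fun _ => e) ∈
        cocycleSubmodule (cohRep K (heisAction.{u} N) s) 1 := by
      have h := ConcreteCategory.congr_hom (groupCohomology.inhomogeneousCochains.d_comp_d 0
        (cohRep K (heisAction.{u} N) s)) ((fun _ => e) : (Fin 0 → Cyc.{u} N) → _)
      exact (LinearMap.mem_ker (f := (inhomogeneousCochains.d (cohRep K (heisAction.{u} N) s) 1).hom)).2 h
    refine (congrArg _ ?_).trans (map_zero _)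
    refine Eq.trans (congrArg _ (sub_eq_zero.1 (cocycle_one_eq_zero _ ?_)))
      (classMap_d (cohRep K (heisAction.{u} N) s) 0 (fun _ => e) hd)
    refine sub_eq_zero.2 ((oddCochain_gen hN1 s _).trans ?_)
    refine Eq.trans ?_ (d_zero_apply (cohRep K (heisAction.{u} N) s) (fun _ => e)
      fun _ => Cyc.gen N).symm
    have h1 : DirectSum.lof K ℕ (Coh K (BaseM.{u} N)) s e s = e :=
      DirectSum.of_eq_same (β := Coh K (BaseM.{u} N)) s e
    rw [LinearMap.sub_apply, DirectSum.sub_apply, act_apply, LinearMap.id_apply, h1]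

theorem bar1_image (s : ℕ) : bar1 s '' (Hs K N s : Set (HRing.{u} K N)) =
    (Ers K N 1 s : Set (ERing.{u} K N)) := by
  ext z
  constructor
  · rintro ⟨w, hw, rfl⟩
    rw [bar1_eq hnorm]
    exact ⟨_, rfl⟩
  · rintro ⟨a, rfl⟩
    obtain ⟨F, rfl⟩ := E2.mk_surjective K _ 1 s a
    exact ⟨_, ⟨_, rfl⟩, bar1_of_cocycle hnorm hN1 F⟩

theorem bar1_image_W (p s : ℕ)
    (hact : ∀ w ∈ Ws K N p s, ∀ q : Cyc.{u} N, act q w ∈ Ws K N p s) :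
    bar1 s '' (Ws K N p s : Set (HRing.{u} K N)) = (D2 K N p 1 s : Set (ERing.{u} K N)) := by
  ext z
  rw [SetLike.mem_coe, mem_D2]
  constructor
  · rintro ⟨w, hw, rfl⟩
    rw [bar1_eq hnorm]
    refine ⟨_, fun x => ?_, rfl⟩
    show DirectSum.of (Coh K (BaseM.{u} N)) s (∑ i ∈ Finset.range (x 0).exp.val, _) ∈ _
    rw [map_sum]
    refine Submodule.sum_mem _ fun i _ => ?_
    have h := hact w hw (Cyc.gen N ^ i)
    rw [of_apply_eq h.2]
    exact h.1
  · rintro ⟨F, hF, rfl⟩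
    exact ⟨_, ⟨hF _, ⟨_, rfl⟩⟩, bar1_of_cocycle hnorm hN1 F⟩

end odd
end columns

/-! ### Products on the second page and periodicity -/

section products
variable {K : Type u} [Field K] {N : ℕ}

theorem E2.of_mk_mul {r s r' s' : ℕ} (F : cocycleSubmodule (cohRep K (heisAction.{u} N) s) r)
    (F' : cocycleSubmodule (cohRep K (heisAction.{u} N) s') r') :
    (DirectSum.of (E2 K (heisAction.{u} N)) (r, s) (E2.mk K _ r s F) *
      DirectSum.of (E2 K (heisAction.{u} N)) (r', s') (E2.mk K _ r' s' F') : ERing.{u} K N) =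
    (-1 : K) ^ (r' * s) • DirectSum.of (E2 K (heisAction.{u} N)) (r + r', s + s')
      (E2.mk K _ (r + r') (s + s') ⟨cupCochain (coeffCup K _ s s') r r' F.1 F'.1,
          cupCochain_mem (coeffCup_equivariant K _ s s') r r' F F'⟩) := by
  refine (DirectSum.of_mul_of (A := E2 K (heisAction.{u} N)) (i := (r, s)) (j := (r', s'))
    (E2.mk K _ r s F) (E2.mk K _ r' s' F')).trans ?_
  refine (congrArg (DirectSum.of (E2 K (heisAction.{u} N)) (r + r', s + s'))
    (E2.mul_mk K (heisAction.{u} N) r s r' s' F F')).trans ?_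
  exact (DirectSum.lof K (ℕ × ℕ) (E2 K (heisAction.{u} N)) (r + r', s + s')).map_smul _ _

theorem mul_mem_invariants {s s' : ℕ} {w w' : HRing.{u} K N} (hw : w ∈ invariants (Hs K N s))
    (hw' : w' ∈ invariants (Hs K N s')) : w * w' ∈ invariants (Hs K N (s + s')) := by
  refine ⟨mul_mem_Hs hw.1 hw'.1, ?_⟩
  rw [SetLike.mem_coe, Submodule.mem_iInf]
  intro q
  have h1 : actAlg q w = w := (Submodule.mem_iInf _).1 hw.2 q
  have h2 : actAlg q w' = w' := (Submodule.mem_iInf _).1 hw'.2 q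
  show actAlg q (w * w') = w * w'
  rw [map_mul, h1, h2]

theorem of_cup {s s' : ℕ} {w w' : HRing.{u} K N} (hw : w ∈ Hs K N s) (hw' : w' ∈ Hs K N s') :
    DirectSum.of (Coh K (BaseM.{u} N)) (s + s') (Coh.cup K _ s s' (w s) (w' s')) = w * w' := by
  refine (DirectSum.of_mul_of (A := Coh K (BaseM.{u} N)) (w s) (w' s')).symm.trans ?_
  rw [of_apply_eq hw, of_apply_eq hw']

theorem bar0_mul_bar0 {s s' : ℕ} {w w' : HRing.{u} K N} (hw : w ∈ invariants (Hs K N s))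
    (hw' : w' ∈ invariants (Hs K N s')) : bar0 s w * bar0 s' w' = bar0 (s + s') (w * w') := by
  rw [bar0_eq hw, bar0_eq hw', E2.of_mk_mul, zero_mul, pow_zero, one_smul]
  refine (bar0_of_cocycle _).symm.trans (congrArg _ ?_)
  refine Eq.trans ?_ (of_cup hw.1 hw'.1)
  refine congrArg (DirectSum.of (Coh K (BaseM.{u} N)) (s + s')) ?_
  refine congrArg (Coh.cup K _ s s' (w s)) ?_
  refine (congrArg (fun q => cohAction K (heisAction.{u} N) s' q (w' s'))
    (Fin.partialProd_zero _)).trans ?_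
  rw [map_one]
  rfl

section
variable [NeZero N] (hnorm : ∀ w : HRing.{u} K N, ∑ i ∈ Finset.range N, act (Cyc.gen N ^ i) w = 0)
  (hN1 : 1 < N)
include hnorm hN1

/-- The sign of the product on the second page appears when a class of column one is multiplied on
the left by an invariant of odd degree. -/
theorem bar0_mul_bar1 {s s' : ℕ} {w w' : HRing.{u} K N} (hw : w ∈ invariants (Hs K N s))
    (hw' : w' ∈ Hs K N s') :
    bar0 s w * bar1 s' w' = (-1 : K) ^ s • bar1 (s + s') (w * w') := by
  rw [bar0_eq hw, bar1_eq hnorm, E2.of_mk_mul, one_mul]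
  refine congrArg _ ((bar1_of_cocycle hnorm hN1 _).symm.trans (congrArg _ ?_))
  refine Eq.trans ?_ (of_cup hw.1 hw')
  refine congrArg (DirectSum.of (Coh K (BaseM.{u} N)) (s + s')) ?_
  refine congrArg (Coh.cup K _ s s' (w s)) ?_
  refine (congrArg₂ (fun q z => cohAction K (heisAction.{u} N) s' q z)
    (Fin.partialProd_zero _) (oddCochain_gen hN1 s' w')).trans ?_
  rw [map_one]
  rfl

end

section period
variable [NeZero N]

/-- The slant product of the carry cocycle is the unit of the coefficients. -/
theorem coeffCup_gamma (hN1 : 1 < N) (s : ℕ) (a : Coh K (BaseM.{u} N) s) (q : Cyc.{u} N) :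
    coeffCup K (heisAction.{u} N) s 0 a ((cohRep K (heisAction.{u} N) 0).ρ q
      (∑ y : Cyc.{u} N, gammaCochain K N ![y, Cyc.gen N])) = a := by
  have h : ∑ y : Cyc.{u} N, gammaCochain K N ![y, Cyc.gen N] = Coh.const K (BaseM.{u} N) 1 := by
    rw [← Cyc.sum_bockstein K hN1, map_sum]
    rfl
  rw [h]
  refine (congrArg (Coh.cup K _ s 0 a) (cohAction_const K (heisAction.{u} N) q 1)).trans ?_
  have h1 := Coh.cup_const K (BaseM.{u} N) 1 s a
  rw [one_smul] at h1
  exact eq_of_heq (Sigma.mk.inj h1).2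

theorem finite_coh (hN1 : 1 < N) (hN : (N : K) = 0) (h2 : (2 : K) ≠ 0) (s : ℕ) :
    Module.Finite K (Coh K (BaseM.{u} N) s) := by
  have h1 : (Hs K N s).FG := by
    rw [Hs_eq hN1 hN h2]
    refine Submodule.FG.map _ (Submodule.FG.prod ?_ ?_)
    · classical
      rw [Polynomial.degreeLT_eq_span_X_pow]
      exact Submodule.fg_span (Finset.finite_toSet _)
    · classical
      rw [Polynomial.degreeLT_eq_span_X_pow]
      exact Submodule.fg_span (Finset.finite_toSet _)
  have h3 : Module.Finite K (LinearMap.range (DirectSum.lof K ℕ (Coh K (BaseM.{u} N)) s)) :=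
    Module.Finite.iff_fg.2 h1
  exact Module.Finite.equiv (LinearEquiv.ofInjective
    (DirectSum.lof K ℕ (Coh K (BaseM.{u} N)) s) (DirectSum.of_injective s)).symm

variable (hnorm : ∀ w : HRing.{u} K N, ∑ i ∈ Finset.range N, act (Cyc.gen N ^ i) w = 0)

include hnorm in
theorem norm_cohRep (s : ℕ) : (cohRep K (heisAction.{u} N) s).ρ.norm = 0 := by
  refine LinearMap.ext fun a => ?_
  have h := congrArg (fun z : HRing.{u} K N => z s)
    (hnorm (DirectSum.of (Coh K (BaseM.{u} N)) s a))
  rw [← Cyc.sum_eq (fun q => act q (DirectSum.of (Coh K (BaseM.{u} N)) s a))] at h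
  have h1 : (∑ q : Cyc.{u} N, act q (DirectSum.of (Coh K (BaseM.{u} N)) s a)) s = 0 := h
  rw [DFinsupp.finsetSum_apply] at h1
  rw [Representation.norm, LinearMap.sum_apply]
  refine Eq.trans (Finset.sum_congr rfl fun q _ => ?_) h1
  rw [act_apply]
  exact congrArg _ (DirectSum.of_eq_same (β := Coh K (BaseM.{u} N)) s a).symm

variable (K N) in
/-- Multiplication by `γ₂` on `E_2^{r,s}`. -/
def gamMul (r s : ℕ) : E2 K (heisAction.{u} N) (r, s) →ₗ[K] E2 K (heisAction.{u} N) (r + 2, s) :=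
  cupClass (coeffCup_equivariant K (heisAction.{u} N) s 0) ⟨_, gammaCochain_mem K N⟩ r

theorem of_mul_gam2 (r s : ℕ) (a : E2 K (heisAction.{u} N) (r, s)) :
    (DirectSum.of (E2 K (heisAction.{u} N)) (r, s) a * gam2 : ERing.{u} K N) =
      DirectSum.of (E2 K (heisAction.{u} N)) (r + 2, s) (gamMul K N r s a) := by
  obtain ⟨F, rfl⟩ := E2.mk_surjective K _ r s a
  rw [gam2_eq, E2.of_mk_mul, pow_mul, neg_one_sq, one_pow, one_smul]
  refine congrArg (DirectSum.of (E2 K (heisAction.{u} N)) (r + 2, s)) ?_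
  exact (cup_classMap (coeffCup_equivariant K (heisAction.{u} N) s 0) r 2 F
    ⟨_, gammaCochain_mem K N⟩).symm

variable (hN1 : 1 < N) (hN : (N : K) = 0) (h2 : (2 : K) ≠ 0)
include hnorm hN1 hN h2

/-- Periodicity of the second page. -/
theorem gamMul_bijective (r s : ℕ) : Function.Bijective (gamMul K N r s) := by
  have : Module.Finite K (cohRep K (heisAction.{u} N) s) := finite_coh hN1 hN h2 s
  exact cupClass_bijective (coeffCup_equivariant K (heisAction.{u} N) s 0)
    ⟨_, gammaCochain_mem K N⟩ (Cyc.gen N) Cyc.mem_zpowers (norm_cohRep hnorm s)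
    (coeffCup_gamma hN1 s) r

theorem gamMul_slant (r s : ℕ) (F : cocycleSubmodule (cohRep K (heisAction.{u} N) s) (r + 2)) :
    gamMul K N r s (E2.mk K _ r s ⟨_, slant_mem (Cyc.gen N) r F⟩) = E2.mk K _ (r + 2) s F := by
  have : Module.Finite K (cohRep K (heisAction.{u} N) s) := finite_coh hN1 hN h2 s
  exact cupClass_slant (coeffCup_equivariant K (heisAction.{u} N) s 0)
    ⟨_, gammaCochain_mem K N⟩ (Cyc.gen N) Cyc.mem_zpowers (norm_cohRep hnorm s)
    (coeffCup_gamma hN1 s) r F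

theorem bijOn_mul_gam2 (r s : ℕ) : Set.BijOn (fun z : ERing.{u} K N => z * gam2)
    (Ers K N r s : Set (ERing.{u} K N)) (Ers K N (r + 2) s : Set (ERing.{u} K N)) := by
  have hb := gamMul_bijective hnorm hN1 hN h2 r s
  refine ⟨?_, ?_, ?_⟩
  · rintro _ ⟨a, rfl⟩
    exact ⟨gamMul K N r s a, (of_mul_gam2 r s a).symm⟩
  · rintro _ ⟨a, rfl⟩ _ ⟨b, rfl⟩ h
    have h1 := (of_mul_gam2 r s a).symm.trans (h.trans (of_mul_gam2 r s b))
    exact congrArg _ (hb.1 (DirectSum.of_injective _ h1))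
  · rintro _ ⟨a, rfl⟩
    obtain ⟨b, rfl⟩ := hb.2 a
    exact ⟨_, ⟨b, rfl⟩, of_mul_gam2 r s b⟩

/-- Periodicity preserves `D_2`: its inverse, the slant product, sums values of a cocycle, and these
stay in `W^s`. -/
theorem D2_add_two (p r s : ℕ) :
    D2 K N p (r + 2) s = (D2 K N p r s).map (LinearMap.mulRight K gam2) := by
  ext z
  constructor
  · intro hz
    obtain ⟨F, hF, rfl⟩ := mem_D2.1 hz
    refine ⟨_, mem_D2.2 ⟨⟨_, slant_mem (Cyc.gen N) r F⟩, fun x => ?_, rfl⟩, ?_⟩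
    · show DirectSum.of (Coh K (BaseM.{u} N)) s (∑ y : Cyc.{u} N, _) ∈ _
      rw [map_sum]
      exact Submodule.sum_mem _ fun y _ => hF _
    · exact (of_mul_gam2 r s _).trans (congrArg _ (gamMul_slant hnorm hN1 hN h2 r s F))
  · rintro ⟨_, hz, rfl⟩
    obtain ⟨F, hF, rfl⟩ := mem_D2.1 hz
    rw [LinearMap.mulRight_apply, gam2_eq, E2.of_mk_mul, pow_mul, neg_one_sq, one_pow, one_smul]
    refine mem_D2.2 ⟨_, fun x => ?_, rfl⟩
    let a := F.1 fun i => x (Fin.castAdd 2 i)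
    have h1 : ∀ c : K, DirectSum.of (Coh K (BaseM.{u} N)) s
        (Coh.cup K _ s 0 a (Coh.const K (BaseM.{u} N) c)) = c • DirectSum.of _ s a := by
      intro c
      have h2 := eq_of_heq (Sigma.mk.inj (Coh.cup_const K (BaseM.{u} N) c s a)).2
      exact (congrArg _ h2).trans
        ((DirectSum.lof K ℕ (Coh K (BaseM.{u} N)) s).map_smul c a)
    have h3 := h1 (bocksteinCochain Cyc.exp fun j => x (Fin.natAdd r j))
    have h4 : DirectSum.of (Coh K (BaseM.{u} N)) s
        (cupCochain (coeffCup K (heisAction.{u} N) s 0) r 2 F.1 (gammaCochain K N) x) =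
        DirectSum.of (Coh K (BaseM.{u} N)) s (Coh.cup K _ s 0 a (Coh.const K (BaseM.{u} N)
          (bocksteinCochain Cyc.exp fun j => x (Fin.natAdd r j)))) := by
      refine congrArg (DirectSum.of (Coh K (BaseM.{u} N)) s) ?_
      exact congrArg (Coh.cup K _ s 0 a) (cohAction_const K (heisAction.{u} N) _ _)
    refine (h4.trans h3) ▸ ?_
    exact Submodule.smul_mem _ _ (hF _)

theorem bijOn_mul_gam2_pow (r s j : ℕ) : Set.BijOn (fun z : ERing.{u} K N => z * gam2 ^ j)
    (Ers K N r s : Set (ERing.{u} K N)) (Ers K N (r + 2 * j) s : Set (ERing.{u} K N)) := by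
  induction j with
  | zero =>
    refine (Set.bijOn_id _).congr fun z _ => ?_
    show z = z * gam2 ^ 0
    rw [pow_zero, mul_one]
  | succ j ih =>
    have h := (bijOn_mul_gam2 hnorm hN1 hN h2 (r + 2 * j) s).comp ih
    rw [show r + 2 * (j + 1) = r + 2 * j + 2 by ring]
    refine h.congr fun z _ => ?_
    show z * gam2 ^ j * gam2 = z * gam2 ^ (j + 1)
    rw [pow_succ, mul_assoc]

theorem D2_add_two_mul (p r s j : ℕ) :
    D2 K N p (r + 2 * j) s = (D2 K N p r s).map (LinearMap.mulRight K (gam2 ^ j)) := by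
  induction j with
  | zero =>
    rw [pow_zero, LinearMap.mulRight_one, Submodule.map_id]
    rfl
  | succ j ih =>
    rw [show r + 2 * (j + 1) = r + 2 * j + 2 by ring, D2_add_two hnorm hN1 hN h2, ih,
      ← Submodule.map_comp, pow_succ, LinearMap.mulRight_mul]

end period
end products

/-! ### The shape of the second page and division by `ν_{2p}` -/

section shape
variable {K : Type u} [Field K] {N : ℕ}

theorem bar_even (j s : ℕ) (w : HRing.{u} K N) : bar (2 * j) s w = bar0 s w * gam2 ^ j := by
  rw [bar, if_pos (even_two_mul j), Nat.mul_div_cancel_left j two_pos]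

theorem bar_odd (j s : ℕ) (w : HRing.{u} K N) : bar (2 * j + 1) s w = bar1 s w * gam2 ^ j := by
  rw [bar, if_neg (by simp), show (2 * j + 1) / 2 = j by omega]

theorem D2_le_Ers (p r s : ℕ) : D2 K N p r s ≤ Ers K N r s := by
  intro z hz
  obtain ⟨F, -, rfl⟩ := mem_D2.1 hz
  exact ⟨_, rfl⟩

/-- In degrees less than `2p` there is no room for a multiple of `z_{2p}`. -/
theorem boxH_le_boxW {p s : ℕ} (h : s < 2 * p) : boxH K s ≤ boxW K p s :=
  box_mono (by omega) (by omega)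

variable [NeZero N]

theorem act_mem_Ws (hN : (N : K) = 0) (h2 : (2 : K) ≠ 0) (p s : ℕ) :
    ∀ w ∈ Ws K N p s, ∀ q : Cyc.{u} N, act q w ∈ Ws K N p s := by
  intro w hw q
  rw [Ws_eq] at hw ⊢
  obtain ⟨v, hv, rfl⟩ := hw
  rw [← Cyc.gen_pow_val q, act_lev hN h2 _ (boxW_le p s hv)]
  exact ⟨_, shear_memW _ hv, rfl⟩

theorem shearDiff_memH {s : ℕ} {v : Polynomial K × Polynomial K} (hv : v ∈ boxH K s) :
    shearDiff K s v ∈ boxH K s := Submodule.sub_mem _ (shear_memH 1 hv) hv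

theorem shearDiff_memW {p s : ℕ} {v : Polynomial K × Polynomial K} (hv : v ∈ boxW K p s) :
    shearDiff K s v ∈ boxW K p s := Submodule.sub_mem _ (shear_memW 1 hv) hv

/-- Multiplication by `z_{2p}` commutes with `σ - 1`. -/
theorem shearDiff_zpoly_smul (p : ℕ) [CharP K p] (s : ℕ) (v : Polynomial K × Polynomial K) :
    shearDiff K (s + 2 * p) (zpoly K p • v) = zpoly K p • shearDiff K s v := by
  rw [shearDiff, LinearMap.sub_apply, shear_zpoly_smul, shearDiff, LinearMap.sub_apply, smul_sub]
  rfl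

/-- If `σ - 1` takes an element of `H^s(M)` into `W^s`, then so it does to an element of `W^s`, with
the same value. -/
theorem exists_shearDiff_eq {p : ℕ} [CharP K p] {s : ℕ} {v : Polynomial K × Polynomial K}
    (hv : v ∈ boxH K s) (h : shearDiff K s v ∈ boxW K p s) :
    ∃ w ∈ boxW K p s, shearDiff K s w = shearDiff K s v := by
  rcases lt_or_ge s (2 * p) with hs | hs
  · exact ⟨v, boxH_le_boxW hs hv, rfl⟩
  · obtain ⟨t, rfl⟩ := Nat.exists_eq_add_of_le' hs
    obtain ⟨w, hw, u, hu, rfl⟩ := exists_box_decomp hv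
    refine ⟨w, hw, ?_⟩
    rw [map_add, shearDiff_zpoly_smul] at h ⊢
    -- Write `v = w + z u`. Then `z (σ - 1) u` lies in `W`, so that it vanishes by uniqueness.
    have h1 := Submodule.sub_mem _ (shearDiff_memW hw) h
    have h2 := (box_decomp_unique (u := shearDiff K t u) h1 (by abel)).2
    rw [h2, smul_zero, add_zero]

section
variable (hN1 : 1 < N) (hN : (N : K) = 0) (h2 : (2 : K) ≠ 0)
include hN1 hN h2

theorem lev_mem_sigmaSubOne_iff {s : ℕ} {u : Polynomial K × Polynomial K} (hu : u ∈ boxH K s) :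
    lev K N s u ∈ sigmaSubOne (Hs K N s) ↔ ∃ v ∈ boxH K s, shearDiff K s v = u := by
  rw [Hs_eq hN1 hN h2, sigmaSubOne_map hN h2 le_rfl]
  constructor
  · rintro ⟨_, ⟨v, hv, rfl⟩, h⟩
    exact ⟨v, hv, lev_injOn hN1 hN s (shearDiff_memH hv) hu h⟩
  · rintro ⟨v, hv, rfl⟩
    exact ⟨_, ⟨v, hv, rfl⟩, rfl⟩

/-- An element of `W^s` that is a difference in `H^s(M)` is a difference in `W^s`; hence the first
column of `D_2` is `W^s / (σ - 1) W^s`. -/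
theorem sigmaSubOne_inf_Ws (p : ℕ) [CharP K p] {s : ℕ} {w : HRing.{u} K N}
    (hw : w ∈ Ws K N p s) : w ∈ sigmaSubOne (Hs K N s) ↔ w ∈ sigmaSubOne (Ws K N p s) := by
  refine ⟨fun h => ?_, fun h => Submodule.map_mono inf_le_right h⟩
  rw [Ws_eq] at hw
  obtain ⟨u, hu, rfl⟩ := hw
  obtain ⟨v, hv, hvu⟩ := (lev_mem_sigmaSubOne_iff hN1 hN h2 (boxW_le p s hu)).1 h
  obtain ⟨v', hv', h'⟩ := exists_shearDiff_eq (p := p) hv (hvu ▸ hu)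
  rw [Ws_eq, sigmaSubOne_map hN h2 (boxW_le p s)]
  exact ⟨_, ⟨v', hv', h'.trans hvu⟩, rfl⟩

variable (hnorm : ∀ w : HRing.{u} K N, ∑ i ∈ Finset.range N, act (Cyc.gen N ^ i) w = 0)
include hnorm

theorem bar1_eq_zero_iff_of_mem_Ws (p : ℕ) [CharP K p] {s : ℕ} {w : HRing.{u} K N}
    (hw : w ∈ Ws K N p s) : bar1 s w = 0 ↔ w ∈ sigmaSubOne (Ws K N p s) :=
  (bar1_eq_zero_iff hnorm hN1 hw.2).trans (sigmaSubOne_inf_Ws hN1 hN h2 p hw)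

theorem shape_even (p j s : ℕ) :
    (∀ (c : K), ∀ w ∈ invariants (Hs K N s), ∀ w' ∈ invariants (Hs K N s),
      bar (2 * j) s (c • w + w') = c • bar (2 * j) s w + bar (2 * j) s w') ∧
    Set.BijOn (bar (2 * j) s) (invariants (Hs K N s) : Set (HRing.{u} K N))
      (Ers K N (2 * j) s : Set (ERing.{u} K N)) ∧
    Set.BijOn (bar (2 * j) s) (invariants (Ws K N p s) : Set (HRing.{u} K N))
      (D2 K N p (2 * j) s : Set (ERing.{u} K N)) := by
  have hb := bijOn_mul_gam2_pow hnorm hN1 hN h2 0 s j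
  have hD := D2_add_two_mul hnorm hN1 hN h2 p 0 s j
  rw [zero_add] at hb hD
  have hf : (bar (2 * j) s : HRing.{u} K N → ERing.{u} K N) = (· * gam2 ^ j) ∘ bar0 s :=
    funext fun w => bar_even j s w
  have h0 : Set.BijOn (bar (2 * j) s) (invariants (Hs K N s) : Set (HRing.{u} K N))
      (Ers K N (2 * j) s : Set (ERing.{u} K N)) := by
    rw [hf]
    exact hb.comp (bar0_image (K := K) s ▸ (bar0_injOn s).bijOn_image)
  refine ⟨fun c w hw w' hw' => ?_, h0, ?_⟩
  · rw [bar_even, bar_even, bar_even, bar0_linear c hw hw', add_mul, smul_mul_assoc]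
  · have h1 : bar (2 * j) s '' (invariants (Ws K N p s) : Set (HRing.{u} K N)) =
        (D2 K N p (2 * j) s : Set (ERing.{u} K N)) := by
      rw [hf, Set.image_comp, bar0_image_W, hD]
      rfl
    rw [← h1]
    exact (h0.injOn.mono (invariants_mono inf_le_right)).bijOn_image

theorem shape_odd (p j s : ℕ) [CharP K p] :
    (∀ (c : K), ∀ w ∈ Hs K N s, ∀ w' ∈ Hs K N s,
      bar (2 * j + 1) s (c • w + w') = c • bar (2 * j + 1) s w + bar (2 * j + 1) s w') ∧
    bar (2 * j + 1) s '' (Hs K N s : Set (HRing.{u} K N)) =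
      (Ers K N (2 * j + 1) s : Set (ERing.{u} K N)) ∧
    (∀ w ∈ Hs K N s, ∀ w' ∈ Hs K N s, bar (2 * j + 1) s w = bar (2 * j + 1) s w' ↔
      w - w' ∈ sigmaSubOne (Hs K N s)) ∧
    bar (2 * j + 1) s '' (Ws K N p s : Set (HRing.{u} K N)) =
      (D2 K N p (2 * j + 1) s : Set (ERing.{u} K N)) ∧
    (∀ w ∈ Ws K N p s, ∀ w' ∈ Ws K N p s, bar (2 * j + 1) s w = bar (2 * j + 1) s w' ↔
      w - w' ∈ sigmaSubOne (Ws K N p s)) := by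
  have hb := bijOn_mul_gam2_pow hnorm hN1 hN h2 1 s j
  have hD := D2_add_two_mul hnorm hN1 hN h2 p 1 s j
  rw [add_comm] at hb hD
  have hf : (bar (2 * j + 1) s : HRing.{u} K N → ERing.{u} K N) = (· * gam2 ^ j) ∘ bar1 s :=
    funext fun w => bar_odd j s w
  have himg := bar1_image hnorm hN1 s
  have key : ∀ w ∈ Hs K N s, ∀ w' ∈ Hs K N s, bar (2 * j + 1) s w = bar (2 * j + 1) s w' ↔
      w - w' ∈ sigmaSubOne (Hs K N s) := by
    intro w hw w' hw'
    have hE : ∀ v ∈ Hs K N s, bar1 s v ∈ Ers K N 1 s := fun v hv => by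
      have : bar1 s v ∈ (Ers K N 1 s : Set (ERing.{u} K N)) := himg ▸ Set.mem_image_of_mem _ hv
      exact this
    rw [← bar1_eq_zero_iff hnorm hN1 (Submodule.sub_mem _ hw hw'), ← bar1Lin_apply hnorm, map_sub,
      sub_eq_zero, bar_odd, bar_odd]
    exact hb.injOn.eq_iff (hE w hw) (hE w' hw')
  refine ⟨fun c w hw w' hw' => ?_, ?_, key, ?_, fun w hw w' hw' => ?_⟩
  · rw [bar_odd, bar_odd, bar_odd, bar1_linear hnorm, add_mul, smul_mul_assoc]
  · rw [hf, Set.image_comp, himg]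
    exact hb.image_eq
  · rw [hf, Set.image_comp, bar1_image_W hnorm hN1 p s (act_mem_Ws hN h2 p s), hD]
    rfl
  · rw [key w hw.2 w' hw'.2]
    exact sigmaSubOne_inf_Ws hN1 hN h2 p (Submodule.sub_mem _ hw hw')

end
end shape

/-- Induction over the columns: every column is a multiple of one of the first two by a power of
`γ₂`. -/
theorem column_induction {P : ℕ → Prop} (h0 : P 0) (h1 : P 1) (h : ∀ r, P r → P (r + 2)) (r : ℕ) :
    P r := by
  induction r using Nat.strong_induction_on with
  | _ r ih =>
    match r, ih with
    | 0, _ => exact h0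
    | 1, _ => exact h1
    | r + 2, ih => exact h r (ih r (by omega))

section decomposition
variable {K : Type u} [Field K] {N : ℕ} [NeZero N] {p : ℕ} [CharP K p]
  (hN1 : 1 < N) (hN : (N : K) = 0) (h2 : (2 : K) ≠ 0)
  (hnorm : ∀ w : HRing.{u} K N, ∑ i ∈ Finset.range N, act (Cyc.gen N ^ i) w = 0)

include hN h2 in
theorem z2p_mem : (z2p p : HRing.{u} K N) ∈ invariants (Hs K N (2 * p)) := by
  have hb : ((zpoly K p, 0) : Polynomial K × Polynomial K) ∈ boxH K (2 * p) := by
    have := zpoly_smul_mem p (one_mem_boxH (K := K))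
    rw [zero_add, Prod.smul_mk, smul_zero, smul_eq_mul, mul_one] at this
    exact this
  rw [mem_invariants, z2p_eq_lev hN]
  refine ⟨lev_mem_Hs hb, ?_⟩
  rw [act_gen_lev hN h2 hb, shear_apply]
  simp only [taylor_zpoly, map_zero, smul_zero, add_zero]

section
include hN h2

theorem nu2p_mul_bar0 {t : ℕ} {v : HRing.{u} K N} (hv : v ∈ invariants (Hs K N t)) :
    nu2p p * bar0 t v = bar0 (t + 2 * p) (z2p p * v) := by
  rw [nu2p, bar0_mul_bar0 (z2p_mem hN h2) hv, add_comm]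

include hnorm hN1 in
theorem nu2p_mul_bar1 {t : ℕ} {v : HRing.{u} K N} (hv : v ∈ Hs K N t) :
    nu2p p * bar1 t v = bar1 (t + 2 * p) (z2p p * v) := by
  rw [nu2p, bar0_mul_bar1 hnorm hN1 (z2p_mem hN h2) hv, add_comm, pow_mul, neg_one_sq, one_pow,
    one_smul]

end

include hN1 hN h2

theorem mem_invariants_lev {s : ℕ} {v : Polynomial K × Polynomial K} (hv : v ∈ boxH K s) :
    lev K N s v ∈ invariants (Hs K N s) ↔ shearDiff K s v = 0 := by
  rw [Hs_eq hN1 hN h2, invariants_map hN h2 hN1 le_rfl]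
  constructor
  · rintro ⟨w, ⟨hw, hw0⟩, h⟩
    rwa [← lev_injOn hN1 hN s hw hv h]
  · exact fun h => ⟨v, ⟨hv, h⟩, rfl⟩

theorem exists_bar0 {s : ℕ} {x : ERing.{u} K N} (hx : x ∈ Ers K N 0 s) :
    ∃ v ∈ boxH K s, shearDiff K s v = 0 ∧ x = bar0 s (lev K N s v) := by
  have hx : x ∈ (Ers K N 0 s : Set (ERing.{u} K N)) := hx
  rw [← bar0_image] at hx
  obtain ⟨w, hw, rfl⟩ := hx
  have h := hw.1
  rw [Hs_eq hN1 hN h2] at h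
  obtain ⟨v, hv, rfl⟩ := h
  exact ⟨v, hv, (mem_invariants_lev hN1 hN h2 hv).1 hw, rfl⟩

include hnorm

theorem exists_bar1 {s : ℕ} {x : ERing.{u} K N} (hx : x ∈ Ers K N 1 s) :
    ∃ v ∈ boxH K s, x = bar1 s (lev K N s v) := by
  have hx : x ∈ (Ers K N 1 s : Set (ERing.{u} K N)) := hx
  rw [← bar1_image hnorm hN1] at hx
  obtain ⟨w, hw, rfl⟩ := hx
  have hw : w ∈ Hs K N s := hw
  rw [Hs_eq hN1 hN h2] at hw
  obtain ⟨v, hv, rfl⟩ := hw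
  exact ⟨v, hv, rfl⟩

omit hnorm [CharP K p] in
theorem bar0_lev_mem_D2 {s : ℕ} {v : Polynomial K × Polynomial K} (hv : v ∈ boxW K p s)
    (h : shearDiff K s v = 0) : bar0 s (lev K N s v) ∈ D2 K N p 0 s := by
  have h1 : bar0 s (lev K N s v) ∈ (D2 K N p 0 s : Set (ERing.{u} K N)) := by
    rw [← bar0_image_W]
    refine ⟨_, ?_, rfl⟩
    rw [SetLike.mem_coe, invariants_Ws hN1 hN h2]
    exact ⟨v, ⟨hv, h⟩, rfl⟩
  exact h1

omit [CharP K p] in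
theorem bar1_lev_mem_D2 {s : ℕ} {v : Polynomial K × Polynomial K} (hv : v ∈ boxW K p s) :
    bar1 s (lev K N s v) ∈ D2 K N p 1 s := by
  have h1 : bar1 s (lev K N s v) ∈ (D2 K N p 1 s : Set (ERing.{u} K N)) := by
    rw [← bar1_image_W hnorm hN1 p s (act_mem_Ws hN h2 p s)]
    refine ⟨_, ?_, rfl⟩
    rw [SetLike.mem_coe, Ws_eq]
    exact ⟨v, hv, rfl⟩
  exact h1

omit hnorm [CharP K p] in
theorem exists_bar0_of_mem_D2 {s : ℕ} {x : ERing.{u} K N} (hx : x ∈ D2 K N p 0 s) :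
    ∃ v ∈ boxW K p s, shearDiff K s v = 0 ∧ x = bar0 s (lev K N s v) := by
  have hx : x ∈ (D2 K N p 0 s : Set (ERing.{u} K N)) := hx
  rw [← bar0_image_W] at hx
  obtain ⟨w, hw, rfl⟩ := hx
  rw [SetLike.mem_coe, invariants_Ws hN1 hN h2] at hw
  obtain ⟨v, ⟨hv, hv0⟩, rfl⟩ := hw
  exact ⟨v, hv, hv0, rfl⟩

omit [CharP K p] in
theorem exists_bar1_of_mem_D2 {s : ℕ} {x : ERing.{u} K N} (hx : x ∈ D2 K N p 1 s) :
    ∃ v ∈ boxW K p s, x = bar1 s (lev K N s v) := by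
  have hx : x ∈ (D2 K N p 1 s : Set (ERing.{u} K N)) := hx
  rw [← bar1_image_W hnorm hN1 p s (act_mem_Ws hN h2 p s)] at hx
  obtain ⟨w, hw, rfl⟩ := hx
  rw [SetLike.mem_coe, Ws_eq] at hw
  obtain ⟨v, hv, rfl⟩ := hw
  exact ⟨v, hv, rfl⟩

omit [CharP K p] in
/-- In degrees less than `2p` the second page is `D_2`. -/
theorem Ers_le_D2 (r : ℕ) {s : ℕ} (hs : s < 2 * p) : Ers K N r s ≤ D2 K N p r s := by
  induction r using column_induction with
  | h0 =>
    intro x hx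
    obtain ⟨v, hv, hv0, rfl⟩ := exists_bar0 hN1 hN h2 hx
    exact bar0_lev_mem_D2 hN1 hN h2 (boxH_le_boxW hs hv) hv0
  | h1 =>
    intro x hx
    obtain ⟨v, hv, rfl⟩ := exists_bar1 hN1 hN h2 hnorm hx
    exact bar1_lev_mem_D2 hN1 hN h2 hnorm (boxH_le_boxW hs hv)
  | h r ih =>
    intro x hx
    obtain ⟨y, hy, rfl⟩ := (bijOn_mul_gam2 hnorm hN1 hN h2 r s).surjOn hx
    rw [D2_add_two hnorm hN1 hN h2]
    exact ⟨y, ih hy, rfl⟩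

/-- Every class of degree at least `2p` is the sum of a class in `D_2` and a multiple of `ν_{2p}`.
-/
theorem exists_decomp (r : ℕ) {t : ℕ} : ∀ x ∈ Ers K N r (t + 2 * p),
    ∃ d ∈ D2 K N p r (t + 2 * p), ∃ e ∈ Ers K N r t, x = d + nu2p p * e := by
  induction r using column_induction with
  | h0 =>
    intro x hx
    obtain ⟨v, hv, hv0, rfl⟩ := exists_bar0 hN1 hN h2 hx
    obtain ⟨w, hw, u, hu, rfl⟩ := exists_box_decomp hv
    rw [map_add, shearDiff_zpoly_smul] at hv0
    obtain ⟨hw0, hu0⟩ := box_decomp_unique (shearDiff_memW hw) hv0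
    have hw' := (mem_invariants_lev hN1 hN h2 (boxW_le p _ hw)).2 hw0
    have hu' := (mem_invariants_lev hN1 hN h2 hu).2 hu0
    refine ⟨_, bar0_lev_mem_D2 hN1 hN h2 hw hw0, bar0 t (lev K N t u), ?_, ?_⟩
    · rw [bar0_eq hu']
      exact ⟨_, rfl⟩
    · have hz : z2p p * lev K N t u ∈ invariants (Hs K N (t + 2 * p)) := by
        rw [add_comm]
        exact mul_mem_invariants (z2p_mem hN h2) hu'
      have h := bar0_linear 1 hw' hz
      rw [one_smul, one_smul] at h
      rw [nu2p_mul_bar0 hN h2 hu', ← h, map_add, z2p_mul_lev hN p hu]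
  | h1 =>
    intro x hx
    obtain ⟨v, hv, rfl⟩ := exists_bar1 hN1 hN h2 hnorm hx
    obtain ⟨w, hw, u, hu, rfl⟩ := exists_box_decomp hv
    refine ⟨_, bar1_lev_mem_D2 hN1 hN h2 hnorm hw, bar1 t (lev K N t u), ?_, ?_⟩
    · rw [bar1_eq hnorm]
      exact ⟨_, rfl⟩
    · rw [nu2p_mul_bar1 hN1 hN h2 hnorm (lev_mem_Hs hu), map_add, z2p_mul_lev hN p hu]
      exact (bar1Lin hnorm _).map_add _ _
  | h r ih =>
    intro x hx
    obtain ⟨y, hy, rfl⟩ := (bijOn_mul_gam2 hnorm hN1 hN h2 r _).surjOn hx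
    obtain ⟨d, hd, e, he, rfl⟩ := ih y hy
    refine ⟨d * gam2, ?_, e * gam2, (bijOn_mul_gam2 hnorm hN1 hN h2 r t).mapsTo he, ?_⟩
    · rw [D2_add_two hnorm hN1 hN h2]
      exact ⟨d, hd, rfl⟩
    · show (d + nu2p p * e) * gam2 = _
      rw [add_mul, mul_assoc]

theorem nu2p_mul_mem (r : ℕ) {t : ℕ} : ∀ e ∈ Ers K N r t, nu2p p * e ∈ Ers K N r (t + 2 * p) := by
  induction r using column_induction with
  | h0 =>
    intro x hx
    obtain ⟨v, hv, hv0, rfl⟩ := exists_bar0 hN1 hN h2 hx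
    have hv' := (mem_invariants_lev hN1 hN h2 hv).2 hv0
    have hz : z2p p * lev K N t v ∈ invariants (Hs K N (t + 2 * p)) := by
      rw [add_comm]
      exact mul_mem_invariants (z2p_mem hN h2) hv'
    rw [nu2p_mul_bar0 hN h2 hv', bar0_eq hz]
    exact ⟨_, rfl⟩
  | h1 =>
    intro x hx
    obtain ⟨v, hv, rfl⟩ := exists_bar1 hN1 hN h2 hnorm hx
    rw [nu2p_mul_bar1 hN1 hN h2 hnorm (lev_mem_Hs hv), bar1_eq hnorm]
    exact ⟨_, rfl⟩
  | h r ih =>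
    intro x hx
    obtain ⟨y, hy, rfl⟩ := (bijOn_mul_gam2 hnorm hN1 hN h2 r _).surjOn hx
    show nu2p p * (y * gam2) ∈ _
    rw [← mul_assoc]
    exact (bijOn_mul_gam2 hnorm hN1 hN h2 r _).mapsTo (ih y hy)

/-- The decomposition `E_2 = D_2 ⊕ ν_{2p} E_2` is direct, and multiplication by `ν_{2p}` is
injective. -/
theorem decomp_unique (r : ℕ) {t : ℕ} : ∀ d ∈ D2 K N p r (t + 2 * p), ∀ e ∈ Ers K N r t,
    d + nu2p p * e = 0 → d = 0 ∧ e = 0 := by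
  induction r using column_induction with
  | h0 =>
    intro d hd e he h
    obtain ⟨w, hw, hw0, rfl⟩ := exists_bar0_of_mem_D2 hN1 hN h2 hd
    obtain ⟨u, hu, hu0, rfl⟩ := exists_bar0 hN1 hN h2 he
    have hw' := (mem_invariants_lev hN1 hN h2 (boxW_le p _ hw)).2 hw0
    have hu' := (mem_invariants_lev hN1 hN h2 hu).2 hu0
    have hz : z2p p * lev K N t u ∈ invariants (Hs K N (t + 2 * p)) := by
      rw [add_comm]
      exact mul_mem_invariants (z2p_mem hN h2) hu'
    have h3 := bar0_linear 1 hw' hz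
    rw [one_smul, one_smul] at h3
    have h00 : ∀ s, bar0 s (0 : HRing.{u} K N) = 0 := fun s => by
      have := bar0_linear 1 (Submodule.zero_mem (invariants (Hs K N s))) (Submodule.zero_mem _)
      rw [one_smul, one_smul, add_zero] at this
      exact left_eq_add.1 this
    rw [nu2p_mul_bar0 hN h2 hu', ← h3, ← h00] at h
    have h4 := bar0_injOn _ (Submodule.add_mem _ hw' hz) (Submodule.zero_mem _) h
    rw [z2p_mul_lev hN p hu, ← map_add] at h4
    have h5 := eq_zero_of_lev hN1 hN
      (Submodule.add_mem _ (boxW_le p _ hw) (zpoly_smul_mem p hu)) h4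
    obtain ⟨rfl, rfl⟩ := box_decomp_unique hw h5
    rw [map_zero, map_zero, h00, h00]
    exact ⟨rfl, rfl⟩
  | h1 =>
    intro d hd e he h
    obtain ⟨w, hw, rfl⟩ := exists_bar1_of_mem_D2 hN1 hN h2 hnorm hd
    obtain ⟨u, hu, rfl⟩ := exists_bar1 hN1 hN h2 hnorm he
    have h3 : bar1 (t + 2 * p) (lev K N (t + 2 * p) (w + zpoly K p • u)) = 0 := by
      rw [← h, nu2p_mul_bar1 hN1 hN h2 hnorm (lev_mem_Hs hu), map_add, z2p_mul_lev hN p hu]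
      exact (bar1Lin hnorm _).map_add _ _
    have hb := Submodule.add_mem _ (boxW_le p _ hw) (zpoly_smul_mem p hu)
    rw [bar1_eq_zero_iff hnorm hN1 (lev_mem_Hs hb), lev_mem_sigmaSubOne_iff hN1 hN h2 hb] at h3
    obtain ⟨v, hv, hv'⟩ := h3
    obtain ⟨w', hw', u', hu', rfl⟩ := exists_box_decomp hv
    rw [map_add, shearDiff_zpoly_smul, ← sub_eq_zero, add_sub_add_comm, ← smul_sub] at hv'
    obtain ⟨e1, e2⟩ := box_decomp_unique (Submodule.sub_mem _ (shearDiff_memW hw') hw) hv'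
    rw [bar1_eq_zero_iff hnorm hN1 (lev_mem_Hs (boxW_le p _ hw)),
      bar1_eq_zero_iff hnorm hN1 (lev_mem_Hs hu),
      lev_mem_sigmaSubOne_iff hN1 hN h2 (boxW_le p _ hw), lev_mem_sigmaSubOne_iff hN1 hN h2 hu]
    exact ⟨⟨w', boxW_le p _ hw', sub_eq_zero.1 e1⟩, ⟨u', hu', sub_eq_zero.1 e2⟩⟩
  | h r ih =>
    intro d hd e he h
    rw [D2_add_two hnorm hN1 hN h2] at hd
    obtain ⟨d, hd, rfl⟩ := hd
    obtain ⟨e', he', rfl⟩ := (bijOn_mul_gam2 hnorm hN1 hN h2 r _).surjOn he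
    have h3 : (d + nu2p p * e') * gam2 = 0 * gam2 := by
      rw [zero_mul, add_mul, mul_assoc]
      exact h
    have h4 := (bijOn_mul_gam2 hnorm hN1 hN h2 r (t + 2 * p)).injOn
      (Submodule.add_mem _ (D2_le_Ers p r _ hd) (nu2p_mul_mem hN1 hN h2 hnorm r e' he'))
      (Submodule.zero_mem _) h3
    obtain ⟨rfl, rfl⟩ := ih d hd e' he' h4
    exact ⟨zero_mul _, zero_mul _⟩

end decomposition

/-! ### Bases of `D_2` -/

section column_zero
variable {K : Type u} [Field K] {N : ℕ} [NeZero N]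

theorem one_mem_invariants : (1 : HRing.{u} K N) ∈ invariants (Hs K N 0) := by
  rw [mem_invariants]
  exact ⟨one_mem_Hs, by rw [act_eq, map_one]⟩

theorem bar0_one : bar0 0 (1 : HRing.{u} K N) = 1 := by
  rw [bar0_eq one_mem_invariants]
  refine congrArg (DirectSum.of (E2 K (heisAction.{u} N)) (0, 0))
    (congrArg (E2.mk K _ 0 0) (Subtype.ext (funext fun x => ?_)))
  exact DirectSum.of_eq_same (β := Coh K (BaseM.{u} N)) 0 _

theorem x2_mem_invariants : (x2 : HRing.{u} K N) ∈ invariants (Hs K N 2) :=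
  mem_invariants.2 ⟨x2_mem, act_x2 _⟩

theorem lam2_pow (i : ℕ) :
    (x2 : HRing.{u} K N) ^ i ∈ invariants (Hs K N (2 * i)) ∧
      (lam2 : ERing.{u} K N) ^ i = bar0 (2 * i) (x2 ^ i) := by
  induction i with
  | zero => exact ⟨one_mem_invariants, bar0_one.symm⟩
  | succ i ih =>
    refine ⟨?_, ?_⟩
    · exact mul_mem_invariants ih.1 x2_mem_invariants
    · rw [pow_succ, ih.2, lam2, bar0_mul_bar0 ih.1 x2_mem_invariants]
      rfl

theorem lam2_pow_mul_bar0 (i : ℕ) {s : ℕ} {w : HRing.{u} K N} (hw : w ∈ invariants (Hs K N s)) :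
    lam2 ^ i * bar0 s w = bar0 (2 * i + s) (x2 ^ i * w) := by
  rw [(lam2_pow i).2, bar0_mul_bar0 (lam2_pow i).1 hw]

variable (hN : (N : K) = 0)
include hN

theorem x1_mem_invariants : (x1 : HRing.{u} K N) ∈ invariants (Hs K N 1) :=
  mem_invariants.2 ⟨x1_mem, act_x1 hN _⟩

variable (h2 : (2 : K) ≠ 0)
include h2

theorem x1_mul_y1_mem_invariants : (x1 * y1 : HRing.{u} K N) ∈ invariants (Hs K N 2) := by
  have hd : (x1 * y1 : HRing.{u} K N) ∈ Hs K N (1 + 1) := mul_mem_Hs x1_mem y1_mem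
  refine mem_invariants.2 ⟨hd, ?_⟩
  have h := act_y1 (K := K) (N := N) hN 1
  rw [pow_one, Nat.cast_one, one_smul] at h
  rw [act_eq, map_mul, ← act_eq, ← act_eq, h, act_x1 hN, mul_add, x1_sq hN h2, add_zero]

omit h2 in
theorem nu3_mem_invariants :
    (x1 * y2 - y1 * x2 : HRing.{u} K N) ∈ invariants (Hs K N 3) := by
  have hd : (x1 * y2 : HRing.{u} K N) ∈ Hs K N (1 + 2) := mul_mem_Hs x1_mem y2_mem
  have hd' : (y1 * x2 : HRing.{u} K N) ∈ Hs K N (1 + 2) := mul_mem_Hs y1_mem x2_mem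
  refine mem_invariants.2 ⟨Submodule.sub_mem _ hd hd', ?_⟩
  have h := act_y1 (K := K) (N := N) hN 1
  have h' := act_y2 (K := K) (N := N) 1
  rw [pow_one, Nat.cast_one, one_smul] at h h'
  rw [act_eq, map_sub, map_mul, map_mul, ← act_eq, ← act_eq, ← act_eq, ← act_eq, h, h', act_x1 hN,
    act_x2, mul_add, add_mul, add_sub_add_right_eq_sub]

omit h2 in
theorem lam1_mul_bar0 {s : ℕ} {w : HRing.{u} K N} (hw : w ∈ invariants (Hs K N s)) :
    lam1 * bar0 s w = bar0 (1 + s) (x1 * w) := bar0_mul_bar0 (x1_mem_invariants hN) hw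

end column_zero

section bases
variable {K : Type u} [Field K] {N : ℕ} [NeZero N] {p : ℕ} [Fact p.Prime] [CharP K p]
  (hN1 : 1 < N) (hN : (N : K) = 0) (h2 : (2 : K) ≠ 0)

omit [NeZero N] [Fact p.Prime] [CharP K p] in
/-- On invariants, where it has no junk value, the class in column zero is the restriction of a
linear map. -/
theorem exists_bar0Lin (s : ℕ) : ∃ L : HRing.{u} K N →ₗ[K] ERing.{u} K N,
    ∀ w ∈ invariants (Hs K N s), L w = bar0 s w := by
  let g : invariants (Hs K N s) →ₗ[K] ERing.{u} K N :=
    { toFun := fun w => bar0 s w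
      map_add' := fun w w' => by
        have := bar0_linear 1 w.2 w'.2
        rwa [one_smul, one_smul] at this
      map_smul' := fun c w => by
        have h0 := bar0_linear 1 (Submodule.zero_mem (invariants (Hs K N s))) (Submodule.zero_mem _)
        rw [one_smul, one_smul, add_zero] at h0
        have := bar0_linear c w.2 (Submodule.zero_mem _)
        rwa [left_eq_add.1 h0, add_zero, add_zero] at this }
  obtain ⟨L, hL⟩ := g.exists_extend
  exact ⟨L, fun w hw => LinearMap.congr_fun hL ⟨w, hw⟩⟩

omit [NeZero N] [Fact p.Prime] [CharP K p] in
theorem IsBasisOf.map_bar0 {ι : Type*} {s : ℕ} {v : ι → HRing.{u} K N}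
    (h : IsBasisOf v (invariants (Ws K N p s))) :
    IsBasisOf (bar0 s ∘ v) (D2 K N p 0 s) := by
  obtain ⟨L, hL⟩ := exists_bar0Lin (K := K) (N := N) s
  have hle : invariants (Ws K N p s) ≤ invariants (Hs K N s) := invariants_mono inf_le_right
  have h1 := h.map L fun w hw w' hw' e => bar0_injOn s (hle hw) (hle hw') <| by
    rwa [← hL w (hle hw), ← hL w' (hle hw')]
  have e1 : (invariants (Ws K N p s)).map L = D2 K N p 0 s := by
    apply SetLike.coe_injective
    rw [← bar0_image_W, Submodule.map_coe]
    exact Set.image_congr fun w hw => hL w (hle hw)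
  have e2 : L ∘ v = bar0 s ∘ v := funext fun i =>
    hL _ (hle (h.2 ▸ Submodule.subset_span (Set.mem_range_self i)))
  rwa [e1, e2] at h1

include hN1 hN h2

theorem isBasisOf_D2_zero_zero : IsBasisOf (![1] : Fin 1 → ERing.{u} K N) (D2 K N p 0 0) := by
  convert (isBasisOf_invariants_zero (p := p) hN1 hN h2).map_bar0 using 1
  funext k
  fin_cases k
  exact bar0_one.symm

theorem isBasisOf_D2_zero_one : IsBasisOf (![lam1] : Fin 1 → ERing.{u} K N) (D2 K N p 0 1) := by
  convert (isBasisOf_invariants_one (p := p) hN1 hN h2).map_bar0 using 1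
  funext k
  fin_cases k
  rfl

theorem isBasisOf_D2_zero_even {i : ℕ} (hi : 1 ≤ i) :
    IsBasisOf (![lam2 ^ i, lam2 ^ (i - 1) * nu2] : Fin 2 → ERing.{u} K N)
      (D2 K N p 0 (2 * i)) := by
  convert (isBasisOf_invariants_even (p := p) hN1 hN h2 hi).map_bar0 using 1
  funext k
  fin_cases k
  · exact (lam2_pow i).2
  · refine (lam2_pow_mul_bar0 (i - 1) (x1_mul_y1_mem_invariants hN h2)).trans ?_
    have hc : Commute (x1 * y1 : HRing.{u} K N) (x2 ^ (i - 1)) :=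
      ((x1_comm_x2 hN).mul_left (y1_comm_x2 hN)).pow_right _
    rw [← hc.eq, show 2 * (i - 1) + 2 = 2 * i by omega]
    rfl

theorem isBasisOf_D2_zero_odd {i : ℕ} (hi : 1 ≤ i) :
    IsBasisOf (![lam1 * lam2 ^ i, lam2 ^ (i - 1) * nu3] : Fin 2 → ERing.{u} K N)
      (D2 K N p 0 (2 * i + 1)) := by
  convert (isBasisOf_invariants_odd (p := p) hN1 hN h2 hi).map_bar0 using 1
  funext k
  fin_cases k
  · show lam1 * lam2 ^ i = _
    rw [(lam2_pow i).2, lam1_mul_bar0 hN (lam2_pow i).1, add_comm]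
    rfl
  · refine (lam2_pow_mul_bar0 (i - 1) (nu3_mem_invariants hN)).trans ?_
    have hc : Commute (x1 * y2 - y1 * x2 : HRing.{u} K N) (x2 ^ (i - 1)) :=
      (((x1_comm_x2 hN).mul_left (x2_comm_y2.symm)).sub_left
        ((y1_comm_x2 hN).mul_left (Commute.refl x2))).pow_right _
    rw [← hc.eq, show 2 * (i - 1) + 3 = 2 * i + 1 by omega]
    rfl

variable (hnorm : ∀ w : HRing.{u} K N, ∑ i ∈ Finset.range N, act (Cyc.gen N ^ i) w = 0)
include hnorm

omit [Fact p.Prime] [CharP K p] in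
/-- A basis in columns zero and one gives bases in all columns. -/
theorem IsBasisOf.mul_gam2_pow {ι : Type*} {r s : ℕ} {v : ι → ERing.{u} K N}
    (h : IsBasisOf v (D2 K N p r s)) (j : ℕ) :
    IsBasisOf (fun k => v k * gam2 ^ j) (D2 K N p (r + 2 * j) s) := by
  rw [D2_add_two_mul hnorm hN1 hN h2]
  exact h.map (LinearMap.mulRight K (gam2 ^ j))
    ((bijOn_mul_gam2_pow hnorm hN1 hN h2 r s j).injOn.mono (D2_le_Ers p r s))

omit [Fact p.Prime] [CharP K p] h2 in
/-- The sign comes from the product of the second page. -/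
theorem lam1_mul_bar1 {s : ℕ} {w : HRing.{u} K N} (hw : w ∈ Hs K N s) :
    lam1 * bar1 s w = -bar1 (1 + s) (x1 * w) := by
  rw [lam1, bar0_mul_bar1 hnorm hN1 (x1_mem_invariants hN) hw, pow_one, neg_one_smul]

omit [Fact p.Prime] [CharP K p] hN h2 in
theorem lam2_pow_mul_bar1 (i : ℕ) {s : ℕ} {w : HRing.{u} K N} (hw : w ∈ Hs K N s) :
    lam2 ^ i * bar1 s w = bar1 (2 * i + s) (x2 ^ i * w) := by
  rw [(lam2_pow i).2, bar0_mul_bar1 hnorm hN1 (lam2_pow i).1 hw, pow_mul, neg_one_sq, one_pow,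
    one_smul]

omit hN1 hN h2 hnorm [Fact p.Prime] [CharP K p] [NeZero N] in
theorem mu_even {k : ℕ} (hk : 1 ≤ k) :
    (mu (2 * k) : ERing.{u} K N) = bar1 (2 * (k - 1) + 1) (y1 * y2 ^ (k - 1)) := by
  rw [mu, if_pos (even_two_mul k), Nat.mul_div_cancel_left k two_pos,
    show 2 * k - 1 = 2 * (k - 1) + 1 by omega]

omit hN1 hN h2 hnorm [Fact p.Prime] [CharP K p] [NeZero N] in
theorem mu_odd (k : ℕ) : (mu (2 * k + 1) : ERing.{u} K N) = bar1 (2 * k) (y2 ^ k) := by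
  rw [mu, if_neg (by simp), show (2 * k + 1) / 2 = k by omega, Nat.add_sub_cancel]

omit hN1 hN h2 hnorm [Fact p.Prime] [CharP K p] [NeZero N] in
theorem y2_pow_mem (k : ℕ) : (y2 : HRing.{u} K N) ^ k ∈ Hs K N (2 * k) := by
  rw [mul_comm]
  exact pow_mem_Hs y2_mem k

omit hN1 hN h2 hnorm [Fact p.Prime] [CharP K p] [NeZero N] in
theorem y1_mul_y2_pow_mem (k : ℕ) : (y1 * y2 ^ k : HRing.{u} K N) ∈ Hs K N (2 * k + 1) := by
  rw [add_comm]
  exact mul_mem_Hs y1_mem (y2_pow_mem k)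

omit [Fact p.Prime] [CharP K p] hN h2 in
theorem lam2_pow_mul_mu_odd (j k : ℕ) : lam2 ^ j * (mu (2 * k + 1) : ERing.{u} K N) =
    bar1Lin hnorm (2 * (j + k)) (lev K N (2 * (j + k)) (Polynomial.X ^ k, 0)) := by
  rw [mu_odd, lam2_pow_mul_bar1 hN1 hnorm j (y2_pow_mem k), bar1Lin_apply, ← mul_add,
    lev_inl_even (Nat.le_add_left k j), Nat.add_sub_cancel]

omit [Fact p.Prime] [CharP K p] h2 in
theorem lam2_pow_mul_mu_even (j k : ℕ) : lam2 ^ j * (mu (2 * (k + 1)) : ERing.{u} K N) =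
    bar1Lin hnorm (2 * (j + k) + 1) (lev K N (2 * (j + k) + 1) (0, Polynomial.X ^ k)) := by
  have hc : Commute (y1 : HRing.{u} K N) (x2 ^ j) := (y1_comm_x2 hN).pow_right j
  rw [mu_even (Nat.le_add_left 1 k), Nat.add_sub_cancel,
    lam2_pow_mul_bar1 hN1 hnorm j (y1_mul_y2_pow_mem k), bar1Lin_apply, ← add_assoc, ← mul_add,
    lev_inr_odd (Nat.le_add_left k j), Nat.add_sub_cancel, ← mul_assoc, ← hc.eq, mul_assoc]

omit [Fact p.Prime] [CharP K p] h2 in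
theorem lam1_mul_lam2_pow_mul_mu_odd (j k : ℕ) :
    lam1 * lam2 ^ j * (mu (2 * k + 1) : ERing.{u} K N) =
      (-1 : K) • bar1Lin hnorm (2 * (j + k) + 1)
        (lev K N (2 * (j + k) + 1) (Polynomial.X ^ k, 0)) := by
  have hm : lev K N (2 * (j + k)) (Polynomial.X ^ k, 0) ∈ Hs K N (2 * (j + k)) :=
    lev_mem_Hs ⟨X_pow_mem.2 (by omega), Submodule.zero_mem _⟩
  rw [mul_assoc, lam2_pow_mul_mu_odd hN1 hnorm, bar1Lin_apply, lam1_mul_bar1 hN1 hN hnorm hm,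
    neg_one_smul, bar1Lin_apply, add_comm 1, lev_inl_odd (Nat.le_add_left k j),
    lev_inl_even (Nat.le_add_left k j)]

omit [Fact p.Prime] [CharP K p] h2 in
theorem lam1_mul_lam2_pow_mul_mu_even (j k : ℕ) :
    lam1 * lam2 ^ j * (mu (2 * (k + 1)) : ERing.{u} K N) =
      (-1 : K) • bar1Lin hnorm (2 * (j + k + 1))
        (lev K N (2 * (j + k + 1)) (0, Polynomial.X ^ k)) := by
  have hm : lev K N (2 * (j + k) + 1) (0, Polynomial.X ^ k) ∈ Hs K N (2 * (j + k) + 1) :=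
    lev_mem_Hs ⟨Submodule.zero_mem _, X_pow_mem.2 (by omega)⟩
  rw [mul_assoc, lam2_pow_mul_mu_even hN1 hN hnorm, bar1Lin_apply, lam1_mul_bar1 hN1 hN hnorm hm,
    neg_one_smul, bar1Lin_apply, show 1 + (2 * (j + k) + 1) = 2 * (j + k + 1) by ring,
    lev_inr_even (by omega), lev_inr_odd (Nat.le_add_left k j), ← mul_assoc,
    show j + k + 1 - 1 - k = j + k - k by omega]

omit [Fact p.Prime] in
theorem bar1Lin_lev_eq_zero_iff (s : ℕ) : ∀ u ∈ boxW K p s,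
    (bar1Lin hnorm s ∘ₗ lev K N s) u = 0 ↔ u ∈ (boxW K p s).map (shearDiff K s) := by
  intro u hu
  have hw : lev K N s u ∈ Ws K N p s := by
    rw [Ws_eq]
    exact ⟨u, hu, rfl⟩
  refine (bar1_eq_zero_iff_of_mem_Ws hN1 hN h2 hnorm p hw).trans ?_
  rw [Ws_eq, sigmaSubOne_map hN h2 (boxW_le p s)]
  constructor
  · rintro ⟨_, ⟨v, hv, rfl⟩, h⟩
    exact ⟨v, hv, lev_injOn hN1 hN s (shearDiff_memH (boxW_le p s hv)) (boxW_le p s hu) h⟩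
  · exact fun h => ⟨u, h, rfl⟩

omit [Fact p.Prime] [CharP K p] in
theorem map_bar1Lin_lev (s : ℕ) :
    (boxW K p s).map (bar1Lin hnorm s ∘ₗ lev K N s) = D2 K N p 1 s := by
  apply SetLike.coe_injective
  rw [← bar1_image_W hnorm hN1 p s (act_mem_Ws hN h2 p s), Ws_eq, Submodule.map_comp]
  rfl

theorem isBasisOf_D2_one_zero : IsBasisOf (![gam1] : Fin 1 → ERing.{u} K N) (D2 K N p 1 0) := by
  have h := isBasisOf_coker_zero _ (bar1Lin_lev_eq_zero_iff (p := p) hN1 hN h2 hnorm 0)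
  rw [map_bar1Lin_lev hN1 hN h2] at h
  convert h using 3
  exact congrArg (bar1 0) one_eq_lev

theorem isBasisOf_D2_one_one : IsBasisOf (![mu 2] : Fin 1 → ERing.{u} K N) (D2 K N p 1 1) := by
  have h := isBasisOf_coker_one _ (bar1Lin_lev_eq_zero_iff (p := p) hN1 hN h2 hnorm 1)
  rw [map_bar1Lin_lev hN1 hN h2] at h
  convert h using 3
  have := lam2_pow_mul_mu_even hN1 hN hnorm 0 0
  rwa [pow_zero, one_mul, pow_zero] at this

theorem isBasisOf_D2_one_even_of_lt {i : ℕ} (hi : 1 ≤ i) (hip : i < p) :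
    IsBasisOf (![mu (2 * i + 1), lam1 * mu (2 * i)] : Fin 2 → ERing.{u} K N)
      (D2 K N p 1 (2 * i)) := by
  have h := isBasisOf_coker_even _ hi (bar1Lin_lev_eq_zero_iff (p := p) hN1 hN h2 hnorm (2 * i))
  rw [map_bar1Lin_lev hN1 hN h2, min_eq_left (by omega), min_eq_left (by omega)] at h
  have h' := h.smul_pair (one_ne_zero (α := K)) (neg_ne_zero.2 one_ne_zero)
  obtain ⟨i, rfl⟩ := Nat.exists_eq_add_of_le' hi
  convert h' using 3
  · have := lam2_pow_mul_mu_odd hN1 hnorm 0 (i + 1)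
    rw [pow_zero, one_mul, zero_add] at this
    rw [one_smul]
    exact this
  · have := lam1_mul_lam2_pow_mul_mu_even hN1 hN hnorm 0 i
    rw [pow_zero, mul_one, zero_add] at this
    rw [this]
    rfl

theorem isBasisOf_D2_one_odd_of_lt {i : ℕ} (hi : 1 ≤ i) (hip : i < p) :
    IsBasisOf (![mu (2 * i + 1 + 1), lam1 * mu (2 * i + 1)] : Fin 2 → ERing.{u} K N)
      (D2 K N p 1 (2 * i + 1)) := by
  have h := isBasisOf_coker_odd _ hi
    (bar1Lin_lev_eq_zero_iff (p := p) hN1 hN h2 hnorm (2 * i + 1))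
  rw [map_bar1Lin_lev hN1 hN h2, min_eq_left (by omega)] at h
  convert h.swap.smul_pair (one_ne_zero (α := K)) (neg_ne_zero.2 one_ne_zero) using 3
  · have := lam2_pow_mul_mu_even hN1 hN hnorm 0 i
    rw [pow_zero, one_mul, zero_add] at this
    rw [one_smul]
    exact this
  · have := lam1_mul_lam2_pow_mul_mu_odd hN1 hN hnorm 0 i
    rw [pow_zero, mul_one, zero_add] at this
    rw [this]
    rfl

theorem isBasisOf_D2_one_even_of_le {i : ℕ} (hi : p ≤ i) :
    IsBasisOf (![lam1 * lam2 ^ (i - p) * mu (2 * p), lam2 ^ (i - p + 1) * mu (2 * p - 1)] :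
      Fin 2 → ERing.{u} K N) (D2 K N p 1 (2 * i)) := by
  have hp := (Fact.out : p.Prime).pos
  have h := isBasisOf_coker_even _ (hp.trans_le hi)
    (bar1Lin_lev_eq_zero_iff (p := p) hN1 hN h2 hnorm (2 * i))
  rw [map_bar1Lin_lev hN1 hN h2, min_eq_right (by omega), min_eq_right (by omega)] at h
  convert h.swap.smul_pair (neg_ne_zero.2 one_ne_zero) (one_ne_zero (α := K)) using 3
  · have := lam1_mul_lam2_pow_mul_mu_even hN1 hN hnorm (i - p) (p - 1)
    rw [show i - p + (p - 1) + 1 = i by omega, Nat.sub_add_cancel hp] at this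
    rw [this]
    rfl
  · have := lam2_pow_mul_mu_odd hN1 hnorm (i - p + 1) (p - 1)
    rw [show i - p + 1 + (p - 1) = i by omega, show 2 * (p - 1) + 1 = 2 * p - 1 by omega] at this
    rw [one_smul, this]
    rfl

theorem isBasisOf_D2_one_odd_of_le {i : ℕ} (hi : p ≤ i) :
    IsBasisOf (![lam2 ^ (i - p + 1) * mu (2 * p), lam1 * lam2 ^ (i - p + 1) * mu (2 * p - 1)] :
      Fin 2 → ERing.{u} K N) (D2 K N p 1 (2 * i + 1)) := by
  have hp := (Fact.out : p.Prime).pos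
  have h := isBasisOf_coker_odd _ (hp.trans_le hi)
    (bar1Lin_lev_eq_zero_iff (p := p) hN1 hN h2 hnorm (2 * i + 1))
  rw [map_bar1Lin_lev hN1 hN h2, min_eq_right (by omega)] at h
  convert h.swap.smul_pair (one_ne_zero (α := K)) (neg_ne_zero.2 one_ne_zero) using 3
  · have := lam2_pow_mul_mu_even hN1 hN hnorm (i - p + 1) (p - 1)
    rw [show i - p + 1 + (p - 1) = i by omega, Nat.sub_add_cancel hp] at this
    rw [one_smul, this]
    rfl
  · have := lam1_mul_lam2_pow_mul_mu_odd hN1 hN hnorm (i - p + 1) (p - 1)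
    rw [show i - p + 1 + (p - 1) = i by omega, show 2 * (p - 1) + 1 = 2 * p - 1 by omega] at this
    rw [this]
    rfl

end bases

/-! ### The second page as `K[ν_{2p}] ⊗ D_2` -/

section components
variable {K : Type u} [Field K] {N : ℕ}

variable (K N) in
/-- The projection of the second page onto `E_2^{r,s}`. -/
def projE (rs : ℕ × ℕ) : ERing.{u} K N →ₗ[K] ERing.{u} K N :=
  DirectSum.lof K (ℕ × ℕ) (E2 K (heisAction.{u} N)) rs ∘ₗ
    DirectSum.component K (ℕ × ℕ) (E2 K (heisAction.{u} N)) rs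

theorem projE_eq_self {r s : ℕ} {z : ERing.{u} K N} (hz : z ∈ Ers K N r s) :
    projE K N (r, s) z = z := by
  obtain ⟨a, rfl⟩ := hz
  exact congrArg (DirectSum.lof K (ℕ × ℕ) (E2 K (heisAction.{u} N)) (r, s))
    (DirectSum.component.lof_self K _ a)

theorem projE_eq_zero {r s : ℕ} {rs : ℕ × ℕ} (h : (r, s) ≠ rs) {z : ERing.{u} K N}
    (hz : z ∈ Ers K N r s) : projE K N rs z = 0 := by
  obtain ⟨a, rfl⟩ := hz
  have h1 := DirectSum.of_eq_of_ne (β := E2 K (heisAction.{u} N)) (r, s) rs a h.symm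
  exact (congrArg (DirectSum.lof K (ℕ × ℕ) (E2 K (heisAction.{u} N)) rs) h1).trans (map_zero _)

theorem projE_mem (r s : ℕ) (z : ERing.{u} K N) : projE K N (r, s) z ∈ Ers K N r s := ⟨_, rfl⟩

theorem eq_zero_of_projE {z : ERing.{u} K N} (h : ∀ r s, projE K N (r, s) z = 0) : z = 0 := by
  refine DFinsupp.ext fun rs => ?_
  exact DirectSum.of_injective (β := E2 K (heisAction.{u} N)) rs
    ((h rs.1 rs.2).trans (map_zero _).symm)

theorem ERing.induction {P : ERing.{u} K N → Prop} (h0 : P 0)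
    (h : ∀ r s, ∀ z ∈ Ers K N r s, P z) (hadd : ∀ z w, P z → P w → P (z + w)) (z) : P z := by
  induction z using DirectSum.induction_on with
  | zero => exact h0
  | of rs a => exact h rs.1 rs.2 _ ⟨a, rfl⟩
  | add z w hz hw => exact hadd z w hz hw

theorem projE_mem_D2 {p : ℕ} (r s : ℕ) {d : ERing.{u} K N} (hd : d ∈ D2tot K N p) :
    projE K N (r, s) d ∈ D2 K N p r s := by
  suffices h : D2tot K N p ≤ (D2 K N p r s).comap (projE K N (r, s)) from h hd
  refine iSup_le fun r' => iSup_le fun s' => ?_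
  intro d hd
  rw [Submodule.mem_comap]
  by_cases h : (r', s') = (r, s)
  · obtain ⟨rfl, rfl⟩ := Prod.mk.inj h
    rwa [projE_eq_self (D2_le_Ers p _ _ hd)]
  · rw [projE_eq_zero h (D2_le_Ers p _ _ hd)]
    exact Submodule.zero_mem _

end components

section tensor
variable {K : Type u} [Field K] {N : ℕ} [NeZero N] {p : ℕ} [CharP K p]
  (hN1 : 1 < N) (hN : (N : K) = 0) (h2 : (2 : K) ≠ 0)
  (hnorm : ∀ w : HRing.{u} K N, ∑ i ∈ Finset.range N, act (Cyc.gen N ^ i) w = 0)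
include hN1 hN h2 hnorm

/-- A subspace that contains a column of `D_2` and is closed under multiplication by `ν_{2p}`
contains that column of the second page. -/
theorem Ers_le_of_D2_le (hp : 0 < p) {A : Submodule K (ERing.{u} K N)} {r : ℕ}
    (hA : ∀ a ∈ A, nu2p p * a ∈ A) (hD : ∀ s, D2 K N p r s ≤ A) (s : ℕ) : Ers K N r s ≤ A := by
  induction s using Nat.strong_induction_on with
  | _ s ih =>
    rcases lt_or_ge s (2 * p) with hs | hs
    · exact (Ers_le_D2 hN1 hN h2 hnorm r hs).trans (hD s)
    · obtain ⟨t, rfl⟩ := Nat.exists_eq_add_of_le' hs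
      intro x hx
      obtain ⟨d, hd, e, he, rfl⟩ := exists_decomp hN1 hN h2 hnorm r x hx
      exact Submodule.add_mem _ (hD _ hd) (hA e (ih t (by omega) he))

/-- Multiplication by `ν_{2p}` is homogeneous. -/
theorem projE_nu2p_mul (r t : ℕ) (e : ERing.{u} K N) :
    projE K N (r, t + 2 * p) (nu2p p * e) = nu2p p * projE K N (r, t) e := by
  induction e using ERing.induction with
  | h0 => simp only [mul_zero, map_zero]
  | h r' s' z hz =>
    by_cases h : (r', s') = (r, t)
    · obtain ⟨rfl, rfl⟩ := Prod.mk.inj h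
      rw [projE_eq_self hz, projE_eq_self (nu2p_mul_mem hN1 hN h2 hnorm r' z hz)]
    · rw [projE_eq_zero h hz, mul_zero, projE_eq_zero ?_ (nu2p_mul_mem hN1 hN h2 hnorm r' z hz)]
      intro h'
      obtain ⟨h1, h3⟩ := Prod.mk.inj h'
      exact h (Prod.ext h1 (by simpa using h3))
  | hadd z w hz hw => simp only [mul_add, map_add, hz, hw]

/-- The decomposition `E_2 = D_2 ⊕ ν_{2p} E_2` for inhomogeneous elements. -/
theorem D2tot_add_nu2p_mul {d : ERing.{u} K N} (hd : d ∈ D2tot K N p) {e : ERing.{u} K N}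
    (h : d + nu2p p * e = 0) : d = 0 ∧ e = 0 := by
  have he : e = 0 := by
    refine eq_zero_of_projE fun r t => ?_
    have h1 := congrArg (projE K N (r, t + 2 * p)) h
    rw [map_add, map_zero, projE_nu2p_mul hN1 hN h2 hnorm] at h1
    exact (decomp_unique hN1 hN h2 hnorm r _ (projE_mem_D2 r _ hd) _ (projE_mem r t e) h1).2
  rw [he, mul_zero, add_zero] at h
  exact ⟨h, he⟩

/-- The powers of `ν_{2p}` are linearly independent over `D_2`. -/
theorem eq_zero_of_sum_nu2p_pow (n : ℕ) : ∀ g : ℕ → D2tot K N p,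
    ∑ i ∈ Finset.range n, nu2p p ^ i * (g i : ERing.{u} K N) = 0 → ∀ i < n, g i = 0 := by
  induction n with
  | zero => exact fun g _ i hi => absurd hi (Nat.not_lt_zero i)
  | succ n ih =>
    intro g h i hi
    have e : ∑ i ∈ Finset.range (n + 1), nu2p p ^ i * (g i : ERing.{u} K N) =
        (g 0 : ERing.{u} K N) + nu2p p * ∑ i ∈ Finset.range n, nu2p p ^ i * (g (i + 1) : ERing.{u} K N) := by
      rw [Finset.sum_range_succ', pow_zero, one_mul, add_comm, Finset.mul_sum]
      simp only [pow_succ', mul_assoc]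
    obtain ⟨h0, h1⟩ := D2tot_add_nu2p_mul hN1 hN h2 hnorm (g 0).2 (e ▸ h)
    rcases i with _ | i
    · exact Subtype.ext h0
    · exact ih (fun i => g (i + 1)) h1 i (by omega)

omit hN1 hN h2 hnorm [CharP K p] [NeZero N] in
theorem tensorMul_tmul (f : Polynomial K) (d : D2tot K N p) :
    tensorMul K N p (TensorProduct.tmul K f d) =
      Polynomial.aeval (nu2p p : ERing.{u} K N) f * d := rfl

theorem tensorMul_injective : Function.Injective (tensorMul.{u} K N p) := by
  rw [injective_iff_map_eq_zero]
  intro x hx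
  let b := TensorProduct.equivFinsuppOfBasisLeft (N := D2tot.{u} K N p) (Polynomial.basisMonomials K)
  obtain ⟨f, rfl⟩ := b.symm.surjective x
  have e : tensorMul.{u} K N p (b.symm f) =
      f.sum fun i d => nu2p p ^ i * (d : ERing.{u} K N) := by
    rw [TensorProduct.equivFinsuppOfBasisLeft_symm_apply, map_finsuppSum]
    refine Finsupp.sum_congr fun i _ => ?_
    rw [tensorMul_tmul, Polynomial.coe_basisMonomials, Polynomial.aeval_monomial, map_one, one_mul]
  obtain ⟨n, hn⟩ := f.support.exists_nat_subset_range
  rw [e, Finsupp.sum_of_support_subset f hn _ (fun i _ => by rw [ZeroMemClass.coe_zero, mul_zero])]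
    at hx
  have hf : f = 0 := by
    ext1 i
    by_cases hi : i < n
    · exact eq_zero_of_sum_nu2p_pow hN1 hN h2 hnorm n f hx i hi
    · exact Finsupp.notMem_support_iff.1 fun h => hi (Finset.mem_range.1 (hn h))
  rw [hf, map_zero]

theorem tensorMul_surjective (hp : 0 < p) : Function.Surjective (tensorMul.{u} K N p) := by
  rw [← LinearMap.range_eq_top, eq_top_iff]
  rintro z -
  have hA : ∀ a ∈ LinearMap.range (tensorMul.{u} K N p),
      nu2p p * a ∈ LinearMap.range (tensorMul.{u} K N p) := by
    rintro _ ⟨x, rfl⟩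
    induction x with
    | zero =>
      rw [map_zero, mul_zero]
      exact Submodule.zero_mem _
    | add x y hx hy =>
      rw [map_add, mul_add]
      exact Submodule.add_mem _ hx hy
    | tmul f d =>
      refine ⟨TensorProduct.tmul K (Polynomial.X * f) d, ?_⟩
      rw [tensorMul_tmul, tensorMul_tmul, map_mul, Polynomial.aeval_X, mul_assoc]
  induction z using ERing.induction with
  | h0 => exact Submodule.zero_mem _
  | hadd z w hz hw => exact Submodule.add_mem _ hz hw
  | h r s z hz =>
    refine Ers_le_of_D2_le hN1 hN h2 hnorm hp hA (fun s d hd => ?_) s hz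
    refine ⟨TensorProduct.tmul K 1 ⟨d, ?_⟩, ?_⟩
    · exact (le_iSup (fun s => D2 K N p r s) s).trans (le_iSup (fun r => ⨆ s, D2 K N p r s) r) hd
    · rw [tensorMul_tmul, map_one, one_mul]

end tensor

/-! ### A normal form in the algebra of column zero -/

open Polynomial

theorem commute_aeval {K A : Type*} [CommSemiring K] [Semiring A] [Algebra K A] {x y : A}
    (h : Commute x y) (f : K[X]) : Commute (aeval x f) y :=
  Algebra.commute_of_mem_adjoin_singleton_of_commute (aeval_mem_adjoin_singleton K x) h.symm |>.symm

namespace ColAlg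
variable {K : Type u} [Field K]

theorem induction {P : ColAlg K → Prop} (h0 : ∀ c : K, P (algebraMap K _ c))
    (h1 : ∀ a, P (gen K a)) (hmul : ∀ x y, P x → P y → P (x * y))
    (hadd : ∀ x y, P x → P y → P (x + y)) (x : ColAlg K) : P x := by
  obtain ⟨x, rfl⟩ := RingQuot.mkAlgHom_surjective K (ColRel K) x
  induction x using FreeAlgebra.induction with
  | grade0 c =>
    rw [AlgHom.commutes]
    exact h0 c
  | grade1 a => exact h1 a
  | mul x y hx hy =>
    rw [map_mul]
    exact hmul _ _ hx hy
  | add x y hx hy =>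
    rw [map_add]
    exact hadd _ _ hx hy

variable (K) in
/-- Graded commutativity of the generators. -/
theorem gen_mul_gen (a b : ColGen) :
    gen K a * gen K b = (-1 : K) ^ (a.deg * b.deg) • (gen K b * gen K a) := by
  have h := RingQuot.mkAlgHom_rel K (ColRel.comm (K := K) a b)
  rwa [map_mul, map_smul, map_mul] at h

variable (K)

theorem commute_l2 (a : ColGen) : Commute (gen K .l2) (gen K a) := by
  have h := gen_mul_gen K .l2 a
  rw [show ColGen.l2.deg = 2 from rfl, pow_mul, neg_one_sq, one_pow, one_smul] at h
  exact h

theorem commute_n2 (a : ColGen) : Commute (gen K .n2) (gen K a) := by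
  have h := gen_mul_gen K .n2 a
  rw [show ColGen.n2.deg = 2 from rfl, pow_mul, neg_one_sq, one_pow, one_smul] at h
  exact h

theorem n2_mul_n2 : gen K .n2 * gen K .n2 = 0 := by
  have h := RingQuot.mkAlgHom_rel K (ColRel.nu2_sq (K := K))
  rwa [map_pow, map_zero, pow_two] at h

theorem l1_mul_n2 : gen K .l1 * gen K .n2 = 0 := by
  have h := RingQuot.mkAlgHom_rel K (ColRel.lam1_nu2 (K := K))
  rwa [map_mul, map_zero] at h

theorem n2_mul_n3 : gen K .n2 * gen K .n3 = 0 := by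
  have h := RingQuot.mkAlgHom_rel K (ColRel.nu2_nu3 (K := K))
  rwa [map_mul, map_zero] at h

theorem l1_mul_n3 : gen K .l1 * gen K .n3 = (-1 : K) • (gen K .l2 * gen K .n2) := by
  have h := RingQuot.mkAlgHom_rel K (ColRel.lam1_nu3 (K := K))
  rw [map_add, map_mul, map_mul, map_zero] at h
  exact (eq_neg_of_add_eq_zero_left h).trans (neg_one_smul K _).symm

theorem n3_mul_l1 : gen K .n3 * gen K .l1 = gen K .l2 * gen K .n2 := by
  have h := gen_mul_gen K .n3 .l1
  rw [show ColGen.n3.deg = 3 from rfl, show ColGen.l1.deg = 1 from rfl, l1_mul_n3] at h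
  rw [h, smul_smul]
  norm_num

variable {K} (h2 : (2 : K) ≠ 0)
include h2

/-- Graded commutativity makes odd squares vanish once `2` is invertible. -/
theorem mul_self_eq_zero_of_odd {a : ColGen} (ha : Odd a.deg) : gen K a * gen K a = 0 := by
  have h := gen_mul_gen K a a
  rw [(ha.mul ha).neg_one_pow] at h
  have h1 : (2 : K) • (gen K a * gen K a) = 0 := by
    rw [two_smul]
    nth_rewrite 1 [h]
    nth_rewrite 2 [← one_smul K (gen K a * gen K a)]
    rw [← add_smul, neg_add_cancel, zero_smul]
  exact (smul_eq_zero.1 h1).resolve_left h2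

theorem l1_mul_l1 : gen K .l1 * gen K .l1 = 0 := mul_self_eq_zero_of_odd h2 odd_one

theorem n3_mul_n3 : gen K .n3 * gen K .n3 = 0 :=
  mul_self_eq_zero_of_odd h2 (by decide : Odd 3)

omit h2

variable (K) in
/-- The map `K[t]^4 → ColAlg K` that writes the elements of the algebra as
`a(λ₂) + b(λ₂) λ₁ + c(λ₂) ν₂ + d(λ₂) ν₃`. -/
def normalForm : (K[X] × K[X]) × (K[X] × K[X]) →ₗ[K] ColAlg K :=
  let L : K[X] →ₗ[K] ColAlg K := (aeval (gen K .l2)).toLinearMap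
  (L.coprod (LinearMap.mulRight K (gen K .l1) ∘ₗ L)).coprod
    ((LinearMap.mulRight K (gen K .n2) ∘ₗ L).coprod (LinearMap.mulRight K (gen K .n3) ∘ₗ L))

theorem normalForm_apply (v : (K[X] × K[X]) × (K[X] × K[X])) : normalForm K v =
    aeval (gen K .l2) v.1.1 + aeval (gen K .l2) v.1.2 * gen K .l1 +
      (aeval (gen K .l2) v.2.1 * gen K .n2 + aeval (gen K .l2) v.2.2 * gen K .n3) := rfl

theorem gen_mul_aeval (a : ColGen) (f : K[X]) (z : ColAlg K) :
    gen K a * (aeval (gen K .l2) f * z) = aeval (gen K .l2) f * (gen K a * z) := by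
  rw [← mul_assoc, ← (commute_aeval (commute_l2 K a) f).eq, mul_assoc]

include h2 in
/-- The multiplication table of the generators. -/
theorem exists_gen_mul_normalForm (a : ColGen) (v : (K[X] × K[X]) × (K[X] × K[X])) :
    ∃ w, gen K a * normalForm K v = normalForm K w := by
  have h0 : gen K a * aeval (gen K .l2) v.1.1 = aeval (gen K .l2) v.1.1 * gen K a :=
    (commute_aeval (commute_l2 K a) _).eq.symm
  have hX : ∀ f : K[X], aeval (gen K .l2) (X * f) = aeval (gen K .l2) f * gen K .l2 := fun f => by
    rw [mul_comm, map_mul, aeval_X]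
  have h := normalForm_apply v
  rw [h, mul_add, mul_add, mul_add, gen_mul_aeval, gen_mul_aeval, gen_mul_aeval, h0]
  cases a with
  | l1 =>
    refine ⟨((0, v.1.1), ((-1 : K) • (X * v.2.2), 0)), ?_⟩
    rw [normalForm_apply, l1_mul_l1 h2, l1_mul_n2, l1_mul_n3]
    simp only [map_zero, map_smul, hX, mul_zero, zero_mul, add_zero, zero_add, mul_smul_comm,
      smul_mul_assoc, mul_assoc]
  | l2 =>
    refine ⟨((X * v.1.1, X * v.1.2), (X * v.2.1, X * v.2.2)), ?_⟩
    rw [normalForm_apply]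
    simp only [hX, mul_assoc]
  | n2 =>
    refine ⟨((0, 0), (v.1.1, 0)), ?_⟩
    rw [normalForm_apply, n2_mul_n2, n2_mul_n3, (commute_n2 K .l1).eq, l1_mul_n2]
    simp only [map_zero, mul_zero, zero_mul, add_zero, zero_add]
  | n3 =>
    refine ⟨((0, 0), (X * v.1.2, v.1.1)), ?_⟩
    rw [normalForm_apply, n3_mul_n3 h2, n3_mul_l1, ← (commute_n2 K .n3).eq, n2_mul_n3]
    simp only [map_zero, hX, mul_zero, zero_mul, add_zero, zero_add, mul_assoc]
    exact add_comm _ _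

include h2 in
/-- Every element of the presented algebra has a normal form: the normal forms contain `1` and are
stable under multiplication by the generators. -/
theorem normalForm_surjective : Function.Surjective (normalForm K) := by
  have key : ∀ x : ColAlg K, ∀ v, ∃ w, x * normalForm K v = normalForm K w := by
    intro x
    induction x using ColAlg.induction with
    | h0 c => exact fun v => ⟨c • v, by rw [map_smul, Algebra.smul_def]⟩
    | h1 a => exact exists_gen_mul_normalForm h2 a
    | hmul x y hx hy =>
      intro v
      obtain ⟨w, hw⟩ := hy v
      obtain ⟨w', hw'⟩ := hx w
      exact ⟨w', by rw [mul_assoc, hw, hw']⟩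
    | hadd x y hx hy =>
      intro v
      obtain ⟨w, hw⟩ := hx v
      obtain ⟨w', hw'⟩ := hy v
      exact ⟨w + w', by rw [add_mul, hw, hw', map_add]⟩
  intro x
  obtain ⟨w, hw⟩ := key x ((1, 0), (0, 0))
  refine ⟨w, ?_⟩
  rw [← hw, normalForm_apply]
  simp only [map_zero, map_one, zero_mul, add_zero, mul_one]

end ColAlg

/-! ### The relations of column zero -/

open Polynomial
section relations
variable {K : Type u} [Field K] {N : ℕ} [NeZero N] (hN : (N : K) = 0) (h2 : (2 : K) ≠ 0)

/-- The invariant elements of `H^•(M)` that represent the generators of the zeroth column. -/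
def colRep : ColGen → HRing.{u} K N
  | .l1 => x1
  | .l2 => x2
  | .n2 => x1 * y1
  | .n3 => x1 * y2 - y1 * x2

/-- The generators of the zeroth column in the second page. -/
def colVal (a : ColGen) : ERing.{u} K N := bar0 a.deg (colRep a)

include hN h2

theorem colRep_mem_invariants (a : ColGen) : colRep a ∈ invariants (Hs.{u} K N a.deg) := by
  cases a with
  | l1 => exact x1_mem_invariants hN
  | l2 => exact x2_mem_invariants
  | n2 => exact x1_mul_y1_mem_invariants hN h2
  | n3 => exact nu3_mem_invariants hN

theorem colVal_mul (a b : ColGen) : (colVal a * colVal b : ERing.{u} K N) =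
    bar0 (a.deg + b.deg) (colRep a * colRep b) :=
  bar0_mul_bar0 (colRep_mem_invariants hN h2 a) (colRep_mem_invariants hN h2 b)

theorem l1_mul_nu2 : (x1 * (x1 * y1) : HRing.{u} K N) = 0 := by
  rw [← mul_assoc, x1_sq hN h2, zero_mul]

theorem nu2_mul_l1 : (x1 * y1 * x1 : HRing.{u} K N) = 0 := by
  rw [mul_assoc, y1_mul_x1 hN, mul_neg, l1_mul_nu2 hN h2, neg_zero]

theorem nu2_mul_nu2 : (x1 * y1 * (x1 * y1) : HRing.{u} K N) = 0 := by
  rw [← mul_assoc, nu2_mul_l1 hN h2, zero_mul]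

omit h2 in
theorem x2_comm_nu2 : Commute (x2 : HRing.{u} K N) (x1 * y1) :=
  (x1_comm_x2 hN).symm.mul_right (y1_comm_x2 hN).symm

theorem l1_mul_nu3 : (x1 * (x1 * y2 - y1 * x2) : HRing.{u} K N) = -(x2 * (x1 * y1)) := by
  rw [mul_sub, ← mul_assoc, x1_sq hN h2, zero_mul, zero_sub, ← mul_assoc, (x2_comm_nu2 hN).eq]

theorem nu3_mul_l1 : ((x1 * y2 - y1 * x2) * x1 : HRing.{u} K N) = x2 * (x1 * y1) := by
  rw [sub_mul, mul_assoc, ← (x1_comm_y2 hN).eq, ← mul_assoc, x1_sq hN h2, zero_mul, zero_sub,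
    mul_assoc, ← (x1_comm_x2 hN).eq, ← mul_assoc, y1_mul_x1 hN, neg_mul, neg_neg,
    (x2_comm_nu2 hN).eq]

theorem nu3_mul_y1 : ((x1 * y2 - y1 * x2) * y1 : HRing.{u} K N) = x1 * y1 * y2 := by
  rw [sub_mul, mul_assoc, ← (y1_comm_y2 hN).eq, mul_assoc y1, ← (y1_comm_x2 hN).eq, ← mul_assoc,
    ← mul_assoc, y1_sq hN h2, zero_mul, sub_zero]

theorem nu2_mul_nu3 : (x1 * y1 * (x1 * y2 - y1 * x2) : HRing.{u} K N) = 0 := by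
  rw [mul_sub, ← mul_assoc, nu2_mul_l1 hN h2, zero_mul, zero_sub, mul_assoc, ← mul_assoc y1,
    y1_sq hN h2, zero_mul, mul_zero, neg_zero]

theorem nu3_mul_nu2 : ((x1 * y2 - y1 * x2) * (x1 * y1) : HRing.{u} K N) = 0 := by
  rw [← mul_assoc, nu3_mul_l1 hN h2, mul_assoc, mul_assoc, y1_sq hN h2, mul_zero, mul_zero]

theorem nu3_mul_nu3 :
    ((x1 * y2 - y1 * x2) * (x1 * y2 - y1 * x2) : HRing.{u} K N) = 0 := by
  rw [mul_sub, ← mul_assoc _ x1, nu3_mul_l1 hN h2, ← mul_assoc _ y1, nu3_mul_y1 hN h2, mul_assoc x2,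
    ((x2_comm_nu2 hN).mul_right x2_comm_y2).eq, sub_self]

/-- The representatives in `H^•(M)` commute in the graded sense. -/
theorem colRep_comm (a b : ColGen) : (colRep a * colRep b : HRing.{u} K N) =
    (-1 : K) ^ (a.deg * b.deg) • (colRep b * colRep a) := by
  have hx2 : ∀ a, Commute (x2 : HRing.{u} K N) (colRep a) := by
    intro a
    cases a with
    | l1 => exact (x1_comm_x2 hN).symm
    | l2 => exact Commute.refl _
    | n2 => exact x2_comm_nu2 hN
    | n3 =>
      exact ((x1_comm_x2 hN).symm.mul_right x2_comm_y2).sub_right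
        ((y1_comm_x2 hN).symm.mul_right (Commute.refl _))
  have he : ∀ k : ℕ, (-1 : K) ^ (2 * k) = 1 := fun k => by rw [pow_mul, neg_one_sq, one_pow]
  have he' : ∀ k : ℕ, (-1 : K) ^ (k * 2) = 1 := fun k => by rw [mul_comm, he]
  cases a <;> cases b <;> simp only [ColGen.deg, he, he', one_smul]
  case l2.l1 => exact (hx2 .l1).eq
  case l2.n2 => exact (hx2 .n2).eq
  case l2.n3 => exact (hx2 .n3).eq
  case l1.l2 => exact (hx2 .l1).eq.symm
  case n2.l2 => exact (hx2 .n2).eq.symm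
  case n3.l2 => exact (hx2 .n3).eq.symm
  all_goals simp only [colRep, x1_sq hN h2, l1_mul_nu2 hN h2, nu2_mul_l1 hN h2,
    nu2_mul_nu3 hN h2, nu3_mul_nu2 hN h2, nu3_mul_nu3 hN h2, l1_mul_nu3 hN h2,
    nu3_mul_l1 hN h2, smul_zero]
  · norm_num
  · norm_num

omit hN h2 [NeZero N] in
theorem bar0_zero (s : ℕ) : bar0 s (0 : HRing.{u} K N) = 0 := by
  have h := bar0_linear 1 (Submodule.zero_mem (invariants (Hs K N s))) (Submodule.zero_mem _)
  rw [one_smul, one_smul, add_zero] at h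
  exact left_eq_add.1 h

omit hN h2 [NeZero N] in
theorem bar0_smul (c : K) {s : ℕ} {w : HRing.{u} K N} (hw : w ∈ invariants (Hs K N s)) :
    bar0 s (c • w) = c • bar0 s w := by
  have h := bar0_linear c hw (Submodule.zero_mem _)
  rwa [bar0_zero, add_zero, add_zero] at h

/-- The relations of the presentation hold on the second page. -/
theorem colVal_rel ⦃x y : FreeAlgebra K ColGen⦄ (h : ColRel K x y) :
    FreeAlgebra.lift K (colVal : ColGen → ERing.{u} K N) x = FreeAlgebra.lift K colVal y := by
  cases h with
  | comm a b =>
    rw [map_mul, map_smul, map_mul, FreeAlgebra.lift_ι_apply, FreeAlgebra.lift_ι_apply,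
      colVal_mul hN h2, colVal_mul hN h2, colRep_comm hN h2, bar0_smul, add_comm]
    rw [add_comm]
    exact mul_mem_invariants (colRep_mem_invariants hN h2 b) (colRep_mem_invariants hN h2 a)
  | nu2_sq =>
    rw [map_pow, map_zero, FreeAlgebra.lift_ι_apply, pow_two, colVal_mul hN h2]
    simp only [colRep, nu2_mul_nu2 hN h2, bar0_zero]
  | lam1_nu2 =>
    rw [map_mul, map_zero, FreeAlgebra.lift_ι_apply, FreeAlgebra.lift_ι_apply, colVal_mul hN h2]
    simp only [colRep, l1_mul_nu2 hN h2, bar0_zero]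
  | nu2_nu3 =>
    rw [map_mul, map_zero, FreeAlgebra.lift_ι_apply, FreeAlgebra.lift_ι_apply, colVal_mul hN h2]
    simp only [colRep, nu2_mul_nu3 hN h2, bar0_zero]
  | lam1_nu3 =>
    rw [map_add, map_mul, map_mul, map_zero, FreeAlgebra.lift_ι_apply, FreeAlgebra.lift_ι_apply,
      FreeAlgebra.lift_ι_apply, FreeAlgebra.lift_ι_apply, colVal_mul hN h2, colVal_mul hN h2]
    have hm := mul_mem_invariants (colRep_mem_invariants hN h2 .l2)
      (colRep_mem_invariants hN h2 .n2)
    have h := bar0_smul (-1) hm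
    rw [neg_one_smul, neg_one_smul] at h
    have e : (colRep .l1 * colRep .n3 : HRing.{u} K N) = -(colRep .l2 * colRep .n2) :=
      l1_mul_nu3 hN h2
    rw [e]
    exact (congrArg (· + _) h).trans (neg_add_cancel _)

/-- The comparison map from the algebra presented by the generators and relations of the zeroth
column. -/
def colHom : ColAlg K →ₐ[K] ERing.{u} K N :=
  RingQuot.liftAlgHom K ⟨FreeAlgebra.lift K colVal, colVal_rel hN h2⟩

theorem colHom_gen (a : ColGen) : colHom.{u} hN h2 (ColAlg.gen K a) = colVal (N := N) a :=
  (RingQuot.liftAlgHom_mkAlgHom_apply _ _ _ _).trans (FreeAlgebra.lift_ι_apply _ _)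

theorem colHom_normalForm (v : (K[X] × K[X]) × (K[X] × K[X])) :
    colHom.{u} (N := N) hN h2 (ColAlg.normalForm K v) =
      aeval lam2 v.1.1 + aeval lam2 v.1.2 * lam1 +
        (aeval lam2 v.2.1 * nu2 + aeval lam2 v.2.2 * nu3) := by
  have h : ∀ f : K[X], colHom.{u} (N := N) hN h2 (aeval (ColAlg.gen K .l2) f) = aeval lam2 f :=
    fun f => by
      rw [← aeval_algHom_apply, colHom_gen]
      rfl
  rw [ColAlg.normalForm_apply, map_add, map_add, map_add, map_mul, map_mul, map_mul, h, h, h, h,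
    colHom_gen, colHom_gen, colHom_gen]
  rfl

end relations

section injective
variable {K : Type u} [Field K] {N : ℕ} [NeZero N]

omit [NeZero N] in
theorem bar0_mem_Ers {s : ℕ} {w : HRing.{u} K N} (hw : w ∈ invariants (Hs K N s)) :
    bar0 s w ∈ Ers K N 0 s := by
  rw [bar0_eq hw]
  exact ⟨_, rfl⟩

/-- The homogeneous components of a polynomial in `λ₂` times a class of degree `s`. -/
theorem projE_aeval_lam2_mul {s : ℕ} {w : HRing.{u} K N} (hw : w ∈ invariants (Hs K N s)) (i : ℕ)
    (f : K[X]) : projE K N (0, 2 * i + s) (aeval lam2 f * bar0 s w) =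
      f.coeff i • (lam2 ^ i * bar0 s w) := by
  have hm : ∀ k, lam2 ^ k * bar0 s w ∈ Ers K N 0 (2 * k + s) := fun k => by
    rw [lam2_pow_mul_bar0 k hw]
    exact bar0_mem_Ers (mul_mem_invariants (lam2_pow k).1 hw)
  induction f using Polynomial.induction_on' with
  | add f g hf hg => rw [map_add, add_mul, map_add, hf, hg, coeff_add, add_smul]
  | monomial k c =>
    rw [aeval_monomial, mul_assoc, ← Algebra.smul_def, map_smul, coeff_monomial]
    split_ifs with h
    · rw [h, projE_eq_self (hm i)]
    · rw [projE_eq_zero ?_ (hm k), smul_zero, zero_smul]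
      exact fun h' => h (by have := congrArg Prod.snd h'; simpa using this)

theorem projE_aeval_lam2_mul_of_ne {s : ℕ} {w : HRing.{u} K N} (hw : w ∈ invariants (Hs K N s))
    {m : ℕ} (h : ∀ k, 2 * k + s ≠ m) (f : K[X]) :
    projE K N (0, m) (aeval lam2 f * bar0 s w) = 0 := by
  have hm : ∀ k, lam2 ^ k * bar0 s w ∈ Ers K N 0 (2 * k + s) := fun k => by
    rw [lam2_pow_mul_bar0 k hw]
    exact bar0_mem_Ers (mul_mem_invariants (lam2_pow k).1 hw)
  induction f using Polynomial.induction_on' with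
  | add f g hf hg => rw [map_add, add_mul, map_add, hf, hg, add_zero]
  | monomial k c =>
    rw [aeval_monomial, mul_assoc, ← Algebra.smul_def, map_smul, projE_eq_zero ?_ (hm k),
      smul_zero]
    exact fun h' => h k (congrArg Prod.snd h')

/-- The comparison map is injective: it sends the four families of the normal form to bases of the
spaces `D_2^{0,s}`. -/
theorem colHom_injective (p : ℕ) [Fact p.Prime] [CharP K p] (hN1 : 1 < N) (hN : (N : K) = 0)
    (h2 : (2 : K) ≠ 0) : Function.Injective (colHom.{u} (N := N) hN h2) := by
  rw [injective_iff_map_eq_zero]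
  intro x hx
  obtain ⟨v, rfl⟩ := ColAlg.normalForm_surjective h2 x
  have hcomm : ∀ k, lam2 ^ k * lam1 = lam1 * (lam2 ^ k : ERing.{u} K N) := fun k => by
    have h := ((ColAlg.commute_l2 K .l1).pow_left k).map (colHom.{u} (N := N) hN h2)
    rw [map_pow, colHom_gen, colHom_gen] at h
    exact h.eq
  obtain ⟨⟨a, b⟩, ⟨c, d⟩⟩ := v
  rw [colHom_normalForm] at hx
  have hA := fun i => projE_aeval_lam2_mul (K := K) (N := N) one_mem_invariants i a
  have hB := fun i => projE_aeval_lam2_mul (x1_mem_invariants (K := K) hN) i b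
  have hC := fun i => projE_aeval_lam2_mul (x1_mul_y1_mem_invariants (K := K) hN h2) i c
  have hD := fun i => projE_aeval_lam2_mul (nu3_mem_invariants (K := K) hN) i d
  have hA' := fun m (h : ∀ k, 2 * k + 0 ≠ m) =>
    projE_aeval_lam2_mul_of_ne (K := K) (N := N) one_mem_invariants h a
  have hB' := fun m (h : ∀ k, 2 * k + 1 ≠ m) =>
    projE_aeval_lam2_mul_of_ne (x1_mem_invariants (K := K) hN) h b
  have hC' := fun m (h : ∀ k, 2 * k + 2 ≠ m) =>
    projE_aeval_lam2_mul_of_ne (x1_mul_y1_mem_invariants (K := K) hN h2) h c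
  have hD' := fun m (h : ∀ k, 2 * k + 3 ≠ m) =>
    projE_aeval_lam2_mul_of_ne (nu3_mem_invariants (K := K) hN) h d
  simp only [bar0_one, mul_one, add_zero] at hA hA'
  have hproj : ∀ m, projE K N (0, m) (aeval lam2 a) + projE K N (0, m) (aeval lam2 b * lam1) +
      (projE K N (0, m) (aeval lam2 c * nu2) + projE K N (0, m) (aeval lam2 d * nu3)) = 0 :=
    fun m => by rw [← map_add, ← map_add, ← map_add, hx, map_zero]
  have ha0 : a.coeff 0 = 0 := by
    have h := hproj 0
    have h1 := hA 0
    rw [pow_zero, mul_zero] at h1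
    rw [h1, lam1, hB' 0 (by omega), nu2, hC' 0 (by omega), nu3, hD' 0 (by omega), add_zero,
      add_zero, add_zero] at h
    exact (smul_eq_zero.1 h).resolve_right ((isBasisOf_D2_zero_zero (p := p) hN1 hN h2).1.ne_zero 0)
  have hb0 : b.coeff 0 = 0 := by
    have h := hproj 1
    have h1 := hB 0
    rw [pow_zero, one_mul, mul_zero, zero_add] at h1
    rw [hA' 1 (by omega), lam1, h1, nu2, hC' 1 (by omega), nu3, hD' 1 (by omega), add_zero,
      add_zero, zero_add] at h
    exact (smul_eq_zero.1 h).resolve_right ((isBasisOf_D2_zero_one (p := p) hN1 hN h2).1.ne_zero 0)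
  have hac : ∀ k, a.coeff (k + 1) = 0 ∧ c.coeff k = 0 := by
    intro k
    have h := hproj (2 * (k + 1))
    rw [hA (k + 1), lam1, hB' _ (by omega), nu2, nu3, hD' _ (by omega), add_zero, add_zero] at h
    refine LinearIndependent.pair_iff.1
      (isBasisOf_D2_zero_even (p := p) hN1 hN h2 (Nat.le_add_left 1 k)).1 _ _ ?_
    exact (congrArg (_ + ·) (hC k)).symm.trans h
  have hbd : ∀ k, b.coeff (k + 1) = 0 ∧ d.coeff k = 0 := by
    intro k
    have h := hproj (2 * (k + 1) + 1)
    rw [hA' _ (by omega), nu2, hC' _ (by omega), zero_add, zero_add, lam1, hB (k + 1)] at h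
    refine LinearIndependent.pair_iff.1
      (isBasisOf_D2_zero_odd (p := p) hN1 hN h2 (Nat.le_add_left 1 k)).1 _ _ ?_
    rw [← hcomm]
    exact (congrArg (_ + ·) (hD k)).symm.trans h
  have e1 : a = 0 := Polynomial.ext fun k => by
    rcases k with _ | k
    · exact ha0
    · exact (hac k).1
  have e2 : b = 0 := Polynomial.ext fun k => by
    rcases k with _ | k
    · exact hb0
    · exact (hbd k).1
  have e3 : c = 0 := Polynomial.ext fun k => (hac k).2
  have e4 : d = 0 := Polynomial.ext fun k => (hbd k).2
  rw [e1, e2, e3, e4]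
  exact map_zero _

end injective

/-! ### Column zero as an algebra, and generators of the second page -/

open Polynomial
section column
variable {K : Type u} [Field K] {N : ℕ} [NeZero N] {p : ℕ}
  (hN : (N : K) = 0) (h2 : (2 : K) ≠ 0)

theorem z2p_commute {w : HRing.{u} K N} (hx : Commute x2 w) (hy : Commute y2 w) :
    Commute (z2p p) w := by
  refine Commute.list_prod_left _ _ fun z hz => ?_
  obtain ⟨i, -, rfl⟩ := List.mem_map.1 hz
  rw [act_y2]
  exact hy.add_left (hx.smul_left _)

variable [CharP K p]
include hN h2

theorem nu2p_commute_colVal (a : ColGen) : Commute (nu2p p : ERing.{u} K N) (colVal a) := by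
  have hc : Commute (z2p p : HRing.{u} K N) (colRep a) := by
    cases a with
    | l1 => exact z2p_commute (x1_comm_x2 hN).symm (x1_comm_y2 hN).symm
    | l2 => exact z2p_commute (Commute.refl _) x2_comm_y2.symm
    | n2 =>
      exact z2p_commute (x2_comm_nu2 hN) ((x1_comm_y2 hN).symm.mul_right (y1_comm_y2 hN).symm)
    | n3 =>
      exact z2p_commute (((x1_comm_x2 hN).symm.mul_right x2_comm_y2).sub_right
        ((y1_comm_x2 hN).symm.mul_right (Commute.refl _)))
        (((x1_comm_y2 hN).symm.mul_right (Commute.refl _)).sub_right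
          ((y1_comm_y2 hN).symm.mul_right x2_comm_y2.symm))
  have hz := z2p_mem (p := p) hN h2
  have ha := colRep_mem_invariants hN h2 a
  show nu2p p * colVal a = colVal a * nu2p p
  rw [nu2p, colVal, bar0_mul_bar0 hz ha, bar0_mul_bar0 ha hz, hc.eq, add_comm]

theorem nu2p_commute_colHom (f : K[X]) (x : ColAlg K) :
    Commute (aeval (nu2p p : ERing.{u} K N) f) (colHom hN h2 x) := by
  refine commute_aeval ?_ f
  induction x using ColAlg.induction with
  | h0 c =>
    rw [AlgHom.commutes]
    exact (Algebra.commutes c _).symm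
  | h1 a =>
    rw [colHom_gen]
    exact nu2p_commute_colVal hN h2 a
  | hmul x y hx hy =>
    rw [map_mul]
    exact hx.mul_right hy
  | hadd x y hx hy =>
    rw [map_add]
    exact hx.add_right hy

variable (p) in
/-- The map from the algebra presented by generators and relations to the zeroth column. -/
def columnHom : TensorProduct K K[X] (ColAlg K) →ₐ[K] ERing.{u} K N :=
  Algebra.TensorProduct.lift (aeval (nu2p p)) (colHom hN h2) (nu2p_commute_colHom hN h2)

theorem columnHom_tmul (f : K[X]) (x : ColAlg K) :
    columnHom.{u} (N := N) p hN h2 (TensorProduct.tmul K f x) = aeval (nu2p p) f * colHom hN h2 x :=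
  Algebra.TensorProduct.lift_tmul _ _ _ _ _

end column

section generation
variable {K : Type u} [Field K] {N : ℕ} [NeZero N] {p : ℕ} [Fact p.Prime] [CharP K p]
  (hN1 : 1 < N) (hN : (N : K) = 0) (h2 : (2 : K) ≠ 0)
  {A : Subalgebra K (ERing.{u} K N)}

omit [NeZero N] [Fact p.Prime] [CharP K p] in
theorem IsBasisOf.le_of_mem {ι : Type*} {v : ι → ERing.{u} K N} {U : Submodule K (ERing.{u} K N)}
    (h : IsBasisOf v U) (hv : ∀ i, v i ∈ A) : U ≤ Subalgebra.toSubmodule A := by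
  rw [← h.2, Submodule.span_le]
  rintro _ ⟨i, rfl⟩
  exact hv i

include hN1 hN h2

/-- Column zero of `D_2` lies in every algebra that contains its generators. -/
theorem D2_zero_le (h1 : lam1 ∈ A) (h3 : lam2 ∈ A) (h4 : nu2 ∈ A) (h5 : nu3 ∈ A) (s : ℕ) :
    D2 K N p 0 s ≤ Subalgebra.toSubmodule A := by
  obtain ⟨i, rfl | rfl⟩ := Nat.even_or_odd' s
  · rcases i.eq_zero_or_pos with rfl | hi
    · refine (isBasisOf_D2_zero_zero hN1 hN h2).le_of_mem fun k => ?_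
      fin_cases k
      exact A.one_mem
    · refine (isBasisOf_D2_zero_even hN1 hN h2 hi).le_of_mem fun k => ?_
      fin_cases k
      · exact A.pow_mem h3 i
      · exact A.mul_mem (A.pow_mem h3 _) h4
  · rcases i.eq_zero_or_pos with rfl | hi
    · refine (isBasisOf_D2_zero_one hN1 hN h2).le_of_mem fun k => ?_
      fin_cases k
      exact h1
    · refine (isBasisOf_D2_zero_odd hN1 hN h2 hi).le_of_mem fun k => ?_
      fin_cases k
      · exact A.mul_mem h1 (A.pow_mem h3 i)
      · exact A.mul_mem (A.pow_mem h3 _) h5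

variable (hnorm : ∀ w : HRing.{u} K N, ∑ i ∈ Finset.range N, act (Cyc.gen N ^ i) w = 0)
include hnorm

/-- Column one of `D_2` lies in every algebra that contains its generators. -/
theorem D2_one_le (h1 : lam1 ∈ A) (h3 : lam2 ∈ A) (h4 : gam1 ∈ A)
    (h5 : ∀ k, 2 ≤ k → k ≤ 2 * p → mu k ∈ A) (s : ℕ) :
    D2 K N p 1 s ≤ Subalgebra.toSubmodule A := by
  have hp := (Fact.out : p.Prime).two_le
  obtain ⟨i, rfl | rfl⟩ := Nat.even_or_odd' s
  · rcases i.eq_zero_or_pos with rfl | hi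
    · refine (isBasisOf_D2_one_zero hN1 hN h2 hnorm).le_of_mem fun k => ?_
      fin_cases k
      exact h4
    · rcases lt_or_ge i p with hip | hip
      · refine (isBasisOf_D2_one_even_of_lt hN1 hN h2 hnorm hi hip).le_of_mem fun k => ?_
        fin_cases k
        · exact h5 _ (by omega) (by omega)
        · exact A.mul_mem h1 (h5 _ (by omega) (by omega))
      · refine (isBasisOf_D2_one_even_of_le hN1 hN h2 hnorm hip).le_of_mem fun k => ?_
        fin_cases k
        · exact A.mul_mem (A.mul_mem h1 (A.pow_mem h3 _)) (h5 _ (by omega) le_rfl)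
        · exact A.mul_mem (A.pow_mem h3 _) (h5 _ (by omega) (by omega))
  · rcases i.eq_zero_or_pos with rfl | hi
    · refine (isBasisOf_D2_one_one hN1 hN h2 hnorm).le_of_mem fun k => ?_
      fin_cases k
      exact h5 2 le_rfl (by omega)
    · rcases lt_or_ge i p with hip | hip
      · refine (isBasisOf_D2_one_odd_of_lt hN1 hN h2 hnorm hi hip).le_of_mem fun k => ?_
        fin_cases k
        · exact h5 _ (by omega) (by omega)
        · exact A.mul_mem h1 (h5 _ (by omega) (by omega))
      · refine (isBasisOf_D2_one_odd_of_le hN1 hN h2 hnorm hip).le_of_mem fun k => ?_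
        fin_cases k
        · exact A.mul_mem (A.pow_mem h3 _) (h5 _ (by omega) le_rfl)
        · exact A.mul_mem (A.mul_mem h1 (A.pow_mem h3 _)) (h5 _ (by omega) (by omega))

theorem adjoin_eq_top : Algebra.adjoin K
    (({lam1, lam2, nu2, nu3, nu2p p, gam1, gam2} : Set (ERing.{u} K N)) ∪
      {c | ∃ k : ℕ, 2 ≤ k ∧ k ≤ 2 * p ∧ c = mu k}) = ⊤ := by
  set S := ({lam1, lam2, nu2, nu3, nu2p p, gam1, gam2} : Set (ERing.{u} K N)) ∪
    {c | ∃ k : ℕ, 2 ≤ k ∧ k ≤ 2 * p ∧ c = mu k} with hS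
  set A := Algebra.adjoin K S
  have hg : ∀ x ∈ ({lam1, lam2, nu2, nu3, nu2p p, gam1, gam2} : Set (ERing.{u} K N)), x ∈ A :=
    fun x hx => Algebra.subset_adjoin (Or.inl hx)
  have h1 : lam1 ∈ A := hg _ (by simp)
  have h3 : lam2 ∈ A := hg _ (by simp)
  have hm : ∀ k, 2 ≤ k → k ≤ 2 * p → mu k ∈ A := fun k hk hk' =>
    Algebra.subset_adjoin (Or.inr ⟨k, hk, hk', rfl⟩)
  have hD : ∀ r s, D2 K N p r s ≤ Subalgebra.toSubmodule A := by
    intro r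
    induction r using column_induction with
    | h0 => exact D2_zero_le hN1 hN h2 h1 h3 (hg _ (by simp)) (hg _ (by simp))
    | h1 => exact D2_one_le hN1 hN h2 hnorm h1 h3 (hg _ (by simp)) hm
    | h r ih =>
      intro s
      rw [D2_add_two hnorm hN1 hN h2]
      rintro _ ⟨d, hd, rfl⟩
      exact A.mul_mem (ih s hd) (hg _ (by simp))
  rw [eq_top_iff]
  rintro z -
  induction z using ERing.induction with
  | h0 => exact A.zero_mem
  | hadd z w hz hw => exact A.add_mem hz hw
  | h r s z hz =>
    exact Ers_le_of_D2_le hN1 hN h2 hnorm (Fact.out : p.Prime).pos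
      (A := Subalgebra.toSubmodule A) (fun a ha => A.mul_mem (hg _ (by simp)) ha) (hD r) s hz

end generation

theorem aeval_lam2_mul_mem {K : Type u} [Field K] {N : ℕ} {z : ERing.{u} K N} {U : Submodule K (ERing.{u} K N)}
    (h : ∀ k, lam2 ^ k * z ∈ U) (f : K[X]) : aeval lam2 f * z ∈ U := by
  induction f using Polynomial.induction_on' with
  | add f g hf hg =>
    rw [map_add, add_mul]
    exact Submodule.add_mem _ hf hg
  | monomial k c =>
    rw [aeval_monomial, mul_assoc, ← Algebra.smul_def]
    exact Submodule.smul_mem _ c (h k)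

section columnIso
variable {K : Type u} [Field K] {N : ℕ} [NeZero N] {p : ℕ} [Fact p.Prime] [CharP K p]
  (hN1 : 1 < N) (hN : (N : K) = 0) (h2 : (2 : K) ≠ 0)
include hN1

theorem D2_zero_le_range_colHom (s : ℕ) :
    D2 K N p 0 s ≤ Subalgebra.toSubmodule (colHom.{u} (N := N) hN h2).range :=
  have h : ∀ a, colVal a ∈ (colHom.{u} (N := N) hN h2).range := fun a => ⟨_, colHom_gen hN h2 a⟩
  D2_zero_le hN1 hN h2 (h .l1) (h .l2) (h .n2) (h .n3) s

variable (p) in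
/-- The image of the comparison map is column zero of `D_2`. -/
theorem colHom_mem (x : ColAlg K) :
    colHom.{u} (N := N) hN h2 x ∈ ⨆ s, D2 K N p 0 s := by
  have hle : ∀ s, D2 K N p 0 s ≤ ⨆ s, D2 K N p 0 s := le_iSup (fun s => D2 K N p 0 s)
  have hmem : ∀ {ι : Type} {v : ι → ERing.{u} K N} {s : ℕ}, IsBasisOf v (D2 K N p 0 s) → ∀ i,
      v i ∈ ⨆ s, D2 K N p 0 s := fun h i => hle _ (h.2 ▸ Submodule.subset_span (Set.mem_range_self i))
  have hcomm : ∀ k, lam2 ^ k * lam1 = lam1 * (lam2 ^ k : ERing.{u} K N) := fun k => by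
    have h := ((ColAlg.commute_l2 K .l1).pow_left k).map (colHom.{u} (N := N) hN h2)
    rw [map_pow, colHom_gen, colHom_gen] at h
    exact h.eq
  obtain ⟨v, rfl⟩ := ColAlg.normalForm_surjective h2 x
  rw [colHom_normalForm, ← mul_one (aeval lam2 v.1.1)]
  refine Submodule.add_mem _ (Submodule.add_mem _ (aeval_lam2_mul_mem (fun k => ?_) _)
    (aeval_lam2_mul_mem (fun k => ?_) _)) (Submodule.add_mem _ (aeval_lam2_mul_mem (fun k => ?_) _)
    (aeval_lam2_mul_mem (fun k => ?_) _))
  · rw [mul_one]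
    rcases k with _ | k
    · exact hmem (isBasisOf_D2_zero_zero hN1 hN h2) 0
    · exact hmem (isBasisOf_D2_zero_even hN1 hN h2 (Nat.le_add_left 1 k)) 0
  · rw [hcomm]
    rcases k with _ | k
    · rw [pow_zero, mul_one]
      exact hmem (isBasisOf_D2_zero_one hN1 hN h2) 0
    · exact hmem (isBasisOf_D2_zero_odd hN1 hN h2 (Nat.le_add_left 1 k)) 0
  · exact hmem (isBasisOf_D2_zero_even hN1 hN h2 (Nat.le_add_left 1 k)) 1
  · exact hmem (isBasisOf_D2_zero_odd hN1 hN h2 (Nat.le_add_left 1 k)) 1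

variable (hnorm : ∀ w : HRing.{u} K N, ∑ i ∈ Finset.range N, act (Cyc.gen N ^ i) w = 0)
include hnorm

/-- Flatness of `K[ν]` reduces the injectivity to that of `colHom` and of `K[ν] ⊗ D_2 → E_2`. -/
theorem columnHom_injective : Function.Injective (columnHom.{u} (N := N) p hN h2) := by
  have hle : ⨆ s, D2 K N p 0 s ≤ D2tot K N p := le_iSup (fun r => ⨆ s, D2 K N p r s) 0
  let g := (colHom.{u} (N := N) hN h2).toLinearMap.codRestrict (D2tot K N p)
    fun x => hle (colHom_mem p hN1 hN h2 x)
  have hg : Function.Injective g := fun x y h =>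
    colHom_injective p hN1 hN h2 (congrArg Subtype.val h)
  have e : (columnHom.{u} (N := N) p hN h2).toLinearMap = tensorMul K N p ∘ₗ g.lTensor K[X] :=
    TensorProduct.ext' fun f x => columnHom_tmul hN h2 f x
  have h := (tensorMul_injective (p := p) hN1 hN h2 hnorm).comp
    (Module.Flat.lTensor_preserves_injective_linearMap (M := K[X]) g hg)
  intro x y hxy
  refine h ?_
  have hx := LinearMap.congr_fun e x
  have hy := LinearMap.congr_fun e y
  exact hx.symm.trans (hxy.trans hy)

theorem range_columnHom :
    LinearMap.range (columnHom.{u} (N := N) p hN h2).toLinearMap = ⨆ s : ℕ, Ers K N 0 s := by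
  apply le_antisymm
  · rintro _ ⟨x, rfl⟩
    have hB : ∀ b ∈ ⨆ s : ℕ, Ers K N 0 s, nu2p p * b ∈ ⨆ s : ℕ, Ers K N 0 s := by
      suffices h : ⨆ s : ℕ, Ers K N 0 s ≤
          (⨆ s : ℕ, Ers K N 0 s).comap (LinearMap.mulLeft K (nu2p p)) from fun b hb => h hb
      refine iSup_le fun s => ?_
      intro b hb
      exact le_iSup (fun s => Ers K N 0 s) _ (nu2p_mul_mem hN1 hN h2 hnorm 0 b hb)
    have hD : ⨆ s, D2 K N p 0 s ≤ ⨆ s : ℕ, Ers K N 0 s := iSup_mono fun s => D2_le_Ers p 0 s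
    induction x with
    | zero =>
      rw [map_zero]
      exact Submodule.zero_mem _
    | add x y hx hy =>
      rw [map_add]
      exact Submodule.add_mem _ hx hy
    | tmul f x =>
      rw [AlgHom.toLinearMap_apply, columnHom_tmul]
      induction f using Polynomial.induction_on' with
      | add f g hf hg =>
        rw [map_add, add_mul]
        exact Submodule.add_mem _ hf hg
      | monomial k c =>
        rw [aeval_monomial, mul_assoc, ← Algebra.smul_def]
        refine Submodule.smul_mem _ c ?_
        induction k with
        | zero =>
          rw [pow_zero, one_mul]
          exact hD (colHom_mem p hN1 hN h2 x)
        | succ k ih =>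
          rw [pow_succ', mul_assoc]
          exact hB _ ih
  · refine iSup_le fun s => Ers_le_of_D2_le hN1 hN h2 hnorm (Fact.out : p.Prime).pos
      (A := Subalgebra.toSubmodule (columnHom.{u} (N := N) p hN h2).range) (fun a ha => ?_)
      (fun s => ?_) s
    · refine (columnHom.{u} (N := N) p hN h2).range.mul_mem ⟨TensorProduct.tmul K X 1, ?_⟩ ha
      exact (columnHom_tmul hN h2 X 1).trans (by rw [aeval_X, map_one, mul_one])
    · intro d hd
      obtain ⟨x, rfl⟩ := D2_zero_le_range_colHom hN1 hN h2 s hd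
      exact ⟨TensorProduct.tmul K 1 x, (columnHom_tmul hN h2 1 x).trans (by rw [map_one, one_mul]; rfl)⟩

end columnIso

end LHS
end

theorem mainTheorem5 (K : Type u) [Field K] (p n N : ℕ) [Fact p.Prime] [CharP K p]
    (hp : p ≠ 2) (hn : 2 ≤ n) (hN : N = p ^ n) :
    -- All cochains used to define the named classes are cocycles; `z2p` is an invariant of
    -- degree `2 * p`; the norm of `Q` kills the cohomology of `M`.
    ((dualCochain (fun m : BaseM.{u} N => m.1.exp) ∈
        cocycleSubmodule (Rep.trivial K (BaseM.{u} N) K) 1 ∧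
      dualCochain (fun m : BaseM.{u} N => m.2.exp) ∈
        cocycleSubmodule (Rep.trivial K (BaseM.{u} N) K) 1 ∧
      bocksteinCochain (fun m : BaseM.{u} N => m.1.exp) ∈
        cocycleSubmodule (Rep.trivial K (BaseM.{u} N) K) 2 ∧
      bocksteinCochain (fun m : BaseM.{u} N => m.2.exp) ∈
        cocycleSubmodule (Rep.trivial K (BaseM.{u} N) K) 2 ∧
      gammaCochain K N ∈ cocycleSubmodule (cohRep K (heisAction.{u} N) 0) 2) ∧
      (z2p p : HRing K N) ∈ invariants (Hs K N (2 * p)) ∧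
      (∀ w : HRing K N, ∑ i ∈ Finset.range N, act (Cyc.gen N ^ i) w = 0) ∧
      (∀ (s : ℕ), ∀ w ∈ invariants (Hs K N s),
        evenCochain s w ∈ cocycleSubmodule (cohRep K (heisAction.{u} N) s) 0) ∧
      (∀ (s : ℕ) (w : HRing K N),
        oddCochain s w ∈ cocycleSubmodule (cohRep K (heisAction.{u} N) s) 1 ∧
        oddCochain s w (fun _ => Cyc.gen N) = w s)) ∧
    -- The shape of the second page and of `D2`: in even columns these are the invariants of
    -- `H^s(M)` and of `W^s`, in odd columns the quotients by the image of `σ - 1`.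
    ((∀ j s : ℕ,
        (∀ (c : K), ∀ w ∈ invariants (Hs K N s), ∀ w' ∈ invariants (Hs K N s),
          bar (2 * j) s (c • w + w') = c • bar (2 * j) s w + bar (2 * j) s w') ∧
        Set.BijOn (bar (2 * j) s) (invariants (Hs K N s) : Set (HRing K N))
          (Ers K N (2 * j) s : Set (ERing K N)) ∧
        Set.BijOn (bar (2 * j) s) (invariants (Ws K N p s) : Set (HRing K N))
          (D2 K N p (2 * j) s : Set (ERing K N))) ∧
      (∀ j s : ℕ,
        (∀ (c : K), ∀ w ∈ Hs K N s, ∀ w' ∈ Hs K N s,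
          bar (2 * j + 1) s (c • w + w') = c • bar (2 * j + 1) s w + bar (2 * j + 1) s w') ∧
        bar (2 * j + 1) s '' (Hs K N s : Set (HRing K N)) =
          (Ers K N (2 * j + 1) s : Set (ERing K N)) ∧
        (∀ w ∈ Hs K N s, ∀ w' ∈ Hs K N s, bar (2 * j + 1) s w = bar (2 * j + 1) s w' ↔
          w - w' ∈ sigmaSubOne (Hs K N s)) ∧
        bar (2 * j + 1) s '' (Ws K N p s : Set (HRing K N)) =
          (D2 K N p (2 * j + 1) s : Set (ERing K N)) ∧
        (∀ w ∈ Ws K N p s, ∀ w' ∈ Ws K N p s, bar (2 * j + 1) s w = bar (2 * j + 1) s w' ↔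
          w - w' ∈ sigmaSubOne (Ws K N p s)))) ∧
    -- Bases of `(W^s)^Q`.
    (IsBasisOf (![1] : Fin 1 → HRing K N) (invariants (Ws K N p 0)) ∧
      IsBasisOf (![x1] : Fin 1 → HRing K N) (invariants (Ws K N p 1)) ∧
      (∀ i : ℕ, 1 ≤ i →
        IsBasisOf (![x2 ^ i, x1 * y1 * x2 ^ (i - 1)] : Fin 2 → HRing K N)
          (invariants (Ws K N p (2 * i))) ∧
        IsBasisOf (![x1 * x2 ^ i, (x1 * y2 - y1 * x2) * x2 ^ (i - 1)] : Fin 2 → HRing K N)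
          (invariants (Ws K N p (2 * i + 1))))) ∧
    -- Bases of `(σ - 1) W^s`, for `s ≥ 1`.
    (IsBasisOf (![x1] : Fin 1 → HRing K N) (sigmaSubOne (Ws K N p 1)) ∧
      (∀ i : ℕ, 1 ≤ i →
        IsBasisOf
          (Sum.elim
            (fun t : {t : ℕ × ℕ // 1 ≤ t.1 ∧ t.2 ≤ p - 2 ∧ t.1 + t.2 = i} =>
              (x2 ^ t.1.1 * y2 ^ t.1.2 : HRing K N))
            (fun t : {t : ℕ × ℕ // 1 ≤ t.1 ∧ t.2 ≤ p - 2 ∧ t.1 + t.2 + 1 = i} =>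
              (x1 * y1 * x2 ^ t.1.1 * y2 ^ t.1.2 : HRing K N)))
          (sigmaSubOne (Ws K N p (2 * i))) ∧
        IsBasisOf
          (Sum.elim
            (fun t : {t : ℕ × ℕ // 1 ≤ t.1 ∧ t.2 ≤ p - 2 ∧ t.1 + t.2 = i} =>
              (x1 * x2 ^ t.1.1 * y2 ^ t.1.2 : HRing K N))
            (Sum.elim
              (fun t : {t : ℕ × ℕ // 2 ≤ t.1 ∧ t.2 ≤ p - 3 ∧ t.1 + t.2 = i} =>
                (y1 * x2 ^ t.1.1 * y2 ^ t.1.2 : HRing K N))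
              (fun t : {t : ℕ × ℕ // (t.1 = 0 ∨ t.2 = p - 1) ∧ t.2 ≤ p - 1 ∧ t.1 + t.2 = i} =>
                (x1 * x2 ^ t.1.1 * y2 ^ t.1.2 +
                  (t.1.2 : K) • (y1 * x2 ^ (t.1.1 + 1) * y2 ^ (t.1.2 - 1)) : HRing K N))))
          (sigmaSubOne (Ws K N p (2 * i + 1))))) ∧
    -- Bases of `W^s / (σ - 1) W^s`.
    (IsBasisOf ((sigmaSubOne (Ws K N p 0)).mkQ ∘ ![1])
        ((Ws K N p 0).map (sigmaSubOne (Ws K N p 0)).mkQ) ∧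
      IsBasisOf ((sigmaSubOne (Ws K N p 1)).mkQ ∘ ![y1])
        ((Ws K N p 1).map (sigmaSubOne (Ws K N p 1)).mkQ) ∧
      (∀ i : ℕ, 1 ≤ i → i ≤ p - 1 →
        IsBasisOf ((sigmaSubOne (Ws K N p (2 * i))).mkQ ∘ ![x1 * y1 * y2 ^ (i - 1), y2 ^ i])
          ((Ws K N p (2 * i)).map (sigmaSubOne (Ws K N p (2 * i))).mkQ) ∧
        IsBasisOf ((sigmaSubOne (Ws K N p (2 * i + 1))).mkQ ∘ ![x1 * y2 ^ i, y1 * y2 ^ i])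
          ((Ws K N p (2 * i + 1)).map (sigmaSubOne (Ws K N p (2 * i + 1))).mkQ)) ∧
      (∀ i : ℕ, p ≤ i →
        IsBasisOf ((sigmaSubOne (Ws K N p (2 * i))).mkQ ∘
            ![x1 * y1 * x2 ^ (i - p) * y2 ^ (p - 1), x2 ^ (i - p + 1) * y2 ^ (p - 1)])
          ((Ws K N p (2 * i)).map (sigmaSubOne (Ws K N p (2 * i))).mkQ) ∧
        IsBasisOf ((sigmaSubOne (Ws K N p (2 * i + 1))).mkQ ∘
            ![x1 * x2 ^ (i - p + 1) * y2 ^ (p - 1), y1 * x2 ^ (i - p + 1) * y2 ^ (p - 1)])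
          ((Ws K N p (2 * i + 1)).map (sigmaSubOne (Ws K N p (2 * i + 1))).mkQ))) ∧
    -- The algebra structure of the zeroth column.
    (∃ f : TensorProduct K (Polynomial K) (ColAlg K) →ₐ[K] ERing K N,
      f (Polynomial.X ⊗ₜ[K] 1) = nu2p p ∧
      f (1 ⊗ₜ[K] ColAlg.gen K .l1) = lam1 ∧
      f (1 ⊗ₜ[K] ColAlg.gen K .l2) = lam2 ∧
      f (1 ⊗ₜ[K] ColAlg.gen K .n2) = nu2 ∧
      f (1 ⊗ₜ[K] ColAlg.gen K .n3) = nu3 ∧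
      Function.Injective f ∧
      LinearMap.range f.toLinearMap = ⨆ s : ℕ, Ers K N 0 s) ∧
    -- Bases of `D2` in all even columns `2 * j` and all odd columns `2 * j + 1`.
    ((∀ j : ℕ,
        IsBasisOf (fun k => (![1] : Fin 1 → ERing K N) k * gam2 ^ j) (D2 K N p (2 * j) 0) ∧
        IsBasisOf (fun k => (![lam1] : Fin 1 → ERing K N) k * gam2 ^ j) (D2 K N p (2 * j) 1) ∧
        (∀ i : ℕ, 1 ≤ i →
          IsBasisOf (fun k => (![lam2 ^ i, lam2 ^ (i - 1) * nu2] : Fin 2 → ERing K N) k * gam2 ^ j)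
            (D2 K N p (2 * j) (2 * i)) ∧
          IsBasisOf
            (fun k => (![lam1 * lam2 ^ i, lam2 ^ (i - 1) * nu3] : Fin 2 → ERing K N) k * gam2 ^ j)
            (D2 K N p (2 * j) (2 * i + 1)))) ∧
      (∀ j : ℕ,
        IsBasisOf (fun k => (![gam1] : Fin 1 → ERing K N) k * gam2 ^ j)
          (D2 K N p (2 * j + 1) 0) ∧
        IsBasisOf (fun k => (![mu 2] : Fin 1 → ERing K N) k * gam2 ^ j)
          (D2 K N p (2 * j + 1) 1) ∧
        (∀ s : ℕ, 2 ≤ s → s < 2 * p →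
          IsBasisOf (fun k => (![mu (s + 1), lam1 * mu s] : Fin 2 → ERing K N) k * gam2 ^ j)
            (D2 K N p (2 * j + 1) s)) ∧
        (∀ i : ℕ, p ≤ i →
          IsBasisOf
            (fun k => (![lam1 * lam2 ^ (i - p) * mu (2 * p),
              lam2 ^ (i - p + 1) * mu (2 * p - 1)] : Fin 2 → ERing K N) k * gam2 ^ j)
            (D2 K N p (2 * j + 1) (2 * i)) ∧
          IsBasisOf
            (fun k => (![lam2 ^ (i - p + 1) * mu (2 * p),
              lam1 * lam2 ^ (i - p + 1) * mu (2 * p - 1)] : Fin 2 → ERing K N) k * gam2 ^ j)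
            (D2 K N p (2 * j + 1) (2 * i + 1)))) ∧
      (∀ r s : ℕ, D2 K N p (r + 2) s = (D2 K N p r s).map (LinearMap.mulRight K gam2))) ∧
    -- The second page is `K[ν_{2p}] ⊗ D2`, and it is generated by the named classes.
    (Function.Bijective (tensorMul K N p) ∧
      Algebra.adjoin K
        (({lam1, lam2, nu2, nu3, nu2p p, gam1, gam2} : Set (ERing K N)) ∪
          {c | ∃ k : ℕ, 2 ≤ k ∧ k ≤ 2 * p ∧ c = mu k}) = ⊤) := by
  have hp1 := (Fact.out : p.Prime).one_lt
  have hN1 : 1 < N := hN ▸ Nat.one_lt_pow (by omega) hp1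
  have : NeZero N := ⟨by omega⟩
  have hN0 : (N : K) = 0 := by
    rw [hN, Nat.cast_pow, CharP.cast_eq_zero, zero_pow (by omega)]
  have h2 : (2 : K) ≠ 0 := by
    have := natCast_ne_zero (K := K) (p := p) two_ne_zero (by omega)
    exact_mod_cast this
  have hnorm : ∀ w : HRing.{u} K N, ∑ i ∈ Finset.range N, act (Cyc.gen N ^ i) w = 0 :=
    norm_eq_zero hp hn hN
  refine ⟨?_, ⟨fun j s => shape_even hN1 hN0 h2 hnorm p j s,
    fun j s => shape_odd hN1 hN0 h2 hnorm p j s⟩, ?_, ?_, ?_, ?_, ?_, ?_⟩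
  · exact ⟨⟨dualCochain_mem hN0 expA_mul, dualCochain_mem hN0 expB_mul,
      bocksteinCochain_mem expA_mul, bocksteinCochain_mem expB_mul, gammaCochain_mem K N⟩,
      z2p_mem hN0 h2, hnorm, fun s w hw => evenCochain_mem hw,
      fun s w => ⟨oddCochain_mem hnorm s w, oddCochain_gen hN1 s w⟩⟩
  · exact ⟨isBasisOf_invariants_zero hN1 hN0 h2, isBasisOf_invariants_one hN1 hN0 h2,
      fun i hi => ⟨isBasisOf_invariants_even hN1 hN0 h2 hi,
        isBasisOf_invariants_odd hN1 hN0 h2 hi⟩⟩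
  · exact ⟨isBasisOf_image_one hN1 hN0 h2,
      fun i hi => ⟨isBasisOf_image_even hN1 hN0 h2 hi, isBasisOf_image_odd hN1 hN0 h2 hp hi⟩⟩
  · refine ⟨isBasisOf_quot_zero hN1 hN0 h2, isBasisOf_quot_one hN1 hN0 h2,
      fun i hi hip => ⟨?_, ?_⟩, fun i hi => ⟨?_, ?_⟩⟩
    · have h := isBasisOf_quot_even (p := p) hN1 hN0 h2 hi
      rwa [min_eq_left hip, min_eq_left (by omega), Nat.sub_self, Nat.sub_self, pow_zero, one_mul,
        one_mul] at h
    · have h := isBasisOf_quot_odd (p := p) hN1 hN0 h2 hi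
      rwa [min_eq_left hip, Nat.sub_self, pow_zero, one_mul] at h
    · have h := isBasisOf_quot_even (p := p) hN1 hN0 h2 (i := i) (by omega)
      rwa [min_eq_right (by omega), min_eq_right (by omega), ← mul_assoc,
        show i - 1 - (p - 1) = i - p by omega, show i - (p - 1) = i - p + 1 by omega] at h
    · have h := isBasisOf_quot_odd (p := p) hN1 hN0 h2 (i := i) (by omega)
      rwa [min_eq_right (by omega), ← mul_assoc, ← mul_assoc,
        show i - (p - 1) = i - p + 1 by omega] at h
  · exact ⟨columnHom p hN0 h2,
      (columnHom_tmul hN0 h2 _ _).trans (by rw [Polynomial.aeval_X, map_one, mul_one]),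
      (columnHom_tmul hN0 h2 _ _).trans (by rw [map_one, one_mul, colHom_gen]; rfl),
      (columnHom_tmul hN0 h2 _ _).trans (by rw [map_one, one_mul, colHom_gen]; rfl),
      (columnHom_tmul hN0 h2 _ _).trans (by rw [map_one, one_mul, colHom_gen]; rfl),
      (columnHom_tmul hN0 h2 _ _).trans (by rw [map_one, one_mul, colHom_gen]; rfl),
      columnHom_injective hN1 hN0 h2 hnorm, range_columnHom hN1 hN0 h2 hnorm⟩
  · have even : ∀ (j s : ℕ) {ι : Type} {v : ι → ERing.{u} K N}, IsBasisOf v (D2 K N p 0 s) →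
        IsBasisOf (fun k => v k * gam2 ^ j) (D2 K N p (2 * j) s) := fun j s _ _ h => by
      have h' := h.mul_gam2_pow hN1 hN0 h2 hnorm j
      rwa [zero_add] at h'
    have odd : ∀ (j s : ℕ) {ι : Type} {v : ι → ERing.{u} K N}, IsBasisOf v (D2 K N p 1 s) →
        IsBasisOf (fun k => v k * gam2 ^ j) (D2 K N p (2 * j + 1) s) := fun j s _ _ h => by
      have h' := h.mul_gam2_pow hN1 hN0 h2 hnorm j
      rwa [add_comm] at h'
    refine ⟨fun j => ⟨even j _ (isBasisOf_D2_zero_zero hN1 hN0 h2),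
      even j _ (isBasisOf_D2_zero_one hN1 hN0 h2),
      fun i hi => ⟨even j _ (isBasisOf_D2_zero_even hN1 hN0 h2 hi),
        even j _ (isBasisOf_D2_zero_odd hN1 hN0 h2 hi)⟩⟩,
      fun j => ⟨odd j _ (isBasisOf_D2_one_zero hN1 hN0 h2 hnorm),
        odd j _ (isBasisOf_D2_one_one hN1 hN0 h2 hnorm), fun s hs hsp => ?_,
        fun i hi => ⟨odd j _ (isBasisOf_D2_one_even_of_le hN1 hN0 h2 hnorm hi),
          odd j _ (isBasisOf_D2_one_odd_of_le hN1 hN0 h2 hnorm hi)⟩⟩,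
      fun r s => D2_add_two hnorm hN1 hN0 h2 p r s⟩
    obtain ⟨i, rfl | rfl⟩ := Nat.even_or_odd' s
    · exact odd j _ (isBasisOf_D2_one_even_of_lt hN1 hN0 h2 hnorm (by omega) (by omega))
    · exact odd j _ (isBasisOf_D2_one_odd_of_lt hN1 hN0 h2 hnorm (by omega) (by omega))
  · exact ⟨⟨tensorMul_injective hN1 hN0 h2 hnorm,
      tensorMul_surjective hN1 hN0 h2 hnorm (by omega)⟩, adjoin_eq_top hN1 hN0 h2 hnorm⟩
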